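/- For $N\ge 1$ let $V_N=\{0,1\}^N$ be the hypercube, with Hamming distance $|\cdot|$, write $x\sim y$ if $|x-y|=1$, and let $(E_x)_{x\in V_N}$ be i.i.d. random variables, each distributed as the positive part of a standard Gaussian. Fix $\beta>0$, $\overline c\in(0,\log 2)$, $\overline a<1/20$ and $\delta>0$, and put $\alpha=\sqrt{2\overline c}/\beta$. Let $(a_N)$ be real numbers such that $1\le a_N\le \overline a\sqrt{2\log N}$ for all $N$ large enough, and let $(\mathsf t_N)$ be nonnegative numbers such that $\log \mathsf t_N\sim \overline c N$. Set $\tau_{N,x}=e^{\beta\sqrt N E_x}$. Given $(E_x)$, let $(X_t)_{t\ge 0}$ be the continuous-time Markov chain on $V_N$ which jumps from $x$ to each neighbour $y\sim x$ at rate $e^{a_N(E_x+E_y)}$ and starts from the uniform distribution on $V_N$. Let $\overline{\mathbb P}_N$ be the joint law of $(E_x)$ and $X$ (averaged over the energies), with expectation $\overline{\mathbb E}_N$. A site $x$ is discovered before time $t$ if $|X_s-x|\le 1$ for some $s\le t$; let $D_N(t)$ be the number of such sites, $\mathsf d_N=\overline{\mathbb E}_N[D_N(\mathsf t_N)]$,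 $$b_N=(2\log \mathsf d_N)^{1/2}-\frac{\log\log \mathsf d_N+\log(4\pi)}{2(2\log \mathsf d_N)^{1/2}},\qquad B_N=e^{\beta\sqrt N b_N}.$$ Let $Y_1,Y_2,\dots,Y_{2^N}$ be the distinct sites visited by $X$, in order of first visit, and let $x_1,\dots,x_{2^N}$ be the enumeration of $V_N$ obtained by listing successively the closed unit balls around $Y_1,Y_2,\dots$ (each ball being listed in an arbitrary but fixed, non-random, order) and keeping only the first occurrence of each site. Call $x$ a deep trap if $\tau_{N,x}\ge\delta B_N$. Let $r^{(\delta)}_N(1)<r^{(\delta)}_N(2)<\cdots$ be the indices $i$ for which $x_i$ is a deep trap, with $r^{(\delta)}_N(n)=\infty$ if there are fewer than $n$ of them. Let $x^{(\delta)}_N(n)=x_{r^{(\delta)}_N(n)}$ be the $n$-th deep trap discovered, and let $T^{(\delta)}_N(n)=\inf\{t\ge 0: D_N(t)\ge r^{(\delta)}_N(n)\}$ be the time of its discovery; if $r^{(\delta)}_N(n)=\infty$, both $T^{(\delta)}_N(n)$ and the depth $\tau_{N,x^{(\delta)}_N(n)}$ are set to be $\infty$. Then, under $\overline{\mathbb P}_N$,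 the random variables $$\left(\mathsf t_N^{-1}\,T^{(\delta)}_N(n),\ B_N^{-1}\,\tau_{N,x^{(\delta)}_N(n)}\right)_{n\ge 1}$$ converge jointly in distribution as $N\to\infty$, in the sense of finite-dimensional distributions, to random variables $(T^{(\delta)}(n),\tau^{(\delta)}(n))_{n\ge1}$ with the following joint law: $(T^{(\delta)}(n))_{n\ge1}$ is distributed as the successive jump instants of a Poisson process of intensity $\delta^{-\alpha}$; the $\tau^{(\delta)}(n)$, $n\ge1$, are i.i.d. with law $$\alpha\,\delta^{\alpha}\,\frac{\mathrm dz}{z^{\alpha+1}}\,\mathbf 1_{[\delta,+\infty)}(z);$$ and the families $(T^{(\delta)}(n))_{n\ge 1}$ and $(\tau^{(\delta)}(n))_{n\ge 1}$ are independent. -/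

import Mathlib

open MeasureTheory ProbabilityTheory Filter Topology Asymptotics
open scoped ENNReal NNReal

noncomputable section

namespace RandomTraps

/-! ### The hypercube, the random environment and the accelerated walk -/

/-- The hypercube `V_N = {0,1}^N`, seen as an additive group. Its graph distance is `hammingDist`,
and the neighbours of `x` are the points `x + Pi.single i 1`. -/
abbrev Cube (N : ℕ) : Type := Fin N → ZMod 2

/-- The law of the positive part of a standard Gaussian. -/
def posGaussian : Measure ℝ := (gaussianReal 0 1).map (fun z : ℝ => max z 0)

instance : IsProbabilityMeasure posGaussian :=
  Measure.isProbabilityMeasure_map (by fun_prop)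

/-- The exponential law of parameter `1`. -/
def stdExp : Measure ℝ := expMeasure 1

instance : IsProbabilityMeasure stdExp := isProbabilityMeasure_expMeasure one_pos

/-- A sample point consists of the energies `(E_x)`, the starting point of the walk, and one clock
for every step `n` and every direction `i`. -/
abbrev Sample (N : ℕ) : Type := (Cube N → ℝ) × Cube N × (ℕ × Fin N → ℝ)

/-- The averaged measure: the energies are i.i.d. positive parts of standard Gaussians; the starting
point is uniform on the hypercube and the clocks are i.i.d. standard exponential, independently of
the energies. Hence, conditionally on the energies, `walk` below has the law of the continuous-time
Markov chain with jump rates `rate`, started from the uniform measure. -/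
def annealed (N : ℕ) : Measure (Sample N) :=
  (Measure.pi fun _ : Cube N => posGaussian).prod
    ((uniformOn (Set.univ : Set (Cube N))).prod
      (Measure.infinitePi fun _ : ℕ × Fin N => stdExp))

instance (N : ℕ) : IsProbabilityMeasure (annealed N) := by
  unfold annealed; infer_instance

variable {N : ℕ}

/-- The energy `E_x`. -/
def energy (ω : Sample N) (x : Cube N) : ℝ := ω.1 x

/-- The depth `τ_{N,x} = exp (β √N E_x)`. -/
def depth (β : ℝ) (ω : Sample N) (x : Cube N) : ℝ := Real.exp (β * √(N : ℝ) * energy ω x)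

/-- The jump rate `exp (a (E_x + E_y))` of the accelerated walk from `x` to a neighbour `y`. -/
def rate (a : ℝ) (ω : Sample N) (x y : Cube N) : ℝ := Real.exp (a * (energy ω x + energy ω y))

/-- The time at which the `n`-th clock of direction `i` rings when it runs at the rate of the jump
from `x` in direction `i`: an exponential time whose parameter is this rate. -/
def ring (a : ℝ) (ω : Sample N) (n : ℕ) (x : Cube N) (i : Fin N) : ℝ :=
  ω.2.2 (n, i) / rate a ω x (x + Pi.single i 1)

open Classical in
/-- The jump chain: the `(n+1)`-st jump takes the direction of the clock that rings first (in case
of a tie, which has probability zero, the least such direction is taken). -/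
def jumpChain (a : ℝ) (ω : Sample N) : ℕ → Cube N
  | 0 => ω.2.1
  | n + 1 => fun i =>
      if (∀ j, ring a ω n (jumpChain a ω n) i ≤ ring a ω n (jumpChain a ω n) j) ∧
          (∀ j, j < i → ring a ω n (jumpChain a ω n) i < ring a ω n (jumpChain a ω n) j)
      then jumpChain a ω n i + 1
      else jumpChain a ω n i

/-- The time spent by the walk at the `n`-th position of the jump chain: the first ringing time. -/
def holding (a : ℝ) (ω : Sample N) (n : ℕ) : ℝ≥0∞ :=
  ⨅ i : Fin N, ENNReal.ofReal (ring a ω n (jumpChain a ω n) i)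

/-- The instant of the `n`-th jump (the `0`-th one is at time `0`). -/
def jumpTime (a : ℝ) (ω : Sample N) (n : ℕ) : ℝ≥0∞ :=
  ∑ m ∈ Finset.range n, holding a ω m

/-- The accelerated walk `X_t`: the position of the jump chain after the last jump before or at
time `t` (there are almost surely finitely many such jumps). -/
def walk (a : ℝ) (ω : Sample N) (t : ℝ≥0) : Cube N :=
  jumpChain a ω (sSup {n : ℕ | jumpTime a ω n ≤ (t : ℝ≥0∞)})

/-! ### The exploration process -/

/-- Removal of repetitions: the `j`-th (from `0`) distinct value of the sequence `s`, only the first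
occurrence of each value being kept. -/
def distinct {α : Type*} (s : ℕ → α) (j : ℕ) : α :=
  s (Nat.nth (fun m => ∀ l < m, s l ≠ s m) j)

/-- The successive distinct sites visited by the walk, `visited a ω j` being `Y_{j+1}`. -/
def visited (a : ℝ) (ω : Sample N) : ℕ → Cube N := distinct (jumpChain a ω)

/-- An enumeration, for every `y`, of the `N + 1` sites at distance at most `1` from `y`. -/
abbrev BallOrder (N : ℕ) : Type := ∀ y : Cube N, Fin (N + 1) ≃ {x : Cube N // hammingDist x y ≤ 1}

/-- The concatenation of the enumerated unit balls around `Y_1, Y_2, …`. -/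
def ballSequence (a : ℝ) (o : BallOrder N) (ω : Sample N) (m : ℕ) : Cube N :=
  (o (visited a ω (m / (N + 1))) (Fin.ofNat (N + 1) m) : Cube N)

/-- The exploration process: `explored a o ω i` is `x_i`, for `1 ≤ i ≤ 2 ^ N`. -/
def explored (a : ℝ) (o : BallOrder N) (ω : Sample N) (i : ℕ) : Cube N :=
  distinct (ballSequence a o ω) (i - 1)

/-! ### Discovered sites and scales -/

/-- The set of sites discovered before time `t`. -/
def discovered (a : ℝ) (ω : Sample N) (t : ℝ≥0) : Set (Cube N) :=
  {x | ∃ s ≤ t, hammingDist x (walk a ω s) ≤ 1}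

/-- The number `D_N(t)` of sites discovered before time `t`. -/
def numDiscovered (a : ℝ) (ω : Sample N) (t : ℝ≥0) : ℕ := (discovered a ω t).ncard

/-- The scale `d_N`: the averaged expectation of `D_N(t)`. -/
def dScale (N : ℕ) (a : ℝ) (t : ℝ≥0) : ℝ := ∫ ω, (numDiscovered a ω t : ℝ) ∂(annealed N)

/-- The scale `b_N`. -/
def bScale (N : ℕ) (a : ℝ) (t : ℝ≥0) : ℝ :=
  √(2 * Real.log (dScale N a t)) -
    1 / (2 * √(2 * Real.log (dScale N a t))) *
      (Real.log (Real.log (dScale N a t)) + Real.log (4 * Real.pi))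

/-- The depth scale `B_N = exp (β √N b_N)`. -/
def BScale (N : ℕ) (β a : ℝ) (t : ℝ≥0) : ℝ := Real.exp (β * √(N : ℝ) * bScale N a t)

/-! ### Deep traps, in their order of discovery -/

/-- The indices `i` such that the `i`-th explored site is a deep trap, that is, has depth at
least `δ B`. -/
def deepIndices (β a δ B : ℝ) (o : BallOrder N) (ω : Sample N) : Set ℕ :=
  {i | 1 ≤ i ∧ i ≤ 2 ^ N ∧ δ * B ≤ depth β ω (explored a o ω i)}

open Classical in
/-- The index `r(n)` in the exploration process of the `n`-th deep trap (`n ≥ 1`), and `∞` if there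
are less than `n` deep traps. -/
def trapIndex (β a δ B : ℝ) (o : BallOrder N) (ω : Sample N) (n : ℕ) : ℕ∞ :=
  if n ≤ (deepIndices β a δ B o ω).ncard
  then ((Nat.nth (fun i => i ∈ deepIndices β a δ B o ω) (n - 1) : ℕ) : ℕ∞)
  else ⊤

open Classical in
/-- The depth of the `n`-th deep trap discovered, and `∞` if there is none. -/
def trapDepth (β a δ B : ℝ) (o : BallOrder N) (ω : Sample N) (n : ℕ) : ℝ≥0∞ :=
  if trapIndex β a δ B o ω n = ⊤ then ⊤
  else ENNReal.ofReal (depth β ω (explored a o ω (trapIndex β a δ B o ω n).toNat))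

/-- The instant `T(n) = inf {t : D_N(t) ≥ r(n)}` when the `n`-th deep trap is discovered, and `∞` if
there is none. -/
def trapTime (β a δ B : ℝ) (o : BallOrder N) (ω : Sample N) (n : ℕ) : ℝ≥0∞ :=
  ⨅ (t : ℝ≥0) (_ : trapIndex β a δ B o ω n ≤ (numDiscovered a ω t : ℕ∞)), (t : ℝ≥0∞)

/-! ### The limit -/

/-- `M` is a Poisson process of intensity `lam`: it counts the points of a sequence on the half-line
whose successive gaps are i.i.d. exponential random variables of parameter `lam`. -/
def IsPoissonProcess {Ω : Type*} [MeasurableSpace Ω] (P : Measure Ω) (lam : ℝ)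
    (M : ℝ≥0 → Ω → ℕ) : Prop :=
  ∃ ξ : ℕ → Ω → ℝ, (∀ i, HasLaw (ξ i) (expMeasure lam) P) ∧ iIndepFun ξ P ∧
    ∀ᵐ ω ∂P, ∀ t : ℝ≥0,
      M t ω = {n : ℕ | 1 ≤ n ∧ ∑ i ∈ Finset.range n, ξ i ω ≤ (t : ℝ)}.ncard

/-- The `n`-th jump instant of a counting process `M`: the first time when its value is at
least `n`. -/
def jumpInstant {Ω : Type*} (M : ℝ≥0 → Ω → ℕ) (n : ℕ) (ω : Ω) : ℝ≥0∞ :=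
  ⨅ (t : ℝ≥0) (_ : n ≤ M t ω), (t : ℝ≥0∞)

end RandomTraps

end

open RandomTraps

noncomputable section

namespace RandomTraps

/-! ### Product measures, memoryless clocks and variance inequalities -/

section

section Tools

variable {X : Type*} [MeasurableSpace X]

/-! Two facts carry the theorem. The first is that the number of discovered sites is asymptotically
deterministic: for each fixed `s`, the ratio of `D_N(s t_N)` to `d_N` tends to `s` in mean under the
annealed law, and `log d_N` is equivalent to `cbar N` (`tendsto_integral_abs_numDiscovered`). The
second is that the energies met along the exploration are i.i.d. The rates out of a site only
involve energies of its unit ball, and these have all been read before the walk leaves the site; so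
the next explored site is a function of the starting point, the clocks and the energies already
read. Reading an i.i.d. field along an adapted sequence of distinct indices produces an i.i.d.
sequence (`measurePreserving_adapted`, `measurePreserving_fieldSeq`), where auxiliary independent
variables take over once every site has been explored.

Consequently the deep traps, in their order of discovery, are the successive visits of an i.i.d.
sequence to a half-line of high energies. The gaps between their ranks are geometric and independent
of their depths, which are i.i.d. with the conditional law (`map_gapMark_seq`, `gapMarkLaw_eq`). The
level `b_N` is such that `d_N` times the probability of being deep tends to `δ ^ (-α)`, and on the
scale `B_N` the Gaussian tail becomes a power law (`tendsto_mul_setIntegral_deepSet`). Hence the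
gaps divided by `d_N` and the depths divided by `B_N` converge to independent exponential and Pareto
variables (`tendsto_rescaledLaw`). Since the number of discovered sites is almost linear in time,
the discovery time of the trap of rank `r` is close to `t_N r / d_N` (`abs_firstTime_sub_le`). The
time change being deterministic in the limit, no independence between the ranks and the clock of the
walk is needed.

The first fact is proved by blocks. The rates are symmetric, and they are at least one because the
energies are nonnegative; so the uniform law is invariant and the Poincaré inequality of the cube
gives a relative mixing error `2 ^ N exp (-L)` after a delay `L` (`trans_le`), negligible for `L =
N` because `log 2 < 1`. The energies are truncated at `3 √N`, which has an effect with exponentially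
small probability only; the rates are then `exp (o(N))` because `a_N` is at most of order `√(log
N)`. Time is cut into blocks of length `exp (cbar N / 2)` separated by pauses of length `N`. The
contributions of the blocks are nearly uncorrelated, the pauses bring few sites, and the overlaps of
the blocks are of order `exp ((2 cbar - log 2) N)`, negligible because `cbar < log 2`. The
fluctuations of the block mean with the environment are handled by the Efron-Stein inequality:
changing the energy of a site only matters if this site is discovered. The errors are collected in
`lawError` and compared in `expLe_lawError`. -/

/-- Interleaving two independent i.i.d. families along an injection gives an i.i.d. family. -/
theorem measurePreserving_sumElim {ι κ κ' : Type*} (ν : Measure X) [IsProbabilityMeasure ν]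
    (σ : ι → κ ⊕ κ') (hσ : Function.Injective σ) :
    MeasurePreserving (fun p : (κ → X) × (κ' → X) => fun i => Sum.elim p.1 p.2 (σ i))
      ((Measure.infinitePi fun _ : κ => ν).prod (Measure.infinitePi fun _ : κ' => ν))
      (Measure.infinitePi fun _ : ι => ν) := by
  classical
  have hm : Measurable (fun p : (κ → X) × (κ' → X) => fun i => Sum.elim p.1 p.2 (σ i)) := by
    refine measurable_pi_lambda _ fun i => ?_
    rcases σ i with k | k
    · exact (measurable_pi_apply k).comp measurable_fst
    · exact (measurable_pi_apply k).comp measurable_snd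
  refine ⟨hm, Measure.eq_infinitePi _ fun s t ht => ?_⟩
  rw [Measure.map_apply hm (MeasurableSet.pi s.countable_toSet fun i _ => ht i)]
  rcases isEmpty_or_nonempty ι with hι | hι
  · have : s = ∅ := Finset.eq_empty_of_isEmpty s
    subst this
    simp
  -- The sides of the box are transported along `σ`; outside the range of `σ` their value plays no
  -- role, since only indices in `s.image σ` are constrained.
  set t' : κ ⊕ κ' → Set X := fun u => t (Function.invFun σ u) with ht'
  have hts : ∀ i, t' (σ i) = t i := fun i => by
    simp only [ht']; rw [Function.leftInverse_invFun hσ i]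
  have hset : (fun p : (κ → X) × (κ' → X) => fun i => Sum.elim p.1 p.2 (σ i)) ⁻¹' (Set.pi s t) =
      (Set.pi (s.image σ).toLeft fun k => t' (Sum.inl k)) ×ˢ
        (Set.pi (s.image σ).toRight fun k => t' (Sum.inr k)) := by
    ext p
    simp only [Set.mem_preimage, Set.mem_pi, Finset.mem_coe, Set.mem_prod, Finset.mem_toLeft,
      Finset.mem_toRight, Finset.mem_image]
    constructor
    · intro h
      refine ⟨?_, ?_⟩
      · rintro k ⟨i, hi, hk⟩
        rw [← hk, hts]; have := h i hi; rwa [hk] at this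
      · rintro k ⟨i, hi, hk⟩
        rw [← hk, hts]; have := h i hi; rwa [hk] at this
    · rintro ⟨h1, h2⟩ i hi
      rw [← hts]
      rcases hk : σ i with k | k
      · exact h1 k ⟨i, hi, hk⟩
      · exact h2 k ⟨i, hi, hk⟩
  rw [hset, Measure.prod_prod, Measure.infinitePi_pi _ (fun k _ => ht _),
    Measure.infinitePi_pi _ (fun k _ => ht _)]
  have h3 : ∏ i ∈ s, ν (t i) = ∏ u ∈ s.image σ, ν (t' u) := by
    rw [Finset.prod_image fun a _ b _ h => hσ h]
    simp only [hts]
  rw [h3, ← Finset.toLeft_disjSum_toRight (u := s.image σ), Finset.prod_disjSum]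
  simp [ht']

/-- The first `n` levels of `ξ`, followed by `η`. -/
def concat {κ : Type*} (n : ℕ) (ξ η : ℕ × κ → X) : ℕ × κ → X :=
  fun k => if k.1 < n then ξ k else η (k.1 - n, k.2)

theorem measurePreserving_concat {κ : Type*} (ν : Measure X) [IsProbabilityMeasure ν] (n : ℕ) :
    MeasurePreserving (fun p : (ℕ × κ → X) × (ℕ × κ → X) => concat n p.1 p.2)
      ((Measure.infinitePi fun _ : ℕ × κ => ν).prod (Measure.infinitePi fun _ : ℕ × κ => ν))
      (Measure.infinitePi fun _ : ℕ × κ => ν) := by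
  have := measurePreserving_sumElim (κ := ℕ × κ) (κ' := ℕ × κ) ν
    (fun k : ℕ × κ => if k.1 < n then Sum.inl k else Sum.inr (k.1 - n, k.2)) (by
      rintro ⟨a, i⟩ ⟨b, j⟩ h
      dsimp only at h
      split_ifs at h with h1 h2 h2
      · simpa using h
      · simp only [Sum.inr.injEq, Prod.mk.injEq] at h
        ext <;> grind)
  convert this using 2 with p
  funext k
  simp only [concat]
  split_ifs <;> rfl

/-- This is conditioning on the levels below `n`: the clocks of the later levels can be redrawn
independently. The Markov property and the estimates on exits rest on it. -/
theorem lintegral_concat {κ : Type*} (ν : Measure X) [IsProbabilityMeasure ν] (n : ℕ)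
    {f : (ℕ × κ → X) → ℝ≥0∞} (hf : Measurable f) :
    ∫⁻ ξ, f ξ ∂(Measure.infinitePi fun _ : ℕ × κ => ν) =
      ∫⁻ ξ, ∫⁻ η, f (concat n ξ η) ∂(Measure.infinitePi fun _ : ℕ × κ => ν)
        ∂(Measure.infinitePi fun _ : ℕ × κ => ν) := by
  have h := measurePreserving_concat (κ := κ) ν n
  rw [← h.lintegral_comp hf]
  exact lintegral_prod _ (hf.comp h.measurable).aemeasurable

/-- Memorylessness: Lebesgue measure is translation invariant and the density is multiplicative. -/
theorem stdExp_shift {c : ℝ} (hc : 0 ≤ c) {A : Set ℝ} (hA : MeasurableSet A) :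
    stdExp (Set.Ioi c ∩ (fun x => x - c) ⁻¹' A) = ENNReal.ofReal (Real.exp (-c)) * stdExp A := by
  have hdef : stdExp = volume.withDensity (exponentialPDF 1) := rfl
  have hS : MeasurableSet (Set.Ioi c ∩ (fun x => x - c) ⁻¹' A) :=
    measurableSet_Ioi.inter ((measurable_id.sub_const c) hA)
  have hpdf : Measurable (exponentialPDF 1) := (measurable_exponentialPDFReal 1).ennreal_ofReal
  rw [hdef, withDensity_apply _ hS, withDensity_apply _ hA, ← lintegral_indicator hS,
    ← lintegral_indicator hA, ← lintegral_const_mul _ (hpdf.indicator hA),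
    ← lintegral_add_right_eq_self _ c]
  refine lintegral_congr_ae ?_
  -- The origin is discarded because the open half-line excludes it although the density does not
  -- vanish there.
  have h0 : ∀ᵐ x : ℝ, x ≠ 0 := by
    simp [ae_iff]
  filter_upwards [h0] with x hx
  simp only [Set.indicator, Set.mem_inter_iff, Set.mem_Ioi, Set.mem_preimage, add_sub_cancel_right]
  rcases lt_or_gt_of_ne hx with h | h
  · rw [if_neg (by rintro ⟨h1, _⟩; have := Set.mem_Ioi.1 h1; linarith), exponentialPDF_of_neg h]
    simp
  · by_cases hxA : x ∈ A
    · rw [if_pos ⟨Set.mem_Ioi.2 (by linarith), by simpa using hxA⟩, if_pos hxA,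
        exponentialPDF_of_nonneg h.le,
        exponentialPDF_of_nonneg (by linarith), ← ENNReal.ofReal_mul (Real.exp_pos _).le]
      congr 1
      rw [one_mul, one_mul, one_mul, one_mul, ← Real.exp_add]
      congr 1; ring
    · rw [if_neg (by rintro ⟨_, h1⟩; exact hxA (by simpa using h1)), if_neg hxA, mul_zero]

theorem stdExp_Ioi {c : ℝ} (hc : 0 ≤ c) : stdExp (Set.Ioi c) = ENNReal.ofReal (Real.exp (-c)) := by
  have := stdExp_shift hc MeasurableSet.univ
  simpa using this

/-- The law of the clocks. -/
def clockLaw (N : ℕ) : Measure (ℕ × Fin N → ℝ) := Measure.infinitePi fun _ => stdExp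

instance (N : ℕ) : IsProbabilityMeasure (clockLaw N) := by unfold clockLaw; infer_instance

/-- Subtracting `c` from the clocks of the first level. -/
def lower {N : ℕ} (c : Fin N → ℝ) (η : ℕ × Fin N → ℝ) : ℕ × Fin N → ℝ :=
  fun k => if k.1 = 0 then η k - c k.2 else η k

theorem measurable_lower {N : ℕ} (c : Fin N → ℝ) : Measurable (lower c) := by
  refine measurable_pi_lambda _ fun k => ?_
  unfold lower
  split_ifs <;> fun_prop

/-- Coordinatewise memorylessness: given that all first-level clocks have survived the amounts `c`,
the remaining clocks are fresh. After division by the mass of the event, the identity is checked on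
boxes. -/
theorem map_lower_clockLaw {N : ℕ} (c : Fin N → ℝ) (hc : ∀ i, 0 ≤ c i) :
    ((clockLaw N).restrict {η | ∀ i, c i < η (0, i)}).map (lower c) =
      ENNReal.ofReal (Real.exp (-∑ i, c i)) • clockLaw N := by
  classical
  set K := ENNReal.ofReal (Real.exp (-∑ i, c i)) with hK
  have hK0 : K ≠ 0 := by simp [hK, Real.exp_pos]
  have hKt : K ≠ ⊤ := ENNReal.ofReal_ne_top
  have hSm : MeasurableSet {η : ℕ × Fin N → ℝ | ∀ i, c i < η (0, i)} := by
    simp only [Set.ofPred_forall]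
    exact MeasurableSet.iInter fun i => measurableSet_lt measurable_const (measurable_pi_apply _)
  suffices h : K⁻¹ • ((clockLaw N).restrict {η | ∀ i, c i < η (0, i)}).map (lower c) =
      clockLaw N by
    rw [← h, smul_smul, ENNReal.mul_inv_cancel hK0 hKt, one_smul, h]
  refine Measure.eq_infinitePi _ fun s t ht => ?_
  have hbox : MeasurableSet (Set.pi (s : Set (ℕ × Fin N)) t) :=
    MeasurableSet.pi s.countable_toSet fun i _ => ht i
  rw [Measure.smul_apply, Measure.map_apply (measurable_lower c) hbox,
    Measure.restrict_apply (measurable_lower c hbox)]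
  -- The event constrains the whole of level `0`, including the clocks that the box leaves free, so
  -- the box is enlarged by this level.
  set s0 : Finset (ℕ × Fin N) := Finset.univ.image fun i : Fin N => ((0 : ℕ), i) with hs0
  set t' : ℕ × Fin N → Set ℝ := fun k =>
    if k.1 = 0 then Set.Ioi (c k.2) ∩ (fun x => x - c k.2) ⁻¹' (if k ∈ s then t k else Set.univ)
    else t k with ht'
  have hmem0 : ∀ k : ℕ × Fin N, k ∈ s0 ↔ k.1 = 0 := by
    rintro ⟨a, i⟩
    simp [hs0, eq_comm]
  have hset : lower c ⁻¹' (Set.pi s t) ∩ {η | ∀ i, c i < η (0, i)} = Set.pi (s ∪ s0 : Finset _) t' := by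
    ext η
    simp only [Set.mem_inter_iff, Set.mem_preimage, Set.mem_pi, Finset.mem_coe, Set.mem_ofPred_eq,
      Finset.mem_union, hmem0, lower, ht']
    constructor
    · rintro ⟨h1, h2⟩ k hk
      split_ifs with h3 h4
      · exact ⟨by have := h2 k.2; rwa [← h3] at this, by simpa [h3] using h1 k h4⟩
      · exact ⟨by have := h2 k.2; rwa [← h3] at this, trivial⟩
      · have := h1 k (hk.resolve_right h3)
        simpa [h3] using this
    · intro h
      refine ⟨fun k hk => ?_, fun i => ?_⟩
      · have := h k (Or.inl hk)
        split_ifs at this ⊢ with h3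
        · exact this.2
        · exact this
      · have := h (0, i) (Or.inr rfl)
        simp only [if_true] at this
        exact this.1
  have htm : ∀ k, MeasurableSet (if k ∈ s then t k else Set.univ) := fun k => by
    split_ifs
    · exact ht k
    · exact MeasurableSet.univ
  rw [hset]
  unfold clockLaw
  rw [Measure.infinitePi_pi _ (fun k _ => by
    simp only [ht']
    split_ifs
    · exact measurableSet_Ioi.inter ((measurable_id.sub_const _) (ht k))
    · exact measurableSet_Ioi.inter ((measurable_id.sub_const _) MeasurableSet.univ)
    · exact ht k)]
  have hval : ∀ k ∈ s ∪ s0, stdExp (t' k) =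
      (if k.1 = 0 then ENNReal.ofReal (Real.exp (-c k.2)) else 1) *
        (if k ∈ s then stdExp (t k) else 1) := by
    intro k hk
    simp only [ht']
    by_cases h3 : k.1 = 0
    · rw [if_pos h3, if_pos h3, stdExp_shift (hc _) (htm k)]
      split_ifs <;> simp
    · have : k ∈ s := by
        rcases Finset.mem_union.1 hk with h | h
        · exact h
        · exact absurd ((hmem0 k).1 h) h3
      rw [if_neg h3, if_neg h3, if_pos this, one_mul]
  rw [Finset.prod_congr rfl hval, Finset.prod_mul_distrib]
  have e1 : ∏ k ∈ s ∪ s0, (if k.1 = 0 then ENNReal.ofReal (Real.exp (-c k.2)) else 1) = K := by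
    rw [← Finset.prod_subset (Finset.subset_union_right : s0 ⊆ s ∪ s0)]
    · rw [hs0, Finset.prod_image fun i _ j _ h => by simpa using h]
      simp only [if_true]
      rw [hK, ← Finset.sum_neg_distrib, Real.exp_sum,
        ENNReal.ofReal_prod_of_nonneg fun i _ => (Real.exp_pos _).le]
    · intro k _ hk
      rw [if_neg fun h => hk ((hmem0 k).2 h)]
  have e2 : ∏ k ∈ s ∪ s0, (if k ∈ s then stdExp (t k) else 1) = ∏ k ∈ s, stdExp (t k) := by
    rw [← Finset.prod_subset (Finset.subset_union_left : s ⊆ s ∪ s0)]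
    · exact Finset.prod_congr rfl fun k hk => by rw [if_pos hk]
    · intro k _ hk
      rw [if_neg hk]
  rw [e1, e2, smul_eq_mul, ← mul_assoc, ENNReal.inv_mul_cancel hK0 hKt, one_mul]

/-- The memoryless property of the clocks of the first level. -/
theorem lintegral_lower_clockLaw {N : ℕ} (c : Fin N → ℝ) (hc : ∀ i, 0 ≤ c i)
    {f : (ℕ × Fin N → ℝ) → ℝ≥0∞} (hf : Measurable f) :
    ∫⁻ η in {η | ∀ i, c i < η (0, i)}, f (lower c η) ∂(clockLaw N) =
      ENNReal.ofReal (Real.exp (-∑ i, c i)) * ∫⁻ η, f η ∂(clockLaw N) := by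
  rw [← lintegral_map hf (measurable_lower c), map_lower_clockLaw c hc, lintegral_smul_measure,
    smul_eq_mul]

theorem clockLaw_forall_lt {N : ℕ} (c : Fin N → ℝ) (hc : ∀ i, 0 ≤ c i) :
    clockLaw N {η | ∀ i, c i < η (0, i)} = ENNReal.ofReal (Real.exp (-∑ i, c i)) := by
  have := lintegral_lower_clockLaw c hc (f := fun _ => 1) measurable_const
  simpa using this

/-! ### Variance identities and the Efron-Stein inequality -/

theorem integrable_of_abs_le {μ : Measure X} [IsFiniteMeasure μ] {f : X → ℝ} (hf : Measurable f)
    (C : ℝ) (hC : ∀ x, |f x| ≤ C) : Integrable f μ :=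
  Integrable.of_bound hf.aestronglyMeasurable C (ae_of_all _ fun x => by simpa using hC x)

theorem abs_integral_le_of_abs_le {μ : Measure X} [IsProbabilityMeasure μ] {f : X → ℝ}
    (C : ℝ) (hC : ∀ x, |f x| ≤ C) : |∫ x, f x ∂μ| ≤ C := by
  have := norm_integral_le_of_norm_le_const (μ := μ) (f := f) (C := C)
    (ae_of_all _ fun x => by simpa using hC x)
  simpa using this

/-- The bias-variance identity. With a well chosen `c` it bounds the variance by a second moment
around `c`. -/
theorem integral_sub_mean_sq_le {μ : Measure X} [IsProbabilityMeasure μ] {f : X → ℝ}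
    (hf : Measurable f) (C : ℝ) (hC : ∀ x, |f x| ≤ C) (c : ℝ) :
    ∫ x, (f x - ∫ y, f y ∂μ) ^ 2 ∂μ = ∫ x, (f x - c) ^ 2 ∂μ - (∫ y, f y ∂μ - c) ^ 2 := by
  have i1 : Integrable f μ := integrable_of_abs_le hf C hC
  have i2 : Integrable (fun x => f x ^ 2) μ := integrable_of_abs_le (hf.pow_const 2) (C ^ 2)
    fun x => by rw [abs_pow]; exact pow_le_pow_left₀ (abs_nonneg _) (hC x) 2
  set m := ∫ y, f y ∂μ with hm
  have key : ∀ d : ℝ, ∫ x, (f x - d) ^ 2 ∂μ = ∫ x, f x ^ 2 ∂μ - 2 * d * m + d ^ 2 := by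
    intro d
    have : ∀ x, (f x - d) ^ 2 = f x ^ 2 - 2 * d * f x + d ^ 2 := fun x => by ring
    simp only [this]
    have j2 : Integrable (fun x => 2 * d * f x) μ := i1.const_mul _
    have j3 : Integrable (fun x => f x ^ 2 - 2 * d * f x) μ := i2.sub j2
    rw [integral_add j3 (integrable_const _), integral_sub i2 j2, integral_const_mul]
    simp [hm]
  rw [key, key]
  ring

theorem sq_integral_le {μ : Measure X} [IsProbabilityMeasure μ] {f : X → ℝ}
    (hf : Measurable f) (C : ℝ) (hC : ∀ x, |f x| ≤ C) :
    (∫ x, f x ∂μ) ^ 2 ≤ ∫ x, f x ^ 2 ∂μ := by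
  have h := integral_sub_mean_sq_le (μ := μ) hf C hC 0
  have h0 : 0 ≤ ∫ x, (f x - ∫ y, f y ∂μ) ^ 2 ∂μ := integral_nonneg fun x => sq_nonneg _
  simp only [sub_zero] at h
  linarith

theorem integral_pi_succ {n : ℕ} (ν : Measure X) [IsProbabilityMeasure ν]
    {F : (Fin (n + 1) → X) → ℝ} (hF : Measurable F) (C : ℝ) (hC : ∀ x, |F x| ≤ C) :
    ∫ x, F x ∂(Measure.pi fun _ : Fin (n + 1) => ν) =
      ∫ y, ∫ a, F (Fin.cons a y) ∂ν ∂(Measure.pi fun _ : Fin n => ν) := by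
  have h := (measurePreserving_piFinSuccAbove (fun _ : Fin (n + 1) => ν) 0).symm
  have h2 := h.integral_comp (MeasurableEquiv.measurableEmbedding _) F
  rw [← h2]
  have h3 : ∀ p : X × (Fin n → X),
      (MeasurableEquiv.piFinSuccAbove (fun _ : Fin (n + 1) => X) 0).symm p = Fin.cons p.1 p.2 := by
    intro p
    simp [MeasurableEquiv.piFinSuccAbove, Fin.insertNthEquiv]
  simp only [h3]
  have hm : Measurable fun p : X × (Fin n → X) => F (Fin.cons p.1 p.2) := by
    have := hF.comp (MeasurableEquiv.piFinSuccAbove (fun _ : Fin (n + 1) => X) 0).symm.measurable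
    convert this using 2 with p
    exact congrArg F (h3 p).symm
  rw [integral_prod_symm _ (integrable_of_abs_le hm C fun p => hC _)]

/-- The Efron-Stein inequality on `Fin n`, comparison being made with a fixed value `z` of the
resampled coordinate. -/
theorem efronStein_fin (ν : Measure X) [IsProbabilityMeasure ν] (z : X) (n : ℕ) :
    ∀ (f : (Fin n → X) → ℝ), Measurable f → ∀ C : ℝ, (∀ x, |f x| ≤ C) →
      ∫ x, (f x - ∫ y, f y ∂(Measure.pi fun _ : Fin n => ν)) ^ 2 ∂(Measure.pi fun _ => ν) ≤
        ∑ i, ∫ x, (f x - f (Function.update x i z)) ^ 2 ∂(Measure.pi fun _ => ν) := by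
  induction n with
  | zero =>
    intro f hf C hC
    have : ∀ x, f x = f default := fun x => congrArg f (Subsingleton.elim _ _)
    simp [this]
  | succ n ih =>
    intro f hf C hC
    have hcons : Measurable fun p : X × (Fin n → X) => (Fin.cons p.1 p.2 : Fin (n + 1) → X) := by
      refine measurable_pi_lambda _ fun i => ?_
      refine Fin.cases ?_ (fun j => ?_) i
      · simpa using measurable_fst
      · simpa [Function.comp_def] using
          (measurable_pi_apply j).comp (measurable_snd (α := X) (β := Fin n → X))
    have hfc : Measurable fun p : X × (Fin n → X) => f (Fin.cons p.1 p.2) := hf.comp hcons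
    have hC0 : 0 ≤ C := by
      obtain ⟨x0⟩ : Nonempty X := ⟨z⟩
      exact (abs_nonneg _).trans (hC fun _ => x0)
    -- The variance of `f` is the mean of its conditional variance in coordinate `0` plus the
    -- variance of `g`, to which the induction hypothesis applies.
    set g : (Fin n → X) → ℝ := fun y => ∫ a, f (Fin.cons a y) ∂ν with hg
    have hgm : Measurable g := by
      have : StronglyMeasurable (Function.uncurry fun (y : Fin n → X) (a : X) => f (Fin.cons a y)) :=
        (hfc.comp measurable_swap).stronglyMeasurable
      exact this.integral_prod_right.measurable
    have hgC : ∀ y, |g y| ≤ C := fun y => abs_integral_le_of_abs_le C fun a => hC _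
    set m := ∫ y, f y ∂(Measure.pi fun _ : Fin (n + 1) => ν) with hm
    have hmg : m = ∫ y, g y ∂(Measure.pi fun _ : Fin n => ν) := integral_pi_succ ν hf C hC
    have hmC : |m| ≤ C := abs_integral_le_of_abs_le C hC
    have sqb : ∀ u v : ℝ, |u| ≤ C → |v| ≤ C → |(u - v) ^ 2| ≤ (2 * C) ^ 2 := by
      intro u v hu hv
      rw [abs_pow]
      exact pow_le_pow_left₀ (abs_nonneg _) ((abs_sub _ _).trans (by linarith)) 2
    have hupm : ∀ i : Fin (n + 1), Measurable fun x : Fin (n + 1) → X => Function.update x i z :=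
      fun i => measurable_update_left
    have hupm' : ∀ i : Fin n, Measurable fun x : Fin n → X => Function.update x i z :=
      fun i => measurable_update_left
    rw [integral_pi_succ ν ((hf.sub_const m).pow_const 2) ((2 * C) ^ 2)
      (fun x => sqb _ _ (hC x) hmC)]
    -- Two uses of the bias-variance identity in the first coordinate: around the global mean, and
    -- around the value at `z`, which dominates the conditional variance.
    have step : ∀ y, ∫ a, (f (Fin.cons a y) - m) ^ 2 ∂ν ≤
        ∫ a, (f (Fin.cons a y) - f (Fin.cons z y)) ^ 2 ∂ν + (g y - m) ^ 2 := by
      intro y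
      have hmy : Measurable fun a => f (Fin.cons a y) :=
        hfc.comp (measurable_id.prodMk measurable_const)
      have e1 := integral_sub_mean_sq_le (μ := ν) hmy C (fun a => hC _) m
      have e2 := integral_sub_mean_sq_le (μ := ν) hmy C (fun a => hC _) (f (Fin.cons z y))
      have e3 : 0 ≤ (∫ a, f (Fin.cons a y) ∂ν - f (Fin.cons z y)) ^ 2 := sq_nonneg _
      simp only [hg]
      linarith
    have hm1 : Measurable fun y => ∫ a, (f (Fin.cons a y) - f (Fin.cons z y)) ^ 2 ∂ν := by
      have : StronglyMeasurable (Function.uncurry fun (y : Fin n → X) (a : X) =>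
          (f (Fin.cons a y) - f (Fin.cons z y)) ^ 2) :=
        (((hfc.comp measurable_swap).sub
          (hfc.comp (measurable_const.prodMk measurable_fst))).pow_const 2).stronglyMeasurable
      exact this.integral_prod_right.measurable
    have b1 : ∀ y, |∫ a, (f (Fin.cons a y) - f (Fin.cons z y)) ^ 2 ∂ν| ≤ (2 * C) ^ 2 :=
      fun y => abs_integral_le_of_abs_le _ fun a => sqb _ _ (hC _) (hC _)
    have b2 : ∀ y, |(g y - m) ^ 2| ≤ (2 * C) ^ 2 := fun y => sqb _ _ (hgC y) hmC
    have hm0 : Measurable fun y => ∫ a, (f (Fin.cons a y) - m) ^ 2 ∂ν := by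
      have : StronglyMeasurable (Function.uncurry fun (y : Fin n → X) (a : X) =>
          (f (Fin.cons a y) - m) ^ 2) :=
        (((hfc.comp measurable_swap).sub_const m).pow_const 2).stronglyMeasurable
      exact this.integral_prod_right.measurable
    have b0 : ∀ y, |∫ a, (f (Fin.cons a y) - m) ^ 2 ∂ν| ≤ (2 * C) ^ 2 :=
      fun y => abs_integral_le_of_abs_le _ fun a => sqb _ _ (hC _) hmC
    have i1 := integrable_of_abs_le (μ := Measure.pi fun _ : Fin n => ν) hm1 _ b1
    have i2 := integrable_of_abs_le (μ := Measure.pi fun _ : Fin n => ν)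
      ((hgm.sub_const m).pow_const 2) _ b2
    refine (integral_mono (integrable_of_abs_le hm0 _ b0) (i1.add i2) step).trans ?_
    rw [integral_add' i1 i2, Fin.sum_univ_succ]
    refine add_le_add (le_of_eq ?_) ?_
    · rw [integral_pi_succ (F := fun x => (f x - f (Function.update x 0 z)) ^ 2) ν
        ((hf.sub (hf.comp (hupm 0))).pow_const 2) ((2 * C) ^ 2)
        (fun x => sqb _ _ (hC _) (hC _))]
      simp
    · rw [hmg]
      refine (ih g hgm C hgC).trans (Finset.sum_le_sum fun i _ => ?_)
      rw [integral_pi_succ (F := fun x => (f x - f (Function.update x i.succ z)) ^ 2) ν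
        ((hf.sub (hf.comp (hupm i.succ))).pow_const 2) ((2 * C) ^ 2)
        (fun x => sqb _ _ (hC _) (hC _))]
      have hm3 : Measurable fun y => ∫ a, (f (Fin.cons a y) -
          f (Function.update (Fin.cons a y : Fin (n + 1) → X) i.succ z)) ^ 2 ∂ν := by
        have : StronglyMeasurable (Function.uncurry fun (y : Fin n → X) (a : X) =>
            (f (Fin.cons a y) - f (Function.update (Fin.cons a y : Fin (n + 1) → X) i.succ z)) ^ 2) :=
          (((hfc.comp measurable_swap).sub
            ((hf.comp (hupm i.succ)).comp (hcons.comp measurable_swap))).pow_const 2).stronglyMeasurable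
        exact this.integral_prod_right.measurable
      refine integral_mono (integrable_of_abs_le ((hgm.sub (hgm.comp (hupm' i))).pow_const 2) _
        (fun y => sqb _ _ (hgC _) (hgC _)))
        (integrable_of_abs_le hm3 _ fun y => abs_integral_le_of_abs_le _
          fun a => sqb _ _ (hC _) (hC _)) fun y => ?_
      have hm4 : Measurable fun a => f (Fin.cons a y) := hfc.comp (measurable_id.prodMk measurable_const)
      have hm5 : Measurable fun a => f (Fin.cons a (Function.update y i z)) :=
        hfc.comp (measurable_id.prodMk measurable_const)
      -- Jensen: the influence of a coordinate on the conditional mean `g` is at most its influence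
      -- on `f`.
      have e := sq_integral_le (μ := ν) (f := fun a => f (Fin.cons a y) -
        f (Fin.cons a (Function.update y i z))) (hm4.sub hm5) (2 * C)
        (fun a => (abs_sub _ _).trans (by linarith [hC (Fin.cons a y), hC (Fin.cons a (Function.update y i z))]))
      rw [integral_sub (integrable_of_abs_le hm4 C fun _ => hC _)
        (integrable_of_abs_le hm5 C fun _ => hC _)] at e
      simpa only [hg, Fin.cons_update] using e

/-- The Efron-Stein inequality. -/
theorem efronStein {ι : Type*} [Fintype ι] [DecidableEq ι] (ν : Measure X) [IsProbabilityMeasure ν]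
    (z : X) {f : (ι → X) → ℝ} (hf : Measurable f) (C : ℝ) (hC : ∀ x, |f x| ≤ C) :
    ∫ x, (f x - ∫ y, f y ∂(Measure.pi fun _ : ι => ν)) ^ 2 ∂(Measure.pi fun _ => ν) ≤
      ∑ i, ∫ x, (f x - f (Function.update x i z)) ^ 2 ∂(Measure.pi fun _ => ν) := by
  let e := (Fintype.equivFin ι).symm
  have hp := measurePreserving_piCongrLeft (fun _ : ι => ν) e
  have hT : ∀ x : Fin (Fintype.card ι) → X, ∀ i,
      MeasurableEquiv.piCongrLeft (fun _ : ι => X) e x i = x (e.symm i) := by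
    intro x i
    obtain ⟨j, rfl⟩ := e.surjective i
    simp [MeasurableEquiv.piCongrLeft]
  set T := MeasurableEquiv.piCongrLeft (fun _ : ι => X) e with hTdef
  have hint : ∀ F : (ι → X) → ℝ, ∫ x, F x ∂(Measure.pi fun _ : ι => ν) =
      ∫ x, F (T x) ∂(Measure.pi fun _ : Fin (Fintype.card ι) => ν) := fun F =>
    (hp.integral_comp (MeasurableEquiv.measurableEmbedding _) F).symm
  have h := efronStein_fin ν z (Fintype.card ι) (fun x => f (T x)) (hf.comp T.measurable) C
    (fun x => hC _)
  rw [hint, hint f]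
  refine h.trans (le_of_eq ?_)
  rw [← e.sum_comp]
  refine Finset.sum_congr rfl fun i _ => ?_
  rw [hint]
  refine integral_congr_ae (ae_of_all _ fun x => ?_)
  have : T (Function.update x i z) = Function.update (T x) (e i) z := by
    funext j
    rw [hT]
    by_cases hj : j = e i
    · subst hj; simp
    · rw [Function.update_of_ne (by
        intro h; exact hj (by rw [← h]; simp)), Function.update_of_ne hj, hT]
  simp only [this]

end Tools

end

/-! ### The walk as a measurable function of its clocks, and its restarts -/

section

variable {N : ℕ}

instance : DiscreteMeasurableSpace (ZMod 2) := inferInstanceAs (DiscreteMeasurableSpace (Fin 2))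

instance : DiscreteMeasurableSpace (Cube N) := MeasurableSingletonClass.toDiscreteMeasurableSpace

/-! ### The jump chain as a deterministic function of the clocks -/

theorem rate_pos (a : ℝ) (ω : Sample N) (x y : Cube N) : 0 < rate a ω x y := Real.exp_pos _

open Classical in
/-- The neighbour of `y` in the direction of the first ringing clock. -/
def step (r : Fin N → ℝ) (y : Cube N) : Cube N := fun i =>
  if (∀ j, r i ≤ r j) ∧ (∀ j, j < i → r i < r j) then y i + 1 else y i

theorem jumpChain_succ (a : ℝ) (ω : Sample N) (n : ℕ) :
    jumpChain a ω (n + 1) = step (ring a ω n (jumpChain a ω n)) (jumpChain a ω n) := rfl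

theorem step_sub (r : Fin N → ℝ) (s : ℝ) (y : Cube N) :
    step (fun i => r i - s) y = step r y := by
  funext i
  simp only [step, sub_le_sub_iff_right, sub_lt_sub_iff_right]

theorem jumpTime_succ (a : ℝ) (ω : Sample N) (n : ℕ) :
    jumpTime a ω (n + 1) = jumpTime a ω n + holding a ω n := Finset.sum_range_succ _ _

theorem jumpTime_zero (a : ℝ) (ω : Sample N) : jumpTime a ω 0 = 0 := by simp [jumpTime]

theorem jumpTime_mono (a : ℝ) (ω : Sample N) : Monotone (jumpTime a ω) :=
  monotone_nat_of_le_succ fun n => by rw [jumpTime_succ]; exact le_self_add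

theorem holding_eq (a : ℝ) (ω : Sample N) (n : ℕ) :
    holding a ω n = ⨅ i : Fin N, ENNReal.ofReal (ring a ω n (jumpChain a ω n) i) := rfl

/-- Two samples with the same starting point whose clocks ring simultaneously along the path have
the same path. -/
theorem path_congr (a : ℝ) {ω ω' : Sample N} (hx : ω.2.1 = ω'.2.1) (n : ℕ)
    (h : ∀ m < n, ∀ i, ring a ω m (jumpChain a ω m) i = ring a ω' m (jumpChain a ω m) i) :
    jumpChain a ω n = jumpChain a ω' n ∧ jumpTime a ω n = jumpTime a ω' n := by
  induction n with
  | zero => exact ⟨hx, by simp [jumpTime_zero]⟩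
  | succ n ih =>
    obtain ⟨h1, h2⟩ := ih fun m hm => h m (hm.trans n.lt_succ_self)
    have h3 := h n n.lt_succ_self
    refine ⟨?_, ?_⟩
    · rw [jumpChain_succ, jumpChain_succ, ← h1]
      congr 1
      funext i
      exact h3 i
    · rw [jumpTime_succ, jumpTime_succ, h2, holding_eq, holding_eq, ← h1]
      congr 1
      exact iInf_congr fun i => by rw [h3 i]

theorem path_congr_clocks (a : ℝ) (E : Cube N → ℝ) (x : Cube N) {ξ ξ' : ℕ × Fin N → ℝ} (n : ℕ)
    (h : ∀ k, k.1 < n → ξ k = ξ' k) :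
    jumpChain a (E, x, ξ) n = jumpChain a (E, x, ξ') n ∧
      jumpTime a (E, x, ξ) n = jumpTime a (E, x, ξ') n :=
  path_congr a (ω := (E, x, ξ)) (ω' := (E, x, ξ')) rfl n fun m hm i => by
    have : ξ (m, i) = ξ' (m, i) := h (m, i) hm
    simp only [ring, rate, energy, this]

/-- The number of jumps up to time `u`. -/
def numJumps (a : ℝ) (u : ℝ≥0) (ω : Sample N) : ℕ := sSup {n : ℕ | jumpTime a ω n ≤ (u : ℝ≥0∞)}

theorem walk_eq (a : ℝ) (ω : Sample N) (u : ℝ≥0) :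
    walk a ω u = jumpChain a ω (numJumps a u ω) := rfl

/-- Positive clocks and no explosion. -/
def Good (a : ℝ) (ω : Sample N) : Prop :=
  (∀ k, 0 < ω.2.2 k) ∧ ∀ u : ℝ≥0, ∃ n, (u : ℝ≥0∞) < jumpTime a ω n

/-- The second alternative accounts for the value `0` given to the supremum of an unbounded set,
that is, for infinitely many jumps in a bounded time. -/
theorem nat_sSup_eq_iff {S : Set ℕ} (h0 : 0 ∈ S) (hS : ∀ m n, m ≤ n → n ∈ S → m ∈ S) (n : ℕ) :
    sSup S = n ↔ (n ∈ S ∧ n + 1 ∉ S) ∨ (n = 0 ∧ ∀ m, m ∈ S) := by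
  by_cases hb : BddAbove S
  · have hmem : sSup S ∈ S := Nat.sSup_mem ⟨0, h0⟩ hb
    constructor
    · rintro rfl
      exact Or.inl ⟨hmem, fun h => by have := le_csSup hb h; omega⟩
    · rintro (⟨h1, h2⟩ | ⟨-, h⟩)
      · refine le_antisymm ?_ (le_csSup hb h1)
        by_contra hlt
        exact h2 (hS _ _ (by omega) hmem)
      · obtain ⟨B, hB⟩ := hb
        have := hB (h (B + 1))
        omega
  · have hall : ∀ m, m ∈ S := by
      intro m
      rw [not_bddAbove_iff] at hb
      obtain ⟨k, hk, hmk⟩ := hb m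
      exact hS _ _ hmk.le hk
    have : sSup S = 0 := by
      rw [csSup_of_not_bddAbove hb]
      simp
    rw [this]
    constructor
    · rintro rfl
      exact Or.inr ⟨rfl, hall⟩
    · rintro (⟨-, h2⟩ | ⟨h, -⟩)
      · exact absurd (hall _) h2
      · exact h.symm

theorem numJumps_eq_iff' (a : ℝ) (u : ℝ≥0) (ω : Sample N) (n : ℕ) :
    numJumps a u ω = n ↔ (jumpTime a ω n ≤ u ∧ ¬ jumpTime a ω (n + 1) ≤ u) ∨
      (n = 0 ∧ ∀ m, jumpTime a ω m ≤ u) :=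
  nat_sSup_eq_iff (S := {n : ℕ | jumpTime a ω n ≤ (u : ℝ≥0∞)})
    (by simp [jumpTime_zero]) (fun m n hmn (h : jumpTime a ω n ≤ u) =>
      (jumpTime_mono a ω hmn).trans h) n

theorem Good.numJumps_eq_iff {a : ℝ} {ω : Sample N} (h : Good a ω) (u : ℝ≥0) (n : ℕ) :
    numJumps a u ω = n ↔ jumpTime a ω n ≤ u ∧ (u : ℝ≥0∞) < jumpTime a ω (n + 1) := by
  rw [numJumps_eq_iff', not_le, or_iff_left]
  rintro ⟨-, hall⟩
  obtain ⟨n, hn⟩ := h.2 u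
  exact absurd (hall n) (not_le.2 hn)

theorem Good.numJumps_spec {a : ℝ} {ω : Sample N} (h : Good a ω) (u : ℝ≥0) :
    jumpTime a ω (numJumps a u ω) ≤ u ∧ (u : ℝ≥0∞) < jumpTime a ω (numJumps a u ω + 1) :=
  (h.numJumps_eq_iff u _).1 rfl

theorem Good.jumpTime_le_iff {a : ℝ} {ω : Sample N} (h : Good a ω) (u : ℝ≥0) (n : ℕ) :
    jumpTime a ω n ≤ u ↔ n ≤ numJumps a u ω := by
  obtain ⟨h1, h2⟩ := h.numJumps_spec u
  constructor
  · intro h3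
    by_contra h4
    have h5 := jumpTime_mono a ω (show numJumps a u ω + 1 ≤ n by omega)
    exact absurd (h2.trans_le h5) (not_lt.2 h3)
  · exact fun h3 => (jumpTime_mono a ω h3).trans h1

/-! ### Restarting the walk -/

/-- The clocks from level `n` on. -/
def shiftClock (n : ℕ) (ξ : ℕ × Fin N → ℝ) : ℕ × Fin N → ℝ := fun k => ξ (n + k.1, k.2)

/-- The sample seen after time `s` has been spent in the `n`-th position. -/
def restart (a : ℝ) (n : ℕ) (s : ℝ) (ω : Sample N) : Sample N :=
  (ω.1, jumpChain a ω n,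
    lower (fun i => rate a ω (jumpChain a ω n) (jumpChain a ω n + Pi.single i 1) * s)
      (shiftClock n ω.2.2))

/-- Lowering each clock by its rate times `s` lowers every ringing time of the current position by
the same `s`; the winner of the race is unchanged, and later levels are not touched. -/
theorem jumpChain_restart (a : ℝ) (n : ℕ) (s : ℝ) (ω : Sample N) (m : ℕ) :
    jumpChain a (restart a n s ω) m = jumpChain a ω (n + m) := by
  induction m with
  | zero => rfl
  | succ m ih =>
    rw [jumpChain_succ, ih, ← add_assoc, jumpChain_succ]
    rcases Nat.eq_zero_or_pos m with rfl | hm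
    · rw [add_zero, ← step_sub (ring a ω n (jumpChain a ω n)) s]
      congr 1
      funext i
      have := (rate_pos a ω (jumpChain a ω n) (jumpChain a ω n + Pi.single i 1)).ne'
      simp only [ring, restart, lower, shiftClock, rate, energy] at this ⊢
      simp only [if_true, add_zero]
      field_simp
    · congr 1
      funext i
      simp [ring, restart, lower, shiftClock, rate, energy, hm.ne']

theorem holding_restart_zero (a : ℝ) (n : ℕ) {s : ℝ} (hs : 0 ≤ s) (ω : Sample N) :
    holding a (restart a n s ω) 0 = holding a ω n - ENNReal.ofReal s := by
  have hsub : ∀ f : Fin N → ℝ≥0∞, ∀ c : ℝ≥0∞, c ≠ ⊤ → (⨅ i, f i) - c = ⨅ i, (f i - c) := by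
    intro f c hc
    rcases isEmpty_or_nonempty (Fin N) with h | h
    · rw [iInf_of_empty, iInf_of_empty, ENNReal.top_sub hc]
    · obtain ⟨i, hi⟩ := exists_eq_ciInf_of_finite (f := f)
      refine le_antisymm (le_iInf fun j => tsub_le_tsub_right (iInf_le _ j) _) ?_
      rw [← hi]
      exact iInf_le (fun i => f i - c) i
  rw [holding_eq, holding_eq, hsub _ _ ENNReal.ofReal_ne_top]
  refine iInf_congr fun i => ?_
  rw [← ENNReal.ofReal_sub _ hs, jumpChain_restart, add_zero]
  congr 1
  have := (rate_pos a ω (jumpChain a ω n) (jumpChain a ω n + Pi.single i 1)).ne'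
  simp only [ring, restart, lower, shiftClock, rate, energy] at this ⊢
  simp only [if_true, add_zero]
  field_simp

theorem holding_restart_succ (a : ℝ) (n : ℕ) (s : ℝ) (ω : Sample N) (m : ℕ) :
    holding a (restart a n s ω) (m + 1) = holding a ω (n + (m + 1)) := by
  rw [holding_eq, holding_eq]
  refine iInf_congr fun i => ?_
  rw [jumpChain_restart]
  simp [ring, restart, lower, shiftClock, rate, energy]

/-- The sample seen from time `u` on. -/
def residual (a : ℝ) (u : ℝ≥0) (ω : Sample N) : Sample N :=
  restart a (numJumps a u ω) ((u : ℝ≥0∞) - jumpTime a ω (numJumps a u ω)).toReal ω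

/-- Stated for the jumps of index `m + 1`, because the restarted sample has its jump of index `0` at
time `u`, whereas jump `n` of the original sample may be earlier. -/
theorem add_jumpTime_restart (a : ℝ) (u : ℝ≥0) (ω : Sample N) (n : ℕ)
    (h1 : jumpTime a ω n ≤ u) (h2 : (u : ℝ≥0∞) < jumpTime a ω (n + 1)) (m : ℕ) :
    (u : ℝ≥0∞) + jumpTime a (restart a n ((u : ℝ≥0∞) - jumpTime a ω n).toReal ω) (m + 1) =
      jumpTime a ω (n + (m + 1)) := by
  have hne : (u : ℝ≥0∞) - jumpTime a ω n ≠ ⊤ := ENNReal.sub_ne_top ENNReal.coe_ne_top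
  induction m with
  | zero =>
    rw [jumpTime_succ, jumpTime_zero, zero_add, holding_restart_zero _ _ ENNReal.toReal_nonneg,
      ENNReal.ofReal_toReal hne, zero_add, jumpTime_succ]
    rw [jumpTime_succ] at h2
    have h3 : (u : ℝ≥0∞) - jumpTime a ω n ≤ holding a ω n := tsub_le_iff_left.2 h2.le
    calc (u : ℝ≥0∞) + (holding a ω n - ((u : ℝ≥0∞) - jumpTime a ω n))
        = (jumpTime a ω n + ((u : ℝ≥0∞) - jumpTime a ω n)) +
            (holding a ω n - ((u : ℝ≥0∞) - jumpTime a ω n)) := by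
          rw [add_tsub_cancel_of_le h1]
      _ = _ := by rw [add_assoc, add_tsub_cancel_of_le h3]
  | succ m ih =>
    rw [jumpTime_succ, ← add_assoc, ih, holding_restart_succ, ← add_assoc n (m + 1) 1,
      jumpTime_succ]

theorem Good.add_jumpTime_residual {a : ℝ} {ω : Sample N} (h : Good a ω) (u : ℝ≥0) (m : ℕ) :
    (u : ℝ≥0∞) + jumpTime a (residual a u ω) (m + 1) =
      jumpTime a ω (numJumps a u ω + (m + 1)) :=
  add_jumpTime_restart a u ω _ (h.numJumps_spec u).1 (h.numJumps_spec u).2 m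

theorem jumpChain_residual (a : ℝ) (u : ℝ≥0) (ω : Sample N) (m : ℕ) :
    jumpChain a (residual a u ω) m = jumpChain a ω (numJumps a u ω + m) :=
  jumpChain_restart _ _ _ _ _

theorem Good.jumpTime_residual_le_iff {a : ℝ} {ω : Sample N} (h : Good a ω) (u s : ℝ≥0) (m : ℕ) :
    jumpTime a (residual a u ω) m ≤ s ↔ jumpTime a ω (numJumps a u ω + m) ≤ (u + s : ℝ≥0) := by
  rcases m with _ | m
  · simp only [jumpTime_zero, add_zero]
    refine iff_of_true (by simp) ((h.numJumps_spec u).1.trans ?_)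
    exact_mod_cast le_self_add
  · rw [← h.add_jumpTime_residual u m, ENNReal.coe_add,
      ENNReal.add_le_add_iff_left ENNReal.coe_ne_top]

theorem lt_ring_of_lt {a : ℝ} {ω : Sample N} {u : ℝ≥0} {n : ℕ} (h1 : jumpTime a ω n ≤ u) :
    (u : ℝ≥0∞) < jumpTime a ω (n + 1) ↔ N = 0 ∨ ∀ i,
      rate a ω (jumpChain a ω n) (jumpChain a ω n + Pi.single i 1) *
        ((u : ℝ≥0∞) - jumpTime a ω n).toReal < ω.2.2 (n, i) ∧ N ≠ 0 := by
  have hne : (u : ℝ≥0∞) - jumpTime a ω n ≠ ⊤ := ENNReal.sub_ne_top ENNReal.coe_ne_top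
  have hJ : jumpTime a ω n ≠ ⊤ := ne_top_of_le_ne_top ENNReal.coe_ne_top h1
  rw [jumpTime_succ]
  have e1 : (u : ℝ≥0∞) < jumpTime a ω n + holding a ω n ↔
      (u : ℝ≥0∞) - jumpTime a ω n < holding a ω n := by
    rw [ENNReal.sub_lt_iff_lt_left hJ h1]
  rw [e1, holding_eq]
  rcases Nat.eq_zero_or_pos N with rfl | hN
  · simp only [iInf_of_empty, true_or, iff_true]
    exact hne.lt_top
  · have : Nonempty (Fin N) := ⟨⟨0, hN⟩⟩
    have e2 : ((u : ℝ≥0∞) - jumpTime a ω n < ⨅ i : Fin N,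
        ENNReal.ofReal (ring a ω n (jumpChain a ω n) i)) ↔ ∀ i,
        (u : ℝ≥0∞) - jumpTime a ω n < ENNReal.ofReal (ring a ω n (jumpChain a ω n) i) := by
      constructor
      · exact fun h i => h.trans_le (iInf_le _ i)
      · intro h
        obtain ⟨i, hi⟩ := exists_eq_ciInf_of_finite
          (f := fun i : Fin N => ENNReal.ofReal (ring a ω n (jumpChain a ω n) i))
        rw [← hi]
        exact h i
    rw [e2]
    simp only [hN.ne', false_or, ne_eq, not_false_eq_true, and_true]
    refine forall_congr' fun i => ?_
    rw [ENNReal.lt_ofReal_iff_toReal_lt hne, ring, lt_div_iff₀ (rate_pos _ _ _ _), mul_comm]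

/-- The absence of a further jump before `u` is a box condition on the clocks of level `n`, with
sides known from the previous levels: this is the form in which memorylessness applies. -/
theorem lt_jumpTime_succ_iff {a : ℝ} {ω : Sample N} {u : ℝ≥0} {n : ℕ} (h1 : jumpTime a ω n ≤ u) :
    (u : ℝ≥0∞) < jumpTime a ω (n + 1) ↔ ∀ i,
      rate a ω (jumpChain a ω n) (jumpChain a ω n + Pi.single i 1) *
        ((u : ℝ≥0∞) - jumpTime a ω n).toReal < ω.2.2 (n, i) := by
  rw [lt_ring_of_lt h1]
  rcases Nat.eq_zero_or_pos N with rfl | hN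
  · simp
  · simp [hN.ne']

theorem Good.residual {a : ℝ} {ω : Sample N} (h : Good a ω) (u : ℝ≥0) : Good a (residual a u ω) := by
  obtain ⟨h1, h2⟩ := h.numJumps_spec u
  refine ⟨?_, fun s => ?_⟩
  · rintro ⟨m, i⟩
    simp only [RandomTraps.residual, restart, lower]
    split_ifs with hm
    · subst hm
      have := (lt_jumpTime_succ_iff h1).1 h2 i
      simpa [shiftClock] using this
    · exact h.1 _
  · obtain ⟨n, hn⟩ := h.2 (u + s)
    refine ⟨n, ?_⟩
    by_contra hle
    rw [not_lt, h.jumpTime_residual_le_iff] at hle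
    exact absurd (hn.trans_le (jumpTime_mono a ω (Nat.le_add_left _ _))) (not_lt.2 hle)

theorem Good.numJumps_add {a : ℝ} {ω : Sample N} (h : Good a ω) (u s : ℝ≥0) :
    numJumps a (u + s) ω = numJumps a u ω + numJumps a s (RandomTraps.residual a u ω) := by
  obtain ⟨h1, h2⟩ := (h.residual u).numJumps_spec s
  rw [h.numJumps_eq_iff]
  rw [h.jumpTime_residual_le_iff] at h1
  rw [← not_le, h.jumpTime_residual_le_iff, not_le] at h2
  exact ⟨h1, h2⟩

theorem Good.walk_add {a : ℝ} {ω : Sample N} (h : Good a ω) (u s : ℝ≥0) :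
    walk a ω (u + s) = walk a (RandomTraps.residual a u ω) s := by
  rw [walk_eq, walk_eq, h.numJumps_add, jumpChain_residual]

/-! ### The discovered set through the jump chain -/

open Classical in
/-- The set of sites at distance at most one from a position reached before time `u`. -/
def disc (a : ℝ) (u : ℝ≥0) (ω : Sample N) : Finset (Cube N) :=
  Finset.univ.filter fun x => ∃ n, jumpTime a ω n ≤ u ∧ hammingDist x (jumpChain a ω n) ≤ 1

theorem mem_disc {a : ℝ} {u : ℝ≥0} {ω : Sample N} {x : Cube N} :
    x ∈ disc a u ω ↔ ∃ n, jumpTime a ω n ≤ u ∧ hammingDist x (jumpChain a ω n) ≤ 1 := by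
  simp [disc]

theorem disc_mono (a : ℝ) (ω : Sample N) {u v : ℝ≥0} (h : u ≤ v) : disc a u ω ⊆ disc a v ω := by
  intro x hx
  rw [mem_disc] at hx ⊢
  obtain ⟨n, h1, h2⟩ := hx
  exact ⟨n, h1.trans (by exact_mod_cast h), h2⟩

theorem Good.disc_add {a : ℝ} {ω : Sample N} (h : Good a ω) (u s : ℝ≥0) :
    disc a (u + s) ω = disc a u ω ∪ disc a s (RandomTraps.residual a u ω) := by
  ext x
  rw [Finset.mem_union, mem_disc, mem_disc, mem_disc]
  constructor
  · rintro ⟨n, h1, h2⟩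
    by_cases hn : jumpTime a ω n ≤ u
    · exact Or.inl ⟨n, hn, h2⟩
    · rw [h.jumpTime_le_iff, not_le] at hn
      obtain ⟨m, rfl⟩ := Nat.exists_eq_add_of_lt hn
      exact Or.inr ⟨m + 1, (h.jumpTime_residual_le_iff u s _).2 h1,
        by rw [jumpChain_residual]; exact h2⟩
  · rintro (⟨n, h1, h2⟩ | ⟨m, h1, h2⟩)
    · exact ⟨n, h1.trans (by exact_mod_cast le_self_add), h2⟩
    · exact ⟨_, (h.jumpTime_residual_le_iff u s m).1 h1, by rwa [jumpChain_residual] at h2⟩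

theorem Good.jumpTime_lt_succ {a : ℝ} {ω : Sample N} (h : Good a ω) {n : ℕ}
    (hn : jumpTime a ω n ≠ ⊤) : jumpTime a ω n < jumpTime a ω (n + 1) := by
  lift jumpTime a ω n to ℝ≥0 using hn with u hu
  rw [lt_jumpTime_succ_iff hu.ge]
  intro i
  simpa [hu] using h.1 (n, i)

/-- Positive clocks force every position of the jump chain to be held for a positive time, so `walk`
does not skip any of them; the jump chain can replace the walk from here on. -/
theorem Good.discovered_eq {a : ℝ} {ω : Sample N} (h : Good a ω) (u : ℝ≥0) :
    discovered a ω u = disc a u ω := by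
  ext x
  rw [Finset.mem_coe, mem_disc]
  constructor
  · rintro ⟨s, hs, hx⟩
    exact ⟨numJumps a s ω, (h.numJumps_spec s).1.trans (by exact_mod_cast hs), hx⟩
  · rintro ⟨n, h1, h2⟩
    have hn : jumpTime a ω n ≠ ⊤ := ne_top_of_le_ne_top ENNReal.coe_ne_top h1
    have h3 := h.jumpTime_lt_succ hn
    obtain ⟨s, hs⟩ : ∃ s : ℝ≥0, (s : ℝ≥0∞) = jumpTime a ω n := ⟨_, ENNReal.coe_toNNReal hn⟩
    refine ⟨s, by rw [← hs] at h1; exact_mod_cast h1, ?_⟩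
    have : numJumps a s ω = n := (h.numJumps_eq_iff s n).2 ⟨hs.ge, by rw [hs]; exact h3⟩
    rw [walk_eq, this]
    exact h2

theorem Good.numDiscovered_eq {a : ℝ} {ω : Sample N} (h : Good a ω) (u : ℝ≥0) :
    numDiscovered a ω u = (disc a u ω).card := by
  rw [numDiscovered, h.discovered_eq, Set.ncard_coe_finset]

/-! ### Measurability -/

theorem measurable_comp_countable {A B ι : Type*} [MeasurableSpace A] [MeasurableSpace B]
    [MeasurableSpace ι] [Countable ι] [MeasurableSingletonClass ι] {F : ι → A → B}
    (hF : ∀ i, Measurable (F i)) {g : A → ι} (hg : Measurable g) :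
    Measurable fun x => F (g x) x := by
  have : Measurable fun p : ι × A => F p.1 p.2 := measurable_from_prod_countable_right hF
  exact this.comp (hg.prodMk measurable_id)

@[fun_prop]
theorem measurable_rate (a : ℝ) (x y : Cube N) : Measurable fun ω : Sample N => rate a ω x y := by
  unfold rate energy
  fun_prop

@[fun_prop]
theorem measurable_ring (a : ℝ) (n : ℕ) (y : Cube N) (i : Fin N) :
    Measurable fun ω : Sample N => ring a ω n y i := by
  unfold ring
  fun_prop

theorem measurable_step (y : Cube N) : Measurable fun r : Fin N → ℝ => step r y := by
  refine measurable_pi_lambda _ fun i => ?_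
  refine Measurable.ite ?_ measurable_const measurable_const
  simp only [Set.ofPred_and, Set.ofPred_forall]
  refine MeasurableSet.inter (MeasurableSet.iInter fun j => ?_)
    (MeasurableSet.iInter fun j => MeasurableSet.iInter fun _ => ?_)
  · exact measurableSet_le (measurable_pi_apply _) (measurable_pi_apply _)
  · exact measurableSet_lt (measurable_pi_apply _) (measurable_pi_apply _)

@[fun_prop]
theorem measurable_jumpChain (a : ℝ) (n : ℕ) : Measurable fun ω : Sample N => jumpChain a ω n := by
  induction n with
  | zero => exact measurable_snd.fst
  | succ n ih =>
    refine measurable_comp_countable (F := fun y ω => step (ring a ω n y) y) (fun y => ?_) ih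
    exact (measurable_step y).comp (measurable_pi_lambda _ fun i => measurable_ring a n y i)

@[fun_prop]
theorem measurable_holding (a : ℝ) (n : ℕ) : Measurable fun ω : Sample N => holding a ω n := by
  refine Measurable.iInf fun i => ENNReal.measurable_ofReal.comp ?_
  exact measurable_comp_countable (F := fun y ω => ring a ω n y i)
    (fun y => measurable_ring a n y i) (measurable_jumpChain a n)

@[fun_prop]
theorem measurable_jumpTime (a : ℝ) (n : ℕ) : Measurable fun ω : Sample N => jumpTime a ω n :=
  Finset.measurable_fun_sum _ fun m _ => measurable_holding a m

@[fun_prop]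
theorem measurable_numJumps (a : ℝ) (u : ℝ≥0) : Measurable fun ω : Sample N => numJumps a u ω := by
  refine measurable_to_countable' fun n => ?_
  have h1 : ∀ m, MeasurableSet {ω : Sample N | jumpTime a ω m ≤ (u : ℝ≥0∞)} := fun m =>
    measurableSet_le (measurable_jumpTime a m) measurable_const
  have : (fun ω : Sample N => numJumps a u ω) ⁻¹' {n} =
      ({ω | jumpTime a ω n ≤ (u : ℝ≥0∞)} ∩ {ω | jumpTime a ω (n + 1) ≤ (u : ℝ≥0∞)}ᶜ) ∪
        ({_ω | n = 0} ∩ ⋂ m, {ω | jumpTime a ω m ≤ (u : ℝ≥0∞)}) := by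
    ext ω
    simp [numJumps_eq_iff']
  rw [this]
  exact ((h1 n).inter (h1 (n + 1)).compl).union
    ((MeasurableSet.const _).inter (MeasurableSet.iInter h1))

@[fun_prop]
theorem measurable_walk (a : ℝ) (u : ℝ≥0) : Measurable fun ω : Sample N => walk a ω u :=
  measurable_comp_countable (F := fun n ω => jumpChain a ω n) (measurable_jumpChain a)
    (measurable_numJumps a u)

@[fun_prop]
theorem measurable_rate_jumpChain (a : ℝ) (n : ℕ) (i : Fin N) :
    Measurable fun ω : Sample N =>
      rate a ω (jumpChain a ω n) (jumpChain a ω n + Pi.single i 1) := by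
  have h (y : Cube N) : Measurable fun ω : Sample N => rate a ω y (y + Pi.single i 1) :=
    measurable_rate a y _
  exact measurable_comp_countable h (measurable_jumpChain a n)

theorem measurable_restart (a : ℝ) (n : ℕ) {s : Sample N → ℝ} (hs : Measurable s) :
    Measurable fun ω : Sample N => restart a n (s ω) ω := by
  refine measurable_fst.prodMk ((measurable_jumpChain a n).prodMk ?_)
  refine measurable_pi_lambda _ fun k => ?_
  simp only [lower, shiftClock]
  split_ifs
  · have h1 := measurable_rate_jumpChain (N := N) a n k.2
    have h2 : Measurable fun ω : Sample N => ω.2.2 (n + k.1, k.2) := by fun_prop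
    exact h2.sub (h1.mul hs)
  · fun_prop

@[fun_prop]
theorem measurable_residual (a : ℝ) (u : ℝ≥0) : Measurable fun ω : Sample N => residual a u ω :=
  measurable_comp_countable
    (F := fun n ω => restart a n ((u : ℝ≥0∞) - jumpTime a ω n).toReal ω)
    (fun n => measurable_restart a n (by fun_prop)) (measurable_numJumps a u)

theorem measurableSet_mem_disc (a : ℝ) (u : ℝ≥0) (x : Cube N) :
    MeasurableSet {ω : Sample N | x ∈ disc a u ω} := by
  simp only [mem_disc, Set.ofPred_exists]
  refine MeasurableSet.iUnion fun n => ?_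
  refine (measurableSet_le (measurable_jumpTime a n) measurable_const).inter ?_
  exact measurable_jumpChain a n (Set.to_countable {y | hammingDist x y ≤ 1}).measurableSet

instance : MeasurableSpace (Finset (Cube N)) := ⊤

@[fun_prop]
theorem measurable_disc (a : ℝ) (u : ℝ≥0) : Measurable fun ω : Sample N => disc a u ω := by
  refine measurable_to_countable' fun S => ?_
  have : (fun ω : Sample N => disc a u ω) ⁻¹' {S} =
      ⋂ x, {ω | x ∈ disc a u ω ↔ x ∈ S} := by
    ext ω
    simp [Finset.ext_iff]
  rw [this]
  refine MeasurableSet.iInter fun x => ?_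
  by_cases hx : x ∈ S
  · simpa only [hx, iff_true] using measurableSet_mem_disc a u x
  · simp only [hx, iff_false]
    exact (measurableSet_mem_disc a u x).compl

end

/-! ### Absence of explosion and the Markov property -/

section

variable {N : ℕ}

/-! ### Slow clocks and absence of explosion -/

theorem lintegral_exp_stdExp {θ : ℝ} (hθ : 0 ≤ θ) :
    ∫⁻ x, ENNReal.ofReal (Real.exp (-(θ * x))) ∂stdExp = ENNReal.ofReal (1 / (1 + θ)) := by
  have hdef : stdExp = volume.withDensity (exponentialPDF 1) := rfl
  have hpdf : ∀ r, Measurable (exponentialPDF r) := fun r =>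
    (measurable_exponentialPDFReal r).ennreal_ofReal
  rw [hdef, lintegral_withDensity_eq_lintegral_mul _ (hpdf 1) (by fun_prop)]
  have h1 : ∀ x, (exponentialPDF 1 * fun x => ENNReal.ofReal (Real.exp (-(θ * x)))) x =
      ENNReal.ofReal (1 / (1 + θ)) * exponentialPDF (1 + θ) x := by
    intro x
    simp only [Pi.mul_apply]
    rcases lt_or_ge x 0 with h | h
    · simp [exponentialPDF_of_neg h]
    · rw [exponentialPDF_of_nonneg h, exponentialPDF_of_nonneg h,
        ← ENNReal.ofReal_mul (by positivity), ← ENNReal.ofReal_mul (by positivity)]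
      congr 1
      rw [one_mul, one_mul, ← Real.exp_add]
      have : -x + -(θ * x) = -((1 + θ) * x) := by ring
      rw [this]
      field_simp
  simp only [h1]
  rw [lintegral_const_mul _ (hpdf _), lintegral_exponentialPDF_eq_one (by linarith), mul_one]

/-- The product over the first `n` levels of the sums of `exp (- 2 N ξ)`. -/
def slowWeight (n : ℕ) (ξ : ℕ × Fin N → ℝ) : ℝ≥0∞ :=
  ∏ m ∈ Finset.range n, ∑ i, ENNReal.ofReal (Real.exp (-(2 * N * ξ (m, i))))

@[fun_prop]
theorem measurable_slowWeight (n : ℕ) : Measurable (slowWeight (N := N) n) := by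
  unfold slowWeight
  fun_prop

theorem lintegral_eval_clockLaw (k : ℕ × Fin N) {f : ℝ → ℝ≥0∞} (hf : Measurable f) :
    ∫⁻ ξ, f (ξ k) ∂(clockLaw N) = ∫⁻ x, f x ∂stdExp :=
  (measurePreserving_eval_infinitePi (fun _ : ℕ × Fin N => stdExp) k).lintegral_comp hf

/-- The coefficient `2 N` makes the mean of each factor equal to `N / (1 + 2 N)`, at most `1 / 2`;
the levels are independent, so the means multiply. -/
theorem lintegral_slowWeight_le (n : ℕ) :
    ∫⁻ ξ, slowWeight n ξ ∂(clockLaw N) ≤ 2⁻¹ ^ n := by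
  induction n with
  | zero => simp [slowWeight]
  | succ n ih =>
    unfold clockLaw
    rw [lintegral_concat stdExp n (measurable_slowWeight (n + 1))]
    have h1 : ∀ ξ η : ℕ × Fin N → ℝ, slowWeight (n + 1) (concat n ξ η) =
        slowWeight n ξ * ∑ i, ENNReal.ofReal (Real.exp (-(2 * N * η (0, i)))) := by
      intro ξ η
      rw [slowWeight, Finset.prod_range_succ, slowWeight]
      congr 1
      · refine Finset.prod_congr rfl fun m hm => ?_
        simp [concat, Finset.mem_range.1 hm]
      · simp [concat]
    have h2 : ∫⁻ η, ∑ i, ENNReal.ofReal (Real.exp (-(2 * N * η (0, i)))) ∂(clockLaw N) ≤ 2⁻¹ := by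
      rw [lintegral_finsetSum _ fun i _ => by fun_prop]
      have h3 : ∀ i : Fin N, ∫⁻ η : ℕ × Fin N → ℝ,
          ENNReal.ofReal (Real.exp (-(2 * N * η (0, i)))) ∂(clockLaw N) =
            ENNReal.ofReal (1 / (1 + 2 * N)) := fun i => by
        rw [lintegral_eval_clockLaw (0, i)
          (f := fun x => ENNReal.ofReal (Real.exp (-(2 * N * x)))) (by fun_prop),
          lintegral_exp_stdExp (by positivity)]
      simp only [h3, Finset.sum_const, Finset.card_univ, Fintype.card_fin, nsmul_eq_mul]
      rw [← ENNReal.ofReal_natCast, ← ENNReal.ofReal_mul (by positivity)]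
      have : (2⁻¹ : ℝ≥0∞) = ENNReal.ofReal (1 / 2) := by
        rw [ENNReal.ofReal_div_of_pos two_pos]; simp
      rw [this]
      refine ENNReal.ofReal_le_ofReal ?_
      rw [mul_one_div, div_le_div_iff₀ (by positivity) two_pos]
      linarith
    simp only [h1]
    calc _ = ∫⁻ ξ, slowWeight n ξ *
          ∫⁻ η, ∑ i, ENNReal.ofReal (Real.exp (-(2 * N * η (0, i)))) ∂(clockLaw N) ∂(clockLaw N) := by
          refine lintegral_congr fun ξ => ?_
          exact lintegral_const_mul _ (by fun_prop)
      _ = (∫⁻ ξ, slowWeight n ξ ∂(clockLaw N)) *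
          ∫⁻ η, ∑ i, ENNReal.ofReal (Real.exp (-(2 * N * η (0, i)))) ∂(clockLaw N) :=
          lintegral_mul_const _ (by fun_prop)
      _ ≤ _ := by
          rw [pow_succ]
          gcongr

/-- The clocks of the first `n` levels are exceptionally fast. -/
def fastEvent (n : ℕ) (T : ℝ) : Set (ℕ × Fin N → ℝ) :=
  {ξ | ENNReal.ofReal (Real.exp (-(2 * N * T))) ≤ slowWeight n ξ}

theorem measurableSet_fastEvent (n : ℕ) (T : ℝ) : MeasurableSet (fastEvent (N := N) n T) :=
  measurableSet_le measurable_const (measurable_slowWeight n)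

theorem clockLaw_fastEvent_le (n : ℕ) (T : ℝ) :
    clockLaw N (fastEvent n T) ≤ ENNReal.ofReal (Real.exp (2 * N * T)) * 2⁻¹ ^ n := by
  have h := mul_meas_ge_le_lintegral (μ := clockLaw N) (measurable_slowWeight (N := N) n)
    (ENNReal.ofReal (Real.exp (-(2 * N * T))))
  have h2 := h.trans (lintegral_slowWeight_le n)
  have h3 : ENNReal.ofReal (Real.exp (2 * N * T)) * ENNReal.ofReal (Real.exp (-(2 * N * T))) = 1 := by
    rw [← ENNReal.ofReal_mul (Real.exp_pos _).le, ← Real.exp_add]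
    simp
  calc clockLaw N (fastEvent n T)
      = ENNReal.ofReal (Real.exp (2 * N * T)) * (ENNReal.ofReal (Real.exp (-(2 * N * T))) *
          clockLaw N (fastEvent n T)) := by rw [← mul_assoc, h3, one_mul]
    _ ≤ _ := by gcongr; exact h2

/-- A Chernoff bound that does not see the path. At each level some clock is at most `R` times the
holding time; keeping this clock alone in the sum over directions and multiplying over the levels
leaves the exponential of the total elapsed time. -/
theorem mem_fastEvent_of_jumpTime_le (hN : N ≠ 0) {a R : ℝ} {ω : Sample N} (hR : ∀ x y, rate a ω x y ≤ R)
    {n : ℕ} {s : ℝ≥0} (h : jumpTime a ω n ≤ s) : ω.2.2 ∈ fastEvent n (R * s) := by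
  have : Nonempty (Fin N) := ⟨⟨0, Nat.pos_of_ne_zero hN⟩⟩
  have hR0 : 0 ≤ R := (rate_pos a ω 0 0).le.trans (hR 0 0)
  have hfin : ∀ m < n, holding a ω m ≠ ⊤ := by
    intro m hm
    refine ne_top_of_le_ne_top ENNReal.coe_ne_top (le_trans ?_ h)
    exact Finset.single_le_sum (f := fun m => holding a ω m) (fun _ _ => zero_le)
      (Finset.mem_range.2 hm)
  have hsum : ∑ m ∈ Finset.range n, (holding a ω m).toReal ≤ s := by
    rw [← ENNReal.toReal_sum fun m hm => hfin m (Finset.mem_range.1 hm)]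
    exact ENNReal.toReal_le_coe_of_le_coe h
  have hfac : ∀ m ∈ Finset.range n,
      ENNReal.ofReal (Real.exp (-(2 * N * (R * (holding a ω m).toReal)))) ≤
        ∑ i, ENNReal.ofReal (Real.exp (-(2 * N * ω.2.2 (m, i)))) := by
    intro m _
    obtain ⟨i, hi⟩ := exists_eq_ciInf_of_finite
      (f := fun i : Fin N => ENNReal.ofReal (ring a ω m (jumpChain a ω m) i))
    have h1 : ω.2.2 (m, i) ≤ R * (holding a ω m).toReal := by
      rw [holding_eq, ← hi]
      rcases le_total (ω.2.2 (m, i)) 0 with h0 | h0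
      · exact h0.trans (mul_nonneg hR0 ENNReal.toReal_nonneg)
      · have hp := rate_pos a ω (jumpChain a ω m) (jumpChain a ω m + Pi.single i 1)
        rw [ring, ENNReal.toReal_ofReal (div_nonneg h0 hp.le)]
        have := hR (jumpChain a ω m) (jumpChain a ω m + Pi.single i 1)
        rw [mul_div_assoc', le_div_iff₀ hp, mul_comm]
        exact mul_le_mul_of_nonneg_right this h0
    refine le_trans (ENNReal.ofReal_le_ofReal (Real.exp_le_exp.2 ?_))
      (Finset.single_le_sum (f := fun i => ENNReal.ofReal (Real.exp (-(2 * N * ω.2.2 (m, i)))))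
        (fun _ _ => zero_le) (Finset.mem_univ i))
    have : (0 : ℝ) ≤ 2 * N := by positivity
    exact neg_le_neg (mul_le_mul_of_nonneg_left h1 this)
  show ENNReal.ofReal _ ≤ slowWeight n ω.2.2
  refine le_trans ?_ (Finset.prod_le_prod' hfac)
  rw [← ENNReal.ofReal_prod_of_nonneg fun i _ => (Real.exp_pos _).le, ← Real.exp_sum]
  refine ENNReal.ofReal_le_ofReal (Real.exp_le_exp.2 ?_)
  rw [Finset.sum_neg_distrib, ← Finset.mul_sum, ← Finset.mul_sum]
  refine neg_le_neg ?_
  gcongr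

theorem ae_clock_pos (N : ℕ) : ∀ᵐ ξ ∂(clockLaw N), ∀ k, 0 < ξ k := by
  rw [ae_all_iff]
  intro k
  have h1 : ∀ᵐ x ∂stdExp, 0 < x := by
    have h2 : stdExp (Set.Ioi 0) = 1 := by simpa using stdExp_Ioi le_rfl
    have h3 : {x : ℝ | ¬ 0 < x} = (Set.Ioi 0)ᶜ := by ext; simp
    rw [ae_iff, h3, prob_compl_eq_zero_iff measurableSet_Ioi, h2]
  exact (measurePreserving_eval_infinitePi (fun _ : ℕ × Fin N => stdExp) k).quasiMeasurePreserving.ae h1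

/-- On a finite graph the rates are bounded, so infinitely many jumps before an integer time would
put the clocks in `fastEvent n` for every `n`, and the probability of this event is geometrically
small in `n`. -/
theorem ae_good (a : ℝ) (E : Cube N → ℝ) (x : Cube N) :
    ∀ᵐ ξ ∂(clockLaw N), Good a (E, x, ξ) := by
  have h : ∀ᵐ ξ ∂(clockLaw N), ∀ u : ℕ, ∃ n, ((u : ℝ≥0) : ℝ≥0∞) < jumpTime a (E, x, ξ) n := by
    rcases eq_or_ne N 0 with rfl | hN
    · refine ae_of_all _ fun ξ u => ⟨1, ?_⟩
      rw [jumpTime_succ, holding_eq, iInf_of_empty]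
      simp
    rw [ae_all_iff]
    intro u
    set R : ℝ := ∑ p : Cube N × Cube N, rate a (E, x, 0) p.1 p.2 with hRdef
    have hR : ∀ ξ, ∀ y z, rate a (E, x, ξ) y z ≤ R := fun ξ y z =>
      Finset.single_le_sum (f := fun p : Cube N × Cube N => rate a (E, x, 0) p.1 p.2)
        (fun _ _ => (rate_pos _ _ _ _).le) (Finset.mem_univ (y, z))
    rw [ae_iff]
    refine le_antisymm ?_ zero_le
    have hb : ∀ n, clockLaw N {ξ | ¬ ∃ n, ((u : ℝ≥0) : ℝ≥0∞) < jumpTime a (E, x, ξ) n} ≤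
        ENNReal.ofReal (Real.exp (2 * N * (R * (u : ℝ≥0)))) * 2⁻¹ ^ n := by
      intro n
      refine le_trans (measure_mono fun ξ hξ => ?_) (clockLaw_fastEvent_le n _)
      rw [Set.mem_ofPred_eq, not_exists] at hξ
      exact mem_fastEvent_of_jumpTime_le (ω := (E, x, ξ)) hN (hR ξ) (not_lt.1 (hξ n))
    refine ge_of_tendsto (x := atTop) (?_ : Tendsto (fun n : ℕ =>
      ENNReal.ofReal (Real.exp (2 * N * (R * (u : ℝ≥0)))) * 2⁻¹ ^ n) atTop (𝓝 0)) (Eventually.of_forall hb)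
    have := ENNReal.Tendsto.const_mul (a := ENNReal.ofReal (Real.exp (2 * N * (R * (u : ℝ≥0)))))
      (ENNReal.tendsto_pow_atTop_nhds_zero_of_lt_one (r := 2⁻¹) (by simp))
      (Or.inr ENNReal.ofReal_ne_top)
    simpa using this
  filter_upwards [h, ae_clock_pos N] with ξ h1 h2
  refine ⟨h2, fun u => ?_⟩
  obtain ⟨m, hm⟩ := exists_nat_ge u
  obtain ⟨n, hn⟩ := h1 m
  exact ⟨n, lt_of_le_of_lt (by exact_mod_cast hm) hn⟩

/-! ### The Markov property -/

/-- `G` is a function of the walk up to time `u`. -/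
def Adapted (a : ℝ) (E : Cube N → ℝ) (x : Cube N) (u : ℝ≥0) (G : (ℕ × Fin N → ℝ) → ℝ≥0∞) : Prop :=
  ∀ n ξ ξ', (∀ k, k.1 < n → ξ k = ξ' k) → jumpTime a (E, x, ξ) n ≤ u →
    (u : ℝ≥0∞) < jumpTime a (E, x, ξ) (n + 1) → (u : ℝ≥0∞) < jumpTime a (E, x, ξ') (n + 1) →
    G ξ = G ξ'

theorem shiftClock_concat (n : ℕ) (ξ η : ℕ × Fin N → ℝ) : shiftClock n (concat n ξ η) = η := by
  funext k
  simp [shiftClock, concat]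

theorem measurable_sample (E : Cube N → ℝ) (x : Cube N) :
    Measurable fun ξ : ℕ × Fin N → ℝ => ((E, x, ξ) : Sample N) := by fun_prop

/-- The first `n` levels being fixed, the event says that the clocks of level `n` exceed what has
been consumed of them at time `u`. On it `G` is constant, and memorylessness makes the remaining
clocks fresh. -/
theorem markov_level (a : ℝ) (E : Cube N → ℝ) (x : Cube N) (u : ℝ≥0)
    {G : (ℕ × Fin N → ℝ) → ℝ≥0∞} (hG : Measurable G) (hGa : Adapted a E x u G)
    {H : Sample N → ℝ≥0∞} (hH : Measurable H) (n : ℕ) :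
    ∫⁻ ξ in {ξ | jumpTime a (E, x, ξ) n ≤ u ∧ (u : ℝ≥0∞) < jumpTime a (E, x, ξ) (n + 1)},
        G ξ * H (restart a n ((u : ℝ≥0∞) - jumpTime a (E, x, ξ) n).toReal (E, x, ξ)) ∂(clockLaw N) =
      ∫⁻ ξ in {ξ | jumpTime a (E, x, ξ) n ≤ u ∧ (u : ℝ≥0∞) < jumpTime a (E, x, ξ) (n + 1)},
        G ξ * ∫⁻ η, H (E, jumpChain a (E, x, ξ) n, η) ∂(clockLaw N) ∂(clockLaw N) := by
  have hms := measurable_sample E x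
  have hJ : ∀ m, Measurable fun ξ => jumpTime a (E, x, ξ) m := fun m => (measurable_jumpTime a m).comp hms
  have hY : Measurable fun ξ => jumpChain a (E, x, ξ) n := (measurable_jumpChain a n).comp hms
  have hS : MeasurableSet {ξ | jumpTime a (E, x, ξ) n ≤ u ∧
      (u : ℝ≥0∞) < jumpTime a (E, x, ξ) (n + 1)} :=
    (measurableSet_le (hJ n) measurable_const).inter (measurableSet_lt measurable_const (hJ _))
  have hm1 : Measurable fun ξ =>
      G ξ * H (restart a n ((u : ℝ≥0∞) - jumpTime a (E, x, ξ) n).toReal (E, x, ξ)) := by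
    refine hG.mul (hH.comp ?_)
    exact (measurable_restart a n (s := fun ω => ((u : ℝ≥0∞) - jumpTime a ω n).toReal)
      (by fun_prop)).comp hms
  have hh : Measurable fun y : Cube N => ∫⁻ η, H (E, y, η) ∂(clockLaw N) := measurable_of_countable _
  have hm2 : Measurable fun ξ => G ξ * ∫⁻ η, H (E, jumpChain a (E, x, ξ) n, η) ∂(clockLaw N) :=
    hG.mul (hh.comp hY)
  rw [← lintegral_indicator hS, ← lintegral_indicator hS]
  have hc := fun {f : (ℕ × Fin N → ℝ) → ℝ≥0∞} (hf : Measurable f) =>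
    lintegral_concat (κ := Fin N) stdExp n hf
  unfold clockLaw at *
  rw [hc (hm1.indicator hS), hc (hm2.indicator hS)]
  refine lintegral_congr fun ξ => ?_
  have hcong : ∀ η, jumpChain a (E, x, concat n ξ η) n = jumpChain a (E, x, ξ) n ∧
      jumpTime a (E, x, concat n ξ η) n = jumpTime a (E, x, ξ) n := fun η =>
    path_congr_clocks a E x n fun k hk => by simp [concat, hk]
  set y := jumpChain a (E, x, ξ) n with hy
  set j := jumpTime a (E, x, ξ) n with hj
  by_cases hju : j ≤ u
  -- The amounts consumed at time `u` from the clocks of level `n`.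
  · set c : Fin N → ℝ := fun i => rate a (E, x, ξ) y (y + Pi.single i 1) *
      ((u : ℝ≥0∞) - j).toReal with hcdef
    have hc0 : ∀ i, 0 ≤ c i := fun i => mul_nonneg (rate_pos _ _ _ _).le ENNReal.toReal_nonneg
    have hmem : ∀ η, concat n ξ η ∈ {ξ | jumpTime a (E, x, ξ) n ≤ u ∧
        (u : ℝ≥0∞) < jumpTime a (E, x, ξ) (n + 1)} ↔ η ∈ {η | ∀ i, c i < η (0, i)} := by
      intro η
      have h1 : jumpTime a (E, x, concat n ξ η) n ≤ u := by rw [(hcong η).2]; exact hju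
      rw [Set.mem_ofPred_eq, and_iff_right h1, lt_jumpTime_succ_iff h1, (hcong η).1, (hcong η).2,
        Set.mem_ofPred_eq]
      refine forall_congr' fun i => ?_
      simp only [concat, lt_irrefl, if_false, Nat.sub_self]
      rfl
    -- The common value of `G` on the event, read at an arbitrary point of it: the clocks `c + 1`
    -- satisfy the strict inequalities.
    set g := G (concat n ξ fun k => c k.2 + 1) with hg
    have hgG : ∀ η ∈ {η | ∀ i, c i < η (0, i)}, G (concat n ξ η) = g := by
      intro η hη
      have h2 := (hmem η).2 hη
      refine hGa n _ _ (fun k hk => by simp [concat, hk]) h2.1 h2.2 ?_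
      exact ((hmem _).2 (by intro i; simp)).2
    have hSm : MeasurableSet {η : ℕ × Fin N → ℝ | ∀ i, c i < η (0, i)} := by
      simp only [Set.ofPred_forall]
      exact MeasurableSet.iInter fun i => measurableSet_lt measurable_const (measurable_pi_apply _)
    have hres : ∀ η, restart a n ((u : ℝ≥0∞) - jumpTime a (E, x, concat n ξ η) n).toReal
        (E, x, concat n ξ η) = (E, y, lower c η) := by
      intro η
      simp only [restart, (hcong η).1, (hcong η).2, shiftClock_concat]
      rfl
    have e1 : ∀ η, Set.indicator {ξ | jumpTime a (E, x, ξ) n ≤ u ∧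
        (u : ℝ≥0∞) < jumpTime a (E, x, ξ) (n + 1)} (fun ξ =>
        G ξ * H (restart a n ((u : ℝ≥0∞) - jumpTime a (E, x, ξ) n).toReal (E, x, ξ))) (concat n ξ η) =
        Set.indicator {η | ∀ i, c i < η (0, i)} (fun η => g * H (E, y, lower c η)) η := by
      intro η
      by_cases hη : η ∈ {η | ∀ i, c i < η (0, i)}
      · rw [Set.indicator_of_mem ((hmem η).2 hη), Set.indicator_of_mem hη, hgG η hη, hres]
      · rw [Set.indicator_of_notMem (fun h => hη ((hmem η).1 h)), Set.indicator_of_notMem hη]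
    have e2 : ∀ η, Set.indicator {ξ | jumpTime a (E, x, ξ) n ≤ u ∧
        (u : ℝ≥0∞) < jumpTime a (E, x, ξ) (n + 1)} (fun ξ =>
        G ξ * ∫⁻ η, H (E, jumpChain a (E, x, ξ) n, η) ∂(Measure.infinitePi fun _ => stdExp))
          (concat n ξ η) =
        Set.indicator {η | ∀ i, c i < η (0, i)}
          (fun _ => g * ∫⁻ η, H (E, y, η) ∂(Measure.infinitePi fun _ => stdExp)) η := by
      intro η
      by_cases hη : η ∈ {η | ∀ i, c i < η (0, i)}
      · rw [Set.indicator_of_mem ((hmem η).2 hη), Set.indicator_of_mem hη, hgG η hη, (hcong η).1]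
      · rw [Set.indicator_of_notMem (fun h => hη ((hmem η).1 h)), Set.indicator_of_notMem hη]
    have hHy : Measurable fun η => H (E, y, η) := hH.comp (measurable_sample E y)
    have hHyl : Measurable fun η => H (E, y, lower c η) := hHy.comp (measurable_lower c)
    rw [lintegral_congr e1, lintegral_congr e2, lintegral_indicator hSm, lintegral_indicator hSm,
      lintegral_const_mul _ hHyl]
    have h5 := lintegral_lower_clockLaw c hc0 hHy
    have h6 := clockLaw_forall_lt c hc0
    unfold clockLaw at h5 h6
    rw [h5, lintegral_const, Measure.restrict_apply_univ, h6]
    ring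
  · have hz : ∀ (f : (ℕ × Fin N → ℝ) → ℝ≥0∞) η, Set.indicator {ξ | jumpTime a (E, x, ξ) n ≤ u ∧
        (u : ℝ≥0∞) < jumpTime a (E, x, ξ) (n + 1)} f (concat n ξ η) = 0 := by
      intro f η
      refine Set.indicator_of_notMem ?_ _
      rintro ⟨h1, -⟩
      rw [(hcong η).2] at h1
      exact hju h1
    simp only [hz]

theorem lintegral_eq_tsum_level (a : ℝ) (E : Cube N → ℝ) (x : Cube N) (u : ℝ≥0)
    (F : (ℕ × Fin N → ℝ) → ℝ≥0∞) :
    ∫⁻ ξ, F ξ ∂(clockLaw N) = ∑' n, ∫⁻ ξ in {ξ | jumpTime a (E, x, ξ) n ≤ u ∧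
      (u : ℝ≥0∞) < jumpTime a (E, x, ξ) (n + 1)}, F ξ ∂(clockLaw N) := by
  have hms := measurable_sample E x
  have hJ : ∀ m, Measurable fun ξ => jumpTime a (E, x, ξ) m := fun m => (measurable_jumpTime a m).comp hms
  have hS : ∀ n, MeasurableSet {ξ | jumpTime a (E, x, ξ) n ≤ u ∧
      (u : ℝ≥0∞) < jumpTime a (E, x, ξ) (n + 1)} := fun n =>
    (measurableSet_le (hJ n) measurable_const).inter (measurableSet_lt measurable_const (hJ _))
  rw [← lintegral_iUnion hS]
  · rw [← setLIntegral_univ]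
    refine setLIntegral_congr ?_
    filter_upwards [ae_good a E x] with ξ hξ
    refine propext (iff_of_true trivial (Set.mem_iUnion.2 ⟨_, hξ.numJumps_spec u⟩))
  · intro m n hmn
    refine Set.disjoint_left.2 ?_
    rintro ξ ⟨h1, h2⟩ ⟨h3, h4⟩
    rcases lt_or_gt_of_ne hmn with h | h
    · exact absurd ((h2.trans_le (jumpTime_mono a _ (Nat.succ_le_of_lt h))).trans_le h3) (lt_irrefl _)
    · exact absurd ((h4.trans_le (jumpTime_mono a _ (Nat.succ_le_of_lt h))).trans_le h1) (lt_irrefl _)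

/-- The Markov property at time `u`. -/
theorem markov (a : ℝ) (E : Cube N → ℝ) (x : Cube N) (u : ℝ≥0)
    {G : (ℕ × Fin N → ℝ) → ℝ≥0∞} (hG : Measurable G) (hGa : Adapted a E x u G)
    {H : Sample N → ℝ≥0∞} (hH : Measurable H) :
    ∫⁻ ξ, G ξ * H (residual a u (E, x, ξ)) ∂(clockLaw N) =
      ∫⁻ ξ, G ξ * ∫⁻ η, H (E, walk a (E, x, ξ) u, η) ∂(clockLaw N) ∂(clockLaw N) := by
  rw [lintegral_eq_tsum_level a E x u, lintegral_eq_tsum_level a E x u]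
  refine tsum_congr fun n => ?_
  have hms := measurable_sample E x
  have hJ : ∀ m, Measurable fun ξ => jumpTime a (E, x, ξ) m := fun m => (measurable_jumpTime a m).comp hms
  have hS : MeasurableSet {ξ | jumpTime a (E, x, ξ) n ≤ u ∧
      (u : ℝ≥0∞) < jumpTime a (E, x, ξ) (n + 1)} :=
    (measurableSet_le (hJ n) measurable_const).inter (measurableSet_lt measurable_const (hJ _))
  have hn : ∀ ξ ∈ {ξ | jumpTime a (E, x, ξ) n ≤ u ∧
      (u : ℝ≥0∞) < jumpTime a (E, x, ξ) (n + 1)}, numJumps a u (E, x, ξ) = n := fun ξ hξ =>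
    (numJumps_eq_iff' a u _ n).2 (Or.inl ⟨hξ.1, not_le.2 hξ.2⟩)
  have h := markov_level a E x u hG hGa hH n
  rw [setLIntegral_congr_fun hS fun ξ hξ => ?_, h]
  · refine setLIntegral_congr_fun hS fun ξ hξ => ?_
    simp only [walk_eq, hn ξ hξ]
  · simp only [residual, hn ξ hξ]

end

/-! ### Transition probabilities and their first-order expansion in time -/

section

variable {N : ℕ}

/-! ### Transition probabilities -/

/-- The jump rates as a function of the energies. -/
def conductance (a : ℝ) (E : Cube N → ℝ) (x y : Cube N) : ℝ := Real.exp (a * (E x + E y))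

theorem conductance_pos (a : ℝ) (E : Cube N → ℝ) (x y : Cube N) : 0 < conductance a E x y :=
  Real.exp_pos _

theorem conductance_comm (a : ℝ) (E : Cube N → ℝ) (x y : Cube N) :
    conductance a E x y = conductance a E y x := by
  unfold conductance; rw [add_comm]

/-- The rate of the jump from `x` in direction `i`. -/
def jumpRate (a : ℝ) (E : Cube N → ℝ) (x : Cube N) (i : Fin N) : ℝ :=
  conductance a E x (x + Pi.single i 1)

theorem jumpRate_pos (a : ℝ) (E : Cube N → ℝ) (x : Cube N) (i : Fin N) : 0 < jumpRate a E x i :=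
  Real.exp_pos _

theorem add_single_add_single (x : Cube N) (i : Fin N) :
    x + Pi.single i 1 + Pi.single i 1 = x := by
  rw [add_assoc, ← Pi.single_add]
  have : (1 + 1 : ZMod 2) = 0 := by decide
  rw [this]
  simp

theorem jumpRate_symm (a : ℝ) (E : Cube N → ℝ) (x : Cube N) (i : Fin N) :
    jumpRate a E (x + Pi.single i 1) i = jumpRate a E x i := by
  unfold jumpRate
  rw [add_single_add_single, conductance_comm]

/-- The transition probabilities of the walk. -/
def trans (a : ℝ) (E : Cube N → ℝ) (u : ℝ≥0) (x y : Cube N) : ℝ :=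
  (clockLaw N).real {ξ | walk a (E, x, ξ) u = y}

theorem measurable_walk_clock (a : ℝ) (E : Cube N → ℝ) (u : ℝ≥0) (x : Cube N) :
    Measurable fun ξ => walk a (E, x, ξ) u := (measurable_walk a u).comp (measurable_sample E x)

theorem trans_nonneg (a : ℝ) (E : Cube N → ℝ) (u : ℝ≥0) (x y : Cube N) : 0 ≤ trans a E u x y :=
  measureReal_nonneg

theorem ofReal_trans (a : ℝ) (E : Cube N → ℝ) (u : ℝ≥0) (x y : Cube N) :
    ENNReal.ofReal (trans a E u x y) = clockLaw N {ξ | walk a (E, x, ξ) u = y} :=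
  ofReal_measureReal

theorem lintegral_walk (a : ℝ) (E : Cube N → ℝ) (u : ℝ≥0) (x : Cube N) (f : Cube N → ℝ≥0∞) :
    ∫⁻ ξ, f (walk a (E, x, ξ) u) ∂(clockLaw N) =
      ∑ y, ENNReal.ofReal (trans a E u x y) * f y := by
  have hm := measurable_walk_clock a E u x
  rw [← lintegral_map (measurable_of_countable f) hm, lintegral_fintype]
  refine Finset.sum_congr rfl fun y _ => ?_
  rw [ofReal_trans, Measure.map_apply hm (measurableSet_singleton y), mul_comm]
  rfl

theorem sum_trans (a : ℝ) (E : Cube N → ℝ) (u : ℝ≥0) (x : Cube N) : ∑ y, trans a E u x y = 1 := by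
  have h := lintegral_walk a E u x fun _ => 1
  simp only [lintegral_const, measure_univ, mul_one] at h
  rw [← ENNReal.ofReal_sum_of_nonneg fun y _ => trans_nonneg a E u x y] at h
  have := congrArg ENNReal.toReal h
  rw [ENNReal.toReal_ofReal (Finset.sum_nonneg fun y _ => trans_nonneg a E u x y)] at this
  simpa using this.symm

theorem trans_add (a : ℝ) (E : Cube N → ℝ) (u s : ℝ≥0) (x y : Cube N) :
    trans a E (u + s) x y = ∑ z, trans a E u x z * trans a E s z y := by
  have hS : MeasurableSet {ω : Sample N | walk a ω s = y} :=
    measurable_walk a s (measurableSet_singleton y)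
  have h := markov a E x u (G := fun _ => 1) measurable_const (fun _ _ _ _ _ _ _ => rfl)
    (H := Set.indicator {ω | walk a ω s = y} 1) (measurable_one.indicator hS)
  simp only [one_mul] at h
  have h1 : ∫⁻ ξ, Set.indicator {ω | walk a ω s = y} 1 (residual a u (E, x, ξ)) ∂(clockLaw N) =
      ENNReal.ofReal (trans a E (u + s) x y) := by
    have hS' : MeasurableSet {ξ | walk a (E, x, ξ) (u + s) = y} :=
      measurable_walk_clock a E (u + s) x (measurableSet_singleton y)
    rw [ofReal_trans, ← lintegral_indicator_one hS']
    refine lintegral_congr_ae ?_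
    filter_upwards [ae_good a E x] with ξ hξ
    have hw := hξ.walk_add u s
    by_cases hy : walk a (E, x, ξ) (u + s) = y
    · rw [Set.indicator_of_mem (by rw [Set.mem_ofPred_eq, ← hw]; exact hy),
        Set.indicator_of_mem (by exact hy)]
      rfl
    · rw [Set.indicator_of_notMem (by rw [Set.mem_ofPred_eq, ← hw]; exact hy),
        Set.indicator_of_notMem (by exact hy)]
  have h2 : ∀ z, ∫⁻ η, Set.indicator {ω | walk a ω s = y} 1 (E, z, η) ∂(clockLaw N) =
      ENNReal.ofReal (trans a E s z y) := by
    intro z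
    have hS' : MeasurableSet {ξ | walk a (E, z, ξ) s = y} :=
      measurable_walk_clock a E s z (measurableSet_singleton y)
    rw [ofReal_trans, ← lintegral_indicator_one hS']
    rfl
  rw [h1] at h
  simp only [h2] at h
  rw [lintegral_walk a E u x fun z => ENNReal.ofReal (trans a E s z y)] at h
  simp only [← ENNReal.ofReal_mul (trans_nonneg a E u x _)] at h
  rw [← ENNReal.ofReal_sum_of_nonneg fun z _ =>
    mul_nonneg (trans_nonneg a E u x z) (trans_nonneg a E s z y)] at h
  have := congrArg ENNReal.toReal h
  rwa [ENNReal.toReal_ofReal (trans_nonneg _ _ _ _ _), ENNReal.toReal_ofReal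
    (Finset.sum_nonneg fun z _ => mul_nonneg (trans_nonneg a E u x z) (trans_nonneg a E s z y))]
    at this

/-! ### Transition probabilities in small time -/

theorem step_eq_of_lt {r : Fin N → ℝ} {i : Fin N} (h : ∀ j, j ≠ i → r i < r j) (y : Cube N) :
    step r y = y + Pi.single i 1 := by
  funext j
  by_cases hj : j = i
  · subst hj
    rw [step, if_pos]
    · simp
    · refine ⟨fun k => ?_, fun k hk => h k hk.ne⟩
      by_cases hk : k = j
      · rw [hk]
      · exact (h k hk).le
  · rw [step, if_neg]
    · simp [hj]
    · rintro ⟨h1, -⟩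
      exact absurd (h j hj) (not_lt.2 (h1 i))

theorem trans_self_ge (a : ℝ) (E : Cube N → ℝ) (u : ℝ≥0) (x : Cube N) :
    Real.exp (-∑ i, jumpRate a E x i * u) ≤ trans a E u x x := by
  have h0 : ∀ i, 0 ≤ jumpRate a E x i * u := fun i =>
    mul_nonneg (conductance_pos _ _ _ _).le u.2
  rw [← ENNReal.ofReal_le_ofReal_iff (trans_nonneg _ _ _ _ _), ofReal_trans,
    ← clockLaw_forall_lt _ h0]
  refine measure_mono fun ξ hξ => ?_
  rw [Set.mem_ofPred_eq] at hξ ⊢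
  have hJ0 : jumpTime a (E, x, ξ) 0 ≤ u := by simp [jumpTime_zero]
  have : numJumps a u (E, x, ξ) = 0 := by
    rw [numJumps_eq_iff']
    refine Or.inl ⟨hJ0, ?_⟩
    rw [not_le, lt_jumpTime_succ_iff hJ0]
    intro i
    rw [jumpTime_zero, tsub_zero, ENNReal.coe_toReal]
    exact hξ i
  rw [walk_eq, this]
  rfl

theorem stdExp_Iic {c : ℝ} (hc : 0 ≤ c) :
    stdExp (Set.Iic c) = ENNReal.ofReal (1 - Real.exp (-c)) := by
  rw [← Set.compl_Ioi, prob_compl_eq_one_sub measurableSet_Ioi, stdExp_Ioi hc,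
    ENNReal.ofReal_sub _ (Real.exp_pos _).le, ENNReal.ofReal_one]

/-- A favourable event: at `x` the clock `i` rings before `u` and the others after it, and then no
clock at the new position rings within a delay `u`. It only involves the clocks of two levels, hence
is a box. -/
theorem trans_neighbour_ge (a : ℝ) (E : Cube N → ℝ) (u : ℝ≥0) (x : Cube N) (i : Fin N) :
    (1 - Real.exp (-(jumpRate a E x i * u))) *
      Real.exp (-(∑ j ∈ Finset.univ.erase i, jumpRate a E x j * u +
        ∑ j, jumpRate a E (x + Pi.single i 1) j * u)) ≤ trans a E u x (x + Pi.single i 1) := by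
  set x' := x + Pi.single i 1 with hx'
  have h0 : ∀ y i, 0 ≤ jumpRate a E y i * u := fun y i =>
    mul_nonneg (conductance_pos _ _ _ _).le u.2
  set t : ℕ × Fin N → Set ℝ := fun k =>
    if k.1 = 0 then if k.2 = i then Set.Iic (jumpRate a E x i * u) else
      Set.Ioi (jumpRate a E x k.2 * u) else Set.Ioi (jumpRate a E x' k.2 * u) with ht
  have htm : ∀ k, MeasurableSet (t k) := by
    intro k
    simp only [ht]
    split_ifs
    · exact measurableSet_Iic
    · exact measurableSet_Ioi
    · exact measurableSet_Ioi
  have hbox : clockLaw N (Set.pi (({0, 1} : Finset ℕ) ×ˢ (Finset.univ : Finset (Fin N)) :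
      Finset (ℕ × Fin N)) t) = ENNReal.ofReal ((1 - Real.exp (-(jumpRate a E x i * u))) *
      Real.exp (-(∑ j ∈ Finset.univ.erase i, jumpRate a E x j * u +
        ∑ j, jumpRate a E x' j * u))) := by
    unfold clockLaw
    rw [Measure.infinitePi_pi _ fun k _ => htm k, Finset.prod_product,
      Finset.prod_insert (by simp), Finset.prod_singleton]
    have e1 : ∏ j, stdExp (t (1, j)) = ENNReal.ofReal (Real.exp (-∑ j, jumpRate a E x' j * u)) := by
      rw [← Finset.sum_neg_distrib, Real.exp_sum,
        ENNReal.ofReal_prod_of_nonneg fun i _ => (Real.exp_pos _).le]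
      refine Finset.prod_congr rfl fun j _ => ?_
      simp only [ht, one_ne_zero, if_false]
      exact stdExp_Ioi (h0 _ _)
    have e2 : ∏ j, stdExp (t (0, j)) = ENNReal.ofReal (1 - Real.exp (-(jumpRate a E x i * u))) *
        ENNReal.ofReal (Real.exp (-∑ j ∈ Finset.univ.erase i, jumpRate a E x j * u)) := by
      rw [← Finset.mul_prod_erase _ _ (Finset.mem_univ i), ← Finset.sum_neg_distrib, Real.exp_sum,
        ENNReal.ofReal_prod_of_nonneg fun i _ => (Real.exp_pos _).le]
      congr 1
      · simp only [ht, if_true]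
        exact stdExp_Iic (h0 _ _)
      · refine Finset.prod_congr rfl fun j hj => ?_
        simp only [ht, if_true, if_neg (Finset.ne_of_mem_erase hj)]
        exact stdExp_Ioi (h0 _ _)
    have hle : 0 ≤ 1 - Real.exp (-(jumpRate a E x i * u)) := by
      rw [sub_nonneg, Real.exp_le_one_iff]
      linarith [h0 x i]
    rw [e1, e2, ← ENNReal.ofReal_mul hle, ← ENNReal.ofReal_mul (mul_nonneg hle (Real.exp_pos _).le)]
    congr 1
    rw [mul_assoc, ← Real.exp_add]
    congr 2
    ring
  rw [← ENNReal.ofReal_le_ofReal_iff (trans_nonneg _ _ _ _ _), ofReal_trans, ← hbox]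
  refine measure_mono fun ξ hξ => ?_
  have m0 : ∀ j, ξ (0, j) ∈ t (0, j) := fun j => hξ (0, j) (by simp)
  have m1 : ∀ j, ξ (1, j) ∈ t (1, j) := fun j => hξ (1, j) (by simp)
  have m0i : ξ (0, i) ≤ jumpRate a E x i * u := by
    have := m0 i
    simpa [ht] using this
  have m0j : ∀ j, j ≠ i → jumpRate a E x j * u < ξ (0, j) := fun j hj => by
    have := m0 j
    simpa [ht, hj] using this
  have m1j : ∀ j, jumpRate a E x' j * u < ξ (1, j) := fun j => by
    have := m1 j
    simpa [ht] using this
  set ω : Sample N := (E, x, ξ) with hω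
  have hring : ∀ j, ring a ω 0 x j = ξ (0, j) / jumpRate a E x j := fun j => rfl
  have hY1 : jumpChain a ω 1 = x' := by
    refine step_eq_of_lt (fun j hj => ?_) x
    have c1 : ring a ω 0 x i ≤ u := by
      rw [hring, div_le_iff₀ (jumpRate_pos _ _ _ _), mul_comm]
      exact m0i
    have c2 : u < ring a ω 0 x j := by
      rw [hring, lt_div_iff₀ (jumpRate_pos _ _ _ _), mul_comm]
      exact m0j j hj
    exact c1.trans_lt c2
  have hJ1 : jumpTime a ω 1 ≤ u := by
    rw [jumpTime_succ, jumpTime_zero, zero_add, holding_eq]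
    refine (iInf_le _ i).trans ?_
    refine (ENNReal.ofReal_le_ofReal (q := (u : ℝ)) ?_).trans (ENNReal.ofReal_coe_nnreal).le
    show ring a ω 0 x i ≤ u
    rw [hring, div_le_iff₀ (jumpRate_pos _ _ _ _), mul_comm]
    exact m0i
  have hnum : numJumps a u ω = 1 := by
    rw [numJumps_eq_iff']
    refine Or.inl ⟨hJ1, ?_⟩
    rw [not_le, lt_jumpTime_succ_iff hJ1]
    intro j
    rw [hY1]
    refine lt_of_le_of_lt ?_ (m1j j)
    refine mul_le_mul_of_nonneg_left ?_ (conductance_pos _ _ _ _).le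
    exact ENNReal.toReal_le_coe_of_le_coe tsub_le_self
  show walk a ω u = x'
  rw [walk_eq, hnum, hY1]

theorem sub_sq_sub_mul_le {p q : ℝ} (hp : 0 ≤ p) (hq : 0 ≤ q) :
    p - p ^ 2 - p * q ≤ (1 - Real.exp (-p)) * Real.exp (-q) := by
  have h1 : 1 - Real.exp (-p) ≤ p := by linarith [Real.add_one_le_exp (-p)]
  have h2 : 0 ≤ 1 - Real.exp (-p) := by
    rw [sub_nonneg, Real.exp_le_one_iff]; linarith
  have h3 : p - p ^ 2 ≤ 1 - Real.exp (-p) := by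
    have h4 : Real.exp (-p) ≤ 1 / (1 + p) := by
      rw [Real.exp_neg, inv_eq_one_div]
      exact one_div_le_one_div_of_le (by linarith) (by linarith [Real.add_one_le_exp p])
    have h5 : 1 / (1 + p) ≤ 1 - p + p ^ 2 := by
      rw [div_le_iff₀ (by linarith)]
      nlinarith [pow_nonneg hp 3]
    linarith
  have h6 : 1 - q ≤ Real.exp (-q) := by linarith [Real.add_one_le_exp (-q)]
  nlinarith [mul_le_mul_of_nonneg_left h6 h2, mul_le_mul_of_nonneg_right h1 hq]

/-- The generator of the walk. -/
def gen (a : ℝ) (E : Cube N → ℝ) (f : Cube N → ℝ) (x : Cube N) : ℝ :=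
  ∑ i, jumpRate a E x i * (f (x + Pi.single i 1) - f x)

/-- The semigroup of the walk. -/
def semi (a : ℝ) (E : Cube N → ℝ) (u : ℝ≥0) (f : Cube N → ℝ) (x : Cube N) : ℝ :=
  ∑ y, trans a E u x y * f y

theorem add_single_ne (x : Cube N) (i : Fin N) : x + Pi.single i 1 ≠ x := by
  intro h
  have := congrFun h i
  simp at this

theorem add_single_injective (x : Cube N) : Function.Injective fun i => x + Pi.single i (1 : ZMod 2) := by
  intro i j h
  by_contra hij
  have := congrFun (add_left_cancel h) i
  simp [Pi.single_eq_of_ne hij] at this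

/-- Only lower bounds of the transition probabilities are needed: they sum to one up to an error of
order `h ^ 2`, so their total defect, which is all that is lost, has this order. -/
theorem abs_semi_sub_le {a : ℝ} {E : Cube N → ℝ} {R : ℝ} (hR : ∀ x y, conductance a E x y ≤ R)
    (h : ℝ≥0) {f : Cube N → ℝ} {M : ℝ} (hM : ∀ x, |f x| ≤ M) (x : Cube N) :
    |semi a E h f x - (f x + h * gen a E f x)| ≤ 6 * N ^ 2 * R ^ 2 * h ^ 2 * M := by
  classical
  have hM0 : 0 ≤ M := (abs_nonneg _).trans (hM x)
  have hR0 : 0 ≤ R := (conductance_pos a E x x).le.trans (hR x x)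
  -- The loss at a neighbour is at most `p ^ 2 + p q` with `p ≤ R h` and `q ≤ 2 N R h`, hence at
  -- most `K h ^ 2` as soon as `N ≥ 1`.
  set K : ℝ := 3 * N * R ^ 2 with hK
  have hK0 : 0 ≤ K := by positivity
  set c := jumpRate a E x with hc
  have hc0 : ∀ i, 0 ≤ c i := fun i => (conductance_pos _ _ _ _).le
  have hcR : ∀ i, c i ≤ R := fun i => hR _ _
  -- the lower bound of the transition probabilities
  set lb : Cube N → ℝ := fun y => (if y = x then 1 - h * ∑ i, c i else 0) +
    ∑ i, if y = x + Pi.single i 1 then c i * h - K * h ^ 2 else 0 with hlb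
  have hle : ∀ y, lb y ≤ trans a E h x y := by
    intro y
    by_cases hy : y = x
    · subst hy
      have : lb y = 1 - h * ∑ i, c i := by
        simp only [hlb, if_true, (add_single_ne y _).symm, if_false, Finset.sum_const_zero, add_zero]
      rw [this]
      refine le_trans ?_ (trans_self_ge a E h y)
      rw [← Finset.sum_mul]
      linarith [Real.add_one_le_exp (-((∑ i, jumpRate a E y i) * (h : ℝ)))]
    · by_cases hy2 : ∃ i, y = x + Pi.single i 1
      · obtain ⟨i, rfl⟩ := hy2
        have e1 : lb (x + Pi.single i 1) = c i * h - K * h ^ 2 := by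
          simp only [hlb, if_neg hy, zero_add]
          rw [Finset.sum_eq_single i]
          · simp
          · intro j _ hj
            rw [if_neg fun h => hj (add_single_injective x h).symm]
          · simp
        rw [e1]
        refine le_trans ?_ (trans_neighbour_ge a E h x i)
        set q := ∑ j ∈ Finset.univ.erase i, jumpRate a E x j * h +
          ∑ j, jumpRate a E (x + Pi.single i 1) j * h with hq
        have hq0 : 0 ≤ q := add_nonneg
          (Finset.sum_nonneg fun j _ => mul_nonneg (conductance_pos _ _ _ _).le h.2)
          (Finset.sum_nonneg fun j _ => mul_nonneg (conductance_pos _ _ _ _).le h.2)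
        have hqle : q ≤ 2 * N * R * h := by
          have s1 : ∑ j ∈ Finset.univ.erase i, jumpRate a E x j * h ≤ N * (R * h) := by
            refine (Finset.sum_le_sum_of_subset_of_nonneg (Finset.erase_subset _ _)
              fun j _ _ => mul_nonneg (conductance_pos _ _ _ _).le h.2).trans ?_
            refine (Finset.sum_le_sum fun j _ => mul_le_mul_of_nonneg_right (hR _ _) h.2).trans ?_
            simp
          have s2 : ∑ j, jumpRate a E (x + Pi.single i 1) j * h ≤ N * (R * h) := by
            refine (Finset.sum_le_sum fun j _ => mul_le_mul_of_nonneg_right (hR _ _) h.2).trans ?_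
            simp
          linarith
        refine le_trans ?_ (sub_sq_sub_mul_le (mul_nonneg (hc0 i) h.2) hq0)
        have hN1 : (1 : ℝ) ≤ N := by exact_mod_cast Nat.one_le_iff_ne_zero.2 (by rintro rfl; exact i.elim0)
        have b1 : (c i * h) ≤ R * h := mul_le_mul_of_nonneg_right (hcR i) h.2
        have hh : (0 : ℝ) ≤ h := h.2
        have b2 : (c i * h) ^ 2 ≤ (R * h) ^ 2 := pow_le_pow_left₀ (mul_nonneg (hc0 i) hh) b1 2
        have b3 : (c i * h) * q ≤ (R * h) * (2 * N * R * h) :=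
          mul_le_mul b1 hqle hq0 (mul_nonneg hR0 hh)
        have b4 : R ^ 2 * h ^ 2 * 1 ≤ R ^ 2 * h ^ 2 * N :=
          mul_le_mul_of_nonneg_left hN1 (by positivity)
        nlinarith
      · have : lb y = 0 := by
          simp only [hlb, if_neg hy, zero_add]
          exact Finset.sum_eq_zero fun i _ => if_neg fun h => hy2 ⟨i, h⟩
        rw [this]
        exact trans_nonneg _ _ _ _ _
  have hsum : ∀ g : Cube N → ℝ, ∑ y, lb y * g y = (1 - h * ∑ i, c i) * g x +
      ∑ i, (c i * h - K * h ^ 2) * g (x + Pi.single i 1) := by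
    intro g
    simp only [hlb, add_mul, Finset.sum_add_distrib, Finset.sum_mul, ite_mul, zero_mul]
    rw [Finset.sum_comm]
    simp
  have hlb1 : ∑ y, lb y = 1 - N * K * h ^ 2 := by
    have := hsum fun _ => 1
    simp only [mul_one, Finset.sum_sub_distrib, Finset.sum_const, Finset.card_univ,
      Fintype.card_fin, nsmul_eq_mul] at this
    rw [this, ← Finset.sum_mul]
    ring
  have hexp : semi a E h f x - (f x + h * gen a E f x) =
      ∑ y, (trans a E h x y - lb y) * f y - ∑ i, K * h ^ 2 * f (x + Pi.single i 1) := by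
    simp only [sub_mul, Finset.sum_sub_distrib]
    rw [hsum, semi, gen]
    simp only [sub_mul, mul_sub, Finset.sum_sub_distrib, Finset.mul_sum, Finset.sum_mul]
    have e1 : ∑ i, c i * h * f (x + Pi.single i 1) = ∑ i, (h : ℝ) * (c i * f (x + Pi.single i 1)) :=
      Finset.sum_congr rfl fun i _ => by ring
    have e2 : ∑ i, (h : ℝ) * c i * f x = ∑ i, (h : ℝ) * (c i * f x) :=
      Finset.sum_congr rfl fun i _ => by ring
    rw [e1, e2]
    ring
  have b1 : |∑ y, (trans a E h x y - lb y) * f y| ≤ N * K * h ^ 2 * M := by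
    refine (Finset.abs_sum_le_sum_abs _ _).trans ?_
    calc ∑ y, |(trans a E h x y - lb y) * f y| ≤ ∑ y, (trans a E h x y - lb y) * M := by
          refine Finset.sum_le_sum fun y _ => ?_
          rw [abs_mul, abs_of_nonneg (sub_nonneg.2 (hle y))]
          exact mul_le_mul_of_nonneg_left (hM y) (sub_nonneg.2 (hle y))
      _ = N * K * h ^ 2 * M := by
          rw [← Finset.sum_mul, Finset.sum_sub_distrib, sum_trans, hlb1]
          ring
  have b2 : |∑ i, K * h ^ 2 * f (x + Pi.single i 1)| ≤ N * (K * h ^ 2 * M) := by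
    refine (Finset.abs_sum_le_sum_abs _ _).trans ?_
    refine (Finset.sum_le_sum fun i _ => (?_ : _ ≤ K * h ^ 2 * M)).trans (by simp)
    rw [abs_mul, abs_of_nonneg (by positivity)]
    exact mul_le_mul_of_nonneg_left (hM _) (by positivity)
  rw [hexp]
  refine (abs_sub _ _).trans ?_
  rw [hK] at b1 b2
  nlinarith

end

section

variable {N : ℕ}

/-! ### Stationarity and relaxation -/

theorem semi_add (a : ℝ) (E : Cube N → ℝ) (u s : ℝ≥0) (f : Cube N → ℝ) :
    semi a E (u + s) f = semi a E u (semi a E s f) := by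
  funext x
  simp only [semi, trans_add, Finset.sum_mul, Finset.mul_sum]
  rw [Finset.sum_comm]
  exact Finset.sum_congr rfl fun z _ => Finset.sum_congr rfl fun y _ => by ring

theorem abs_semi_le (a : ℝ) (E : Cube N → ℝ) (u : ℝ≥0) {f : Cube N → ℝ} {M : ℝ}
    (hM : ∀ x, |f x| ≤ M) (x : Cube N) : |semi a E u f x| ≤ M := by
  refine (Finset.abs_sum_le_sum_abs _ _).trans ?_
  calc ∑ y, |trans a E u x y * f y| ≤ ∑ y, trans a E u x y * M := by
        refine Finset.sum_le_sum fun y _ => ?_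
        rw [abs_mul, abs_of_nonneg (trans_nonneg _ _ _ _ _)]
        exact mul_le_mul_of_nonneg_left (hM y) (trans_nonneg _ _ _ _ _)
    _ = M := by rw [← Finset.sum_mul, sum_trans, one_mul]

theorem sum_add_single (f : Cube N → ℝ) (i : Fin N) : ∑ x : Cube N, f (x + Pi.single i 1) = ∑ x, f x :=
  Equiv.sum_comp (Equiv.addRight (Pi.single i (1 : ZMod 2) : Cube N)) f

theorem sum_gen (a : ℝ) (E : Cube N → ℝ) (f : Cube N → ℝ) : ∑ x, gen a E f x = 0 := by
  simp only [gen]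
  rw [Finset.sum_comm]
  refine Finset.sum_eq_zero fun i _ => ?_
  simp only [mul_sub, Finset.sum_sub_distrib]
  rw [← sum_add_single (fun x => jumpRate a E x i * f x) i]
  simp [jumpRate_symm]

/-- Summation by parts: the sum is averaged with its image under the flip of coordinate `i`, which
leaves the rate of that edge unchanged. -/
theorem sum_mul_gen (a : ℝ) (E : Cube N → ℝ) (f : Cube N → ℝ) :
    ∑ x, f x * gen a E f x =
      -(1 / 2) * ∑ i, ∑ x, jumpRate a E x i * (f (x + Pi.single i 1) - f x) ^ 2 := by
  simp only [gen, Finset.mul_sum]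
  rw [Finset.sum_comm]
  refine Finset.sum_congr rfl fun i _ => ?_
  have h1 := sum_add_single (fun x => f x * (jumpRate a E x i * (f (x + Pi.single i 1) - f x))) i
  simp only [jumpRate_symm, add_single_add_single] at h1
  have h2 : ∑ x, f x * (jumpRate a E x i * (f (x + Pi.single i 1) - f x)) =
      1 / 2 * (∑ x, f x * (jumpRate a E x i * (f (x + Pi.single i 1) - f x)) +
        ∑ x, f (x + Pi.single i 1) * (jumpRate a E x i * (f x - f (x + Pi.single i 1)))) := by
    rw [h1]; ring
  rw [h2, ← Finset.sum_add_distrib, Finset.mul_sum]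
  exact Finset.sum_congr rfl fun x _ => by ring

theorem integral_pi_uniform (f : Cube N → ℝ) :
    ∫ x, f x ∂(Measure.pi fun _ : Fin N => (uniformOn (Set.univ : Set (ZMod 2)))) =
      (2 ^ N)⁻¹ * ∑ x, f x := by
  rw [integral_fintype .of_finite, Finset.mul_sum]
  refine Finset.sum_congr rfl fun x _ => ?_
  rw [smul_eq_mul]
  congr 1
  have h1 : ∀ z : ZMod 2, uniformOn (Set.univ : Set (ZMod 2)) {z} = 2⁻¹ := fun z => by
    rw [uniformOn_univ]
    simp
  rw [measureReal_def, Measure.pi_singleton]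
  simp [h1]

/-- The Poincaré inequality on the hypercube. -/
theorem poincare_cube {f : Cube N → ℝ} (hf : ∑ x, f x = 0) :
    ∑ x, f x ^ 2 ≤ 1 / 2 * ∑ i, ∑ x, (f (x + Pi.single i 1) - f x) ^ 2 := by
  have hfin : ∀ x, |f x| ≤ ∑ y, |f y| := fun x =>
    Finset.single_le_sum (f := fun y => |f y|) (fun _ _ => abs_nonneg _) (Finset.mem_univ x)
  have h := efronStein (ι := Fin N) (uniformOn (Set.univ : Set (ZMod 2))) 0
    (measurable_of_countable f) _ hfin
  simp only [integral_pi_uniform] at h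
  rw [hf, mul_zero, ← Finset.mul_sum] at h
  simp only [sub_zero] at h
  have h2 := le_of_mul_le_mul_left h (by positivity)
  refine h2.trans ?_
  rw [Finset.mul_sum]
  refine Finset.sum_le_sum fun i _ => ?_
  set g : Cube N → ℝ := fun x => (f (x + Pi.single i 1) - f x) ^ 2 with hg
  have h3 : ∀ x : Cube N, (f x - f (Function.update x i 0)) ^ 2 = if x i = 1 then g x else 0 := by
    intro x
    have hz : ∀ z : ZMod 2, z = 0 ∨ z = 1 := by decide
    rcases hz (x i) with h0 | h1
    · have : Function.update x i 0 = x := by rw [← h0]; exact Function.update_eq_self _ _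
      rw [this, h0]
      simp
    · have : Function.update x i 0 = x + Pi.single i 1 := by
        funext j
        by_cases hj : j = i
        · subst hj
          have : (1 + 1 : ZMod 2) = 0 := by decide
          simp [h1, this]
        · simp [hj]
      rw [this, if_pos h1, hg]
      ring
  -- Comparison with the value `0` in Efron-Stein only charges the endpoints with `x i = 1`;
  -- flipping the coordinate shows that this is half of the whole sum, whence the factor `1 / 2`.
  have h4 : ∑ x, (if x i = 1 then g x else 0) = ∑ x, (if x i = 1 then 0 else g x) := by
    rw [← sum_add_single _ i]
    refine Finset.sum_congr rfl fun x _ => ?_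
    have hz : ∀ z : ZMod 2, z = 0 ∨ z = 1 := by decide
    have hgx : g (x + Pi.single i 1) = g x := by
      simp only [hg, add_single_add_single]; ring
    have e11 : (1 + 1 : ZMod 2) = 0 := by decide
    have e01 : (0 : ZMod 2) ≠ 1 := by decide
    rcases hz (x i) with h0 | h1
    · simp [h0, hgx]
    · simp [h1, e11]
  have h5 : ∑ x, g x = ∑ x, (if x i = 1 then g x else 0) + ∑ x, (if x i = 1 then 0 else g x) := by
    rw [← Finset.sum_add_distrib]
    refine Finset.sum_congr rfl fun x _ => ?_
    split_ifs <;> simp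
  simp only [h3]
  rw [h5, ← h4]
  linarith

/-! ### Invariance of the uniform law and the spectral gap, by an Euler scheme -/

section Bounded

variable {a : ℝ} {E : Cube N → ℝ} {R : ℝ}

theorem card_cube : Fintype.card (Cube N) = 2 ^ N := by simp [ZMod.card]

theorem exists_conductance_le (a : ℝ) (E : Cube N → ℝ) :
    ∃ R, ∀ x y, conductance a E x y ≤ R :=
  ⟨∑ p : Cube N × Cube N, conductance a E p.1 p.2, fun x y =>
    Finset.single_le_sum (f := fun p : Cube N × Cube N => conductance a E p.1 p.2)
      (fun _ _ => (conductance_pos _ _ _ _).le) (Finset.mem_univ (x, y))⟩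

/-- The generator preserves sums exactly, so a time step `h` spoils the total sum by `O(h ^ 2)`
only. With `n` steps of length `u / n` the error vanishes, which yields invariance without
differentiating the semigroup. -/
theorem abs_sum_semi_sub_le (hR : ∀ x y, conductance a E x y ≤ R) (h : ℝ≥0) (n : ℕ)
    {f : Cube N → ℝ} {M : ℝ} (hM : ∀ x, |f x| ≤ M) :
    |∑ x, semi a E (n * h) f x - ∑ x, f x| ≤
      n * (2 ^ N * (6 * N ^ 2 * R ^ 2 * h ^ 2 * M)) := by
  induction n with
  | zero =>
    have : ∀ x, semi a E 0 f x = f x := by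
      intro x
      have ht : ∀ y, trans a E 0 x y = if y = x then 1 else 0 := by
        have h1 : (1 : ℝ) ≤ trans a E 0 x x := by simpa using trans_self_ge a E 0 x
        have h2 := sum_trans a E 0 x
        rw [← Finset.add_sum_erase _ _ (Finset.mem_univ x)] at h2
        have h3 : ∀ y ∈ Finset.univ.erase x, 0 ≤ trans a E 0 x y := fun y _ => trans_nonneg _ _ _ _ _
        have h4 := Finset.sum_nonneg h3
        have h5 : ∑ y ∈ Finset.univ.erase x, trans a E 0 x y = 0 := by linarith
        intro y
        split_ifs with hy
        · subst hy; linarith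
        · exact (Finset.sum_eq_zero_iff_of_nonneg h3).1 h5 y (Finset.mem_erase.2 ⟨hy, Finset.mem_univ _⟩)
      simp [semi, ht]
    simp [this]
  | succ n ih =>
    have h1 : semi a E ((n + 1 : ℕ) * h) f = semi a E h (semi a E (n * h) f) := by
      rw [← semi_add]
      congr 1
      push_cast
      ring
    set g := semi a E (n * h) f with hg
    have hgM : ∀ x, |g x| ≤ M := abs_semi_le a E _ hM
    have h2 : |∑ x, semi a E h g x - ∑ x, g x| ≤ 2 ^ N * (6 * N ^ 2 * R ^ 2 * h ^ 2 * M) := by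
      have h3 : ∑ x, semi a E h g x - ∑ x, g x =
          ∑ x, (semi a E h g x - (g x + h * gen a E g x)) := by
        rw [Finset.sum_sub_distrib, Finset.sum_add_distrib, ← Finset.mul_sum, sum_gen]
        ring
      rw [h3]
      refine (Finset.abs_sum_le_sum_abs _ _).trans ?_
      refine (Finset.sum_le_sum fun x _ => abs_semi_sub_le hR h hgM x).trans (le_of_eq ?_)
      rw [Finset.sum_const, Finset.card_univ, card_cube, nsmul_eq_mul]
      push_cast
      ring
    rw [h1]
    have h4 : ∑ x, semi a E h g x - ∑ x, f x =
        (∑ x, semi a E h g x - ∑ x, g x) + (∑ x, g x - ∑ x, f x) := by ring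
    rw [h4]
    refine (abs_add_le _ _).trans ?_
    push_cast
    linarith

theorem sum_semi (a : ℝ) (E : Cube N → ℝ) (u : ℝ≥0) (f : Cube N → ℝ) :
    ∑ x, semi a E u f x = ∑ x, f x := by
  obtain ⟨R, hR⟩ := exists_conductance_le a E
  have hM : ∀ x, |f x| ≤ ∑ y, |f y| := fun x =>
    Finset.single_le_sum (f := fun y => |f y|) (fun _ _ => abs_nonneg _) (Finset.mem_univ x)
  set C : ℝ := 2 ^ N * (6 * N ^ 2 * R ^ 2 * u ^ 2 * ∑ y, |f y|) with hC
  have hb : ∀ n : ℕ, 0 < n → |∑ x, semi a E u f x - ∑ x, f x| ≤ C / n := by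
    intro n hn
    have h := abs_sum_semi_sub_le hR (u / n) n hM
    have h1 : (n : ℝ≥0) * (u / n) = u := by
      field_simp
    rw [h1] at h
    refine h.trans (le_of_eq ?_)
    rw [hC]
    have : (n : ℝ) ≠ 0 := by positivity
    push_cast
    field_simp
  have h0 : |∑ x, semi a E u f x - ∑ x, f x| ≤ 0 := by
    refine ge_of_tendsto (tendsto_const_div_atTop_nhds_zero_nat C) ?_
    filter_upwards [eventually_gt_atTop 0] with n hn using hb n hn
  have := abs_nonpos_iff.1 h0
  linarith

/-- The uniform distribution is invariant. -/
theorem sum_trans_left (a : ℝ) (E : Cube N → ℝ) (u : ℝ≥0) (y : Cube N) :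
    ∑ x, trans a E u x y = 1 := by
  classical
  have := sum_semi a E u fun z => if z = y then 1 else 0
  simpa [semi] using this

/-- Conductances at least one make the Dirichlet form dominate that of the simple walk, and the
Poincaré inequality gives a drift `-2 h` of the squared norm. The constant `C` may depend on
everything but `h` and `f`, since `h` tends to `0` afterwards. -/
theorem exists_semi_contraction (hR : ∀ x y, conductance a E x y ≤ R)
    (h1 : ∀ x y, 1 ≤ conductance a E x y) :
    ∃ C, 0 ≤ C ∧ ∀ h : ℝ≥0, h ≤ 1 → ∀ f : Cube N → ℝ, ∑ x, f x = 0 →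
      ∑ x, semi a E h f x ^ 2 ≤ (1 - 2 * h + C * h ^ 2) * ∑ x, f x ^ 2 := by
  set D : ℝ := 6 * N ^ 2 * R ^ 2 with hD
  have hD0 : 0 ≤ D := by positivity
  have hR0 : 0 ≤ R := (conductance_pos a E 0 0).le.trans (hR 0 0)
  refine ⟨2 ^ N * (2 * D + 2 * (2 * N * R) ^ 2 + 2 * D ^ 2), by positivity, ?_⟩
  intro h hh1 f hf
  have hh0 : (0 : ℝ) ≤ h := h.2
  have hh1' : (h : ℝ) ≤ 1 := by exact_mod_cast hh1
  set V := ∑ x, f x ^ 2 with hV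
  have hV0 : 0 ≤ V := Finset.sum_nonneg fun x _ => sq_nonneg _
  set M := √V with hM
  have hM0 : 0 ≤ M := Real.sqrt_nonneg _
  have hMM : M ^ 2 = V := Real.sq_sqrt hV0
  have hfM : ∀ x, |f x| ≤ M := fun x => by
    refine Real.abs_le_sqrt ?_
    exact Finset.single_le_sum (f := fun x => f x ^ 2) (fun _ _ => sq_nonneg _) (Finset.mem_univ x)
  set e : Cube N → ℝ := fun x => semi a E h f x - (f x + h * gen a E f x) with he
  have heb : ∀ x, |e x| ≤ D * h ^ 2 * M := fun x => abs_semi_sub_le hR h hfM x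
  have hgenb : ∀ x, |gen a E f x| ≤ 2 * N * R * M := by
    intro x
    refine (Finset.abs_sum_le_sum_abs _ _).trans ?_
    refine (Finset.sum_le_sum fun i _ => (?_ : _ ≤ R * (2 * M))).trans (by simp; linarith)
    rw [abs_mul, abs_of_pos (jumpRate_pos _ _ _ _)]
    exact mul_le_mul (hR _ _) ((abs_sub _ _).trans (by linarith [hfM x, hfM (x + Pi.single i 1)]))
      (abs_nonneg _) hR0
  have hpo : ∑ x, f x * gen a E f x ≤ -V := by
    rw [sum_mul_gen]
    have h2 := poincare_cube hf
    have h3 : ∑ i, ∑ x, (f (x + Pi.single i 1) - f x) ^ 2 ≤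
        ∑ i, ∑ x, jumpRate a E x i * (f (x + Pi.single i 1) - f x) ^ 2 :=
      Finset.sum_le_sum fun i _ => Finset.sum_le_sum fun x _ =>
        le_mul_of_one_le_left (sq_nonneg _) (h1 _ _)
    linarith
  have hsum : ∑ x, semi a E h f x ^ 2 = V + 2 * h * ∑ x, f x * gen a E f x +
      ∑ x, (2 * (f x * e x) + (h * gen a E f x + e x) ^ 2) := by
    rw [hV, Finset.mul_sum, ← Finset.sum_add_distrib, ← Finset.sum_add_distrib]
    refine Finset.sum_congr rfl fun x _ => ?_
    have : semi a E h f x = f x + h * gen a E f x + e x := by simp only [he]; ring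
    rw [this]
    ring
  have hrem : ∀ x, 2 * (f x * e x) + (h * gen a E f x + e x) ^ 2 ≤
      (2 * D + 2 * (2 * N * R) ^ 2 + 2 * D ^ 2) * h ^ 2 * V := by
    intro x
    have r1 : f x * e x ≤ M * (D * h ^ 2 * M) := by
      refine (le_abs_self _).trans ?_
      rw [abs_mul]
      exact mul_le_mul (hfM x) (heb x) (abs_nonneg _) hM0
    have r2 : (gen a E f x) ^ 2 ≤ (2 * N * R * M) ^ 2 := by
      rw [← sq_abs]; exact pow_le_pow_left₀ (abs_nonneg _) (hgenb x) 2
    have r3 : (e x) ^ 2 ≤ (D * h ^ 2 * M) ^ 2 := by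
      rw [← sq_abs]; exact pow_le_pow_left₀ (abs_nonneg _) (heb x) 2
    have r4 : (h * gen a E f x + e x) ^ 2 ≤ 2 * (h ^ 2 * (gen a E f x) ^ 2) + 2 * (e x) ^ 2 := by
      nlinarith [sq_nonneg (h * gen a E f x - e x)]
    have r5 : (h : ℝ) ^ 2 * (gen a E f x) ^ 2 ≤ h ^ 2 * (2 * N * R * M) ^ 2 :=
      mul_le_mul_of_nonneg_left r2 (sq_nonneg _)
    have r6 : (D * h ^ 2 * M) ^ 2 ≤ D ^ 2 * h ^ 2 * M ^ 2 := by
      have : (h : ℝ) ^ 2 * h ^ 2 ≤ h ^ 2 * 1 :=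
        mul_le_mul_of_nonneg_left (pow_le_one₀ hh0 hh1') (sq_nonneg _)
      nlinarith [mul_le_mul_of_nonneg_left this (by positivity : 0 ≤ D ^ 2 * M ^ 2)]
    rw [← hMM]
    nlinarith
  rw [hsum]
  have hremS : ∑ x, (2 * (f x * e x) + (h * gen a E f x + e x) ^ 2) ≤
      2 ^ N * ((2 * D + 2 * (2 * N * R) ^ 2 + 2 * D ^ 2) * h ^ 2 * V) := by
    refine (Finset.sum_le_sum fun x _ => hrem x).trans (le_of_eq ?_)
    rw [Finset.sum_const, Finset.card_univ, card_cube, nsmul_eq_mul]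
    push_cast
    ring
  have := mul_le_mul_of_nonneg_left hpo hh0
  nlinarith

/-- The contraction is iterated over `n` steps of length `u / n`; the quadratic remainder
contributes `C u ^ 2 / n` to the exponent and disappears in the limit. -/
theorem sum_semi_sq_le (h1 : ∀ x y, 1 ≤ conductance a E x y) (u : ℝ≥0)
    {f : Cube N → ℝ} (hf : ∑ x, f x = 0) :
    ∑ x, semi a E u f x ^ 2 ≤ Real.exp (-(2 * u)) * ∑ x, f x ^ 2 := by
  obtain ⟨R, hR⟩ := exists_conductance_le a E
  obtain ⟨C, hC0, hC⟩ := exists_semi_contraction hR h1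
  have iter : ∀ (h : ℝ≥0), h ≤ 1 → ∀ n : ℕ, ∑ x, semi a E (n * h) f x ^ 2 ≤
      Real.exp (n * (-(2 * h) + C * h ^ 2)) * ∑ x, f x ^ 2 := by
    intro h hh n
    induction n with
    | zero =>
      refine (le_of_eq ?_)
      have : ∀ x, semi a E 0 f x = f x := by
        have e0 := sum_semi a E 0
        intro x
        have hb := abs_semi_sub_le hR 0 (f := f) (M := ∑ y, |f y|) (fun x =>
          Finset.single_le_sum (f := fun y => |f y|) (fun _ _ => abs_nonneg _) (Finset.mem_univ x)) x
        simp only [NNReal.coe_zero, zero_mul, add_zero, ne_eq, OfNat.ofNat_ne_zero, not_false_eq_true,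
          zero_pow, mul_zero] at hb
        exact sub_eq_zero.1 (abs_nonpos_iff.1 hb)
      simp [this]
    | succ n ih =>
      have e1 : semi a E ((n + 1 : ℕ) * h) f = semi a E h (semi a E (n * h) f) := by
        rw [← semi_add]
        congr 1
        push_cast
        ring
      rw [e1]
      refine (hC h hh _ (by rw [sum_semi, hf])).trans ?_
      have e2 : 1 - 2 * (h : ℝ) + C * h ^ 2 ≤ Real.exp (-(2 * h) + C * h ^ 2) := by
        linarith [Real.add_one_le_exp (-(2 * (h : ℝ)) + C * h ^ 2)]
      refine (mul_le_mul_of_nonneg_right e2 (Finset.sum_nonneg fun x _ => sq_nonneg _)).trans ?_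
      refine (mul_le_mul_of_nonneg_left ih (Real.exp_pos _).le).trans (le_of_eq ?_)
      rw [← mul_assoc, ← Real.exp_add]
      congr 2
      push_cast
      ring
  have hlim : Tendsto (fun n : ℕ => Real.exp (-(2 * u) + C * u ^ 2 / n) * ∑ x, f x ^ 2) atTop
      (𝓝 (Real.exp (-(2 * u)) * ∑ x, f x ^ 2)) := by
    refine Tendsto.mul_const _ ((Real.continuous_exp.tendsto _).comp ?_)
    simpa using (tendsto_const_div_atTop_nhds_zero_nat (C * (u : ℝ) ^ 2)).const_add (-(2 * (u : ℝ)))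
  refine ge_of_tendsto hlim ?_
  obtain ⟨n0, hn0⟩ := exists_nat_ge u
  filter_upwards [eventually_ge_atTop (max 1 n0)] with n hn
  have hn1 : 0 < n := lt_of_lt_of_le Nat.one_pos ((le_max_left _ _).trans hn)
  have hnu : u ≤ n := hn0.trans (by exact_mod_cast (le_max_right _ _).trans hn)
  have hle : u / n ≤ 1 := div_le_one_of_le₀ hnu zero_le
  have h := iter (u / n) hle n
  have e1 : (n : ℝ≥0) * (u / n) = u := by field_simp
  rw [e1] at h
  refine h.trans (le_of_eq ?_)
  congr 2
  have : (n : ℝ) ≠ 0 := by positivity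
  push_cast
  field_simp

/-- The decay is applied to the centred indicator of `y`, whose squared norm is at most one; a
single term of the sum of squares is then bounded by the sum. -/
theorem trans_le (h1 : ∀ x y, 1 ≤ conductance a E x y) (u : ℝ≥0) (x y : Cube N) :
    trans a E u x y ≤ (2 ^ N)⁻¹ + Real.exp (-u) := by
  classical
  set f : Cube N → ℝ := fun z => (if z = y then 1 else 0) - (2 ^ N)⁻¹ with hf
  have hc : (Finset.univ : Finset (Cube N)).card = 2 ^ N := by rw [Finset.card_univ, card_cube]
  have hpos : (0 : ℝ) < 2 ^ N := by positivity
  have hsum : ∑ z, f z = 0 := by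
    simp only [hf, Finset.sum_sub_distrib, Finset.sum_const, hc, nsmul_eq_mul]
    simp [hpos.ne']
  have hsq : ∑ z, f z ^ 2 ≤ 1 := by
    have e : ∀ z, f z ^ 2 = (if z = y then 1 - 2 * (2 ^ N)⁻¹ else 0) + ((2 ^ N)⁻¹) ^ 2 := by
      intro z
      simp only [hf]
      split_ifs <;> ring
    simp only [e, Finset.sum_add_distrib, Finset.sum_const, hc, nsmul_eq_mul]
    simp only [Finset.sum_ite_eq', Finset.mem_univ, if_true]
    push_cast
    have : (2 : ℝ) ^ N * ((2 ^ N)⁻¹) ^ 2 = (2 ^ N)⁻¹ := by field_simp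
    rw [this]
    have : (0 : ℝ) < (2 ^ N)⁻¹ := by positivity
    linarith
  have h := sum_semi_sq_le h1 u hsum
  have h2 : semi a E u f x ^ 2 ≤ Real.exp (-(2 * u)) * 1 :=
    (Finset.single_le_sum (f := fun x => semi a E u f x ^ 2) (fun _ _ => sq_nonneg _)
      (Finset.mem_univ x)).trans (h.trans (mul_le_mul_of_nonneg_left hsq (Real.exp_pos _).le))
  have h3 : semi a E u f x = trans a E u x y - (2 ^ N)⁻¹ := by
    simp only [semi, hf, mul_sub, Finset.sum_sub_distrib, ← Finset.sum_mul, sum_trans]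
    simp
  have h4 : Real.exp (-(2 * u)) * 1 = Real.exp (-u) ^ 2 := by
    rw [mul_one, ← Real.exp_nat_mul]
    congr 1
    push_cast
    ring
  rw [h4, h3] at h2
  have := abs_le_of_sq_le_sq h2 (Real.exp_pos _).le
  linarith [(abs_le.1 this).2]

end Bounded

end

/-! ### Stationarity, decoupling and discovery probabilities for fixed energies -/

section

variable {N : ℕ}

/-! ### The quenched law -/

/-- The joint law of the starting point and the clocks. -/
def quenched (N : ℕ) : Measure (Cube N × (ℕ × Fin N → ℝ)) :=
  (uniformOn (Set.univ : Set (Cube N))).prod (clockLaw N)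

instance (N : ℕ) : IsProbabilityMeasure (quenched N) := by unfold quenched; infer_instance

theorem lintegral_quenched {f : Cube N × (ℕ × Fin N → ℝ) → ℝ≥0∞} (hf : Measurable f) :
    ∫⁻ p, f p ∂(quenched N) = (2 ^ N)⁻¹ * ∑ x, ∫⁻ ξ, f (x, ξ) ∂(clockLaw N) := by
  unfold quenched
  rw [lintegral_prod _ hf.aemeasurable, lintegral_fintype, Finset.mul_sum]
  refine Finset.sum_congr rfl fun x _ => ?_
  rw [mul_comm, uniformOn_univ]
  congr 1
  simp [ZMod.card]

theorem measurable_pair (E : Cube N → ℝ) :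
    Measurable fun p : Cube N × (ℕ × Fin N → ℝ) => ((E, p) : Sample N) :=
  measurable_const.prodMk measurable_id

theorem measurableSet_good (a : ℝ) : MeasurableSet {ω : Sample N | Good a ω} := by
  have : {ω : Sample N | Good a ω} = (⋂ k, {ω | 0 < ω.2.2 k}) ∩
      ⋂ u : ℕ, ⋃ n, {ω | ((u : ℝ≥0) : ℝ≥0∞) < jumpTime a ω n} := by
    ext ω
    simp only [Good, Set.mem_ofPred_eq, Set.mem_inter_iff, Set.mem_iInter, Set.mem_iUnion]
    refine and_congr_right fun _ => ⟨fun h u => h u, fun h u => ?_⟩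
    obtain ⟨m, hm⟩ := exists_nat_ge u
    obtain ⟨n, hn⟩ := h m
    exact ⟨n, lt_of_le_of_lt (by exact_mod_cast hm) hn⟩
  rw [this]
  refine (MeasurableSet.iInter fun k => measurableSet_lt measurable_const (by fun_prop)).inter
    (MeasurableSet.iInter fun u => MeasurableSet.iUnion fun n =>
      measurableSet_lt measurable_const (by fun_prop))

theorem ae_good_quenched (a : ℝ) (E : Cube N → ℝ) : ∀ᵐ p ∂(quenched N), Good a (E, p) := by
  have hm : MeasurableSet {p : Cube N × (ℕ × Fin N → ℝ) | Good a (E, p)} :=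
    measurable_pair E (measurableSet_good a)
  refine (Measure.measure_prod_null hm.compl).2 (ae_of_all _ fun x => ?_)
  exact ae_good a E x

theorem lintegral_fiber {H : Sample N → ℝ≥0∞} (hH : Measurable H) (E : Cube N → ℝ) :
    ∫⁻ p, H (E, p) ∂(quenched N) = (2 ^ N)⁻¹ * ∑ y, ∫⁻ η, H (E, y, η) ∂(clockLaw N) :=
  lintegral_quenched (hH.comp (measurable_pair E))

/-- The uniform distribution is stationary for the sample seen from time `u`. -/
theorem lintegral_residual (a : ℝ) (E : Cube N → ℝ) (u : ℝ≥0) {H : Sample N → ℝ≥0∞}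
    (hH : Measurable H) :
    ∫⁻ p, H (residual a u (E, p)) ∂(quenched N) = ∫⁻ p, H (E, p) ∂(quenched N) := by
  rw [lintegral_quenched (f := fun p => H (residual a u (E, p)))
    (hH.comp ((measurable_residual a u).comp (measurable_pair E))), lintegral_fiber hH]
  congr 1
  have h1 : ∀ x, ∫⁻ ξ, H (residual a u (E, x, ξ)) ∂(clockLaw N) =
      ∑ y, ENNReal.ofReal (trans a E u x y) * ∫⁻ η, H (E, y, η) ∂(clockLaw N) := by
    intro x
    have := markov a E x u (G := fun _ => 1) measurable_const (fun _ _ _ _ _ _ _ => rfl) hH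
    simp only [one_mul] at this
    rw [this]
    exact lintegral_walk a E u x fun y => ∫⁻ η, H (E, y, η) ∂(clockLaw N)
  simp only [h1]
  rw [Finset.sum_comm]
  refine Finset.sum_congr rfl fun y _ => ?_
  rw [← Finset.sum_mul, ← ENNReal.ofReal_sum_of_nonneg fun x _ => trans_nonneg _ _ _ _ _,
    sum_trans_left, ENNReal.ofReal_one, one_mul]

/-- The mixing bound: after a delay `L` the future is nearly independent of the past. -/
theorem lintegral_mul_residual_le {a : ℝ} {E : Cube N → ℝ} (h1 : ∀ x y, 1 ≤ conductance a E x y)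
    (u L : ℝ≥0) {G : Cube N × (ℕ × Fin N → ℝ) → ℝ≥0∞} (hG : Measurable G)
    (hGa : ∀ x, Adapted a E x u fun ξ => G (x, ξ)) {H : Sample N → ℝ≥0∞} (hH : Measurable H) :
    ∫⁻ p, G p * H (residual a L (residual a u (E, p))) ∂(quenched N) ≤
      ENNReal.ofReal (1 + 2 ^ N * Real.exp (-L)) * (∫⁻ p, G p ∂(quenched N)) *
        ∫⁻ p, H (E, p) ∂(quenched N) := by
  have hH' : Measurable fun ω : Sample N => H (residual a L ω) := hH.comp (measurable_residual a L)
  rw [lintegral_quenched (f := fun p => G p * H (residual a L (residual a u (E, p))))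
    (hG.mul (hH'.comp ((measurable_residual a u).comp (measurable_pair E)))), lintegral_quenched hG]
  set I := ∫⁻ p, H (E, p) ∂(quenched N) with hI
  -- After the delay `L` the position has a density at most `1 + 2 ^ N exp (-L)` with respect to the
  -- uniform law, whatever the starting point.
  have hk : ∀ y, ∫⁻ η, H (residual a L (E, y, η)) ∂(clockLaw N) ≤
      ENNReal.ofReal (1 + 2 ^ N * Real.exp (-L)) * I := by
    intro y
    have := markov a E y L (G := fun _ => 1) measurable_const (fun _ _ _ _ _ _ _ => rfl) hH
    simp only [one_mul] at this
    rw [this, lintegral_walk a E L y fun z => ∫⁻ η, H (E, z, η) ∂(clockLaw N)]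
    have hb : ∀ z, ENNReal.ofReal (trans a E L y z) ≤
        ENNReal.ofReal (1 + 2 ^ N * Real.exp (-L)) * (2 ^ N)⁻¹ := by
      intro z
      have e1 : ((2 : ℝ≥0∞) ^ N)⁻¹ = ENNReal.ofReal ((2 ^ N)⁻¹) := by
        rw [ENNReal.ofReal_inv_of_pos (by positivity), ENNReal.ofReal_pow (by norm_num)]
        simp
      rw [e1, ← ENNReal.ofReal_mul (by positivity)]
      refine ENNReal.ofReal_le_ofReal ((trans_le h1 L y z).trans (le_of_eq ?_))
      field_simp
    calc ∑ z, ENNReal.ofReal (trans a E L y z) * ∫⁻ η, H (E, z, η) ∂(clockLaw N)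
        ≤ ∑ z, ENNReal.ofReal (1 + 2 ^ N * Real.exp (-L)) * (2 ^ N)⁻¹ *
            ∫⁻ η, H (E, z, η) ∂(clockLaw N) := by
          gcongr with z
          exact hb z
      _ = _ := by rw [← Finset.mul_sum, mul_assoc, hI, lintegral_fiber hH]
  have hx : ∀ x, ∫⁻ ξ, G (x, ξ) * H (residual a L (residual a u (E, x, ξ))) ∂(clockLaw N) ≤
      (ENNReal.ofReal (1 + 2 ^ N * Real.exp (-L)) * I) * ∫⁻ ξ, G (x, ξ) ∂(clockLaw N) := by
    intro x
    have hGx : Measurable fun ξ => G (x, ξ) := hG.comp (measurable_const.prodMk measurable_id)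
    rw [markov a E x u hGx (hGa x) hH', ← lintegral_const_mul _ hGx]
    refine lintegral_mono fun ξ => ?_
    rw [mul_comm (G (x, ξ))]
    exact mul_le_mul_left (hk _) _
  calc (2 ^ N)⁻¹ * ∑ x, ∫⁻ ξ, G (x, ξ) * H (residual a L (residual a u (E, x, ξ))) ∂(clockLaw N)
      ≤ (2 ^ N)⁻¹ * ∑ x, (ENNReal.ofReal (1 + 2 ^ N * Real.exp (-L)) * I) *
          ∫⁻ ξ, G (x, ξ) ∂(clockLaw N) := by
        gcongr with x
        exact hx x
    _ = _ := by
        rw [← Finset.mul_sum]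
        ring

theorem adapted_disc (a : ℝ) (E : Cube N → ℝ) (x : Cube N) (u : ℝ≥0)
    (F : Finset (Cube N) → ℝ≥0∞) : Adapted a E x u fun ξ => F (disc a u (E, x, ξ)) := by
  intro n ξ ξ' h h1 h2 h3
  refine congrArg F ?_
  have hlt : ∀ ξ : ℕ × Fin N → ℝ, (u : ℝ≥0∞) < jumpTime a (E, x, ξ) (n + 1) →
      ∀ m, jumpTime a (E, x, ξ) m ≤ u → m ≤ n := by
    intro ξ h4 m hm
    by_contra hmn
    exact absurd ((h4.trans_le (jumpTime_mono a _ (show n + 1 ≤ m by omega))).trans_le hm)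
      (lt_irrefl _)
  have hc : ∀ m ≤ n, jumpChain a (E, x, ξ) m = jumpChain a (E, x, ξ') m ∧
      jumpTime a (E, x, ξ) m = jumpTime a (E, x, ξ') m := fun m hm =>
    path_congr_clocks a E x m fun k hk => h k (by omega)
  ext y
  rw [mem_disc, mem_disc]
  constructor
  · rintro ⟨m, hm, hy⟩
    have := hc m (hlt ξ h2 m hm)
    exact ⟨m, by rw [← this.2]; exact hm, by rw [← this.1]; exact hy⟩
  · rintro ⟨m, hm, hy⟩
    have := hc m (hlt ξ' h3 m hm)
    exact ⟨m, by rw [this.2]; exact hm, by rw [this.1]; exact hy⟩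

/-! ### Discovery probabilities -/

theorem card_ball_le (y : Cube N) :
    (Finset.univ.filter fun x : Cube N => hammingDist x y ≤ 1).card ≤ N + 1 := by
  classical
  have hsub : (Finset.univ.filter fun x : Cube N => hammingDist x y ≤ 1) ⊆
      insert y (Finset.univ.image fun i => y + Pi.single i 1) := by
    intro x hx
    rw [Finset.mem_filter] at hx
    have h := hx.2
    by_cases hxy : x = y
    · simp [hxy]
    · have h1 : hammingDist x y = 1 := by
        have := hammingDist_pos.2 hxy
        omega
      obtain ⟨i, hi⟩ := Finset.card_eq_one.1 h1
      refine Finset.mem_insert_of_mem (Finset.mem_image.2 ⟨i, Finset.mem_univ _, ?_⟩)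
      have hz : ∀ u v : ZMod 2, u ≠ v → v + 1 = u := by decide
      ext j
      have hj : j ∈ ({i} : Finset (Fin N)) ↔ x j ≠ y j := by rw [← hi]; simp
      rw [Finset.mem_singleton] at hj
      by_cases hji : j = i
      · subst hji
        simpa using hz _ _ (hj.1 rfl)
      · have : x j = y j := by
          by_contra h2
          exact hji (hj.2 h2)
        simp [this, hji]
  refine (Finset.card_le_card hsub).trans ((Finset.card_insert_le _ _).trans ?_)
  have := Finset.card_image_le (s := Finset.univ) (f := fun i : Fin N => y + Pi.single i (1 : ZMod 2))
  simp only [Finset.card_univ, Fintype.card_fin] at this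
  omega

/-- The quenched probability that `x` is discovered before time `s`. -/
def hit (a : ℝ) (E : Cube N → ℝ) (s : ℝ≥0) (x : Cube N) : ℝ≥0∞ :=
  quenched N {p | x ∈ disc a s (E, p)}

theorem measurableSet_hit (a : ℝ) (E : Cube N → ℝ) (s : ℝ≥0) (x : Cube N) :
    MeasurableSet {p | x ∈ disc a s (E, p)} :=
  measurable_pair E (measurableSet_mem_disc a s x)

theorem hit_mono (a : ℝ) (E : Cube N → ℝ) {s t : ℝ≥0} (h : s ≤ t) (x : Cube N) :
    hit a E s x ≤ hit a E t x := measure_mono fun _ hp => disc_mono a _ h hp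

theorem quenched_residual_mem (a : ℝ) (E : Cube N → ℝ) (u : ℝ≥0) {S : Set (Sample N)}
    (hS : MeasurableSet S) :
    quenched N {p | residual a u (E, p) ∈ S} = quenched N {p | (E, p) ∈ S} := by
  have h1 : MeasurableSet {p | residual a u (E, p) ∈ S} :=
    (measurable_residual a u).comp (measurable_pair E) hS
  have h2 : MeasurableSet {p | ((E, p) : Sample N) ∈ S} := measurable_pair E hS
  have h := lintegral_residual a E u (H := S.indicator 1) (measurable_one.indicator hS)
  rw [← lintegral_indicator_one h1, ← lintegral_indicator_one h2]
  exact h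

/-- Subadditivity in time: a site discovered before `u + s` is discovered either before `u` or by
the sample seen from `u` on, which is again stationary. -/
theorem hit_add_le (a : ℝ) (E : Cube N → ℝ) (u s : ℝ≥0) (x : Cube N) :
    hit a E (u + s) x ≤ hit a E u x + hit a E s x := by
  have h := quenched_residual_mem a E u (measurableSet_mem_disc a s x)
  calc hit a E (u + s) x ≤ quenched N ({p | x ∈ disc a u (E, p)} ∪
        {p | residual a u (E, p) ∈ {ω | x ∈ disc a s ω}}) := by
        refine measure_mono_ae ?_
        filter_upwards [ae_good_quenched a E] with p hp hx
        have hx : x ∈ disc a (u + s) (E, p) := hx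
        rw [hp.disc_add u s, Finset.mem_union] at hx
        exact hx
    _ ≤ _ := (measure_union_le _ _).trans (by rw [h]; rfl)

/-- A site discovered before `h` has its ball entered at some jump. Conditionally on this, with
probability at least `exp (-N R h)` the walk stays where it entered until time `h`. By stationarity
it is in the ball at time `h` with probability at most `(N + 1) / 2 ^ N`. -/
theorem hit_small {a : ℝ} {E : Cube N → ℝ} {R : ℝ} (hR : ∀ x y, conductance a E x y ≤ R)
    (h : ℝ≥0) (x : Cube N) :
    ENNReal.ofReal (Real.exp (-(N * (R * h)))) * hit a E h x ≤ (2 ^ N)⁻¹ * (N + 1) := by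
  have hR0 : 0 ≤ R := (conductance_pos a E x x).le.trans (hR x x)
  set B : Set (Cube N) := {y | hammingDist x y ≤ 1} with hB
  have hBm : MeasurableSet {ω : Sample N | walk a ω 0 ∈ B} :=
    measurable_walk a 0 (Set.to_countable B).measurableSet
  -- the probability of being in the ball at time `h`
  have e1 : quenched N {p | walk a (E, p) h ∈ B} ≤ (2 ^ N)⁻¹ * (N + 1) := by
    have hm : MeasurableSet {ω : Sample N | ω.2.1 ∈ B} :=
      measurable_snd.fst (Set.to_countable B).measurableSet
    have h2 := quenched_residual_mem a E h hm
    have h3 : {p | residual a h (E, p) ∈ {ω : Sample N | ω.2.1 ∈ B}} =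
      {p | walk a (E, p) h ∈ B} := rfl
    rw [← h3, h2]
    have hm2 : MeasurableSet {p : Cube N × (ℕ × Fin N → ℝ) | p.1 ∈ B} :=
      measurable_fst (Set.to_countable B).measurableSet
    have h4 : {p : Cube N × (ℕ × Fin N → ℝ) | ((E, p) : Sample N) ∈ {ω : Sample N | ω.2.1 ∈ B}} =
      {p | p.1 ∈ B} := rfl
    rw [h4, ← lintegral_indicator_one hm2, lintegral_quenched (measurable_one.indicator hm2)]
    gcongr
    have h5 : ∀ y, ∫⁻ ξ, Set.indicator {p : Cube N × (ℕ × Fin N → ℝ) | p.1 ∈ B} 1 (y, ξ)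
        ∂(clockLaw N) = if hammingDist y x ≤ 1 then 1 else 0 := by
      intro y
      by_cases hy : hammingDist y x ≤ 1
      · have : ∀ ξ, Set.indicator {p : Cube N × (ℕ × Fin N → ℝ) | p.1 ∈ B} (1 : Cube N × (ℕ × Fin N → ℝ) → ℝ≥0∞) (y, ξ) = 1 :=
          fun ξ => Set.indicator_of_mem (by
            show hammingDist x y ≤ 1
            rwa [hammingDist_comm]) _
        simp [this, hy]
      · have : ∀ ξ, Set.indicator {p : Cube N × (ℕ × Fin N → ℝ) | p.1 ∈ B} (1 : Cube N × (ℕ × Fin N → ℝ) → ℝ≥0∞) (y, ξ) = 0 :=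
          fun ξ => Set.indicator_of_notMem (by
            show ¬ hammingDist x y ≤ 1
            rwa [hammingDist_comm]) _
        simp [this, hy]
    simp only [h5, Finset.sum_boole]
    exact_mod_cast card_ball_le x
  refine le_trans ?_ e1
  have hm1 : MeasurableSet {p | walk a (E, p) h ∈ B} :=
    ((measurable_walk a h).comp (measurable_pair E)) (Set.to_countable B).measurableSet
  rw [hit, ← lintegral_indicator_one (measurableSet_hit a E h x), ← lintegral_indicator_one hm1,
    lintegral_quenched (measurable_one.indicator (measurableSet_hit a E h x)),
    lintegral_quenched (measurable_one.indicator hm1), ← mul_assoc,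
    mul_comm (ENNReal.ofReal _) ((2 ^ N)⁻¹), mul_assoc, Finset.mul_sum]
  gcongr with y
  -- conditionally on the starting point
  set A : ℕ → Set (ℕ × Fin N → ℝ) := fun n => {ξ | jumpTime a (E, y, ξ) n ≤ h ∧
    jumpChain a (E, y, ξ) n ∈ B ∧ ∀ m < n, jumpChain a (E, y, ξ) m ∉ B} with hA
  have hms := measurable_sample E y
  have hYB : ∀ m, MeasurableSet {ξ | jumpChain a (E, y, ξ) m ∈ B} := fun m =>
    ((measurable_jumpChain a m).comp hms) (Set.to_countable B).measurableSet
  have hAm : ∀ n, MeasurableSet (A n) := by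
    intro n
    refine (measurableSet_le ((measurable_jumpTime a n).comp hms) measurable_const).inter
      ((hYB n).inter ?_)
    have : {ξ | ∀ m < n, jumpChain a (E, y, ξ) m ∉ B} =
      ⋂ m, ⋂ (_ : m < n), {ξ | jumpChain a (E, y, ξ) m ∈ B}ᶜ := by ext; simp
    refine (MeasurableSet.congr ?_ this.symm : MeasurableSet {ξ | ∀ m < n, jumpChain a (E, y, ξ) m ∉ B})
    exact MeasurableSet.iInter fun m => MeasurableSet.iInter fun _ => (hYB m).compl
  -- On this event no clock of level `n` rings within a delay `h`, even at the maximal rate. It only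
  -- involves level `n`, whereas `A n` only involves the previous levels.
  set S : ℕ → Set (ℕ × Fin N → ℝ) := fun n => {ξ | ∀ i, R * h < ξ (n, i)} with hS
  have hSm : ∀ n, MeasurableSet (S n) := by
    intro n
    simp only [hS, Set.ofPred_forall]
    exact MeasurableSet.iInter fun i => measurableSet_lt measurable_const (measurable_pi_apply _)
  have hAcong : ∀ n ξ η, concat n ξ η ∈ A n ↔ ξ ∈ A n := by
    intro n ξ η
    have hc : ∀ m ≤ n, jumpChain a (E, y, concat n ξ η) m = jumpChain a (E, y, ξ) m ∧
        jumpTime a (E, y, concat n ξ η) m = jumpTime a (E, y, ξ) m := fun m hm =>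
      path_congr_clocks a E y m fun k hk => by simp [concat, hk.trans_le hm]
    simp only [hA, Set.mem_ofPred_eq, (hc n le_rfl).1, (hc n le_rfl).2]
    refine and_congr_right fun _ => and_congr_right fun _ => ?_
    exact forall_congr' fun m => forall_congr' fun hm => by rw [(hc m hm.le).1]
  have hprob : ∀ n, clockLaw N (A n ∩ S n) =
      ENNReal.ofReal (Real.exp (-(N * (R * h)))) * clockLaw N (A n) := by
    intro n
    have hcl := clockLaw_forall_lt (N := N) (fun _ => R * h) fun _ => mul_nonneg hR0 h.2
    have hconc := lintegral_concat (κ := Fin N) stdExp n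
      (measurable_one.indicator ((hAm n).inter (hSm n)) : Measurable (Set.indicator (A n ∩ S n)
        (1 : (ℕ × Fin N → ℝ) → ℝ≥0∞)))
    rw [lintegral_indicator_one ((hAm n).inter (hSm n))] at hconc
    change clockLaw N (A n ∩ S n) = _ at hconc
    rw [hconc]
    have hin : ∀ ξ η, Set.indicator (A n ∩ S n) (1 : (ℕ × Fin N → ℝ) → ℝ≥0∞) (concat n ξ η) =
        Set.indicator (A n) (1 : (ℕ × Fin N → ℝ) → ℝ≥0∞) ξ *
          Set.indicator {η | ∀ i, R * h < η (0, i)} (1 : (ℕ × Fin N → ℝ) → ℝ≥0∞) η := by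
      intro ξ η
      have hS2 : concat n ξ η ∈ S n ↔ η ∈ {η : ℕ × Fin N → ℝ | ∀ i, R * h < η (0, i)} := by
        simp [hS, concat]
      by_cases h3 : ξ ∈ A n
      · by_cases h4 : η ∈ {η : ℕ × Fin N → ℝ | ∀ i, R * h < η (0, i)}
        · rw [Set.indicator_of_mem h3, Set.indicator_of_mem h4, Set.indicator_of_mem
            (show concat n ξ η ∈ A n ∩ S n from ⟨(hAcong n ξ η).2 h3, hS2.2 h4⟩)]
          simp only [Pi.one_apply, mul_one]
        · rw [Set.indicator_of_notMem h4, Set.indicator_of_notMem fun h5 => h4 (hS2.1 h5.2), mul_zero]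
      · rw [Set.indicator_of_notMem h3,
          Set.indicator_of_notMem fun h5 => h3 ((hAcong n ξ η).1 h5.1), zero_mul]
    simp only [hin]
    have hTm : MeasurableSet {η : ℕ × Fin N → ℝ | ∀ i, R * h < η (0, i)} := by
      simp only [Set.ofPred_forall]
      exact MeasurableSet.iInter fun i => measurableSet_lt measurable_const (measurable_pi_apply _)
    simp_rw [lintegral_const_mul _ (measurable_one.indicator hTm)]
    rw [lintegral_mul_const _ (measurable_one.indicator (hAm n))]
    rw [lintegral_indicator_one hTm, lintegral_indicator_one (hAm n), mul_comm]
    change clockLaw N _ * clockLaw N _ = _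
    rw [hcl]
    simp
  have hl : ∫⁻ ξ, Set.indicator {p | x ∈ disc a h (E, p)} (1 : Cube N × (ℕ × Fin N → ℝ) → ℝ≥0∞) (y, ξ) ∂(clockLaw N) =
      clockLaw N {ξ | x ∈ disc a h (E, y, ξ)} :=
    lintegral_indicator_one (measurable_sample E y (measurableSet_mem_disc a h x))
  have hr : ∫⁻ ξ, Set.indicator {p | walk a (E, p) h ∈ B} (1 : Cube N × (ℕ × Fin N → ℝ) → ℝ≥0∞) (y, ξ) ∂(clockLaw N) =
      clockLaw N {ξ | walk a (E, y, ξ) h ∈ B} :=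
    lintegral_indicator_one (measurable_sample E y
      (measurable_walk a h (Set.to_countable B).measurableSet))
  rw [hl, hr]
  have hAdisj : Pairwise (Function.onFun Disjoint A) := by
    intro m n hmn
    refine Set.disjoint_left.2 fun ξ h1 h2 => ?_
    rcases lt_or_gt_of_ne hmn with h3 | h3
    · exact h2.2.2 m h3 h1.2.1
    · exact h1.2.2 n h3 h2.2.1
  calc ENNReal.ofReal (Real.exp (-(N * (R * h)))) * clockLaw N {ξ | x ∈ disc a h (E, y, ξ)}
      ≤ ENNReal.ofReal (Real.exp (-(N * (R * h)))) * clockLaw N (⋃ n, A n) := by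
        gcongr
        intro ξ hξ
        classical
        have hξ : ∃ n, jumpTime a (E, y, ξ) n ≤ h ∧ jumpChain a (E, y, ξ) n ∈ B := mem_disc.1 hξ
        refine Set.mem_iUnion.2 ⟨Nat.find hξ, (Nat.find_spec hξ).1, (Nat.find_spec hξ).2, ?_⟩
        intro m hm hmB
        exact Nat.find_min hξ hm ⟨(jumpTime_mono a _ hm.le).trans (Nat.find_spec hξ).1, hmB⟩
    _ = ∑' n, clockLaw N (A n ∩ S n) := by
        rw [measure_iUnion hAdisj hAm, ← ENNReal.tsum_mul_left]
        exact tsum_congr fun n => (hprob n).symm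
    _ = clockLaw N (⋃ n, A n ∩ S n) :=
        (measure_iUnion (fun m n hmn => (hAdisj hmn).mono Set.inter_subset_left
          Set.inter_subset_left) fun n => (hAm n).inter (hSm n)).symm
    _ ≤ clockLaw N {ξ | walk a (E, y, ξ) h ∈ B} := by
        refine measure_mono_ae ?_
        filter_upwards [ae_good a E y] with ξ hg hξ
        obtain ⟨n, hn, hs⟩ := Set.mem_iUnion.1 hξ
        show walk a (E, y, ξ) h ∈ B
        rw [walk_eq]
        have : numJumps a h (E, y, ξ) = n := by
          refine (hg.numJumps_eq_iff h n).2 ⟨hn.1, (lt_jumpTime_succ_iff hn.1).2 fun i => ?_⟩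
          refine lt_of_le_of_lt ?_ (hs i)
          refine mul_le_mul (hR _ _) ?_ ENNReal.toReal_nonneg hR0
          exact ENNReal.toReal_le_coe_of_le_coe tsub_le_self
        rw [this]
        exact hn.2.1

end

/-! ### Expected number of discovered sites, and the decomposition into blocks and pauses -/

section

variable {N : ℕ}

/-! ### Bounds on the number of discovered sites -/

/-- A bound for the quenched mean number of sites discovered before time `s`, when the jump rates
are at most `R`. -/
def discBound (N : ℕ) (R s : ℝ) : ℝ := (s * (N * R) + 1) * (3 * (N + 1))

theorem hit_natCast_mul_le (a : ℝ) (E : Cube N → ℝ) (h : ℝ≥0) (x : Cube N) (k : ℕ) :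
    hit a E ((k + 1 : ℕ) * h) x ≤ (k + 1 : ℕ) * hit a E h x := by
  induction k with
  | zero => simp
  | succ k ih =>
    have e : (((k + 1 + 1 : ℕ) : ℝ≥0) * h) = (k + 1 : ℕ) * h + h := by push_cast; ring
    rw [e]
    refine (hit_add_le a E _ h x).trans ?_
    calc hit a E ((k + 1 : ℕ) * h) x + hit a E h x ≤ (k + 1 : ℕ) * hit a E h x + hit a E h x := by
          gcongr
      _ = (k + 1 + 1 : ℕ) * hit a E h x := by push_cast; ring

/-- Subadditivity reduces the claim to the time scale `1 / (N R)`, on which the probability of not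
moving is bounded below by a constant. -/
theorem hit_toReal_le (hN : N ≠ 0) {a : ℝ} {E : Cube N → ℝ} {R : ℝ}
    (hR : ∀ x y, conductance a E x y ≤ R) (s : ℝ≥0) (x : Cube N) :
    (hit a E s x).toReal ≤ discBound N R s / 2 ^ N := by
  have hR0 : 0 < R := (conductance_pos a E x x).trans_le (hR x x)
  have hN0 : (0 : ℝ) < N := by exact_mod_cast Nat.pos_of_ne_zero hN
  have hfin : ∀ u, hit a E u x ≠ ⊤ := fun u => measure_ne_top _ _
  -- With this choice the exponential factor of `hit_small` is `exp (-1)`; the factor `3` in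
  -- `discBound` bounds `exp 1`.
  set h : ℝ≥0 := ⟨1 / (N * R), by positivity⟩ with hh
  have hhv : (h : ℝ) = 1 / (N * R) := rfl
  have h1 : (hit a E h x).toReal ≤ 3 * (N + 1) / 2 ^ N := by
    have h2 := ENNReal.toReal_mono (ENNReal.mul_ne_top (by simp) (by finiteness))
      (hit_small hR h x)
    rw [ENNReal.toReal_mul, ENNReal.toReal_ofReal (Real.exp_pos _).le, hhv,
      show (N : ℝ) * (R * (1 / (N * R))) = 1 by field_simp] at h2
    have h3 : ((((2 : ℝ≥0∞) ^ N)⁻¹) * (N + 1)).toReal = (N + 1) / 2 ^ N := by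
      rw [ENNReal.toReal_mul, ENNReal.toReal_inv, ENNReal.toReal_pow, ENNReal.toReal_add (by simp)
        (by simp)]
      simp
      ring
    rw [h3] at h2
    have h4 : Real.exp 1 ≤ 3 := by
      have := Real.exp_one_lt_d9
      linarith
    calc (hit a E h x).toReal = Real.exp 1 * (Real.exp (-1) * (hit a E h x).toReal) := by
          rw [← mul_assoc, ← Real.exp_add]; simp
      _ ≤ 3 * ((N + 1) / 2 ^ N) := by gcongr
      _ = _ := by ring
  have h5 : s ≤ ((⌊(s : ℝ) * (N * R)⌋₊ + 1 : ℕ) : ℝ≥0) * h := by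
    rw [← NNReal.coe_le_coe]
    push_cast
    rw [hhv, mul_one_div, le_div_iff₀ (by positivity)]
    exact (Nat.lt_floor_add_one _).le
  have h6 := ENNReal.toReal_mono (ENNReal.mul_ne_top (by simp) (hfin h))
    ((hit_mono a E h5 x).trans (hit_natCast_mul_le a E h x _))
  rw [ENNReal.toReal_mul] at h6
  refine h6.trans ?_
  have h7 : ((⌊(s : ℝ) * (N * R)⌋₊ : ℕ) : ℝ) ≤ s * (N * R) := Nat.floor_le (by positivity)
  unfold discBound
  calc _ ≤ (s * (N * R) + 1) * (3 * (N + 1) / 2 ^ N) := by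
        refine mul_le_mul ?_ h1 ENNReal.toReal_nonneg (by positivity)
        rw [ENNReal.toReal_natCast]
        push_cast
        linarith
    _ = _ := by ring

theorem integrable_comp_finset {A : Type*} [MeasurableSpace A] {μ : Measure A} [IsFiniteMeasure μ]
    {g : A → Finset (Cube N)} (hg : Measurable g) (f : Finset (Cube N) → ℝ) :
    Integrable (fun x => f (g x)) μ :=
  integrable_of_abs_le (measurable_from_top.comp hg) (∑ S, |f S|) fun x =>
    Finset.single_le_sum (f := fun S => |f S|) (fun _ _ => abs_nonneg _) (Finset.mem_univ (g x))

/-- The quenched mean of the number of sites discovered before time `s`. -/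
def meanDisc (a : ℝ) (s : ℝ≥0) (E : Cube N → ℝ) : ℝ :=
  ∫ p, ((disc a s (E, p)).card : ℝ) ∂(quenched N)

theorem measurable_disc_pair (a : ℝ) (s : ℝ≥0) (E : Cube N → ℝ) :
    Measurable fun p => disc a s (E, p) := (measurable_disc a s).comp (measurable_pair E)

theorem card_eq_sum_indicator (S : Finset (Cube N)) :
    (S.card : ℝ) = ∑ x : Cube N, if x ∈ S then (1 : ℝ) else 0 := by
  simp

theorem integral_mem_disc (a : ℝ) (s : ℝ≥0) (E : Cube N → ℝ) (x : Cube N) :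
    ∫ p, (if x ∈ disc a s (E, p) then (1 : ℝ) else 0) ∂(quenched N) = (hit a E s x).toReal := by
  have : (fun p => if x ∈ disc a s (E, p) then (1 : ℝ) else 0) =
      Set.indicator {p | x ∈ disc a s (E, p)} 1 := by
    ext p
    by_cases h : x ∈ disc a s (E, p)
    · rw [if_pos h, Set.indicator_of_mem (by exact h)]; rfl
    · rw [if_neg h, Set.indicator_of_notMem (by exact h)]
  rw [this, integral_indicator_one (measurableSet_hit a E s x)]
  rfl

theorem meanDisc_eq_sum (a : ℝ) (s : ℝ≥0) (E : Cube N → ℝ) :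
    meanDisc a s E = ∑ x, (hit a E s x).toReal := by
  simp only [meanDisc, card_eq_sum_indicator]
  rw [integral_finsetSum _ fun x _ => integrable_comp_finset (measurable_disc_pair a s E)
    fun S => if x ∈ S then (1 : ℝ) else 0]
  exact Finset.sum_congr rfl fun x _ => integral_mem_disc a s E x

theorem meanDisc_le (hN : N ≠ 0) {a : ℝ} {E : Cube N → ℝ} {R : ℝ}
    (hR : ∀ x y, conductance a E x y ≤ R) (s : ℝ≥0) : meanDisc a s E ≤ discBound N R s := by
  rw [meanDisc_eq_sum]
  calc ∑ x, (hit a E s x).toReal ≤ ∑ _x : Cube N, discBound N R s / 2 ^ N :=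
        Finset.sum_le_sum fun x _ => hit_toReal_le hN hR s x
    _ = discBound N R s := by
        rw [Finset.sum_const, Finset.card_univ, card_cube, nsmul_eq_mul]
        push_cast
        field_simp

theorem meanDisc_nonneg (a : ℝ) (s : ℝ≥0) (E : Cube N → ℝ) : 0 ≤ meanDisc a s E :=
  integral_nonneg fun _ => Nat.cast_nonneg _

theorem card_disc_le_pow (a : ℝ) (s : ℝ≥0) (ω : Sample N) : (disc a s ω).card ≤ 2 ^ N :=
  (Finset.card_le_univ _).trans card_cube.le

theorem card_disc_le {a : ℝ} {s : ℝ≥0} {ω : Sample N} {n : ℕ}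
    (h : (s : ℝ≥0∞) < jumpTime a ω n) : (disc a s ω).card ≤ n * (N + 1) := by
  classical
  have hsub : disc a s ω ⊆ (Finset.range n).biUnion fun m =>
      Finset.univ.filter fun x : Cube N => hammingDist x (jumpChain a ω m) ≤ 1 := by
    intro x hx
    obtain ⟨m, hm, hx⟩ := mem_disc.1 hx
    have hmn : m < n := by
      by_contra hnm
      exact absurd (h.trans_le ((jumpTime_mono a ω (not_lt.1 hnm)).trans hm)) (lt_irrefl _)
    exact Finset.mem_biUnion.2 ⟨m, Finset.mem_range.2 hmn, by simpa using hx⟩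
  refine (Finset.card_le_card hsub).trans (Finset.card_biUnion_le.trans ?_)
  refine (Finset.sum_le_card_nsmul _ _ _ fun m _ => card_ball_le _).trans ?_
  simp

theorem one_le_card_disc (a : ℝ) (s : ℝ≥0) (ω : Sample N) : 1 ≤ (disc a s ω).card :=
  Finset.card_pos.2 ⟨jumpChain a ω 0, mem_disc.2 ⟨0, by simp [jumpTime_zero], by simp⟩⟩

/-! ### The block decomposition of the trajectory -/

/-- The sample seen after a block of length `ℓ` followed by a pause of length `L`. -/
def block (a : ℝ) (ℓ L : ℝ≥0) (ω : Sample N) : Sample N := residual a L (residual a ℓ ω)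

theorem measurable_block (a : ℝ) (ℓ L : ℝ≥0) : Measurable (block a ℓ L : Sample N → Sample N) :=
  (measurable_residual a L).comp (measurable_residual a ℓ)

theorem measurable_block_iterate (a : ℝ) (ℓ L : ℝ≥0) (j : ℕ) :
    Measurable ((block a ℓ L)^[j] : Sample N → Sample N) := (measurable_block a ℓ L).iterate j

theorem lintegral_block (a : ℝ) (E : Cube N → ℝ) (ℓ L : ℝ≥0) {H : Sample N → ℝ≥0∞}
    (hH : Measurable H) :
    ∫⁻ p, H (block a ℓ L (E, p)) ∂(quenched N) = ∫⁻ p, H (E, p) ∂(quenched N) := by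
  rw [← lintegral_residual a E L hH]
  exact lintegral_residual a E ℓ (hH.comp (measurable_residual a L))

theorem lintegral_block_iterate (a : ℝ) (E : Cube N → ℝ) (ℓ L : ℝ≥0) {H : Sample N → ℝ≥0∞}
    (hH : Measurable H) (j : ℕ) :
    ∫⁻ p, H ((block a ℓ L)^[j] (E, p)) ∂(quenched N) = ∫⁻ p, H (E, p) ∂(quenched N) := by
  induction j with
  | zero => rfl
  | succ j ih =>
    simp only [Function.iterate_succ_apply]
    exact (lintegral_block a E ℓ L (hH.comp (measurable_block_iterate a ℓ L j))).trans ih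

theorem map_block_iterate (a : ℝ) (E : Cube N → ℝ) (ℓ L : ℝ≥0) (j : ℕ) :
    (quenched N).map (fun p => (block a ℓ L)^[j] (E, p)) = (quenched N).map fun p => (E, p) := by
  have hm : Measurable fun p => (block a ℓ L)^[j] (E, p) :=
    (measurable_block_iterate (N := N) a ℓ L j).comp (measurable_pair E)
  ext S hS
  rw [Measure.map_apply hm hS, Measure.map_apply (measurable_pair E) hS,
    ← lintegral_indicator_one (hm hS), ← lintegral_indicator_one (measurable_pair E hS)]
  exact lintegral_block_iterate a E ℓ L (H := S.indicator 1) (measurable_one.indicator hS) j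

theorem integral_block_iterate (a : ℝ) (E : Cube N → ℝ) (ℓ L : ℝ≥0) {H : Sample N → ℝ}
    (hH : Measurable H) (j : ℕ) :
    ∫ p, H ((block a ℓ L)^[j] (E, p)) ∂(quenched N) = ∫ p, H (E, p) ∂(quenched N) := by
  have hm : Measurable fun p => (block a ℓ L)^[j] (E, p) :=
    (measurable_block_iterate (N := N) a ℓ L j).comp (measurable_pair E)
  have h1 := integral_map (μ := quenched N) hm.aemeasurable hH.aestronglyMeasurable
  have h2 := integral_map (μ := quenched N) (measurable_pair E).aemeasurable
    hH.aestronglyMeasurable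
  rw [← h2, ← map_block_iterate a E ℓ L j, ← h1]

/-- The set of the sites discovered during the `j`-th block. -/
def blockDisc (a : ℝ) (ℓ L : ℝ≥0) (E : Cube N → ℝ) (j : ℕ) (p : Cube N × (ℕ × Fin N → ℝ)) :
    Finset (Cube N) := disc a ℓ ((block a ℓ L)^[j] (E, p))

/-- The set of the sites discovered during the pause after the `j`-th block. -/
def pauseDisc (a : ℝ) (ℓ L : ℝ≥0) (E : Cube N → ℝ) (j : ℕ) (p : Cube N × (ℕ × Fin N → ℝ)) :
    Finset (Cube N) := disc a L (residual a ℓ ((block a ℓ L)^[j] (E, p)))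

theorem measurable_blockDisc (a : ℝ) (ℓ L : ℝ≥0) (E : Cube N → ℝ) (j : ℕ) :
    Measurable (blockDisc a ℓ L E j) :=
  (measurable_disc a ℓ).comp ((measurable_block_iterate a ℓ L j).comp (measurable_pair E))

theorem measurable_pauseDisc (a : ℝ) (ℓ L : ℝ≥0) (E : Cube N → ℝ) (j : ℕ) :
    Measurable (pauseDisc a ℓ L E j) :=
  (measurable_disc a L).comp ((measurable_residual a ℓ).comp
    ((measurable_block_iterate a ℓ L j).comp (measurable_pair E)))

theorem integral_blockDisc (a : ℝ) (ℓ L : ℝ≥0) (E : Cube N → ℝ) (j : ℕ)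
    (f : Finset (Cube N) → ℝ) :
    ∫ p, f (blockDisc a ℓ L E j p) ∂(quenched N) = ∫ p, f (disc a ℓ (E, p)) ∂(quenched N) :=
  integral_block_iterate a E ℓ L (H := fun ω => f (disc a ℓ ω))
    (measurable_from_top.comp (measurable_disc a ℓ)) j

theorem integral_pauseDisc (a : ℝ) (ℓ L : ℝ≥0) (E : Cube N → ℝ) (j : ℕ) :
    ∫ p, ((pauseDisc a ℓ L E j p).card : ℝ) ∂(quenched N) = meanDisc a L E := by
  have hm : Measurable fun S : Finset (Cube N) => (S.card : ℝ) := measurable_from_top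
  have h1 := integral_block_iterate a E ℓ L
    (H := fun ω => ((disc a L (residual a ℓ ω)).card : ℝ))
    (hm.comp ((measurable_disc a L).comp (measurable_residual a ℓ))) j
  refine h1.trans ?_
  have h2 : ∀ s : ℝ≥0, ∫ p, ((disc a L (residual a s (E, p))).card : ℝ) ∂(quenched N) =
      (∫⁻ p, (((disc a L (residual a s (E, p))).card : ℝ≥0) : ℝ≥0∞) ∂(quenched N)).toReal := by
    intro s
    have := integrable_comp_finset (μ := quenched N) ((measurable_disc a L).comp
      ((measurable_residual a s).comp (measurable_pair E))) fun S => (S.card : ℝ)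
    rw [lintegral_coe_eq_integral (fun p => ((disc a L (residual a s (E, p))).card : ℝ≥0))
      (by simpa using this), ENNReal.toReal_ofReal (integral_nonneg fun _ => NNReal.coe_nonneg _)]
    simp
  rw [h2 ℓ, lintegral_residual a E ℓ (H := fun ω => (((disc a L ω).card : ℝ≥0) : ℝ≥0∞))
    ((measurable_from_top (f := fun S : Finset (Cube N) => ((S.card : ℝ≥0) : ℝ≥0∞))).comp
      (measurable_disc a L))]
  have := integrable_comp_finset (μ := quenched N) (measurable_disc_pair a L E)
    fun S => (S.card : ℝ)
  rw [lintegral_coe_eq_integral (fun p => ((disc a L (E, p)).card : ℝ≥0))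
    (by simpa using this), ENNReal.toReal_ofReal (integral_nonneg fun _ => NNReal.coe_nonneg _)]
  simp [meanDisc]

/-- Stationarity brings block `i` to time `0`; the pause that follows it decouples it from all later
blocks, and stationarity is used again for block `j`. -/
theorem integral_blockDisc_mul_le {a : ℝ} {E : Cube N → ℝ} (h1 : ∀ x y, 1 ≤ conductance a E x y)
    (ℓ L : ℝ≥0) {i j : ℕ} (hij : i < j) (f : Finset (Cube N) → ℝ≥0) :
    ∫ p, (f (blockDisc a ℓ L E i p) : ℝ) * f (blockDisc a ℓ L E j p) ∂(quenched N) ≤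
      (1 + 2 ^ N * Real.exp (-L)) * (∫ p, (f (disc a ℓ (E, p)) : ℝ) ∂(quenched N)) ^ 2 := by
  obtain ⟨k, rfl⟩ : ∃ k, j = k + 1 + i := ⟨j - i - 1, by omega⟩
  have hf : Measurable fun ω : Sample N => ((f (disc a ℓ ω) : ℝ≥0) : ℝ≥0∞) :=
    (measurable_from_top (f := fun S => ((f S : ℝ≥0) : ℝ≥0∞))).comp (measurable_disc a ℓ)
  have hfk : Measurable fun ω : Sample N =>
      ((f (disc a ℓ ((block a ℓ L)^[k] ω)) : ℝ≥0) : ℝ≥0∞) :=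
    hf.comp (measurable_block_iterate a ℓ L k)
  have e1 : ∫⁻ p, ((f (blockDisc a ℓ L E i p) * f (blockDisc a ℓ L E (k + 1 + i) p) : ℝ≥0) : ℝ≥0∞)
      ∂(quenched N) ≤ ENNReal.ofReal (1 + 2 ^ N * Real.exp (-L)) *
        (∫⁻ p, (f (disc a ℓ (E, p)) : ℝ≥0∞) ∂(quenched N)) *
        ∫⁻ p, (f (disc a ℓ (E, p)) : ℝ≥0∞) ∂(quenched N) := by
    have e2 := lintegral_block_iterate a E ℓ L
      (H := fun ω => (f (disc a ℓ ω) : ℝ≥0∞) * f (disc a ℓ ((block a ℓ L)^[k] (block a ℓ L ω))))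
      (hf.mul (hfk.comp (measurable_block a ℓ L))) i
    have e3 := lintegral_mul_residual_le h1 ℓ L (G := fun p => (f (disc a ℓ (E, p)) : ℝ≥0∞))
      (hf.comp (measurable_pair E)) (fun x => adapted_disc a E x ℓ fun S => (f S : ℝ≥0∞)) hfk
    rw [lintegral_block_iterate a E ℓ L hf k] at e3
    refine le_trans (le_of_eq ?_) (e2.le.trans e3)
    refine lintegral_congr fun p => ?_
    simp only [blockDisc, ENNReal.coe_mul, Function.iterate_add_apply, Function.iterate_succ_apply]
  set m := ∫ p, (f (disc a ℓ (E, p)) : ℝ) ∂(quenched N) with hm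
  have hm0 : 0 ≤ m := integral_nonneg fun _ => NNReal.coe_nonneg _
  have e4 : ∫⁻ p, (f (disc a ℓ (E, p)) : ℝ≥0∞) ∂(quenched N) = ENNReal.ofReal m :=
    lintegral_coe_eq_integral _ (integrable_comp_finset (measurable_disc_pair a ℓ E)
      fun S => (f S : ℝ))
  have hint : Integrable (fun p => ((f (blockDisc a ℓ L E i p) *
      f (blockDisc a ℓ L E (k + 1 + i) p) : ℝ≥0) : ℝ)) (quenched N) := by
    have hfm : Measurable fun S : Finset (Cube N) => (f S : ℝ) := measurable_from_top
    have hb : ∀ S, (f S : ℝ) ≤ ∑ T, (f T : ℝ) := fun S =>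
      Finset.single_le_sum (f := fun T => (f T : ℝ)) (fun _ _ => NNReal.coe_nonneg _)
        (Finset.mem_univ S)
    push_cast
    refine integrable_of_abs_le ((hfm.comp (measurable_blockDisc a ℓ L E i)).mul
      (hfm.comp (measurable_blockDisc a ℓ L E _))) ((∑ T, (f T : ℝ)) * ∑ T, (f T : ℝ)) fun p => ?_
    rw [abs_of_nonneg (by positivity)]
    exact mul_le_mul (hb _) (hb _) (NNReal.coe_nonneg _)
      (Finset.sum_nonneg fun _ _ => NNReal.coe_nonneg _)
  rw [lintegral_coe_eq_integral _ hint, e4, ← ENNReal.ofReal_mul (by positivity),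
    ← ENNReal.ofReal_mul (by positivity), ENNReal.ofReal_le_ofReal_iff (by positivity)] at e1
  push_cast at e1
  rw [mul_assoc, ← sq] at e1
  exact e1

theorem disc_block_union (a : ℝ) (ℓ L : ℝ≥0) {ω : Sample N} (hω : Good a ω) (n : ℕ) :
    disc a (ℓ + L + n * (ℓ + L)) ω = disc a ℓ ω ∪ (disc a L (residual a ℓ ω) ∪
      disc a (n * (ℓ + L)) (block a ℓ L ω)) := by
  rw [add_assoc, hω.disc_add, (hω.residual ℓ).disc_add]
  rfl

theorem Good.block {a : ℝ} {ω : Sample N} (hω : Good a ω) (ℓ L : ℝ≥0) :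
    Good a (RandomTraps.block a ℓ L ω) := (hω.residual ℓ).residual L

theorem card_disc_le_sum {a : ℝ} {ω : Sample N} (hω : Good a ω) (ℓ L : ℝ≥0) (n : ℕ) :
    ((disc a ((n + 1 : ℕ) * (ℓ + L)) ω).card : ℝ) ≤
      ∑ j ∈ Finset.range (n + 1), (((disc a ℓ ((block a ℓ L)^[j] ω)).card : ℝ) +
        (disc a L (residual a ℓ ((block a ℓ L)^[j] ω))).card) := by
  induction n generalizing ω with
  | zero =>
    have h := hω.disc_add ℓ L
    simp only [zero_add, Nat.cast_one, one_mul, Finset.sum_range_one, Function.iterate_zero, id]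
    rw [h]
    exact_mod_cast Finset.card_union_le _ _
  | succ n ih =>
    have e : ((n + 1 + 1 : ℕ) : ℝ≥0) * (ℓ + L) = ℓ + L + (n + 1 : ℕ) * (ℓ + L) := by push_cast; ring
    rw [Finset.sum_range_succ', e, disc_block_union a ℓ L hω]
    simp only [Function.iterate_succ_apply, Function.iterate_zero, id]
    have h1 := ih (hω.block ℓ L)
    have h2 := Finset.card_union_le (disc a ℓ ω) (disc a L (residual a ℓ ω) ∪
      disc a ((n + 1 : ℕ) * (ℓ + L)) (block a ℓ L ω))
    have h3 := Finset.card_union_le (disc a L (residual a ℓ ω))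
      (disc a ((n + 1 : ℕ) * (ℓ + L)) (block a ℓ L ω))
    have h4 : ((disc a ℓ ω ∪ (disc a L (residual a ℓ ω) ∪
      disc a ((n + 1 : ℕ) * (ℓ + L)) (block a ℓ L ω))).card : ℝ) ≤ (disc a ℓ ω).card +
        ((disc a L (residual a ℓ ω)).card + (disc a ((n + 1 : ℕ) * (ℓ + L)) (block a ℓ L ω)).card) :=
      by exact_mod_cast h2.trans (by omega)
    linarith

theorem blocks_subset_disc {a : ℝ} {ω : Sample N} (hω : Good a ω) (ℓ L : ℝ≥0) (n : ℕ) :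
    (Finset.range n).biUnion (fun j => disc a ℓ ((block a ℓ L)^[j] ω)) ⊆
      disc a (n * (ℓ + L)) ω := by
  induction n generalizing ω with
  | zero => simp
  | succ n ih =>
    have e : ((n + 1 : ℕ) : ℝ≥0) * (ℓ + L) = ℓ + L + n * (ℓ + L) := by push_cast; ring
    rw [e, disc_block_union a ℓ L hω]
    intro x hx
    obtain ⟨j, hj, hx⟩ := Finset.mem_biUnion.1 hx
    rcases j with _ | j
    · exact Finset.mem_union_left _ hx
    · refine Finset.mem_union_right _ (Finset.mem_union_right _ (ih (hω.block ℓ L) ?_))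
      exact Finset.mem_biUnion.2 ⟨j, by simpa using hj, hx⟩

/-- A Bonferroni inequality, by induction on the number of sets: each new set loses at most its
intersections with the previous ones. -/
theorem sum_card_le_card_biUnion {ι : Type*} [DecidableEq ι] (A : ℕ → Finset ι) (n : ℕ) :
    ∑ j ∈ Finset.range n, ((A j).card : ℝ) ≤ ((Finset.range n).biUnion A).card +
      ∑ j ∈ Finset.range n, ∑ i ∈ Finset.range j, ((A i ∩ A j).card : ℝ) := by
  induction n with
  | zero => simp
  | succ n ih =>
    rw [Finset.sum_range_succ, Finset.sum_range_succ, Finset.range_add_one, Finset.biUnion_insert]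
    have h1 := Finset.card_union_add_card_inter (A n) ((Finset.range n).biUnion A)
    have h2 : (A n ∩ (Finset.range n).biUnion A).card ≤
        ∑ i ∈ Finset.range n, (A i ∩ A n).card := by
      rw [Finset.inter_biUnion]
      refine Finset.card_biUnion_le.trans (Finset.sum_le_sum fun i _ => ?_)
      rw [Finset.inter_comm]
    have h1' : ((A n ∪ (Finset.range n).biUnion A).card : ℝ) +
        (A n ∩ (Finset.range n).biUnion A).card = (A n).card + ((Finset.range n).biUnion A).card := by
      exact_mod_cast h1
    have h2' : ((A n ∩ (Finset.range n).biUnion A).card : ℝ) ≤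
        ∑ i ∈ Finset.range n, ((A i ∩ A n).card : ℝ) := by exact_mod_cast h2
    linarith

end

section

variable {N : ℕ}

/-! ### The quenched law of large numbers -/

/-- A number of jumps which is exceeded before time `s` with probability at most `4 ^ (-N)` when the
rates are at most `R`. -/
def jumpBound (N : ℕ) (R s : ℝ) : ℕ := ⌈2 * N + 4 * N * (R * s)⌉₊

/-- The number of sites discovered within `jumpBound N R s` jumps. -/
def discMax (N : ℕ) (R s : ℝ) : ℝ := jumpBound N R s * (N + 1)

theorem discMax_nonneg (N : ℕ) (R s : ℝ) : 0 ≤ discMax N R s := by unfold discMax; positivity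

theorem quenched_fastEvent_le {R s : ℝ} (hR : 0 ≤ R) (hs : 0 ≤ s) :
    (quenched N).real {p | p.2 ∈ fastEvent (jumpBound N R s) (R * s)} ≤ (4 ^ N)⁻¹ := by
  have h1 : quenched N {p | p.2 ∈ fastEvent (jumpBound N R s) (R * s)} =
      clockLaw N (fastEvent (jumpBound N R s) (R * s)) := by
    have h2 : {p : Cube N × (ℕ × Fin N → ℝ) | p.2 ∈ fastEvent (jumpBound N R s) (R * s)} =
      Set.univ ×ˢ fastEvent (jumpBound N R s) (R * s) := by ext; simp
    rw [h2, quenched, Measure.prod_prod, measure_univ, one_mul]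
  rw [measureReal_def, h1]
  have h3 := ENNReal.toReal_mono (by finiteness)
    (clockLaw_fastEvent_le (N := N) (jumpBound N R s) (R * s))
  refine h3.trans ?_
  rw [ENNReal.toReal_mul, ENNReal.toReal_ofReal (Real.exp_pos _).le, ENNReal.toReal_pow,
    ENNReal.toReal_inv, ENNReal.toReal_ofNat]
  -- In `jumpBound`, the `2 N` levels pay for `4 ^ N` and the `4 N R s` levels for the exponential,
  -- because `log 2 ≥ 1 / 2`.
  have h4 : Real.exp (2 * N * (R * s)) * 4 ^ N ≤ 2 ^ jumpBound N R s := by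
    have hl : (1 : ℝ) / 2 ≤ Real.log 2 := by linarith [Real.log_two_gt_d9]
    have e1 : (4 : ℝ) ^ N = Real.exp (2 * N * Real.log 2) := by
      rw [mul_comm 2 (N : ℝ), mul_assoc, Real.exp_nat_mul, mul_comm 2, Real.exp_mul,
        Real.exp_log (by norm_num)]
      norm_num
    have e2 : (2 : ℝ) ^ jumpBound N R s = Real.exp (jumpBound N R s * Real.log 2) := by
      rw [Real.exp_nat_mul, Real.exp_log (by norm_num)]
    rw [e1, e2, ← Real.exp_add]
    refine Real.exp_le_exp.2 ?_
    have h5 : 2 * N + 4 * N * (R * s) ≤ (jumpBound N R s : ℝ) := Nat.le_ceil _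
    have h6 : 0 ≤ N * (R * s) := by positivity
    nlinarith [mul_le_mul_of_nonneg_right h5 (by linarith : 0 ≤ Real.log 2)]
  rw [inv_pow, ← div_eq_mul_inv, div_le_iff₀ (by positivity), inv_mul_eq_div,
    le_div_iff₀ (by positivity)]
  exact h4

theorem measurableSet_fast (n : ℕ) (T : ℝ) :
    MeasurableSet {p : Cube N × (ℕ × Fin N → ℝ) | p.2 ∈ fastEvent n T} :=
  measurable_snd (measurableSet_fastEvent n T)

theorem card_disc_le_discMax (hN : N ≠ 0) {a : ℝ} {E : Cube N → ℝ} {R : ℝ}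
    (hR : ∀ x y, conductance a E x y ≤ R) (s : ℝ≥0) {p : Cube N × (ℕ × Fin N → ℝ)}
    (hp : p.2 ∉ fastEvent (jumpBound N R s) (R * s)) :
    ((disc a s (E, p)).card : ℝ) ≤ discMax N R s := by
  have h : (s : ℝ≥0∞) < jumpTime a (E, p) (jumpBound N R s) := by
    by_contra hlt
    exact hp (mem_fastEvent_of_jumpTime_le hN (ω := (E, p)) (by exact hR) (not_lt.1 hlt))
  unfold discMax
  exact_mod_cast card_disc_le h

theorem integral_indicator_fast_le {R s : ℝ} (hR : 0 ≤ R) (hs : 0 ≤ s) :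
    ∫ p, Set.indicator {p : Cube N × (ℕ × Fin N → ℝ) | p.2 ∈ fastEvent (jumpBound N R s) (R * s)}
      (fun _ => (1 : ℝ)) p ∂(quenched N) ≤ (4 ^ N)⁻¹ := by
  have := integral_indicator_one (μ := quenched N) (measurableSet_fast (N := N) (jumpBound N R s) (R * s))
  refine le_trans (le_of_eq ?_) (quenched_fastEvent_le hR hs)
  rw [← this]
  rfl

/-- On the event of fast clocks the square is at most `4 ^ N`, which its probability `4 ^ (-N)`
compensates; elsewhere the number of sites is at most `discMax`. -/
theorem integral_card_disc_sq_le (hN : N ≠ 0) {a : ℝ} {E : Cube N → ℝ} {R : ℝ}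
    (hR : ∀ x y, conductance a E x y ≤ R) (s : ℝ≥0) :
    ∫ p, ((disc a s (E, p)).card : ℝ) ^ 2 ∂(quenched N) ≤ discMax N R s ^ 2 + 1 := by
  have hR0 : 0 ≤ R := (conductance_pos a E 0 0).le.trans (hR 0 0)
  set S := {p : Cube N × (ℕ × Fin N → ℝ) | p.2 ∈ fastEvent (jumpBound N R s) (R * s)} with hS
  have hSi : Integrable (fun p => Set.indicator S (fun _ => (1 : ℝ)) p) (quenched N) :=
    (integrable_const 1).indicator (measurableSet_fast _ _)
  calc ∫ p, ((disc a s (E, p)).card : ℝ) ^ 2 ∂(quenched N)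
      ≤ ∫ p, (discMax N R s ^ 2 + 4 ^ N * Set.indicator S (fun _ => (1 : ℝ)) p) ∂(quenched N) := by
        refine integral_mono (integrable_comp_finset (measurable_disc_pair a s E)
          fun T => (T.card : ℝ) ^ 2) ((integrable_const _).add (hSi.const_mul _)) fun p => ?_
        by_cases hp : p ∈ S
        · have h1 : ((disc a s (E, p)).card : ℝ) ≤ 2 ^ N := by exact_mod_cast card_disc_le_pow a s _
          have h2 : ((disc a s (E, p)).card : ℝ) ^ 2 ≤ (2 ^ N) ^ 2 := by gcongr
          simp only [Set.indicator_of_mem hp]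
          have h3 : ((2 : ℝ) ^ N) ^ 2 = 4 ^ N := by rw [← pow_mul, mul_comm, pow_mul]; norm_num
          nlinarith [sq_nonneg (discMax N R s)]
        · simp only [Set.indicator_of_notMem hp, mul_zero, add_zero]
          have := card_disc_le_discMax hN hR s hp
          gcongr
    _ = discMax N R s ^ 2 + 4 ^ N * ∫ p, Set.indicator S (fun _ => (1 : ℝ)) p ∂(quenched N) := by
        rw [integral_add (integrable_const _) (hSi.const_mul _), integral_const_mul]
        simp
    _ ≤ discMax N R s ^ 2 + 4 ^ N * (4 ^ N)⁻¹ := by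
        gcongr
        exact integral_indicator_fast_le hR0 s.2
    _ = _ := by rw [mul_inv_cancel₀ (by positivity)]

/-- The mixing error after a pause of length `L`. -/
def mixError (N : ℕ) (L : ℝ) : ℝ := 2 ^ N * Real.exp (-L)

theorem mixError_nonneg (N : ℕ) (L : ℝ) : 0 ≤ mixError N L := by unfold mixError; positivity

/-- Site by site, the probability of being found in both blocks is almost the product of two
discovery probabilities, each at most `discBound / 2 ^ N`; there are `2 ^ N` sites. -/
theorem integral_card_blockDisc_inter_le (hN : N ≠ 0) {a : ℝ} {E : Cube N → ℝ} {R : ℝ}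
    (h1 : ∀ x y, 1 ≤ conductance a E x y) (hR : ∀ x y, conductance a E x y ≤ R)
    (ℓ L : ℝ≥0) {i j : ℕ} (hij : i < j) :
    ∫ p, ((blockDisc a ℓ L E i p ∩ blockDisc a ℓ L E j p).card : ℝ) ∂(quenched N) ≤
      (1 + mixError N L) * discBound N R ℓ ^ 2 / 2 ^ N := by
  classical
  have hR0 : 0 ≤ R := (conductance_pos a E 0 0).le.trans (hR 0 0)
  have e : ∀ p, ((blockDisc a ℓ L E i p ∩ blockDisc a ℓ L E j p).card : ℝ) =
      ∑ x : Cube N, (((if x ∈ blockDisc a ℓ L E i p then 1 else 0 : ℝ≥0) : ℝ)) *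
        ((if x ∈ blockDisc a ℓ L E j p then 1 else 0 : ℝ≥0) : ℝ) := by
    intro p
    rw [card_eq_sum_indicator]
    refine Finset.sum_congr rfl fun x _ => ?_
    by_cases h2 : x ∈ blockDisc a ℓ L E i p <;> by_cases h3 : x ∈ blockDisc a ℓ L E j p <;>
      simp [h2, h3]
  have hint : ∀ x ∈ (Finset.univ : Finset (Cube N)), Integrable (fun p =>
      (((if x ∈ blockDisc a ℓ L E i p then 1 else 0 : ℝ≥0) : ℝ)) *
        ((if x ∈ blockDisc a ℓ L E j p then 1 else 0 : ℝ≥0) : ℝ)) (quenched N) := by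
    intro x _
    have hfm : Measurable fun S : Finset (Cube N) => ((if x ∈ S then 1 else 0 : ℝ≥0) : ℝ) :=
      measurable_from_top
    refine integrable_of_abs_le ((hfm.comp (measurable_blockDisc a ℓ L E i)).mul
      (hfm.comp (measurable_blockDisc a ℓ L E j))) 1 fun p => ?_
    split_ifs <;> simp
  simp only [e]
  rw [integral_finsetSum _ hint]
  calc _ ≤ ∑ _x : Cube N, (1 + mixError N L) * (discBound N R ℓ / 2 ^ N) ^ 2 := by
        refine Finset.sum_le_sum fun x _ => ?_
        refine (integral_blockDisc_mul_le h1 ℓ L hij fun S => if x ∈ S then 1 else 0).trans ?_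
        have e2 : ∫ p, ((if x ∈ disc a ℓ (E, p) then 1 else 0 : ℝ≥0) : ℝ) ∂(quenched N) =
            (hit a E ℓ x).toReal := by
          rw [← integral_mem_disc]
          refine integral_congr_ae (ae_of_all _ fun p => ?_)
          by_cases h : x ∈ disc a ℓ (E, p) <;> simp [h]
        rw [e2]
        have h5 := hit_toReal_le hN hR ℓ x
        have h6 := mixError_nonneg N L
        unfold mixError at h6 ⊢
        gcongr
    _ = _ := by
        rw [Finset.sum_const, Finset.card_univ, card_cube, nsmul_eq_mul]
        push_cast
        field_simp

/-- Distinct blocks are separated by a pause, so each covariance is at most `mixError` times the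
squared mean; the diagonal terms are second moments of a single block. -/
theorem integral_sum_card_sub_sq_le (hN : N ≠ 0) {a : ℝ} {E : Cube N → ℝ} {R : ℝ}
    (h1 : ∀ x y, 1 ≤ conductance a E x y) (hR : ∀ x y, conductance a E x y ≤ R)
    (ℓ L : ℝ≥0) (n : ℕ) :
    ∫ p, (∑ j ∈ Finset.range n, ((blockDisc a ℓ L E j p).card : ℝ) - n * meanDisc a ℓ E) ^ 2
      ∂(quenched N) ≤
      n * (discMax N R ℓ ^ 2 + 1) + n ^ 2 * (mixError N L * discBound N R ℓ ^ 2) := by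
  have hR0 : 0 ≤ R := (conductance_pos a E 0 0).le.trans (hR 0 0)
  have hcm : Measurable fun S : Finset (Cube N) => (S.card : ℝ) := measurable_from_top
  have hWm : ∀ j, Measurable fun p => ((blockDisc a ℓ L E j p).card : ℝ) := fun j =>
    hcm.comp (measurable_blockDisc a ℓ L E j)
  have hWb : ∀ j p, ((blockDisc a ℓ L E j p).card : ℝ) ≤ 2 ^ N := fun j p => by
    exact_mod_cast card_disc_le_pow a ℓ _
  have hWi : ∀ j, Integrable (fun p => ((blockDisc a ℓ L E j p).card : ℝ)) (quenched N) := fun j =>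
    integrable_comp_finset (measurable_blockDisc a ℓ L E j) fun S => (S.card : ℝ)
  set m := meanDisc a ℓ E with hm
  have hm0 : 0 ≤ m := meanDisc_nonneg a ℓ E
  have hmF : m ≤ discBound N R ℓ := meanDisc_le hN hR ℓ
  have hmean : ∫ p, ∑ j ∈ Finset.range n, ((blockDisc a ℓ L E j p).card : ℝ) ∂(quenched N) = n * m := by
    rw [integral_finsetSum _ fun j _ => hWi j]
    have : ∀ j, ∫ p, ((blockDisc a ℓ L E j p).card : ℝ) ∂(quenched N) = m := fun j =>
      integral_blockDisc a ℓ L E j fun S => (S.card : ℝ)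
    simp [this]
  have hb : ∀ p, |∑ j ∈ Finset.range n, ((blockDisc a ℓ L E j p).card : ℝ)| ≤ n * 2 ^ N := by
    intro p
    rw [abs_of_nonneg (Finset.sum_nonneg fun _ _ => Nat.cast_nonneg _)]
    refine (Finset.sum_le_card_nsmul _ _ _ fun j _ => hWb j p).trans ?_
    simp
  have hvar := integral_sub_mean_sq_le (μ := quenched N)
    (Finset.measurable_fun_sum (Finset.range n) fun j _ => hWm j) _ hb 0
  rw [hmean] at hvar
  rw [hvar]
  simp only [sub_zero]
  have hsq : ∫ p, (∑ j ∈ Finset.range n, ((blockDisc a ℓ L E j p).card : ℝ)) ^ 2 ∂(quenched N) ≤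
      n * (discMax N R ℓ ^ 2 + 1) + n ^ 2 * ((1 + mixError N L) * m ^ 2) := by
    have hij : ∀ i j, Integrable (fun p => ((blockDisc a ℓ L E i p).card : ℝ) *
        (blockDisc a ℓ L E j p).card) (quenched N) := by
      intro i j
      refine integrable_of_abs_le ((hWm i).mul (hWm j)) (2 ^ N * 2 ^ N) fun p => ?_
      rw [abs_of_nonneg (by positivity)]
      exact mul_le_mul (hWb i p) (hWb j p) (Nat.cast_nonneg _) (by positivity)
    have hlt : ∀ i j, i < j → ∫ p, ((blockDisc a ℓ L E i p).card : ℝ) *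
        (blockDisc a ℓ L E j p).card ∂(quenched N) ≤ (1 + mixError N L) * m ^ 2 := by
      intro i j h
      have := integral_blockDisc_mul_le h1 ℓ L h fun S => (S.card : ℝ≥0)
      simpa [meanDisc, mixError, hm] using this
    have hpos : 0 ≤ (1 + mixError N L) * m ^ 2 := by
      have := mixError_nonneg N L
      positivity
    simp only [sq (∑ j ∈ Finset.range n, _), Finset.sum_mul_sum]
    rw [integral_finsetSum _ fun i _ => integrable_finsetSum _ fun j _ => hij i j]
    calc _ ≤ ∑ i ∈ Finset.range n, ∑ j ∈ Finset.range n, ((if i = j then (discMax N R ℓ ^ 2 + 1) else 0)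
            + (1 + mixError N L) * m ^ 2) := by
          refine Finset.sum_le_sum fun i _ => ?_
          rw [integral_finsetSum _ fun j _ => hij i j]
          refine Finset.sum_le_sum fun j _ => ?_
          rcases lt_trichotomy i j with h | h | h
          · rw [if_neg h.ne, zero_add]
            exact hlt i j h
          · subst h
            rw [if_pos rfl]
            have e1 := integral_blockDisc a ℓ L E i fun S => (S.card : ℝ) ^ 2
            have e2 := integral_card_disc_sq_le hN hR ℓ
            simp only [← sq]
            rw [e1]
            linarith
          · rw [if_neg h.ne', zero_add]
            simp only [mul_comm ((blockDisc a ℓ L E i _).card : ℝ)]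
            exact hlt j i h
      _ = _ := by
          simp only [Finset.sum_add_distrib, Finset.sum_ite_eq, Finset.sum_const,
            Finset.card_range, nsmul_eq_mul]
          rw [Finset.sum_congr rfl fun i hi => if_pos hi]
          simp only [Finset.sum_const, Finset.card_range, nsmul_eq_mul]
          ring
  have h7 : mixError N L * m ^ 2 ≤ mixError N L * discBound N R ℓ ^ 2 := by
    have := mixError_nonneg N L
    gcongr
  nlinarith [sq_nonneg (n : ℝ)]

/-- The overlap error of the block decomposition. -/
def overlapError (N : ℕ) (R : ℝ) (ℓ L : ℝ) (n : ℕ) : ℝ :=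
  n ^ 2 * ((1 + mixError N L) * discBound N R ℓ ^ 2 / 2 ^ N)

theorem integral_overlap_le (hN : N ≠ 0) {a : ℝ} {E : Cube N → ℝ} {R : ℝ}
    (h1 : ∀ x y, 1 ≤ conductance a E x y) (hR : ∀ x y, conductance a E x y ≤ R)
    (ℓ L : ℝ≥0) (n : ℕ) :
    Integrable (fun p => ∑ j ∈ Finset.range n, ∑ i ∈ Finset.range j,
      ((blockDisc a ℓ L E i p ∩ blockDisc a ℓ L E j p).card : ℝ)) (quenched N) ∧
    ∫ p, ∑ j ∈ Finset.range n, ∑ i ∈ Finset.range j,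
      ((blockDisc a ℓ L E i p ∩ blockDisc a ℓ L E j p).card : ℝ) ∂(quenched N) ≤
      overlapError N R ℓ L n := by
  have hint : ∀ i j, Integrable (fun p =>
      ((blockDisc a ℓ L E i p ∩ blockDisc a ℓ L E j p).card : ℝ)) (quenched N) := by
    intro i j
    have hm : Measurable fun p => blockDisc a ℓ L E i p ∩ blockDisc a ℓ L E j p := by
      refine measurable_comp_countable (F := fun S p => S ∩ blockDisc a ℓ L E j p) (fun S => ?_)
        (measurable_blockDisc a ℓ L E i)
      exact (measurable_from_top (f := fun T => S ∩ T)).comp (measurable_blockDisc a ℓ L E j)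
    exact integrable_comp_finset hm fun S => (S.card : ℝ)
  refine ⟨integrable_finsetSum _ fun j _ => integrable_finsetSum _ fun i _ => hint i j, ?_⟩
  rw [integral_finsetSum _ fun j _ => integrable_finsetSum _ fun i _ => hint i j]
  have hc : 0 ≤ (1 + mixError N L) * discBound N R ℓ ^ 2 / 2 ^ N := by
    have := mixError_nonneg N L
    positivity
  calc _ ≤ ∑ j ∈ Finset.range n, ∑ _i ∈ Finset.range n,
        (1 + mixError N L) * discBound N R ℓ ^ 2 / 2 ^ N := by
        refine Finset.sum_le_sum fun j hj => ?_
        rw [integral_finsetSum _ fun i _ => hint i j]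
        refine (Finset.sum_le_sum fun i hi => integral_card_blockDisc_inter_le hN h1 hR ℓ L
          (Finset.mem_range.1 hi)).trans ?_
        refine Finset.sum_le_sum_of_subset_of_nonneg ?_ fun _ _ _ => hc
        exact Finset.range_mono (Finset.mem_range.1 hj).le
    _ = _ := by
        simp only [Finset.sum_const, Finset.card_range, nsmul_eq_mul, overlapError]
        ring

/-- The union of the blocks is discovered before `t`, up to their overlaps. With blocks of length
`0` this lower bound also shows that the mean is not too small (`le_truncMean`). -/
theorem mul_meanDisc_sub_le (hN : N ≠ 0) {a : ℝ} {E : Cube N → ℝ} {R : ℝ}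
    (h1 : ∀ x y, 1 ≤ conductance a E x y) (hR : ∀ x y, conductance a E x y ≤ R)
    (ℓ L : ℝ≥0) (n : ℕ) {t : ℝ≥0} (ht : n * (ℓ + L) ≤ t) :
    n * meanDisc a ℓ E - overlapError N R ℓ L n ≤ meanDisc a t E := by
  classical
  obtain ⟨hi, hle⟩ := integral_overlap_le hN h1 hR ℓ L n
  have hWi : ∀ j, Integrable (fun p => ((blockDisc a ℓ L E j p).card : ℝ)) (quenched N) := fun j =>
    integrable_comp_finset (measurable_blockDisc a ℓ L E j) fun S => (S.card : ℝ)
  have hDi : Integrable (fun p => ((disc a t (E, p)).card : ℝ)) (quenched N) :=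
    integrable_comp_finset (measurable_disc_pair a t E) fun S => (S.card : ℝ)
  have hmean : ∫ p, ∑ j ∈ Finset.range n, ((blockDisc a ℓ L E j p).card : ℝ) ∂(quenched N) =
      n * meanDisc a ℓ E := by
    rw [integral_finsetSum _ fun j _ => hWi j]
    have : ∀ j, ∫ p, ((blockDisc a ℓ L E j p).card : ℝ) ∂(quenched N) = meanDisc a ℓ E := fun j =>
      integral_blockDisc a ℓ L E j fun S => (S.card : ℝ)
    simp [this]
  have := integral_mono_ae (integrable_finsetSum (Finset.range n) fun j _ => hWi j) (hDi.add hi) (by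
    filter_upwards [ae_good_quenched a E] with p hp
    refine (sum_card_le_card_biUnion (fun j => blockDisc a ℓ L E j p) n).trans ?_
    refine add_le_add (Nat.cast_le.2 ?_) le_rfl
    exact Finset.card_le_card ((blocks_subset_disc hp ℓ L n).trans (disc_mono a _ ht)))
  rw [hmean, integral_add' hDi hi] at this
  unfold meanDisc at this ⊢
  linarith

/-- The quenched concentration of the number of discovered sites. -/
theorem integral_abs_card_disc_sub_le (hN : N ≠ 0) {a : ℝ} {E : Cube N → ℝ} {R : ℝ}
    (h1 : ∀ x y, 1 ≤ conductance a E x y) (hR : ∀ x y, conductance a E x y ≤ R)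
    (ℓ L : ℝ≥0) (n : ℕ) {t : ℝ≥0} (ht : n * (ℓ + L) ≤ t) (ht' : t ≤ (n + 1 : ℕ) * (ℓ + L)) :
    ∫ p, |((disc a t (E, p)).card : ℝ) - n * meanDisc a ℓ E| ∂(quenched N) ≤
      √(n * (discMax N R ℓ ^ 2 + 1) + n ^ 2 * (mixError N L * discBound N R ℓ ^ 2)) +
      ((n + 1) * discBound N R L + discBound N R ℓ + overlapError N R ℓ L n) := by
  classical
  obtain ⟨hi, hle⟩ := integral_overlap_le hN h1 hR ℓ L n
  have hWi : ∀ j, Integrable (fun p => ((blockDisc a ℓ L E j p).card : ℝ)) (quenched N) := fun j =>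
    integrable_comp_finset (measurable_blockDisc a ℓ L E j) fun S => (S.card : ℝ)
  have hVi : ∀ j, Integrable (fun p => ((pauseDisc a ℓ L E j p).card : ℝ)) (quenched N) := fun j =>
    integrable_comp_finset (measurable_pauseDisc a ℓ L E j) fun S => (S.card : ℝ)
  have hDi : Integrable (fun p => ((disc a t (E, p)).card : ℝ)) (quenched N) :=
    integrable_comp_finset (measurable_disc_pair a t E) fun S => (S.card : ℝ)
  set m := meanDisc a ℓ E with hm
  have hWs : Integrable (fun p => ∑ j ∈ Finset.range n, ((blockDisc a ℓ L E j p).card : ℝ))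
    (quenched N) := integrable_finsetSum _ fun j _ => hWi j
  have hVs : Integrable (fun p => ∑ j ∈ Finset.range (n + 1), ((pauseDisc a ℓ L E j p).card : ℝ))
    (quenched N) := integrable_finsetSum _ fun j _ => hVi j
  have hX : Integrable (fun p => |∑ j ∈ Finset.range n, ((blockDisc a ℓ L E j p).card : ℝ) - n * m|)
    (quenched N) := (hWs.sub (integrable_const _)).abs
  have hVW : Integrable (fun p => ∑ j ∈ Finset.range (n + 1), ((pauseDisc a ℓ L E j p).card : ℝ) +
      (blockDisc a ℓ L E n p).card) (quenched N) := hVs.add (hWi n)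
  have hVWO : Integrable (fun p => ∑ j ∈ Finset.range (n + 1), ((pauseDisc a ℓ L E j p).card : ℝ) +
      (blockDisc a ℓ L E n p).card + ∑ j ∈ Finset.range n, ∑ i ∈ Finset.range j,
      ((blockDisc a ℓ L E i p ∩ blockDisc a ℓ L E j p).card : ℝ)) (quenched N) := hVW.add hi
  -- Up to time `t` the walk has gone through at least `n` blocks with their pauses, and through at
  -- most `n + 1` of them. The number of sites is thus at least the sum over `n` blocks minus the
  -- overlaps, and at most the same sum plus one block and all the pauses.
  have hmain : ∫ p, |((disc a t (E, p)).card : ℝ) - n * m| ∂(quenched N) ≤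
      ∫ p, (|∑ j ∈ Finset.range n, ((blockDisc a ℓ L E j p).card : ℝ) - n * m| +
        (∑ j ∈ Finset.range (n + 1), ((pauseDisc a ℓ L E j p).card : ℝ) +
          (blockDisc a ℓ L E n p).card + ∑ j ∈ Finset.range n, ∑ i ∈ Finset.range j,
      ((blockDisc a ℓ L E i p ∩ blockDisc a ℓ L E j p).card : ℝ))) ∂(quenched N) := by
    refine integral_mono_ae (hDi.sub (integrable_const _)).abs (hX.add hVWO) ?_
    filter_upwards [ae_good_quenched a E] with p hp
    have u1 : ((disc a t (E, p)).card : ℝ) ≤ (disc a ((n + 1 : ℕ) * (ℓ + L)) (E, p)).card := by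
      exact_mod_cast Finset.card_le_card (disc_mono a _ ht')
    have u2 := card_disc_le_sum hp ℓ L n
    rw [Finset.sum_add_distrib, Finset.sum_range_succ] at u2
    have l1 := sum_card_le_card_biUnion (fun j => blockDisc a ℓ L E j p) n
    have l2 : ((((Finset.range n).biUnion fun j => blockDisc a ℓ L E j p).card : ℕ) : ℝ) ≤
        (disc a t (E, p)).card := by
      exact_mod_cast Finset.card_le_card ((blocks_subset_disc hp ℓ L n).trans (disc_mono a _ ht))
    have p1 : 0 ≤ ∑ j ∈ Finset.range (n + 1), ((pauseDisc a ℓ L E j p).card : ℝ) :=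
      Finset.sum_nonneg fun _ _ => Nat.cast_nonneg _
    have p2 : (0 : ℝ) ≤ (blockDisc a ℓ L E n p).card := Nat.cast_nonneg _
    have p3 : 0 ≤ ∑ j ∈ Finset.range n, ∑ i ∈ Finset.range j,
      ((blockDisc a ℓ L E i p ∩ blockDisc a ℓ L E j p).card : ℝ) :=
      Finset.sum_nonneg fun _ _ => Finset.sum_nonneg fun _ _ => Nat.cast_nonneg _
    have a1 := le_abs_self (∑ j ∈ Finset.range n, ((blockDisc a ℓ L E j p).card : ℝ) - n * m)
    have a2 := neg_abs_le (∑ j ∈ Finset.range n, ((blockDisc a ℓ L E j p).card : ℝ) - n * m)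
    have u3 : ((disc a ((n + 1 : ℕ) * (ℓ + L)) (E, p)).card : ℝ) ≤
        ∑ j ∈ Finset.range n, ((blockDisc a ℓ L E j p).card : ℝ) + (blockDisc a ℓ L E n p).card +
        ∑ j ∈ Finset.range (n + 1), ((pauseDisc a ℓ L E j p).card : ℝ) := u2
    refine abs_le.2 ⟨?_, ?_⟩
    · linarith
    · linarith
  refine hmain.trans ?_
  rw [integral_add hX hVWO, integral_add hVW hi, integral_add hVs (hWi n),
    integral_finsetSum _ fun j _ => hVi j]
  have e1 : ∫ p, ((blockDisc a ℓ L E n p).card : ℝ) ∂(quenched N) ≤ discBound N R ℓ := by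
    rw [integral_blockDisc a ℓ L E n fun S => (S.card : ℝ)]
    exact meanDisc_le hN hR ℓ
  have e2 : ∑ j ∈ Finset.range (n + 1), ∫ p, ((pauseDisc a ℓ L E j p).card : ℝ) ∂(quenched N) ≤
      (n + 1) * discBound N R L := by
    refine (Finset.sum_le_card_nsmul _ _ (discBound N R L) fun j _ => ?_).trans (by simp)
    rw [integral_pauseDisc]
    exact meanDisc_le hN hR L
  have e3 : ∫ p, |∑ j ∈ Finset.range n, ((blockDisc a ℓ L E j p).card : ℝ) - n * m| ∂(quenched N) ≤
      √(n * (discMax N R ℓ ^ 2 + 1) + n ^ 2 * (mixError N L * discBound N R ℓ ^ 2)) := by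
    refine Real.le_sqrt_of_sq_le ((sq_integral_le (μ := quenched N) ?_ (n * 2 ^ N + n * m) ?_).trans ?_)
    · have hcm : Measurable fun S : Finset (Cube N) => (S.card : ℝ) := measurable_from_top
      exact ((Finset.measurable_fun_sum (Finset.range n) fun j _ =>
        hcm.comp (measurable_blockDisc a ℓ L E j)).sub_const _).norm
    · intro p
      rw [abs_abs]
      refine (abs_sub _ _).trans ?_
      rw [abs_of_nonneg (Finset.sum_nonneg fun _ _ => Nat.cast_nonneg _),
        abs_of_nonneg (mul_nonneg (Nat.cast_nonneg _) (meanDisc_nonneg a ℓ E))]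
      refine add_le_add ?_ le_rfl
      refine (Finset.sum_le_card_nsmul _ _ (2 ^ N : ℝ) fun j _ => ?_).trans (by simp)
      exact_mod_cast card_disc_le_pow a ℓ _
    · simp only [sq_abs]
      exact integral_sum_card_sub_sq_le hN h1 hR ℓ L n
  linarith

end

section

variable {N : ℕ}

/-! ### Dependence on the environment -/

/-- The energies truncated to the interval `[0, Λ]`. -/
def clamp (Λ : ℝ) (E : Cube N → ℝ) : Cube N → ℝ := fun x => max 0 (min (E x) Λ)

@[fun_prop]
theorem measurable_clamp (Λ : ℝ) : Measurable (clamp Λ : (Cube N → ℝ) → Cube N → ℝ) :=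
  measurable_pi_lambda _ fun x => by unfold clamp; fun_prop

theorem one_le_conductance_clamp {a : ℝ} (ha : 0 ≤ a) (Λ : ℝ) (E : Cube N → ℝ) (x y : Cube N) :
    1 ≤ conductance a (clamp Λ E) x y := by
  refine Real.one_le_exp (mul_nonneg ha (add_nonneg ?_ ?_)) <;> exact le_max_left _ _

theorem conductance_clamp_le {a Λ : ℝ} (ha : 0 ≤ a) (hΛ : 0 ≤ Λ) (E : Cube N → ℝ) (x y : Cube N) :
    conductance a (clamp Λ E) x y ≤ Real.exp (2 * a * Λ) := by
  refine Real.exp_le_exp.2 ?_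
  have h : ∀ x, clamp Λ E x ≤ Λ := fun x => max_le hΛ (min_le_right _ _)
  have := mul_le_mul_of_nonneg_left (add_le_add (h x) (h y)) ha
  show a * (clamp Λ E x + clamp Λ E y) ≤ _
  linarith

/-- An undiscovered site is at distance at least two from every position of the walk, so its energy
enters none of the rates used before time `u`. -/
theorem disc_congr_energy {a : ℝ} {E E' : Cube N → ℝ} {y : Cube N} (hE : ∀ x, x ≠ y → E x = E' x)
    {u : ℝ≥0} {p : Cube N × (ℕ × Fin N → ℝ)} (hp : Good a (E, p)) (hy : y ∉ disc a u (E, p)) :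
    disc a u (E', p) = disc a u (E, p) := by
  obtain ⟨h1, h2⟩ := hp.numJumps_spec u
  set n := numJumps a u (E, p) with hn
  -- Agreement is needed up to jump `n + 1`, so that this jump falls after `u` for both environments
  -- and nothing more is discovered.
  have hpath : ∀ k ≤ n + 1, jumpChain a (E, p) k = jumpChain a (E', p) k ∧
      jumpTime a (E, p) k = jumpTime a (E', p) k := by
    intro k hk
    refine path_congr a (ω := (E, p)) (ω' := (E', p)) rfl k fun m hm i => ?_
    have hm' : jumpTime a (E, p) m ≤ u := (jumpTime_mono a _ (by omega : m ≤ n)).trans h1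
    have hd : ¬ hammingDist y (jumpChain a (E, p) m) ≤ 1 := fun h => hy (mem_disc.2 ⟨m, hm', h⟩)
    have hn1 : jumpChain a (E, p) m ≠ y := by
      intro h
      rw [h, hammingDist_self] at hd
      omega
    have hn2 : jumpChain a (E, p) m + Pi.single i 1 ≠ y := by
      intro h
      refine hd ?_
      rw [← h]
      refine (Finset.card_le_card (t := {i}) fun j hj => ?_).trans (Finset.card_singleton i).le
      rw [Finset.mem_singleton]
      by_contra hji
      rw [Finset.mem_filter] at hj
      exact hj.2 (by simp [hji])
    simp only [ring, rate, energy]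
    rw [hE _ hn1, hE _ hn2]
  have hlt : ∀ {F : Cube N → ℝ} {m : ℕ}, (u : ℝ≥0∞) < jumpTime a (F, p) (n + 1) →
      jumpTime a (F, p) m ≤ u → m ≤ n := by
    intro F m h4 hm
    by_contra hmn
    exact absurd ((h4.trans_le (jumpTime_mono a _ (show n + 1 ≤ m by omega))).trans_le hm)
      (lt_irrefl _)
  ext x
  rw [mem_disc, mem_disc]
  constructor
  · rintro ⟨m, hm, hx⟩
    have hmn := hlt (by rw [← (hpath (n + 1) le_rfl).2]; exact h2) hm
    obtain ⟨e1, e2⟩ := hpath m (by omega)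
    exact ⟨m, by rwa [e2], by rwa [e1]⟩
  · rintro ⟨m, hm, hx⟩
    obtain ⟨e1, e2⟩ := hpath m (by have := hlt h2 hm; omega)
    exact ⟨m, by rwa [← e2], by rwa [← e1]⟩

/-- A bound for the influence of one energy on the quenched mean number of discovered sites. -/
def influence (N : ℕ) (R s : ℝ) : ℝ := (discMax N R s * discBound N R s + 1) / 2 ^ N

/-- The energy at `y` matters only if `y` is discovered, which has probability at most `discBound /
2 ^ N`, and the change is then at most `discMax`. Fast clocks cost at most `2 ^ N * 4 ^ (-N)`, the
term `1 / 2 ^ N` of `influence`. -/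
theorem abs_meanDisc_sub_le (hN : N ≠ 0) {a R : ℝ} {E E' : Cube N → ℝ} {y : Cube N}
    (hE : ∀ x, x ≠ y → E x = E' x) (hR : ∀ x y, conductance a E x y ≤ R)
    (hR' : ∀ x y, conductance a E' x y ≤ R) (s : ℝ≥0) :
    |meanDisc a s E - meanDisc a s E'| ≤ influence N R s := by
  have hR0 : 0 ≤ R := (conductance_pos a E 0 0).le.trans (hR 0 0)
  set S := {p : Cube N × (ℕ × Fin N → ℝ) | p.2 ∈ fastEvent (jumpBound N R s) (R * s)} with hS
  have hSi : Integrable (fun p => Set.indicator S (fun _ => (1 : ℝ)) p) (quenched N) :=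
    (integrable_const 1).indicator (measurableSet_fast _ _)
  have hyi : Integrable (fun p => if y ∈ disc a s (E, p) then (1 : ℝ) else 0) (quenched N) :=
    integrable_comp_finset (measurable_disc_pair a s E) fun S => if y ∈ S then (1 : ℝ) else 0
  have hi : ∀ E : Cube N → ℝ, Integrable (fun p => ((disc a s (E, p)).card : ℝ)) (quenched N) :=
    fun E => integrable_comp_finset (measurable_disc_pair a s E) fun S => (S.card : ℝ)
  have hU := discMax_nonneg N R s
  unfold meanDisc
  rw [← integral_sub (hi E) (hi E')]
  refine abs_integral_le_integral_abs.trans ?_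
  calc ∫ p, |((disc a s (E, p)).card : ℝ) - (disc a s (E', p)).card| ∂(quenched N)
      ≤ ∫ p, (discMax N R s * (if y ∈ disc a s (E, p) then (1 : ℝ) else 0) +
          2 ^ N * Set.indicator S (fun _ => (1 : ℝ)) p) ∂(quenched N) := by
        refine integral_mono_ae ((hi E).sub (hi E')).abs
          ((hyi.const_mul _).add (hSi.const_mul _)) ?_
        filter_upwards [ae_good_quenched a E] with p hp
        have c1 : (0 : ℝ) ≤ (disc a s (E, p)).card := Nat.cast_nonneg _
        have c2 : (0 : ℝ) ≤ (disc a s (E', p)).card := Nat.cast_nonneg _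
        by_cases hy : y ∈ disc a s (E, p)
        · rw [if_pos hy, mul_one]
          by_cases hpS : p ∈ S
          · have h1 : ((disc a s (E, p)).card : ℝ) ≤ 2 ^ N := by exact_mod_cast card_disc_le_pow a s _
            have h2 : ((disc a s (E', p)).card : ℝ) ≤ 2 ^ N := by exact_mod_cast card_disc_le_pow a s _
            rw [Set.indicator_of_mem hpS, mul_one]
            refine abs_le.2 ⟨by linarith, by linarith⟩
          · have h1 := card_disc_le_discMax hN hR s hpS
            have h2 := card_disc_le_discMax hN hR' s hpS
            rw [Set.indicator_of_notMem hpS, mul_zero, add_zero]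
            refine abs_le.2 ⟨by linarith, by linarith⟩
        · rw [disc_congr_energy hE hp hy, sub_self, abs_zero, if_neg hy, mul_zero, zero_add]
          exact mul_nonneg (by positivity) (Set.indicator_nonneg (fun _ _ => zero_le_one) _)
    _ = discMax N R s * (hit a E s y).toReal +
          2 ^ N * ∫ p, Set.indicator S (fun _ => (1 : ℝ)) p ∂(quenched N) := by
        rw [integral_add (hyi.const_mul _) (hSi.const_mul _), integral_const_mul,
          integral_const_mul, integral_mem_disc]
    _ ≤ discMax N R s * (discBound N R s / 2 ^ N) + 2 ^ N * (4 ^ N)⁻¹ := by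
        gcongr
        · exact hit_toReal_le hN hR s y
        · exact integral_indicator_fast_le hR0 s.2
    _ = influence N R s := by
        have : (4 : ℝ) ^ N = 2 ^ N * 2 ^ N := by rw [← mul_pow]; norm_num
        unfold influence
        rw [this]
        field_simp

/-- The law of the energies. -/
def energyLaw (N : ℕ) : Measure (Cube N → ℝ) := Measure.pi fun _ => posGaussian

instance (N : ℕ) : IsProbabilityMeasure (energyLaw N) := by unfold energyLaw; infer_instance

theorem annealed_eq_prod (N : ℕ) : annealed N = (energyLaw N).prod (quenched N) := rfl

theorem measurable_meanDisc (a : ℝ) (s : ℝ≥0) :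
    Measurable fun E : Cube N → ℝ => meanDisc a s E := by
  have hm : Measurable fun ω : Sample N => ((disc a s ω).card : ℝ) :=
    (measurable_from_top (f := fun S : Finset (Cube N) => (S.card : ℝ))).comp (measurable_disc a s)
  exact (hm.stronglyMeasurable.integral_prod_right').measurable

theorem meanDisc_le_pow (a : ℝ) (s : ℝ≥0) (E : Cube N → ℝ) : |meanDisc a s E| ≤ 2 ^ N :=
  abs_integral_le_of_abs_le _ fun p => by
    rw [abs_of_nonneg (Nat.cast_nonneg _)]
    exact_mod_cast card_disc_le_pow a s _

/-- The mean number of sites discovered before time `s` in the truncated environment. -/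
def truncMean (N : ℕ) (a Λ : ℝ) (s : ℝ≥0) : ℝ := ∫ E, meanDisc a s (clamp Λ E) ∂(energyLaw N)

/-- Efron-Stein over the `2 ^ N` energies, each being replaced by `0`; truncation makes the bound on
the rates, hence the influence, uniform over environments. -/
theorem integral_abs_meanDisc_sub_le (hN : N ≠ 0) {a Λ : ℝ} (ha : 0 ≤ a) (hΛ : 0 ≤ Λ) (s : ℝ≥0) :
    ∫ E, |meanDisc a s (clamp Λ E) - truncMean N a Λ s| ∂(energyLaw N) ≤
      √(2 ^ N * influence N (Real.exp (2 * a * Λ)) s ^ 2) := by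
  have hf : Measurable fun E : Cube N → ℝ => meanDisc a s (clamp Λ E) :=
    (measurable_meanDisc a s).comp (measurable_clamp Λ)
  have hb : ∀ E : Cube N → ℝ, |meanDisc a s (clamp Λ E)| ≤ 2 ^ N := fun E => meanDisc_le_pow a s _
  have hg : |truncMean N a Λ s| ≤ 2 ^ N := abs_integral_le_of_abs_le _ hb
  refine Real.le_sqrt_of_sq_le ((sq_integral_le (μ := energyLaw N) (hf.sub_const _).norm
    (2 ^ N + 2 ^ N) fun E => ?_).trans ?_)
  · rw [Real.norm_eq_abs, abs_abs]
    exact (abs_sub _ _).trans (add_le_add (hb E) hg)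
  simp only [Real.norm_eq_abs, sq_abs]
  refine (efronStein posGaussian 0 hf (2 ^ N) hb).trans ?_
  refine (Finset.sum_le_card_nsmul _ _ (influence N (Real.exp (2 * a * Λ)) s ^ 2) fun y _ => ?_).trans ?_
  · refine (le_abs_self _).trans (abs_integral_le_of_abs_le _ fun E => ?_)
    rw [abs_pow]
    refine pow_le_pow_left₀ (abs_nonneg _) (abs_meanDisc_sub_le hN (y := y) (fun x hx => ?_)
      (conductance_clamp_le ha hΛ E) (conductance_clamp_le ha hΛ _) s) 2
    simp [clamp, hx]
  · rw [Finset.card_univ, card_cube, nsmul_eq_mul]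
    push_cast
    exact le_rfl

/-- The error of the law of large numbers for the number of discovered sites. -/
def lawError (N : ℕ) (R Λ ℓ L : ℝ) (n : ℕ) : ℝ :=
  -- In order: fluctuations of the sum over the blocks; pauses, last incomplete block and overlaps;
  -- fluctuations of the block mean with the environment; truncation of the energies.
  √(n * (discMax N R ℓ ^ 2 + 1) + n ^ 2 * (mixError N L * discBound N R ℓ ^ 2)) +
    ((n + 1) * discBound N R L + discBound N R ℓ + overlapError N R ℓ L n) +
    n * √(2 ^ N * influence N R ℓ ^ 2) + 2 ^ N * (2 ^ N * posGaussian.real (Set.Ioi Λ))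

theorem posGaussian_Iio : posGaussian (Set.Iio 0) = 0 := by
  rw [posGaussian, Measure.map_apply (by fun_prop) measurableSet_Iio]
  have : (fun z : ℝ => max z 0) ⁻¹' Set.Iio 0 = ∅ := by
    ext z
    simp
  simp [this]

theorem energyLaw_clamp_ne_le (N : ℕ) (Λ : ℝ) :
    (energyLaw N).real {E | clamp Λ E ≠ E} ≤ 2 ^ N * posGaussian.real (Set.Ioi Λ) := by
  have hx : ∀ x : Cube N, (energyLaw N).real {E | Λ < E x ∨ E x < 0} ≤ posGaussian.real (Set.Ioi Λ) := by
    intro x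
    have h1 : {E : Cube N → ℝ | Λ < E x ∨ E x < 0} = Function.eval x ⁻¹' (Set.Ioi Λ ∪ Set.Iio 0) := rfl
    have h2 := (measurePreserving_eval (fun _ : Cube N => posGaussian) x).measure_preimage
      (measurableSet_Ioi (a := Λ) |>.union (measurableSet_Iio (a := (0 : ℝ)))).nullMeasurableSet
    rw [h1, measureReal_def, energyLaw, h2]
    refine ENNReal.toReal_mono (measure_ne_top _ _) ((measure_union_le _ _).trans ?_)
    rw [posGaussian_Iio, add_zero]
  have hsub : {E : Cube N → ℝ | clamp Λ E ≠ E} ⊆ ⋃ x : Cube N, {E | Λ < E x ∨ E x < 0} := by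
    intro E hE
    obtain ⟨x, hx⟩ := Function.ne_iff.1 hE
    refine Set.mem_iUnion.2 ⟨x, ?_⟩
    by_contra h
    have h : ¬ (Λ < E x ∨ E x < 0) := h
    push Not at h
    exact hx (by simp [clamp, min_eq_left h.1, max_eq_right h.2])
  calc (energyLaw N).real {E | clamp Λ E ≠ E}
      ≤ (energyLaw N).real (⋃ x : Cube N, {E | Λ < E x ∨ E x < 0}) := measureReal_mono hsub
    _ ≤ ∑ x : Cube N, (energyLaw N).real {E | Λ < E x ∨ E x < 0} := measureReal_iUnion_fintype_le _
    _ ≤ ∑ _x : Cube N, posGaussian.real (Set.Ioi Λ) := Finset.sum_le_sum fun x _ => hx x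
    _ = _ := by
        rw [Finset.sum_const, Finset.card_univ, card_cube, nsmul_eq_mul]
        push_cast
        rfl

theorem ae_good_annealed (a : ℝ) : ∀ᵐ ω ∂(annealed N), Good a ω := by
  rw [annealed_eq_prod]
  have hm : MeasurableSet {ω : Sample N | Good a ω} := measurableSet_good a
  refine (Measure.measure_prod_null hm.compl).2 (ae_of_all _ fun E => ?_)
  exact ae_good_quenched a E

/-- The law of large numbers for the number of discovered sites. -/
theorem integral_abs_numDiscovered_sub_le (hN : N ≠ 0) {a Λ : ℝ} (ha : 0 ≤ a) (hΛ : 0 ≤ Λ)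
    (ℓ L : ℝ≥0) (n : ℕ) {t : ℝ≥0} (ht : n * (ℓ + L) ≤ t) (ht' : t ≤ (n + 1 : ℕ) * (ℓ + L)) :
    ∫ ω, |(numDiscovered a ω t : ℝ) - n * truncMean N a Λ ℓ| ∂(annealed N) ≤
      lawError N (Real.exp (2 * a * Λ)) Λ ℓ L n := by
  set R := Real.exp (2 * a * Λ) with hR
  set g := truncMean N a Λ ℓ with hg
  have hcm : Measurable fun ω : Sample N => ((disc a t ω).card : ℝ) :=
    (measurable_from_top (f := fun S : Finset (Cube N) => (S.card : ℝ))).comp (measurable_disc a t)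
  have hcl : Measurable fun ω : Sample N => ((clamp Λ ω.1, ω.2) : Sample N) :=
    ((measurable_clamp Λ).comp measurable_fst).prodMk measurable_snd
  have hfm : Measurable fun E : Cube N → ℝ => meanDisc a ℓ (clamp Λ E) :=
    (measurable_meanDisc a ℓ).comp (measurable_clamp Λ)
  have hpow : ∀ ω : Sample N, ((disc a t ω).card : ℝ) ≤ 2 ^ N := fun ω => by
    exact_mod_cast card_disc_le_pow a t ω
  have hmb : ∀ E : Cube N → ℝ, |meanDisc a ℓ (clamp Λ E)| ≤ 2 ^ N := fun E => meanDisc_le_pow a ℓ _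
  have hgb : |g| ≤ 2 ^ N := abs_integral_le_of_abs_le _ hmb
  -- The deviation is split into three parts: `X` for the walk in a fixed truncated environment, `Y`
  -- for the environment, and `Z` for the event that truncation changes an energy, on which the
  -- trivial bound `2 ^ N` is used.
  set X : Sample N → ℝ := fun ω =>
    |((disc a t (clamp Λ ω.1, ω.2)).card : ℝ) - n * meanDisc a ℓ (clamp Λ ω.1)| with hX
  have hXm : Measurable X :=
    ((hcm.comp hcl).sub ((hfm.comp measurable_fst).const_mul _)).norm
  have hXi : Integrable X (annealed N) := by
    refine integrable_of_abs_le hXm (2 ^ N + n * 2 ^ N) fun ω => ?_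
    simp only [hX, abs_abs]
    refine (abs_sub _ _).trans ?_
    rw [abs_of_nonneg (Nat.cast_nonneg _), abs_mul, Nat.abs_cast]
    gcongr
    · exact hpow _
    · exact hmb _
  set Y : Sample N → ℝ := fun ω => n * |meanDisc a ℓ (clamp Λ ω.1) - g| with hY
  have hYi : Integrable Y (annealed N) := by
    refine integrable_of_abs_le (((hfm.comp measurable_fst).sub_const g).norm.const_mul _)
      (n * (2 ^ N + 2 ^ N)) fun ω => ?_
    simp only [hY, abs_mul, Nat.abs_cast, abs_abs]
    gcongr
    exact (abs_sub _ _).trans (add_le_add (hmb _) hgb)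
  have hSm : MeasurableSet {E : Cube N → ℝ | clamp Λ E ≠ E} :=
    (measurableSet_eq_fun (measurable_clamp Λ) measurable_id).compl
  set Z : Sample N → ℝ := fun ω =>
    2 ^ N * Set.indicator {E : Cube N → ℝ | clamp Λ E ≠ E} (fun _ => (1 : ℝ)) ω.1 with hZ
  have hZm : Measurable fun ω : Sample N =>
      Set.indicator {E : Cube N → ℝ | clamp Λ E ≠ E} (fun _ => (1 : ℝ)) ω.1 :=
    (measurable_const.indicator hSm).comp measurable_fst
  have hZi : Integrable Z (annealed N) := by
    refine (integrable_of_abs_le hZm 1 fun ω => ?_).const_mul _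
    rw [abs_of_nonneg (Set.indicator_nonneg (fun _ _ => zero_le_one) _)]
    exact Set.indicator_le_self' (fun _ _ => zero_le_one) _
  have hle : ∫ ω, |(numDiscovered a ω t : ℝ) - n * g| ∂(annealed N) ≤
      ∫ ω, (X ω + Y ω + Z ω) ∂(annealed N) := by
    have hDi : Integrable (fun ω => |((disc a t ω).card : ℝ) - n * g|) (annealed N) :=
      ((integrable_of_abs_le hcm (2 ^ N) fun ω => by
        rw [abs_of_nonneg (Nat.cast_nonneg _)]; exact hpow ω).sub (integrable_const _)).abs
    have hae : (fun ω => |(numDiscovered a ω t : ℝ) - n * g|) =ᵐ[annealed N]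
        fun ω => |((disc a t ω).card : ℝ) - n * g| := by
      filter_upwards [ae_good_annealed a] with ω hω
      rw [hω.numDiscovered_eq]
    rw [integral_congr_ae hae]
    refine integral_mono hDi ((hXi.add hYi).add hZi) fun ω => ?_
    have t1 : |((disc a t (clamp Λ ω.1, ω.2)).card : ℝ) - n * g| ≤ X ω + Y ω := by
      have := abs_add_le (((disc a t (clamp Λ ω.1, ω.2)).card : ℝ) - n * meanDisc a ℓ (clamp Λ ω.1))
        (n * (meanDisc a ℓ (clamp Λ ω.1) - g))
      rw [abs_mul, Nat.abs_cast] at this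
      refine le_trans (le_of_eq ?_) this
      congr 1
      ring
    show |((disc a t ω).card : ℝ) - n * g| ≤ X ω + Y ω + Z ω
    by_cases h : clamp Λ ω.1 = ω.1
    · have : Z ω = 0 := by
        simp only [hZ]
        rw [Set.indicator_of_notMem (by simpa using h), mul_zero]
      rw [this, add_zero]
      rw [h] at t1
      exact t1
    · have : Z ω = 2 ^ N := by
        simp only [hZ]
        rw [Set.indicator_of_mem (by exact h), mul_one]
      rw [this]
      have t2 : |((disc a t ω).card : ℝ) - (disc a t (clamp Λ ω.1, ω.2)).card| ≤ 2 ^ N := by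
        have c1 : (0 : ℝ) ≤ (disc a t ω).card := Nat.cast_nonneg _
        have c2 : (0 : ℝ) ≤ (disc a t (clamp Λ ω.1, ω.2)).card := Nat.cast_nonneg _
        refine abs_le.2 ⟨?_, ?_⟩ <;> linarith [hpow ω, hpow (clamp Λ ω.1, ω.2)]
      have t3 := abs_sub_le ((disc a t ω).card : ℝ) (disc a t (clamp Λ ω.1, ω.2)).card (n * g)
      linarith
  refine hle.trans ?_
  have hXY : Integrable (fun ω => X ω + Y ω) (annealed N) := hXi.add hYi
  rw [integral_add hXY hZi, integral_add hXi hYi]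
  have eX : ∫ ω, X ω ∂(annealed N) ≤
      √(n * (discMax N R ℓ ^ 2 + 1) + n ^ 2 * (mixError N L * discBound N R ℓ ^ 2)) +
      ((n + 1) * discBound N R L + discBound N R ℓ + overlapError N R ℓ L n) := by
    rw [annealed_eq_prod, integral_prod X (by rw [← annealed_eq_prod]; exact hXi)]
    refine (le_abs_self _).trans (abs_integral_le_of_abs_le _ fun E => ?_)
    rw [abs_of_nonneg (integral_nonneg fun _ => abs_nonneg _)]
    exact integral_abs_card_disc_sub_le hN (one_le_conductance_clamp ha Λ E)
      (conductance_clamp_le ha hΛ E) ℓ L n ht ht'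
  have eY : ∫ ω, Y ω ∂(annealed N) ≤ n * √(2 ^ N * influence N R ℓ ^ 2) := by
    simp only [hY]
    rw [integral_const_mul, annealed_eq_prod,
      integral_fun_fst (μ := energyLaw N) (ν := quenched N)
        (fun E => |meanDisc a ℓ (clamp Λ E) - g|)]
    gcongr
    simpa using integral_abs_meanDisc_sub_le hN ha hΛ ℓ
  have eZ : ∫ ω, Z ω ∂(annealed N) ≤ 2 ^ N * (2 ^ N * posGaussian.real (Set.Ioi Λ)) := by
    simp only [hZ]
    rw [integral_const_mul, annealed_eq_prod,
      integral_fun_fst (μ := energyLaw N) (ν := quenched N)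
        (fun E => Set.indicator {E : Cube N → ℝ | clamp Λ E ≠ E} (fun _ => (1 : ℝ)) E)]
    gcongr
    have := integral_indicator_one (μ := energyLaw N) hSm
    rw [probReal_univ, one_smul]
    exact (le_of_eq this).trans (energyLaw_clamp_ne_le N Λ)
  unfold lawError
  linarith

theorem truncMean_le (hN : N ≠ 0) {a Λ : ℝ} (ha : 0 ≤ a) (hΛ : 0 ≤ Λ) (s : ℝ≥0) :
    truncMean N a Λ s ≤ discBound N (Real.exp (2 * a * Λ)) s :=
  (le_abs_self _).trans (abs_integral_le_of_abs_le _ fun E => by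
    rw [abs_of_nonneg (meanDisc_nonneg _ _ _)]
    exact meanDisc_le hN (conductance_clamp_le ha hΛ E) s)

/-- Blocks of length `0` separated by pauses `L`: each one discovers at least the site where the
walk is, so `k` of them give `k` sites up to their overlaps. -/
theorem le_truncMean (hN : N ≠ 0) {a Λ : ℝ} (ha : 0 ≤ a) (hΛ : 0 ≤ Λ) (L : ℝ≥0) (k : ℕ) {s : ℝ≥0}
    (hs : k * L ≤ s) :
    k - overlapError N (Real.exp (2 * a * Λ)) 0 L k ≤ truncMean N a Λ s := by
  have hf : Measurable fun E : Cube N → ℝ => meanDisc a s (clamp Λ E) :=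
    (measurable_meanDisc a s).comp (measurable_clamp Λ)
  have hi : Integrable (fun E : Cube N → ℝ => meanDisc a s (clamp Λ E)) (energyLaw N) :=
    integrable_of_abs_le hf (2 ^ N) fun E => meanDisc_le_pow a s _
  have hle : ∀ E : Cube N → ℝ, k - overlapError N (Real.exp (2 * a * Λ)) 0 L k ≤
      meanDisc a s (clamp Λ E) := by
    intro E
    have h1 := mul_meanDisc_sub_le hN (one_le_conductance_clamp ha Λ E)
      (conductance_clamp_le ha hΛ E) 0 L k (t := s) (by simpa using hs)
    have h2 : 1 ≤ meanDisc a 0 (clamp Λ E) := by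
      have h3 : ∫ _p : Cube N × (ℕ × Fin N → ℝ), (1 : ℝ) ∂(quenched N) ≤
          meanDisc a 0 (clamp Λ E) := by
        refine integral_mono (integrable_const 1) (integrable_comp_finset
          (measurable_disc_pair a 0 _) fun S => (S.card : ℝ)) fun p => ?_
        exact Nat.one_le_cast.2 (one_le_card_disc a 0 (clamp Λ E, p))
      simpa using h3
    have h3 : (k : ℝ) ≤ k * meanDisc a 0 (clamp Λ E) := le_mul_of_one_le_right (Nat.cast_nonneg _) h2
    push_cast at h1
    linarith
  calc _ = ∫ _E : Cube N → ℝ, (k - overlapError N (Real.exp (2 * a * Λ)) 0 L k) ∂(energyLaw N) := by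
        simp
    _ ≤ _ := integral_mono (integrable_const _) hi hle

end

/-! ### Exponential growth rates and the law of large numbers for discovered sites -/

section

/-! ### Exponential orders -/

/-- `f N` is at most `exp (κ N + o(N))` in absolute value. -/
def ExpLe (f : ℕ → ℝ) (κ : ℝ) : Prop :=
  ∀ η > 0, ∀ᶠ N : ℕ in atTop, |f N| ≤ Real.exp ((κ + η) * N)

namespace ExpLe

variable {f g : ℕ → ℝ} {κ κ' : ℝ}

theorem mono (h : ExpLe f κ) (hκ : κ ≤ κ') : ExpLe f κ' := fun η hη => by
  filter_upwards [h η hη] with N hN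
  refine hN.trans (Real.exp_le_exp.2 ?_)
  gcongr

theorem of_le (h : ExpLe g κ) (hfg : ∀ᶠ N in atTop, |f N| ≤ |g N|) : ExpLe f κ := fun η hη => by
  filter_upwards [h η hη, hfg] with N h1 h2 using h2.trans h1

theorem mul (h : ExpLe f κ) (h' : ExpLe g κ') : ExpLe (fun N => f N * g N) (κ + κ') := fun η hη => by
  filter_upwards [h (η / 2) (by positivity), h' (η / 2) (by positivity)] with N h1 h2
  rw [abs_mul]
  refine (mul_le_mul h1 h2 (abs_nonneg _) (Real.exp_pos _).le).trans (le_of_eq ?_)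
  rw [← Real.exp_add]
  congr 1
  ring

theorem add (h : ExpLe f κ) (h' : ExpLe g κ) : ExpLe (fun N => f N + g N) κ := fun η hη => by
  have hlog : ∀ᶠ N : ℕ in atTop, Real.log 2 ≤ η / 2 * N :=
    ((tendsto_natCast_atTop_atTop (R := ℝ)).const_mul_atTop (by positivity : 0 < η / 2)).eventually_ge_atTop _
  filter_upwards [h (η / 2) (by positivity), h' (η / 2) (by positivity), hlog] with N h1 h2 h3
  refine (abs_add_le _ _).trans ((add_le_add h1 h2).trans ?_)
  have h4 : (2 : ℝ) ≤ Real.exp (η / 2 * N) := by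
    rw [← Real.log_le_iff_le_exp (by norm_num)]; exact h3
  calc _ = 2 * Real.exp ((κ + η / 2) * N) := by ring
    _ ≤ Real.exp (η / 2 * N) * Real.exp ((κ + η / 2) * N) := by gcongr
    _ = _ := by rw [← Real.exp_add]; congr 1; ring

theorem sqrt (h : ExpLe f κ) : ExpLe (fun N => √(f N)) (κ / 2) := fun η hη => by
  filter_upwards [h (2 * η) (by positivity)] with N h1
  rw [abs_of_nonneg (Real.sqrt_nonneg _)]
  refine (Real.sqrt_le_sqrt ((le_abs_self _).trans h1)).trans (le_of_eq ?_)
  rw [Real.sqrt_eq_iff_mul_self_eq (Real.exp_pos _).le (Real.exp_pos _).le, ← Real.exp_add]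
  congr 1
  ring

theorem sq (h : ExpLe f κ) : ExpLe (fun N => f N ^ 2) (2 * κ) := by
  have := h.mul h
  simp only [← pow_two, ← two_mul] at this
  exact this

theorem exp (κ : ℝ) : ExpLe (fun N => Real.exp (κ * N)) κ := fun η hη => by
  refine Eventually.of_forall fun N => ?_
  rw [abs_of_pos (Real.exp_pos _)]
  refine Real.exp_le_exp.2 ?_
  gcongr
  linarith

theorem two_pow : ExpLe (fun N => 2 ^ N) (Real.log 2) :=
  (exp (Real.log 2)).of_le (Eventually.of_forall fun N => by
    rw [mul_comm, Real.exp_nat_mul, Real.exp_log (by norm_num)])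

theorem inv_two_pow : ExpLe (fun N => (2 ^ N)⁻¹) (-Real.log 2) :=
  (exp (-Real.log 2)).of_le (Eventually.of_forall fun N => by
    rw [mul_comm, Real.exp_nat_mul, Real.exp_neg, Real.exp_log (by norm_num), inv_pow])

theorem natCast : ExpLe (fun N => (N : ℝ)) 0 := fun η hη => by
  have h := (isLittleO_pow_exp_pos_mul_atTop 1 hη).bound (zero_lt_one)
  filter_upwards [(tendsto_natCast_atTop_atTop (R := ℝ)).eventually h] with N hN
  simpa using hN

theorem const (c : ℝ) : ExpLe (fun _ => c) 0 := by
  refine natCast.of_le ?_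
  filter_upwards [(tendsto_natCast_atTop_atTop (R := ℝ)).eventually_ge_atTop |c|] with N hN
  exact hN.trans (le_abs_self _)

theorem tendsto_zero (h : ExpLe f κ) (hκ : κ < 0) : Tendsto f atTop (𝓝 0) := by
  have h1 : Tendsto (fun N : ℕ => Real.exp ((κ + -κ / 2) * N)) atTop (𝓝 0) := by
    refine Real.tendsto_exp_atBot.comp ?_
    exact (tendsto_natCast_atTop_atTop (R := ℝ)).const_mul_atTop_of_neg (by linarith)
  refine squeeze_zero_norm' ?_ h1
  exact h _ (by linarith)

end ExpLe

/-- A sequence `f` such that `log (f N)` is equivalent to `κ N`. -/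
def ExpEq (f : ℕ → ℝ) (κ : ℝ) : Prop := ExpLe f κ ∧ ExpLe (fun N => (f N)⁻¹) (-κ)

theorem ExpEq.tendsto_log {f : ℕ → ℝ} {κ : ℝ} (h : ExpEq f κ) (hf : ∀ᶠ N in atTop, 0 < f N) :
    Tendsto (fun N : ℕ => Real.log (f N) / N) atTop (𝓝 κ) := by
  rw [Metric.tendsto_nhds]
  intro η hη
  filter_upwards [h.1 (η / 2) (by positivity), h.2 (η / 2) (by positivity), hf,
    eventually_gt_atTop 0] with N h1 h2 h3 h4
  have hN : (0 : ℝ) < N := by exact_mod_cast h4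
  rw [abs_of_pos h3, ← Real.log_le_iff_le_exp h3] at h1
  rw [abs_of_pos (inv_pos.2 h3), ← Real.log_le_iff_le_exp (inv_pos.2 h3), Real.log_inv] at h2
  rw [Real.dist_eq, abs_lt, lt_sub_iff_add_lt, sub_lt_iff_lt_add, lt_div_iff₀ hN, div_lt_iff₀ hN]
  constructor <;> nlinarith

/-! ### Concentration of the number of discovered sites -/

theorem posGaussian_real_Ioi_le {Λ : ℝ} (hΛ : 0 ≤ Λ) :
    posGaussian.real (Set.Ioi Λ) ≤ Real.exp (-Λ ^ 2 / 2) := by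
  have h1 : posGaussian (Set.Ioi Λ) ≤ gaussianReal 0 1 {z | Λ ≤ id z} := by
    rw [posGaussian, Measure.map_apply (by fun_prop) measurableSet_Ioi]
    refine measure_mono fun z hz => ?_
    have hz : Λ < max z 0 := hz
    rcases lt_max_iff.1 hz with h | h
    · exact h.le
    · exact absurd h (not_lt.2 hΛ)
  refine (ENNReal.toReal_mono (measure_ne_top _ _) h1).trans ?_
  have hint : Integrable (fun z : ℝ => Real.exp (Λ * id z)) (gaussianReal 0 1) :=
    integrable_exp_mul_gaussianReal Λ
  refine (measure_ge_le_exp_mul_mgf Λ hΛ hint).trans (le_of_eq ?_)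
  rw [mgf_id_gaussianReal, ← Real.exp_add]
  congr 1
  push_cast
  ring

section Concentration

variable {cbar abar : ℝ} {a : ℕ → ℝ} {t : ℕ → ℝ≥0}

/-- A bound for the rates in the truncated environment. -/
def maxRate (a : ℕ → ℝ) (N : ℕ) : ℝ := Real.exp (2 * a N * (3 * √N))

/-- The exponent `6 a_N √N` is at most of order `√(N log N)`, which is `o(N)`. -/
theorem expLe_maxRate (ha : ∀ᶠ N : ℕ in atTop, 1 ≤ a N ∧ a N ≤ abar * √(2 * Real.log (N : ℝ))) :
    ExpLe (maxRate a) 0 := by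
  intro η hη
  -- Chosen so that `log N ≤ δ N` gives `√(2 log N) ≤ η / (6 (|abar| + 1)) * √N`; the `6` is that of
  -- the exponent `6 a_N √N`.
  set δ : ℝ := (η / (6 * (|abar| + 1))) ^ 2 / 2 with hδ
  have hδ0 : 0 < δ := by positivity
  have hlog := (Real.isLittleO_log_id_atTop.bound hδ0)
  filter_upwards [ha, (tendsto_natCast_atTop_atTop (R := ℝ)).eventually hlog,
    eventually_ge_atTop 1] with N h1 h2 h3
  have hN : (1 : ℝ) ≤ N := by exact_mod_cast h3
  have hl0 : 0 ≤ Real.log N := Real.log_nonneg hN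
  rw [Real.norm_eq_abs, abs_of_nonneg hl0, Real.norm_eq_abs, id, abs_of_pos (by linarith)] at h2
  rw [maxRate, abs_of_pos (Real.exp_pos _), zero_add]
  refine Real.exp_le_exp.2 ?_
  have h4 : √(2 * Real.log N) ≤ (η / (6 * (|abar| + 1))) * √N := by
    refine Real.sqrt_le_iff.2 ⟨by positivity, ?_⟩
    rw [mul_pow, Real.sq_sqrt (by linarith)]
    calc 2 * Real.log N ≤ 2 * (δ * N) := by linarith
      _ = _ := by rw [hδ]; ring
  have h5 : a N ≤ (|abar| + 1) * ((η / (6 * (|abar| + 1))) * √N) := by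
    refine h1.2.trans ?_
    refine (mul_le_mul_of_nonneg_right ((le_abs_self abar).trans (by linarith : |abar| ≤ |abar| + 1))
      (Real.sqrt_nonneg _)).trans ?_
    gcongr
  have h6 : (|abar| + 1) * ((η / (6 * (|abar| + 1))) * √N) = η / 6 * √N := by
    have : |abar| + 1 ≠ 0 := by positivity
    field_simp
  rw [h6] at h5
  calc 2 * a N * (3 * √N) = 6 * √N * a N := by ring
    _ ≤ 6 * √N * (η / 6 * √N) := by gcongr
    _ = η * (√N * √N) := by ring
    _ = η * N := by rw [Real.mul_self_sqrt (by linarith)]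

theorem eventually_time_pos (hc0 : 0 < cbar)
    (ht : (fun N : ℕ => Real.log (t N : ℝ)) ~[atTop] (fun N : ℕ => cbar * (N : ℝ))) :
    (∀ᶠ N in atTop, (0 : ℝ) < t N) ∧ ExpEq (fun N => (t N : ℝ)) cbar := by
  have h : ∀ η > 0, ∀ᶠ N : ℕ in atTop, |Real.log (t N) - cbar * N| ≤ η * N := by
    intro η hη
    have h1 := ht.isLittleO.bound (show 0 < η / cbar by positivity)
    filter_upwards [h1] with N hN
    simp only [Pi.sub_apply, Real.norm_eq_abs] at hN
    refine hN.trans (le_of_eq ?_)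
    rw [abs_of_nonneg (by positivity)]
    field_simp
  have hpos : ∀ᶠ N in atTop, (0 : ℝ) < t N := by
    filter_upwards [h (cbar / 2) (by positivity), eventually_gt_atTop 0] with N h1 h2
    have hN : (0 : ℝ) < N := by exact_mod_cast h2
    -- A vanishing time would have logarithm `0` by convention, which is not close to `cbar N`.
    refine lt_of_le_of_ne (t N).2 fun h3 => ?_
    have h3 : (t N : ℝ) = 0 := h3.symm
    rw [h3, Real.log_zero, zero_sub, abs_neg, abs_of_pos (by positivity)] at h1
    nlinarith
  refine ⟨hpos, fun η hη => ?_, fun η hη => ?_⟩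
  · filter_upwards [h η hη, hpos] with N h1 h2
    rw [abs_of_pos h2, ← Real.log_le_iff_le_exp h2]
    linarith [(abs_le.1 h1).2]
  · filter_upwards [h η hη, hpos] with N h1 h2
    rw [abs_of_pos (inv_pos.2 h2), ← Real.log_le_iff_le_exp (inv_pos.2 h2), Real.log_inv]
    linarith [(abs_le.1 h1).1]

/-- The length of the blocks. -/
def blockLength (cbar : ℝ) (N : ℕ) : ℝ≥0 := ⟨Real.exp (cbar / 2 * N), (Real.exp_pos _).le⟩

/-- The number of complete blocks before time `s * t N`. -/
def numBlocks (cbar : ℝ) (t : ℕ → ℝ≥0) (s : ℝ≥0) (N : ℕ) : ℕ :=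
  ⌊s * t N / (blockLength cbar N + N)⌋₊

theorem coe_blockLength (cbar : ℝ) (N : ℕ) :
    (blockLength cbar N : ℝ) = Real.exp (cbar / 2 * N) := rfl

theorem blockLength_add_pos (cbar : ℝ) (N : ℕ) : (0 : ℝ≥0) < blockLength cbar N + N :=
  add_pos_of_pos_of_nonneg (by rw [← NNReal.coe_pos]; exact Real.exp_pos _) (zero_le)

theorem numBlocks_spec (cbar : ℝ) (t : ℕ → ℝ≥0) (s : ℝ≥0) (N : ℕ) :
    numBlocks cbar t s N * (blockLength cbar N + N) ≤ s * t N ∧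
      s * t N ≤ (numBlocks cbar t s N + 1 : ℕ) * (blockLength cbar N + N) := by
  have hp := blockLength_add_pos cbar N
  constructor
  · rw [← le_div_iff₀ hp]
    exact Nat.floor_le (zero_le)
  · rw [← div_le_iff₀ hp]
    push_cast
    exact (Nat.lt_floor_add_one _).le

theorem expLe_blockLength (cbar : ℝ) : ExpLe (fun N => (blockLength cbar N : ℝ)) (cbar / 2) :=
  ExpLe.exp _

theorem numBlocks_le (cbar : ℝ) (t : ℕ → ℝ≥0) (s : ℝ≥0) (N : ℕ) :
    (numBlocks cbar t s N : ℝ) ≤ s * t N * Real.exp (-(cbar / 2) * N) := by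
  have h := (numBlocks_spec cbar t s N).1
  have h : (numBlocks cbar t s N : ℝ) * (blockLength cbar N + N) ≤ s * t N := by exact_mod_cast h
  rw [coe_blockLength] at h
  have h2 : (numBlocks cbar t s N : ℝ) * Real.exp (cbar / 2 * N) ≤ s * t N :=
    le_trans (by gcongr; simp) h
  rw [neg_mul, Real.exp_neg, ← div_eq_mul_inv, le_div_iff₀ (Real.exp_pos _)]
  exact h2

theorem expLe_numBlocks (hc0 : 0 < cbar)
    (ht : (fun N : ℕ => Real.log (t N : ℝ)) ~[atTop] (fun N : ℕ => cbar * (N : ℝ))) (s : ℝ≥0) :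
    ExpLe (fun N => (numBlocks cbar t s N : ℝ)) (cbar / 2) := by
  have h := ((ExpLe.const (s : ℝ)).mul (eventually_time_pos hc0 ht).2.1).mul (ExpLe.exp (-(cbar / 2)))
  refine (h.mono (by linarith)).of_le (Eventually.of_forall fun N => ?_)
  rw [abs_of_nonneg (Nat.cast_nonneg _)]
  exact (numBlocks_le cbar t s N).trans (le_abs_self _)

theorem tendsto_numBlocks_div (hc0 : 0 < cbar)
    (ht : (fun N : ℕ => Real.log (t N : ℝ)) ~[atTop] (fun N : ℕ => cbar * (N : ℝ))) (s : ℝ≥0) :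
    Tendsto (fun N => (numBlocks cbar t s N : ℝ) / (t N / (blockLength cbar N + N))) atTop (𝓝 s) := by
  obtain ⟨hpos, hexp⟩ := eventually_time_pos hc0 ht
  have h0 : Tendsto (fun N => ((blockLength cbar N : ℝ) + N) * (t N : ℝ)⁻¹) atTop (𝓝 0) := by
    have h1 := ((expLe_blockLength cbar).add (ExpLe.natCast.mono (by linarith))).mul hexp.2
    exact h1.tendsto_zero (by linarith)
  have h1 : Tendsto (fun N => (s : ℝ) - ((blockLength cbar N : ℝ) + N) * (t N : ℝ)⁻¹) atTop (𝓝 s) := by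
    simpa using h0.const_sub (s : ℝ)
  refine tendsto_of_tendsto_of_tendsto_of_le_of_le' h1 tendsto_const_nhds ?_ ?_
  · filter_upwards [hpos] with N hN
    have h2 := (numBlocks_spec cbar t s N).2
    have h2 : (s : ℝ) * t N ≤ (numBlocks cbar t s N + 1) * (blockLength cbar N + N) := by
      exact_mod_cast h2
    have h3 : (0 : ℝ) < blockLength cbar N + N := by exact_mod_cast blockLength_add_pos cbar N
    rw [le_div_iff₀ (by positivity)]
    field_simp
    linarith
  · filter_upwards [hpos] with N hN
    have h2 := (numBlocks_spec cbar t s N).1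
    have h2 : (numBlocks cbar t s N : ℝ) * (blockLength cbar N + N) ≤ s * t N := by exact_mod_cast h2
    have h3 : (0 : ℝ) < blockLength cbar N + N := by exact_mod_cast blockLength_add_pos cbar N
    rw [div_le_iff₀ (by positivity), mul_div_assoc', le_div_iff₀ h3]
    exact h2

theorem expLe_discBound {R s : ℕ → ℝ} {κ : ℝ} (hR : ExpLe R 0) (hs : ExpLe s κ) (hκ : 0 ≤ κ) :
    ExpLe (fun N => discBound N (R N) (s N)) κ := by
  have h1 := (hs.mul (ExpLe.natCast.mul hR)).mono (show κ + (0 + 0) ≤ κ by linarith)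
  have h2 := (h1.add ((ExpLe.const 1).mono hκ)).mul
    ((ExpLe.const 3).mul (ExpLe.natCast.add (ExpLe.const 1)))
  exact h2.mono (by linarith)

theorem expLe_discMax {R s : ℕ → ℝ} {κ : ℝ} (hR : ExpLe R 0) (hs : ExpLe s κ) (hκ : 0 ≤ κ)
    (hR0 : ∀ N, 0 ≤ R N) (hs0 : ∀ N, 0 ≤ s N) :
    ExpLe (fun N => discMax N (R N) (s N)) κ := by
  have h1 := (((ExpLe.const 4).mul ExpLe.natCast).mul (hR.mul hs)).mono
    (show 0 + 0 + (0 + κ) ≤ κ by linarith)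
  have h2 := ((((ExpLe.const 2).mul ExpLe.natCast).mono (by linarith)).add h1).add
    ((ExpLe.const 1).mono hκ)
  have h3 := h2.mul (ExpLe.natCast.add (ExpLe.const 1))
  refine (h3.mono (by linarith)).of_le (Eventually.of_forall fun N => ?_)
  unfold discMax
  rw [abs_mul, abs_mul]
  gcongr
  have := hR0 N
  have := hs0 N
  exact (Nat.ceil_lt_add_one (by positivity)).le

theorem expLe_mixError : ExpLe (fun N => mixError N N) (Real.log 2 - 1) := by
  have h := ExpLe.two_pow.mul (ExpLe.exp (-1))
  simp only [neg_one_mul] at h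
  exact h

theorem expLe_overlapError {R ℓ : ℕ → ℝ} {n : ℕ → ℕ} {κ ν : ℝ} (hR : ExpLe R 0) (hℓ : ExpLe ℓ κ)
    (hκ : 0 ≤ κ) (hn : ExpLe (fun N => (n N : ℝ)) ν) :
    ExpLe (fun N => overlapError N (R N) (ℓ N) N (n N)) (2 * ν + 2 * κ - Real.log 2) := by
  have h1 : ExpLe (fun N => 1 + mixError N N) 0 := (ExpLe.const 1).add
    (expLe_mixError.mono (by linarith [Real.log_two_lt_d9]))
  have h2 := hn.sq.mul ((h1.mul (expLe_discBound hR hℓ hκ).sq).mul ExpLe.inv_two_pow)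
  exact h2.mono (by linarith)

theorem maxRate_pos (a : ℕ → ℝ) (N : ℕ) : 0 < maxRate a N := Real.exp_pos _

/-- Up to subexponential factors the number of blocks and the content of a block are both `exp (cbar
N / 2)`, so every term of `lawError` has an explicit rate, and each is strictly below `cbar`. -/
theorem expLe_lawError (hc0 : 0 < cbar) (hc1 : cbar < Real.log 2)
    (ha : ∀ᶠ N : ℕ in atTop, 1 ≤ a N ∧ a N ≤ abar * √(2 * Real.log (N : ℝ)))
    (ht : (fun N : ℕ => Real.log (t N : ℝ)) ~[atTop] (fun N : ℕ => cbar * (N : ℝ))) (s : ℝ≥0) :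
    ∃ γ > 0, ExpLe (fun N => lawError N (maxRate a N) (3 * √N) (blockLength cbar N) N
      (numBlocks cbar t s N)) (cbar - γ) := by
  have hl2 := Real.log_two_lt_d9
  -- The three constraints come from the diagonal variance of the blocks, from the mixing error
  -- after a pause `N`, and from the influence of the environment, which is more demanding than the
  -- overlaps.
  set γ := min (cbar / 4) (min ((1 - Real.log 2) / 2) ((Real.log 2 - cbar) / 2)) with hγ
  have hγ0 : 0 < γ := lt_min (by linarith) (lt_min (by linarith) (by linarith))
  have hγ1 : γ ≤ cbar / 4 := min_le_left _ _
  have hγ2 : γ ≤ (1 - Real.log 2) / 2 := (min_le_right _ _).trans (min_le_left _ _)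
  have hγ3 : γ ≤ (Real.log 2 - cbar) / 2 := (min_le_right _ _).trans (min_le_right _ _)
  refine ⟨γ, hγ0, ?_⟩
  have hR := expLe_maxRate ha
  have hℓ := expLe_blockLength cbar
  have hn := expLe_numBlocks hc0 ht s
  have hF := expLe_discBound hR hℓ (by linarith)
  have hU := expLe_discMax hR hℓ (by linarith) (fun N => (maxRate_pos a N).le) fun N => NNReal.coe_nonneg _
  have hFL := expLe_discBound hR ExpLe.natCast le_rfl
  have hO := expLe_overlapError hR hℓ (by linarith) hn
  have e1 := ((hn.mul (hU.sq.add ((ExpLe.const 1).mono (by linarith)))).mono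
    (show cbar / 2 + 2 * (cbar / 2) ≤ 2 * cbar - 2 * γ by linarith)).add
    ((hn.sq.mul (expLe_mixError.mul hF.sq)).mono
      (show 2 * (cbar / 2) + (Real.log 2 - 1 + 2 * (cbar / 2)) ≤ 2 * cbar - 2 * γ by linarith))
  have e2 := ((hn.add ((ExpLe.const 1).mono (by linarith))).mul hFL).mono
    (show cbar / 2 + 0 ≤ cbar - γ by linarith)
  have e3 := (e2.add (hF.mono (by linarith))).add (hO.mono (by linarith))
  have hI : ExpLe (fun N => influence N (maxRate a N) (blockLength cbar N)) (cbar - Real.log 2) :=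
    (((hU.mul hF).add ((ExpLe.const 1).mono (by linarith))).mul ExpLe.inv_two_pow).mono (by linarith)
  have e4 := (hn.mul (ExpLe.two_pow.mul hI.sq).sqrt).mono
    (show cbar / 2 + (Real.log 2 + 2 * (cbar - Real.log 2)) / 2 ≤ cbar - γ by linarith)
  -- The truncation level `3 √N` gives a tail `exp (-9 N / 2)`, which beats the factor `4 ^ N` from
  -- the union bound and the trivial bound on the number of sites.
  have htail : ExpLe (fun N => posGaussian.real (Set.Ioi (3 * √N))) (-(9 / 2)) := by
    refine (ExpLe.exp (-(9 / 2))).of_le (Eventually.of_forall fun N => ?_)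
    rw [abs_of_nonneg measureReal_nonneg, abs_of_pos (Real.exp_pos _)]
    refine (posGaussian_real_Ioi_le (by positivity)).trans (Real.exp_le_exp.2 (le_of_eq ?_))
    rw [mul_pow, Real.sq_sqrt (Nat.cast_nonneg _)]
    ring
  have e5 := (ExpLe.two_pow.mul (ExpLe.two_pow.mul htail)).mono
    (show Real.log 2 + (Real.log 2 + -(9 / 2)) ≤ cbar - γ by linarith)
  exact (((e1.sqrt.mono (by linarith)).add e3).add e4).add e5

/-- The mean number of sites discovered in a block. -/
def blockMean (cbar : ℝ) (a : ℕ → ℝ) (N : ℕ) : ℝ := truncMean N (a N) (3 * √N) (blockLength cbar N)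

/-- The upper bound is `discBound`. For the lower bound the walk is observed every `N` units of
time: the observed positions are almost independent and uniform, and too few to repeat often, so the
mean is at least the length of the block up to a factor `2 N`. -/
theorem expEq_blockMean (hc0 : 0 < cbar) (hc1 : cbar < Real.log 2)
    (ha : ∀ᶠ N : ℕ in atTop, 1 ≤ a N ∧ a N ≤ abar * √(2 * Real.log (N : ℝ))) :
    ExpEq (blockMean cbar a) (cbar / 2) ∧ ∀ᶠ N in atTop, 0 < blockMean cbar a N := by
  have hR := expLe_maxRate ha
  have hℓ := expLe_blockLength cbar
  -- The number of observations, spaced by `N`, that fit in one block. Their overlap error has rate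
  -- `cbar - log 2`, hence vanishes.
  set k : ℕ → ℕ := fun N => ⌊(blockLength cbar N : ℝ) * (N : ℝ)⁻¹⌋₊ with hk
  have hkle : ∀ N, (k N : ℝ) ≤ blockLength cbar N * (N : ℝ)⁻¹ := fun N => Nat.floor_le (by positivity)
  have hkE : ExpLe (fun N => (k N : ℝ)) (cbar / 2) := by
    refine hℓ.of_le (Eventually.of_forall fun N => ?_)
    rw [abs_of_nonneg (Nat.cast_nonneg _), abs_of_nonneg (NNReal.coe_nonneg _)]
    refine (hkle N).trans (mul_le_of_le_one_right (NNReal.coe_nonneg _) ?_)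
    rcases Nat.eq_zero_or_pos N with rfl | h
    · simp
    · exact inv_le_one_of_one_le₀ (by exact_mod_cast h)
  have hO : Tendsto (fun N => overlapError N (maxRate a N) 0 N (k N)) atTop (𝓝 0) :=
    (expLe_overlapError hR ((ExpLe.const 0)) le_rfl hkE).tendsto_zero (by linarith)
  have hbig : ∀ᶠ N : ℕ in atTop, 4 ≤ (blockLength cbar N : ℝ) * (N : ℝ)⁻¹ := by
    have h1 : Tendsto (fun N : ℕ => 4 * (N : ℝ) * Real.exp (-(cbar / 2) * N)) atTop (𝓝 0) :=
      (((ExpLe.const 4).mul ExpLe.natCast).mul (ExpLe.exp (-(cbar / 2)))).tendsto_zero (by linarith)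
    filter_upwards [h1.eventually (gt_mem_nhds zero_lt_one), eventually_gt_atTop 0] with N h2 h3
    have hN : (0 : ℝ) < N := by exact_mod_cast h3
    rw [neg_mul, Real.exp_neg, ← div_eq_mul_inv, div_lt_one (Real.exp_pos _)] at h2
    rw [coe_blockLength, ← div_eq_mul_inv, le_div_iff₀ hN]
    exact h2.le
  have hlow : ∀ᶠ N : ℕ in atTop, (blockLength cbar N : ℝ) * (N : ℝ)⁻¹ / 2 ≤ blockMean cbar a N := by
    filter_upwards [hbig, hO.eventually (gt_mem_nhds zero_lt_one), ha, eventually_gt_atTop 0] with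
      N h1 h2 h3 h4
    have hN : (0 : ℝ) < N := by exact_mod_cast h4
    have hks : (k N : ℝ≥0) * (N : ℝ≥0) ≤ blockLength cbar N := by
      rw [← NNReal.coe_le_coe]
      push_cast
      rw [← le_div_iff₀ hN, div_eq_mul_inv]
      exact hkle N
    have h5 := le_truncMean h4.ne' (by linarith [h3.1] : 0 ≤ a N) (by positivity : 0 ≤ 3 * √(N : ℝ))
      (N : ℝ≥0) (k N) hks
    have h6 : (blockLength cbar N : ℝ) * (N : ℝ)⁻¹ < k N + 1 := Nat.lt_floor_add_one _
    have h7 : overlapError N (Real.exp (2 * a N * (3 * √N))) 0 ((N : ℝ≥0) : ℝ) (k N) < 1 := by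
      simpa [maxRate] using h2
    unfold blockMean
    linarith
  refine ⟨⟨?_, ?_⟩, ?_⟩
  · refine (expLe_discBound hR hℓ (by linarith)).of_le ?_
    filter_upwards [ha, eventually_gt_atTop 0, hlow, hbig] with N h1 h2 h3 h4
    refine le_trans ?_ (le_abs_self _)
    rw [abs_of_nonneg (by linarith)]
    exact truncMean_le h2.ne' (by linarith [h1.1]) (by positivity) _
  · have h1 := ((ExpLe.const 2).mul ExpLe.natCast).mul (ExpLe.exp (-(cbar / 2)))
    refine (h1.mono (by linarith)).of_le ?_
    filter_upwards [hlow, hbig, eventually_gt_atTop 0] with N h3 h4 h5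
    have hN : (0 : ℝ) < N := by exact_mod_cast h5
    have hb : 0 < blockMean cbar a N := by linarith
    refine le_trans ?_ (le_abs_self _)
    rw [abs_of_pos (inv_pos.2 hb), neg_mul, Real.exp_neg, ← coe_blockLength]
    have hl : (0 : ℝ) < blockLength cbar N := Real.exp_pos _
    rw [← div_eq_mul_inv, inv_le_comm₀ hb (by positivity), inv_div]
    refine le_trans (le_of_eq ?_) h3
    field_simp
  · filter_upwards [hlow, hbig] with N h3 h4
    linarith

/-- Concentration of the number of discovered sites around its mean, and order of this mean. -/
theorem tendsto_integral_abs_numDiscovered (hc0 : 0 < cbar) (hc1 : cbar < Real.log 2)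
    (ha : ∀ᶠ N : ℕ in atTop, 1 ≤ a N ∧ a N ≤ abar * √(2 * Real.log (N : ℝ)))
    (ht : (fun N : ℕ => Real.log (t N : ℝ)) ~[atTop] (fun N : ℕ => cbar * (N : ℝ))) :
    (∀ᶠ N in atTop, 0 < dScale N (a N) (t N)) ∧
    Tendsto (fun N : ℕ => Real.log (dScale N (a N) (t N)) / N) atTop (𝓝 cbar) ∧
    ∀ s : ℝ≥0, Tendsto (fun N => ∫ ω, |(numDiscovered (a N) ω (s * t N) : ℝ) /
      dScale N (a N) (t N) - s| ∂(annealed N)) atTop (𝓝 0) := by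
  obtain ⟨htpos, htexp⟩ := eventually_time_pos hc0 ht
  obtain ⟨hg, hgpos⟩ := expEq_blockMean hc0 hc1 ha
  -- the reference scale
  set q : ℕ → ℝ := fun N => t N / (blockLength cbar N + N) with hq
  have hpl : ∀ N, (0 : ℝ) < blockLength cbar N + N := fun N => by
    exact_mod_cast blockLength_add_pos cbar N
  have hqpos : ∀ᶠ N in atTop, 0 < q N := by
    filter_upwards [htpos] with N hN using div_pos hN (hpl N)
  have hqinv : ExpLe (fun N => (q N)⁻¹) (-(cbar / 2)) := by
    have h := ((expLe_blockLength cbar).add (ExpLe.natCast.mono (by linarith))).mul htexp.2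
    refine (h.mono (by linarith)).of_le (Eventually.of_forall fun N => le_of_eq ?_)
    rw [hq]
    congr 1
    rw [inv_div, div_eq_mul_inv]
  have hqle : ExpLe q (cbar / 2) := by
    have h := htexp.1.mul (ExpLe.exp (-(cbar / 2)))
    refine (h.mono (by linarith)).of_le (Eventually.of_forall fun N => ?_)
    rw [abs_of_nonneg (div_nonneg (NNReal.coe_nonneg _) (hpl N).le)]
    refine le_trans ?_ (le_abs_self _)
    rw [neg_mul, Real.exp_neg, ← div_eq_mul_inv, ← coe_blockLength]
    exact div_le_div_of_nonneg_left (NNReal.coe_nonneg _) (Real.exp_pos _) (by simp)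
  set D0 : ℕ → ℝ := fun N => q N * blockMean cbar a N with hD0
  have hD0pos : ∀ᶠ N in atTop, 0 < D0 N := by
    filter_upwards [hqpos, hgpos] with N h1 h2 using mul_pos h1 h2
  have hD0inv : ExpLe (fun N => (D0 N)⁻¹) (-cbar) := by
    have := (hqinv.mul hg.2).mono (show -(cbar / 2) + -(cbar / 2) ≤ -cbar by linarith)
    simpa only [hD0, mul_inv] using this
  have hD0le : ExpLe D0 cbar := (hqle.mul hg.1).mono (by linarith)
  have herr : ∀ s : ℝ≥0, Tendsto (fun N => lawError N (maxRate a N) (3 * √N) (blockLength cbar N) N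
      (numBlocks cbar t s N) * (D0 N)⁻¹) atTop (𝓝 0) := by
    intro s
    obtain ⟨γ, hγ, h⟩ := expLe_lawError hc0 hc1 ha ht s
    exact (h.mul hD0inv).tendsto_zero (by linarith)
  have hDi : ∀ N s, Integrable (fun ω => (numDiscovered (a N) ω s : ℝ)) (annealed N) := by
    intro N s
    refine (integrable_of_abs_le (f := fun ω => ((disc (a N) s ω).card : ℝ))
      ((measurable_from_top (f := fun S : Finset (Cube N) => (S.card : ℝ))).comp
      (measurable_disc (a N) s)) (2 ^ N) fun ω => ?_).congr ?_
    · rw [abs_of_nonneg (Nat.cast_nonneg _)]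
      exact_mod_cast card_disc_le_pow (a N) s ω
    · filter_upwards [ae_good_annealed (a N)] with ω hω
      rw [hω.numDiscovered_eq]
  -- concentration with respect to the reference scale
  have hconc : ∀ s : ℝ≥0, Tendsto (fun N => ∫ ω, |(numDiscovered (a N) ω (s * t N) : ℝ) /
      D0 N - s| ∂(annealed N)) atTop (𝓝 0) := by
    intro s
    have h1 := (herr s).add (((tendsto_numBlocks_div hc0 ht s).sub_const (s : ℝ)).abs)
    rw [sub_self, abs_zero, add_zero] at h1
    refine squeeze_zero' (Eventually.of_forall fun N => integral_nonneg fun _ => abs_nonneg _) ?_ h1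
    filter_upwards [hqpos, hgpos, ha, eventually_gt_atTop 0] with N hqN hgN haN hN
    have hD : 0 < D0 N := mul_pos hqN hgN
    obtain ⟨hb1, hb2⟩ := numBlocks_spec cbar t s N
    have h2 := integral_abs_numDiscovered_sub_le hN.ne' (by linarith [haN.1] : 0 ≤ a N)
      (by positivity : 0 ≤ 3 * √(N : ℝ)) (blockLength cbar N) N (numBlocks cbar t s N) hb1 hb2
    have hi1 : Integrable (fun ω => |(numDiscovered (a N) ω (s * t N) : ℝ) -
        numBlocks cbar t s N * blockMean cbar a N| * (D0 N)⁻¹) (annealed N) :=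
      ((hDi N _).sub (integrable_const _)).abs.mul_const _
    calc ∫ ω, |(numDiscovered (a N) ω (s * t N) : ℝ) / D0 N - s| ∂(annealed N)
        ≤ ∫ ω, (|(numDiscovered (a N) ω (s * t N) : ℝ) -
            numBlocks cbar t s N * blockMean cbar a N| * (D0 N)⁻¹ +
            |(numBlocks cbar t s N : ℝ) / q N - s|) ∂(annealed N) := by
          refine integral_mono (((hDi N _).div_const _).sub (integrable_const _)).abs
            (hi1.add (integrable_const _)) fun ω => ?_
          have e : (numBlocks cbar t s N : ℝ) / q N =
              numBlocks cbar t s N * blockMean cbar a N * (D0 N)⁻¹ := by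
            simp only [hD0, mul_inv]
            field_simp
          rw [e]
          refine le_trans (le_of_eq ?_) ((abs_add_le (((numDiscovered (a N) ω (s * t N) : ℝ) -
            numBlocks cbar t s N * blockMean cbar a N) * (D0 N)⁻¹)
            (numBlocks cbar t s N * blockMean cbar a N * (D0 N)⁻¹ - s)).trans
              (le_of_eq ?_))
          · congr 1
            rw [div_eq_mul_inv]
            ring
          · rw [abs_mul, abs_of_pos (inv_pos.2 hD)]
      _ = (∫ ω, |(numDiscovered (a N) ω (s * t N) : ℝ) -
            numBlocks cbar t s N * blockMean cbar a N| ∂(annealed N)) * (D0 N)⁻¹ +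
            |(numBlocks cbar t s N : ℝ) / q N - s| := by
          rw [integral_add hi1 (integrable_const _), integral_mul_const]
          simp
      _ ≤ _ := by
          gcongr
          simpa [maxRate, blockMean] using h2
  -- Convergence in mean for `s = 1` contains convergence of the mean, so the reference scale `D0`
  -- may be exchanged for `dScale`.
  have hratio : Tendsto (fun N => dScale N (a N) (t N) / D0 N) atTop (𝓝 1) := by
    rw [tendsto_iff_norm_sub_tendsto_zero]
    refine squeeze_zero (fun _ => norm_nonneg _) (fun N => ?_) (hconc 1)
    have : dScale N (a N) (t N) / D0 N - 1 =
        ∫ ω, ((numDiscovered (a N) ω (1 * t N) : ℝ) / D0 N - (1 : ℝ≥0)) ∂(annealed N) := by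
      rw [integral_sub ((hDi N _).div_const _) (integrable_const _), integral_div]
      simp [dScale]
    rw [this, Real.norm_eq_abs]
    exact abs_integral_le_integral_abs
  have hdpos : ∀ᶠ N in atTop, 0 < dScale N (a N) (t N) := by
    filter_upwards [hratio.eventually (lt_mem_nhds (show (0 : ℝ) < 1 by norm_num)), hD0pos] with N h1 h2
    exact (div_pos_iff_of_pos_right h2).1 h1
  refine ⟨hdpos, ?_, fun s => ?_⟩
  · have h1 : Tendsto (fun N : ℕ => Real.log (D0 N) / N) atTop (𝓝 cbar) :=
      ExpEq.tendsto_log ⟨hD0le, hD0inv⟩ hD0pos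
    have h2 : Tendsto (fun N : ℕ => Real.log (dScale N (a N) (t N) / D0 N) / N) atTop (𝓝 0) := by
      have h3 := (Real.continuousAt_log (one_ne_zero)).tendsto.comp hratio
      rw [Real.log_one] at h3
      exact h3.div_atTop tendsto_natCast_atTop_atTop
    have h3 := h1.add h2
    rw [add_zero] at h3
    refine h3.congr' ?_
    filter_upwards [hdpos, hD0pos] with N h4 h5
    rw [Real.log_div h4.ne' h5.ne']
    ring
  · have hinv : Tendsto (fun N => D0 N / dScale N (a N) (t N)) atTop (𝓝 1) := by
      have := hratio.inv₀ one_ne_zero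
      simpa using this
    have h1 := ((hconc s).mul hinv).add (((hinv.const_mul (s : ℝ)).sub_const (s : ℝ)).abs)
    simp only [mul_one, sub_self, abs_zero, add_zero] at h1
    refine squeeze_zero' (Eventually.of_forall fun N => integral_nonneg fun _ => abs_nonneg _) ?_ h1
    filter_upwards [hD0pos, hdpos] with N hD hd
    have hi1 : Integrable (fun ω => |(numDiscovered (a N) ω (s * t N) : ℝ) / D0 N - s| *
        (D0 N / dScale N (a N) (t N))) (annealed N) :=
      (((hDi N _).div_const _).sub (integrable_const _)).abs.mul_const _
    calc ∫ ω, |(numDiscovered (a N) ω (s * t N) : ℝ) / dScale N (a N) (t N) - s| ∂(annealed N)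
        ≤ ∫ ω, (|(numDiscovered (a N) ω (s * t N) : ℝ) / D0 N - s| * (D0 N / dScale N (a N) (t N)) +
            |s * (D0 N / dScale N (a N) (t N)) - s|) ∂(annealed N) := by
          refine integral_mono (((hDi N _).div_const _).sub (integrable_const _)).abs
            (hi1.add (integrable_const _)) fun ω => ?_
          refine le_trans (le_of_eq ?_) ((abs_add_le (((numDiscovered (a N) ω (s * t N) : ℝ) / D0 N - s) *
            (D0 N / dScale N (a N) (t N))) (s * (D0 N / dScale N (a N) (t N)) - s)).trans
              (le_of_eq ?_))
          · congr 1
            field_simp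
            ring
          · rw [abs_mul, abs_of_pos (div_pos hD hd)]
      _ = _ := by
          rw [integral_add hi1 (integrable_const _), integral_mul_const]
          simp

end Concentration

end

/-! ### Energies read along the exploration form an i.i.d. sequence -/

section

/-! ### Sampling an i.i.d. family along an adapted enumeration -/

theorem eq_infinitePi_nat {Y : Type*} [MeasurableSpace Y] (ν : Measure Y) [IsProbabilityMeasure ν]
    {μ : Measure (ℕ → Y)}
    (h : ∀ (n : ℕ) (A : ℕ → Set Y), (∀ i, MeasurableSet (A i)) →
      μ {z | ∀ i < n, z i ∈ A i} = ∏ i ∈ Finset.range n, ν (A i)) :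
    μ = Measure.infinitePi fun _ : ℕ => ν := by
  classical
  refine Measure.eq_infinitePi _ fun s t ht => ?_
  have hs : ∀ i ∈ s, i < s.sup id + 1 := fun i hi => Nat.lt_succ_of_le (Finset.le_sup (f := id) hi)
  have e1 : Set.pi s t = {z | ∀ i < s.sup id + 1, z i ∈ if i ∈ s then t i else Set.univ} := by
    ext z
    constructor
    · intro hz i _
      by_cases hi : i ∈ s
      · simpa [hi] using hz i hi
      · simp [hi]
    · intro hz i hi
      have hi : i ∈ s := hi
      simpa [hi] using hz i (hs i hi)
  rw [e1, h _ (fun i => if i ∈ s then t i else Set.univ) fun i => by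
    by_cases hi : i ∈ s <;> simp [hi, ht i]]
  symm
  refine Finset.prod_subset_one_on_sdiff (fun i hi => Finset.mem_range.2 (hs i hi)) ?_ ?_
  · intro i hi
    simp [(Finset.mem_sdiff.1 hi).2]
  · intro i hi
    simp [hi]

section Adaptive

variable {J X : Type*} [MeasurableSpace X]

/-- Resampling coordinate `j` from an independent copy preserves the law and leaves the event `G`
unchanged, so the coordinate is independent of `G`. -/
theorem infinitePi_inter_eval (ν : Measure X) [IsProbabilityMeasure ν] [DecidableEq J] (j : J)
    {G : Set (J → X)} (hG : MeasurableSet G)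
    (hinv : ∀ w y, Function.update w j y ∈ G ↔ w ∈ G) {A : Set X} (hA : MeasurableSet A) :
    (Measure.infinitePi fun _ : J => ν) (G ∩ {w | w j ∈ A}) =
      (Measure.infinitePi fun _ : J => ν) G * ν A := by
  set σ : J → J ⊕ J := fun i => if i = j then Sum.inr j else Sum.inl i with hσ
  have hinj : Function.Injective σ := by
    intro i k h
    simp only [hσ] at h
    split_ifs at h with h1 h2 h2
    · rw [h1, h2]
    · exact Sum.inl_injective h
  have hp := measurePreserving_sumElim ν σ hinj
  have hAm : MeasurableSet {w : J → X | w j ∈ A} := measurable_pi_apply j hA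
  have hev : (Measure.infinitePi fun _ : J => ν) {w | w j ∈ A} = ν A :=
    (measurePreserving_eval_infinitePi (fun _ : J => ν) j).measure_preimage hA.nullMeasurableSet
  have hu : ∀ p : (J → X) × (J → X), (fun i => Sum.elim p.1 p.2 (σ i)) =
      Function.update p.1 j (p.2 j) := by
    intro p
    funext i
    by_cases h : i = j
    · subst h; simp [hσ]
    · simp [hσ, h]
  rw [← hp.measure_preimage (hG.inter hAm).nullMeasurableSet]
  have hset : (fun p : (J → X) × (J → X) => fun i => Sum.elim p.1 p.2 (σ i)) ⁻¹'
      (G ∩ {w | w j ∈ A}) = G ×ˢ {w | w j ∈ A} := by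
    ext p
    simp only [Set.mem_preimage, hu, Set.mem_inter_iff, hinv, Set.mem_prod, Set.mem_ofPred_eq,
      Function.update_self]
  rw [hset, Measure.prod_prod, hev]

/-- An i.i.d. family read along an adapted sequence of distinct indices is an i.i.d. sequence. -/
theorem measurePreserving_adapted [Countable J] (ν : Measure X) [IsProbabilityMeasure ν]
    (c : (J → X) → ℕ → J) (hcm : ∀ n j, MeasurableSet {w | c w n = j})
    (hinj : ∀ w, Function.Injective (c w))
    (had : ∀ n w w', (∀ i < n, w (c w i) = w' (c w i)) → c w' n = c w n) :
    MeasurePreserving (fun w n => w (c w n)) (Measure.infinitePi fun _ : J => ν)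
      (Measure.infinitePi fun _ : ℕ => ν) := by
  classical
  set μ := Measure.infinitePi fun _ : J => ν with hμ
  have hval : ∀ n (A : Set X), MeasurableSet A → MeasurableSet {w : J → X | w (c w n) ∈ A} := by
    intro n A hA
    have : {w : J → X | w (c w n) ∈ A} = ⋃ j, {w | c w n = j} ∩ {w | w j ∈ A} := by
      ext w
      simp
    rw [this]
    exact MeasurableSet.iUnion fun j => (hcm n j).inter (measurable_pi_apply j hA)
  have hm : Measurable fun (w : J → X) n => w (c w n) :=
    measurable_pi_lambda _ fun n => fun A hA => hval n A hA
  refine ⟨hm, eq_infinitePi_nat ν fun n A hA => ?_⟩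
  have hset : ∀ n, MeasurableSet {z : ℕ → X | ∀ i < n, z i ∈ A i} := by
    intro n
    have : {z : ℕ → X | ∀ i < n, z i ∈ A i} = ⋂ i, ⋂ (_ : i < n), {z | z i ∈ A i} := by ext; simp
    rw [this]
    exact MeasurableSet.iInter fun i => MeasurableSet.iInter fun _ => measurable_pi_apply i (hA i)
  rw [Measure.map_apply hm (hset n)]
  have hpre : ∀ n, MeasurableSet {w : J → X | ∀ i < n, w (c w i) ∈ A i} := fun n => hm (hset n)
  change μ {w | ∀ i < n, w (c w i) ∈ A i} = _
  induction n with
  | zero => simp [hμ]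
  | succ n ih =>
    rw [Finset.prod_range_succ, ← ih]
    set F : Set (J → X) := {w | ∀ i < n, w (c w i) ∈ A i} with hF
    have hGm : ∀ j, MeasurableSet (F ∩ {w | c w n = j}) := fun j => (hpre n).inter (hcm n j)
    have hdisj : Pairwise (Function.onFun Disjoint fun j => F ∩ {w | c w n = j}) := by
      intro i j hij
      refine Set.disjoint_left.2 fun w h1 h2 => hij ?_
      exact (show c w n = i from h1.2).symm.trans h2.2
    have e1 : {w : J → X | ∀ i < n + 1, w (c w i) ∈ A i} =
        ⋃ j, (F ∩ {w | c w n = j}) ∩ {w | w j ∈ A n} := by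
      ext w
      simp only [Set.mem_iUnion, Set.mem_inter_iff, Set.mem_ofPred_eq, hF]
      constructor
      · intro h
        exact ⟨c w n, ⟨fun i hi => h i (by omega), rfl⟩, h n (by omega)⟩
      · rintro ⟨j, ⟨h1, h2⟩, h3⟩ i hi
        rcases Nat.lt_succ_iff_lt_or_eq.1 hi with h | h
        · exact h1 i h
        · rw [h, h2]
          exact h3
    have e2 : F = ⋃ j, F ∩ {w | c w n = j} := by
      ext w
      simp
    -- If `j` is the index to be read at step `n`, injectivity says that it has not been read
    -- before, so changing its value alters neither the indices up to `n` nor the values read so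
    -- far.
    have hone : ∀ j w y, w ∈ F ∩ {w | c w n = j} → Function.update w j y ∈ F ∩ {w | c w n = j} := by
      rintro j w y ⟨h1, h2⟩
      have h2 : c w n = j := h2
      have hne : ∀ i < n, c w i ≠ j := fun i hi h => by
        have := hinj w (h.trans h2.symm)
        omega
      have hagree : ∀ k ≤ n, c (Function.update w j y) k = c w k := by
        intro k hk
        refine had k w _ fun i hi => ?_
        rw [Function.update_of_ne (hne i (by omega))]
      refine ⟨fun i hi => ?_, (hagree n le_rfl).trans h2⟩
      rw [hagree i hi.le, Function.update_of_ne (hne i hi)]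
      exact h1 i hi
    have hinv : ∀ j w y, Function.update w j y ∈ F ∩ {w | c w n = j} ↔
        w ∈ F ∩ {w | c w n = j} := by
      intro j w y
      refine ⟨fun h => ?_, hone j w y⟩
      have := hone j _ (w j) h
      simpa using this
    have hev : ∀ j, MeasurableSet {w : J → X | w j ∈ A n} := fun j => measurable_pi_apply j (hA n)
    rw [e1, measure_iUnion (fun i j hij => (hdisj hij).mono Set.inter_subset_left
      Set.inter_subset_left) fun j => (hGm j).inter (hev j)]
    simp only [hμ, infinitePi_inter_eval ν _ (hGm _) (hinv _) (hA n)]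
    rw [ENNReal.tsum_mul_right, ← hμ, ← measure_iUnion hdisj hGm, ← e2]

end Adaptive

/-! ### The removal of repetitions -/

section Distinct

variable {α : Type*}

/-- The value of `s` at `m` appears there for the first time. -/
def IsNew (s : ℕ → α) (m : ℕ) : Prop := ∀ l < m, s l ≠ s m

open Classical in
/-- The number of distinct values of `s` before `n`. -/
def newCount (s : ℕ → α) (n : ℕ) : ℕ := Nat.count (IsNew s) n

theorem newCount_succ (s : ℕ → α) (n : ℕ) [Decidable (IsNew s n)] :
    newCount s (n + 1) = newCount s n + if IsNew s n then 1 else 0 := by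
  unfold newCount
  rw [Nat.count_succ]
  congr

theorem distinct_eq {s : ℕ → α} {n j : ℕ} (h : IsNew s n) (hj : newCount s n = j) :
    distinct s j = s n := by
  classical
  subst hj
  exact congrArg s (Nat.nth_count (p := IsNew s) h)

theorem exists_distinct_eq {s : ℕ → α} {n l : ℕ} (hl : l < n) : ∃ i < newCount s n, distinct s i = s l := by
  classical
  have hex : ∃ m, s m = s l := ⟨l, rfl⟩
  have hm := Nat.find_spec hex
  have hnew : IsNew s (Nat.find hex) := fun k hk h => Nat.find_min hex hk (h.trans hm)
  exact ⟨newCount s (Nat.find hex), Nat.count_strict_mono hnew ((Nat.find_min' hex rfl).trans_lt hl),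
    (distinct_eq hnew rfl).trans hm⟩

theorem newCount_le_of_forall_ne {s : ℕ → α} {j : ℕ} (h : ∀ n, IsNew s n → newCount s n ≠ j) (n : ℕ) :
    newCount s n ≤ j := by
  classical
  induction n with
  | zero => simp [newCount]
  | succ n ih =>
    rw [newCount_succ]
    split_ifs with hn
    · have := h n hn
      omega
    · omega

/-- The two sequences agree for as long as only the first `j` distinct values have been met, and the
next new value appears at the end of this stretch. If there is no such value, the condition holds at
every index and the sequences coincide. -/
theorem distinct_congr {s s' : ℕ → α} {j : ℕ}
    (h : ∀ n, (∀ l < n, ∃ i < j, distinct s i = s l) → s' n = s n) :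
    distinct s' j = distinct s j := by
  classical
  by_cases hex : ∃ n, IsNew s n ∧ newCount s n = j
  · obtain ⟨n, hn, hj⟩ := hex
    have hs : ∀ m ≤ n, s' m = s m := fun m hm => h m fun l hl => by
      rw [← hj]
      exact exists_distinct_eq (by omega)
    have hnew : ∀ m ≤ n, IsNew s' m ↔ IsNew s m := fun m hm =>
      forall₂_congr fun l hl => by rw [hs m hm, hs l (by omega)]
    have hcount : newCount s' n = newCount s n := by
      simp only [newCount, Nat.count_eq_card_filter_range]
      congr 1
      exact Finset.filter_congr fun m hm => hnew m (Finset.mem_range.1 hm).le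
    rw [distinct_eq hn hj, distinct_eq ((hnew n le_rfl).2 hn) (hcount.trans hj), hs n le_rfl]
  -- Here `s` has at most `j` distinct values and `distinct s j` is a default value; equality of the
  -- whole sequences settles this case.
  · push Not at hex
    have : s' = s := funext fun n => h n fun l hl => by
      obtain ⟨i, hi, e⟩ := exists_distinct_eq (s := s) hl
      exact ⟨i, hi.trans_le (newCount_le_of_forall_ne hex n), e⟩
    rw [this]

theorem distinct_ne {s : ℕ → α} {n i j : ℕ} (h : IsNew s n) (hj : newCount s n = j) (hij : i < j) :
    distinct s i ≠ distinct s j := by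
  classical
  rw [distinct_eq h hj]
  subst hj
  exact h _ (Nat.nth_lt_of_lt_count (p := IsNew s) hij)

/-- If `s` takes more than `j` values, its `j`-th distinct value exists. -/
theorem exists_isNew_of_card {s : ℕ → α} {j : ℕ} {S : Finset α} (hS : ∀ x ∈ S, ∃ n, s n = x)
    (hj : j < S.card) : ∃ n, IsNew s n ∧ newCount s n = j := by
  classical
  by_contra hex
  push Not at hex
  have hsub : S ⊆ (Finset.range j).image (distinct s) := by
    intro x hx
    obtain ⟨n, rfl⟩ := hS x hx
    obtain ⟨i, hi, e⟩ := exists_distinct_eq (s := s) (Nat.lt_succ_self n)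
    exact Finset.mem_image.2 ⟨i, Finset.mem_range.2
      (hi.trans_le (newCount_le_of_forall_ne hex _)), e⟩
  have := (Finset.card_le_card hsub).trans Finset.card_image_le
  rw [Finset.card_range] at this
  omega

theorem measurableSet_isNew [MeasurableSpace α] [DiscreteMeasurableSpace α] [Countable α] (n : ℕ) :
    MeasurableSet {s : ℕ → α | IsNew s n} := by
  have : {s : ℕ → α | IsNew s n} = ⋂ l, ⋂ (_ : l < n), {s | s l = s n}ᶜ := by
    ext s
    simp [IsNew]
  rw [this]
  refine MeasurableSet.iInter fun l => MeasurableSet.iInter fun _ => MeasurableSet.compl ?_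
  exact measurableSet_eq_fun (measurable_pi_apply l) (measurable_pi_apply n)

theorem measurable_newCount [MeasurableSpace α] [DiscreteMeasurableSpace α] [Countable α] (n : ℕ) :
    Measurable fun s : ℕ → α => newCount s n := by
  classical
  induction n with
  | zero => simp [newCount]
  | succ n ih =>
    simp only [newCount_succ]
    exact ih.add (Measurable.ite (measurableSet_isNew n) measurable_const measurable_const)

theorem measurable_distinct [MeasurableSpace α] [DiscreteMeasurableSpace α] [Countable α] (j : ℕ) :
    Measurable fun s : ℕ → α => distinct s j := by
  classical
  have hP : ∀ n, MeasurableSet {s : ℕ → α | IsNew s n ∧ newCount s n = j} := fun n =>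
    (measurableSet_isNew n).inter (measurable_newCount n (measurableSet_singleton j))
  have hnth : Measurable fun s : ℕ → α => Nat.nth (IsNew s) j := by
    refine measurable_to_countable' fun n => ?_
    -- The second set accounts for the default value `0` of `Nat.nth` when fewer than `j + 1` new
    -- values exist.
    have e : (fun s : ℕ → α => Nat.nth (IsNew s) j) ⁻¹' {n} =
        {s | IsNew s n ∧ newCount s n = j} ∪
          ({_s | n = 0} ∩ ⋂ m, {s | IsNew s m ∧ newCount s m = j}ᶜ) := by
      ext s
      simp only [Set.mem_preimage, Set.mem_singleton_iff, Set.mem_union, Set.mem_ofPred_eq,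
        Set.mem_inter_iff, Set.mem_iInter, Set.mem_compl_iff]
      constructor
      · rintro rfl
        by_cases hex : ∃ m, IsNew s m ∧ newCount s m = j
        · obtain ⟨m, hm, hj⟩ := hex
          have : Nat.nth (IsNew s) j = m := by rw [← hj]; exact Nat.nth_count hm
          rw [this]
          exact Or.inl ⟨hm, hj⟩
        · push Not at hex
          refine Or.inr ⟨?_, fun m hm => hex m hm.1 hm.2⟩
          have hno : ¬ ∀ hf : (Set.ofPred (IsNew s)).Finite, j < hf.toFinset.card := fun hlt =>
            hex _ (Nat.nth_mem _ hlt) (Nat.count_nth hlt)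
          push Not at hno
          obtain ⟨hf, hle⟩ := hno
          exact Nat.nth_of_card_le hf hle
      · rintro (⟨hm, hj⟩ | ⟨rfl, hno⟩)
        · rw [← hj]; exact Nat.nth_count hm
        · have hno' : ¬ ∀ hf : (Set.ofPred (IsNew s)).Finite, j < hf.toFinset.card := fun hlt =>
            hno _ ⟨Nat.nth_mem _ hlt, Nat.count_nth hlt⟩
          push Not at hno'
          obtain ⟨hf, hle⟩ := hno'
          exact Nat.nth_of_card_le hf hle
    rw [e]
    exact (hP n).union ((MeasurableSet.const _).inter (MeasurableSet.iInter fun m => (hP m).compl))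
  exact measurable_comp_countable (F := fun (n : ℕ) (s : ℕ → α) => s n)
    (fun n => measurable_pi_apply n) hnth

end Distinct

/-! ### The energies along the exploration -/

variable {N : ℕ}

/-- The exploration process, indexed from `0`. -/
def sites (a : ℝ) (o : BallOrder N) (ω : Sample N) (k : ℕ) : Cube N :=
  distinct (ballSequence a o ω) k

theorem measurable_visited (a : ℝ) (j : ℕ) : Measurable fun ω : Sample N => visited a ω j :=
  (measurable_distinct j).comp (measurable_pi_lambda _ fun n => measurable_jumpChain a n)

theorem measurable_ballSequence (a : ℝ) (o : BallOrder N) (m : ℕ) :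
    Measurable fun ω : Sample N => ballSequence a o ω m :=
  (Measurable.of_discrete (f := fun y : Cube N => ((o y (Fin.ofNat (N + 1) m)) : Cube N))).comp
    (measurable_visited a _)

theorem measurable_sites (a : ℝ) (o : BallOrder N) (k : ℕ) :
    Measurable fun ω : Sample N => sites a o ω k :=
  (measurable_distinct k).comp (measurable_pi_lambda _ fun m => measurable_ballSequence a o m)

theorem hammingDist_add_single_le (y : Cube N) (i : Fin N) :
    hammingDist (y + Pi.single i 1) y ≤ 1 := by
  refine (Finset.card_le_card (t := {i}) fun j hj => ?_).trans (Finset.card_singleton i).le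
  rw [Finset.mem_singleton]
  by_contra hji
  rw [Finset.mem_filter] at hj
  exact hj.2 (by simp [hji])

/-- Every jump out of an already visited site is decided by energies in its unit ball, so the next
new position only depends on the balls around the previous ones. -/
theorem visited_congr {a : ℝ} {E E' : Cube N → ℝ} {p : Cube N × (ℕ × Fin N → ℝ)} {j : ℕ}
    (h : ∀ i < j, ∀ x, hammingDist x (visited a (E, p) i) ≤ 1 → E x = E' x) :
    visited a (E', p) j = visited a (E, p) j := by
  refine distinct_congr fun n hn => ?_
  refine ((path_congr a (ω := (E, p)) (ω' := (E', p)) rfl n fun m hm i => ?_).1).symm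
  obtain ⟨k, hk, e⟩ := hn m hm
  have e : visited a (E, p) k = jumpChain a (E, p) m := e
  have h1 := h k hk
  rw [e] at h1
  simp only [ring, rate, energy]
  rw [h1 _ (by simp), h1 _ (hammingDist_add_single_le _ i)]

theorem ballSequence_mem (a : ℝ) (o : BallOrder N) (ω : Sample N) (i : ℕ) {x : Cube N}
    (hx : hammingDist x (visited a ω i) ≤ 1) :
    ∃ r < N + 1, ballSequence a o ω (i * (N + 1) + r) = x := by
  set q := (o (visited a ω i)).symm ⟨x, hx⟩ with hq
  refine ⟨q, q.2, ?_⟩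
  have e1 : (i * (N + 1) + (q : ℕ)) / (N + 1) = i := by
    rw [mul_comm, Nat.mul_add_div (by omega), Nat.div_eq_of_lt q.2, add_zero]
  have e2 : Fin.ofNat (N + 1) (i * (N + 1) + q) = q := by
    ext
    simp [Fin.ofNat, Nat.mod_eq_of_lt q.2]
  rw [ballSequence, e1, e2, hq, Equiv.apply_symm_apply]

/-- The exploration is adapted: the next site only depends on the energies seen so far. -/
theorem sites_congr {a : ℝ} (o : BallOrder N) {E E' : Cube N → ℝ} {p : Cube N × (ℕ × Fin N → ℝ)}
    {k : ℕ} (h : ∀ i < k, E (sites a o (E, p) i) = E' (sites a o (E, p) i)) :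
    sites a o (E', p) k = sites a o (E, p) k := by
  refine distinct_congr fun n hn => ?_
  have hv : visited a (E', p) (n / (N + 1)) = visited a (E, p) (n / (N + 1)) := by
    refine visited_congr fun i hi x hx => ?_
    obtain ⟨r, hr, e⟩ := ballSequence_mem a o (E, p) i hx
    -- The ball of an earlier visited site is listed completely before the ball containing index
    -- `n`, so its energies have been read.
    have hlt : i * (N + 1) + r < n := by
      have h1 : (i + 1) * (N + 1) ≤ n / (N + 1) * (N + 1) := Nat.mul_le_mul_right _ hi
      have h2 := Nat.div_mul_le_self n (N + 1)
      nlinarith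
    obtain ⟨l, hl, e2⟩ := hn _ hlt
    have e2 : sites a o (E, p) l = ballSequence a o (E, p) (i * (N + 1) + r) := e2
    rw [← e, ← e2]
    exact h l hl
  unfold ballSequence
  rw [hv]

open Classical in
/-- The energies of the successively explored sites, completed by the sequence `ζ`. -/
def fieldSeq (a : ℝ) (o : BallOrder N) (ω : Sample N) (ζ : ℕ → ℝ) (k : ℕ) : ℝ :=
  if ∃ i < k, sites a o ω i = sites a o ω k then ζ k else ω.1 (sites a o ω k)

theorem measurableSet_repeat (a : ℝ) (o : BallOrder N) (k : ℕ) :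
    MeasurableSet {ω : Sample N | ∃ i < k, sites a o ω i = sites a o ω k} := by
  have : {ω : Sample N | ∃ i < k, sites a o ω i = sites a o ω k} =
      ⋃ i, ⋃ (_ : i < k), {ω | sites a o ω i = sites a o ω k} := by ext; simp
  rw [this]
  exact MeasurableSet.iUnion fun i => MeasurableSet.iUnion fun _ =>
    measurableSet_eq_fun (measurable_sites a o i) (measurable_sites a o k)

theorem measurable_fieldSeq (a : ℝ) (o : BallOrder N) :
    Measurable fun q : Sample N × (ℕ → ℝ) => fieldSeq a o q.1 q.2 := by
  classical
  refine measurable_pi_lambda _ fun k => ?_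
  unfold fieldSeq
  refine Measurable.ite (measurable_fst (measurableSet_repeat a o k)) (by fun_prop) ?_
  exact measurable_comp_countable (F := fun (y : Cube N) (q : Sample N × (ℕ → ℝ)) => q.1.1 y)
    (fun y => by fun_prop) ((measurable_sites a o k).comp measurable_fst)

/-- The starting point and the clocks are frozen. The energies and the auxiliary sequence form one
i.i.d. family indexed by `Cube N ⊕ ℕ`, read along an adapted sequence: a new site uses its own
energy, a repetition uses the fresh variable of its rank, and therefore no index is read twice. -/
theorem map_fieldSeq_quenched (a : ℝ) (o : BallOrder N) (p : Cube N × (ℕ × Fin N → ℝ)) :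
    MeasurePreserving (fun q : (Cube N → ℝ) × (ℕ → ℝ) => fieldSeq a o (q.1, p) q.2)
      ((energyLaw N).prod (Measure.infinitePi fun _ : ℕ => posGaussian))
      (Measure.infinitePi fun _ : ℕ => posGaussian) := by
  classical
  have h1 := measurePreserving_sumElim (ι := Cube N ⊕ ℕ) (κ := Cube N) (κ' := ℕ) posGaussian id
    Function.injective_id
  rw [Measure.infinitePi_eq_pi] at h1
  set c : (Cube N ⊕ ℕ → ℝ) → ℕ → Cube N ⊕ ℕ := fun w k =>
    if ∃ i < k, sites a o (fun x => w (Sum.inl x), p) i = sites a o (fun x => w (Sum.inl x), p) k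
    then Sum.inr k else Sum.inl (sites a o (fun x => w (Sum.inl x), p) k) with hc
  have hem : Measurable fun w : Cube N ⊕ ℕ → ℝ => ((fun x => w (Sum.inl x), p) : Sample N) :=
    (measurable_pi_lambda _ fun x => measurable_pi_apply _).prodMk measurable_const
  have h2 := measurePreserving_adapted posGaussian c ?_ ?_ ?_
  · have h3 := h2.comp h1
    refine (congrArg (fun f => MeasurePreserving f ((energyLaw N).prod
      (Measure.infinitePi fun _ : ℕ => posGaussian)) (Measure.infinitePi fun _ : ℕ => posGaussian))
      ?_).mpr h3
    funext q k
    simp only [Function.comp, hc, fieldSeq, id]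
    have e : (fun x => Sum.elim q.1 q.2 (Sum.inl x)) = q.1 := rfl
    rw [e]
    split_ifs <;> rfl
  · intro n j
    have hr := hem (measurableSet_repeat a o n)
    rcases j with y | m
    · have : {w | c w n = Sum.inl y} = ((fun w : Cube N ⊕ ℕ → ℝ => ((fun x => w (Sum.inl x), p) :
          Sample N)) ⁻¹' {ω | ∃ i < n, sites a o ω i = sites a o ω n})ᶜ ∩
          {w | sites a o (fun x => w (Sum.inl x), p) n = y} := by
        ext w
        simp only [hc, Set.mem_ofPred_eq, Set.mem_inter_iff, Set.mem_compl_iff, Set.mem_preimage]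
        split_ifs with h <;> simp [h]
      rw [this]
      exact hr.compl.inter ((measurable_sites a o n).comp hem (measurableSet_singleton y))
    · have : {w | c w n = Sum.inr m} = ((fun w : Cube N ⊕ ℕ → ℝ => ((fun x => w (Sum.inl x), p) :
          Sample N)) ⁻¹' {ω | ∃ i < n, sites a o ω i = sites a o ω n}) ∩ {_w | n = m} := by
        ext w
        simp only [hc, Set.mem_ofPred_eq, Set.mem_inter_iff, Set.mem_preimage]
        split_ifs with h <;> simp [h]
      rw [this]
      exact hr.inter (MeasurableSet.const _)
  · intro w
    have hlt : ∀ i k, i < k → c w i ≠ c w k := by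
      intro i k hik h
      simp only [hc] at h
      split_ifs at h with h3 h4 h4
      · exact hik.ne (Sum.inr_injective h)
      · exact h4 ⟨i, hik, Sum.inl_injective h⟩
    intro i k h
    by_contra hne
    rcases lt_or_gt_of_ne hne with h3 | h3
    · exact hlt i k h3 h
    · exact hlt k i h3 h.symm
  · intro n w w' h
    have key : ∀ k ≤ n, sites a o (fun x => w' (Sum.inl x), p) k =
        sites a o (fun x => w (Sum.inl x), p) k := by
      intro k hk
      refine sites_congr o fun i hi => ?_
      -- the first index where this site appears
      have hex : ∃ m, sites a o (fun x => w (Sum.inl x), p) m =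
        sites a o (fun x => w (Sum.inl x), p) i := ⟨i, rfl⟩
      have hm := Nat.find_spec hex
      have hmi : Nat.find hex ≤ i := Nat.find_min' hex rfl
      have hcm : c w (Nat.find hex) = Sum.inl (sites a o (fun x => w (Sum.inl x), p) i) := by
        simp only [hc]
        rw [if_neg, hm]
        rintro ⟨l, hl, e⟩
        exact Nat.find_min hex hl (e.trans hm)
      have := h (Nat.find hex) (by omega)
      rw [hcm] at this
      exact this
    have hiff : (∃ i < n, sites a o (fun x => w' (Sum.inl x), p) i =
        sites a o (fun x => w' (Sum.inl x), p) n) ↔ ∃ i < n, sites a o (fun x => w (Sum.inl x), p) i =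
        sites a o (fun x => w (Sum.inl x), p) n :=
      exists_congr fun i => and_congr_right fun hi => by rw [key i hi.le, key n le_rfl]
    have e : c w' n = if ∃ i < n, sites a o (fun x => w' (Sum.inl x), p) i =
      sites a o (fun x => w' (Sum.inl x), p) n then Sum.inr n else
      Sum.inl (sites a o (fun x => w' (Sum.inl x), p) n) := rfl
    rw [e, if_congr hiff rfl (by rw [key n le_rfl])]

/-- The energies along the exploration form an i.i.d. sequence. -/
theorem measurePreserving_fieldSeq (a : ℝ) (o : BallOrder N) :
    MeasurePreserving (fun q : Sample N × (ℕ → ℝ) => fieldSeq a o q.1 q.2)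
      ((annealed N).prod (Measure.infinitePi fun _ : ℕ => posGaussian))
      (Measure.infinitePi fun _ : ℕ => posGaussian) := by
  refine ⟨measurable_fieldSeq a o, ?_⟩
  set ι := Measure.infinitePi fun _ : ℕ => posGaussian with hι
  ext A hA
  have hmf := measurable_fieldSeq (N := N) a o
  rw [Measure.map_apply hmf hA, ← lintegral_indicator_one (hmf hA)]
  set f : Sample N × (ℕ → ℝ) → ℝ≥0∞ :=
    ((fun q : Sample N × (ℕ → ℝ) => fieldSeq a o q.1 q.2) ⁻¹' A).indicator 1 with hf
  have hfm : Measurable f := measurable_one.indicator (hmf hA)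
  rw [lintegral_prod _ hfm.aemeasurable, annealed_eq_prod]
  have hfm2 : Measurable fun ω : Sample N => ∫⁻ ζ, f (ω, ζ) ∂ι := hfm.lintegral_prod_right'
  rw [lintegral_prod_symm _ hfm2.aemeasurable]
  have key : ∀ p, ∫⁻ E, ∫⁻ ζ, f ((E, p), ζ) ∂ι ∂(energyLaw N) = ι A := by
    intro p
    have hmp := map_fieldSeq_quenched a o p
    have hg : Measurable fun q : (Cube N → ℝ) × (ℕ → ℝ) => f ((q.1, p), q.2) :=
      hfm.comp ((measurable_fst.prodMk measurable_const).prodMk measurable_snd)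
    rw [← lintegral_prod (fun q : (Cube N → ℝ) × (ℕ → ℝ) => f ((q.1, p), q.2)) hg.aemeasurable,
      ← hmp.measure_preimage hA.nullMeasurableSet, ← lintegral_indicator_one (hmp.measurable hA)]
    rfl
  simp only [key]
  simp

end

section

/-! ### Successive visits of a set by an i.i.d. sequence -/

section Gaps

variable {X : Type*}

/-- The first index at which the sequence `z` is in `S`. -/
def firstIn (S : Set X) (z : ℕ → X) : ℕ := sInf {i | z i ∈ S}

/-- The rank of the first visit of `S`, and the position of this visit. -/
def gapMark (S : Set X) (z : ℕ → X) : ℕ × X := (firstIn S z + 1, z (firstIn S z))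

/-- The sequence after its first visit of `S`. -/
def afterFirst (S : Set X) (z : ℕ → X) : ℕ → X := fun i => z (firstIn S z + 1 + i)

/-- The rank of the `n`-th visit of `S`. -/
def visitRank (S : Set X) (z : ℕ → X) (n : ℕ) : ℕ :=
  ∑ k ∈ Finset.range n, (gapMark S ((afterFirst S)^[k] z)).1

/-- The set `S` is visited infinitely often, as seen from the successive visits. -/
def Recurrent (S : Set X) (z : ℕ → X) : Prop := ∀ k, ∃ i, (afterFirst S)^[k] z i ∈ S

theorem afterFirst_iterate (S : Set X) (z : ℕ → X) (n i : ℕ) :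
    (afterFirst S)^[n] z i = z (visitRank S z n + i) := by
  induction n generalizing i with
  | zero => simp [visitRank]
  | succ n ih =>
    rw [Function.iterate_succ_apply', visitRank, Finset.sum_range_succ]
    show (afterFirst S)^[n] z _ = _
    rw [ih]
    congr 1
    simp only [visitRank, gapMark]
    ring

theorem visitRank_succ (S : Set X) (z : ℕ → X) (n : ℕ) :
    visitRank S z (n + 1) = visitRank S z n + firstIn S ((afterFirst S)^[n] z) + 1 := by
  simp only [visitRank, Finset.sum_range_succ, gapMark]
  ring

open Classical in
theorem Recurrent.count_eq {S : Set X} {z : ℕ → X} (h : Recurrent S z) (n : ℕ) :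
    Nat.count (fun i => z i ∈ S) (visitRank S z n) = n := by
  induction n with
  | zero => simp [visitRank]
  | succ n ih =>
    rw [visitRank_succ, add_assoc, Nat.count_add, ih, Nat.count_succ]
    have h1 : z (visitRank S z n + firstIn S ((afterFirst S)^[n] z)) ∈ S := by
      rw [← afterFirst_iterate S z n]
      exact Nat.sInf_mem (s := {i | (afterFirst S)^[n] z i ∈ S}) (h n)
    have h0 : Nat.count (fun k => z (visitRank S z n + k) ∈ S)
        (firstIn S ((afterFirst S)^[n] z)) = 0 := by
      rw [Nat.count_eq_card_filter_range, Finset.card_eq_zero, Finset.filter_eq_empty_iff]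
      intro i hi hiS
      rw [← afterFirst_iterate S z n] at hiS
      exact Nat.notMem_of_lt_sInf (s := {i | (afterFirst S)^[n] z i ∈ S}) (Finset.mem_range.1 hi) hiS
    rw [h0, if_pos h1]

theorem Recurrent.mem {S : Set X} {z : ℕ → X} (h : Recurrent S z) (n : ℕ) :
    z (visitRank S z (n + 1) - 1) ∈ S ∧
      z (visitRank S z (n + 1) - 1) = (gapMark S ((afterFirst S)^[n] z)).2 := by
  have e : visitRank S z (n + 1) - 1 = visitRank S z n + firstIn S ((afterFirst S)^[n] z) := by
    rw [visitRank_succ]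
    omega
  rw [e, ← afterFirst_iterate S z n]
  exact ⟨Nat.sInf_mem (s := {i | (afterFirst S)^[n] z i ∈ S}) (h n), rfl⟩

open Classical in
theorem Recurrent.count_pred_eq {S : Set X} {z : ℕ → X} (h : Recurrent S z) (n : ℕ) :
    Nat.count (fun i => z i ∈ S) (visitRank S z (n + 1) - 1) = n := by
  have h1 := h.count_eq (n + 1)
  obtain ⟨r, hr⟩ : ∃ r, visitRank S z (n + 1) = r + 1 := ⟨_, visitRank_succ S z n⟩
  have h2 := (h.mem n).1
  rw [hr, Nat.add_sub_cancel] at h2 ⊢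
  rw [hr, Nat.count_succ, if_pos h2] at h1
  omega

theorem firstIn_eq_iff {S : Set X} {z : ℕ → X} (i : ℕ) :
    (firstIn S z = i ∧ ∃ j, z j ∈ S) ↔ z i ∈ S ∧ ∀ j < i, z j ∉ S := by
  constructor
  · rintro ⟨rfl, h⟩
    exact ⟨Nat.sInf_mem (s := {i | z i ∈ S}) h, fun j hj => Nat.notMem_of_lt_sInf hj⟩
  · rintro ⟨h1, h2⟩
    refine ⟨le_antisymm (Nat.sInf_le (s := {i | z i ∈ S}) h1) ?_, i, h1⟩
    by_contra hlt
    exact h2 _ (not_le.1 hlt) (Nat.sInf_mem (s := {i | z i ∈ S}) ⟨i, h1⟩)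

variable [MeasurableSpace X]

theorem measurableSet_mem_seq {S : Set X} (hS : MeasurableSet S) (i : ℕ) :
    MeasurableSet {z : ℕ → X | z i ∈ S} := measurable_pi_apply i hS

theorem measurableSet_firstAt {S : Set X} (hS : MeasurableSet S) (i : ℕ) :
    MeasurableSet {z : ℕ → X | z i ∈ S ∧ ∀ j < i, z j ∉ S} := by
  have : {z : ℕ → X | z i ∈ S ∧ ∀ j < i, z j ∉ S} =
      {z | z i ∈ S} ∩ ⋂ j, ⋂ (_ : j < i), {z | z j ∈ S}ᶜ := by ext; simp
  rw [this]
  exact (measurableSet_mem_seq hS i).inter (MeasurableSet.iInter fun j => MeasurableSet.iInter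
    fun _ => (measurableSet_mem_seq hS j).compl)

theorem measurable_firstIn {S : Set X} (hS : MeasurableSet S) :
    Measurable (firstIn S : (ℕ → X) → ℕ) := by
  refine measurable_to_countable' fun i => ?_
  have : firstIn S ⁻¹' {i} = {z : ℕ → X | z i ∈ S ∧ ∀ j < i, z j ∉ S} ∪
      ({_z | i = 0} ∩ ⋂ j, {z | z j ∈ S}ᶜ) := by
    ext z
    simp only [Set.mem_preimage, Set.mem_singleton_iff, Set.mem_union, ← firstIn_eq_iff,
      Set.mem_inter_iff, Set.mem_iInter, Set.mem_compl_iff, Set.mem_ofPred_eq]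
    by_cases h : ∃ j, z j ∈ S
    · have : ¬ ∀ j, z j ∉ S := by push Not; exact h
      simp only [h, and_true, this, and_false, or_false]
    · have h' : ∀ j, z j ∉ S := by push Not at h; exact h
      have h0 : firstIn S z = 0 := by
        have : {i | z i ∈ S} = ∅ := by ext j; simpa using h' j
        rw [firstIn, this, Nat.sInf_empty]
      simp only [h, and_false, false_or, h0]
      exact ⟨fun e => ⟨e.symm, h'⟩, fun e => e.1.symm⟩
  rw [this]
  exact (measurableSet_firstAt hS i).union ((MeasurableSet.const _).inter
    (MeasurableSet.iInter fun j => (measurableSet_mem_seq hS j).compl))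

theorem measurable_gapMark {S : Set X} (hS : MeasurableSet S) :
    Measurable (gapMark S : (ℕ → X) → ℕ × X) :=
  ((measurable_firstIn hS).add_const 1).prodMk
    (measurable_comp_countable (F := fun (i : ℕ) (z : ℕ → X) => z i)
      (fun i => measurable_pi_apply i) (measurable_firstIn hS))

theorem measurable_afterFirst {S : Set X} (hS : MeasurableSet S) :
    Measurable (afterFirst S : (ℕ → X) → ℕ → X) :=
  measurable_pi_lambda _ fun i =>
    measurable_comp_countable (F := fun (k : ℕ) (z : ℕ → X) => z (k + 1 + i))
      (fun _ => measurable_pi_apply _) (measurable_firstIn hS)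

variable (ν : Measure X) [IsProbabilityMeasure ν]

/-- The law of an i.i.d. sequence. -/
abbrev iidLaw : Measure (ℕ → X) := Measure.infinitePi fun _ : ℕ => ν

theorem iidLaw_firstAt {S A : Set X} (hS : MeasurableSet S) (hA : MeasurableSet A) (i : ℕ) :
    iidLaw ν {z | (z i ∈ S ∩ A) ∧ ∀ j < i, z j ∉ S} = ν Sᶜ ^ i * ν (S ∩ A) := by
  classical
  have e : {z : ℕ → X | (z i ∈ S ∩ A) ∧ ∀ j < i, z j ∉ S} =
      Set.pi (Finset.range (i + 1)) fun j => if j = i then S ∩ A else Sᶜ := by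
    ext z
    simp only [Set.mem_ofPred_eq, Set.mem_pi, Finset.mem_coe, Finset.mem_range]
    constructor
    · rintro ⟨h1, h2⟩ j hj
      by_cases hji : j = i
      · rw [if_pos hji, hji]; exact h1
      · rw [if_neg hji]; exact h2 j (by omega)
    · intro h
      refine ⟨by simpa using h i (by omega), fun j hj => ?_⟩
      have := h j (by omega)
      rw [if_neg hj.ne] at this
      exact this
  rw [e, iidLaw, Measure.infinitePi_pi _ (fun j _ => by
    by_cases hji : j = i
    · rw [if_pos hji]; exact hS.inter hA
    · rw [if_neg hji]; exact hS.compl), Finset.prod_range_succ, if_pos rfl]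
  congr 1
  rw [Finset.prod_congr rfl fun j hj => by rw [if_neg (Finset.mem_range.1 hj).ne]]
  simp

theorem ae_exists_mem {S : Set X} (hS : MeasurableSet S) (hpos : ν S ≠ 0) :
    ∀ᵐ z ∂(iidLaw ν), ∃ i, z i ∈ S := by
  have h1 : ∀ n : ℕ, iidLaw ν {z | ¬ ∃ i, z i ∈ S} ≤ ν Sᶜ ^ n := by
    intro n
    have h2 : iidLaw ν (Set.pi (Finset.range n) fun _ => Sᶜ) = ν Sᶜ ^ n := by
      rw [iidLaw, Measure.infinitePi_pi _ fun _ _ => hS.compl]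
      simp
    rw [← h2]
    refine measure_mono fun z hz i _ hi => hz ⟨i, hi⟩
  have hlt : ν Sᶜ < 1 := by
    rw [prob_compl_eq_one_sub hS]
    exact ENNReal.sub_lt_self (by simp) (by simp) hpos
  exact le_antisymm (ge_of_tendsto' (ENNReal.tendsto_pow_atTop_nhds_zero_of_lt_one hlt) h1) (zero_le)

/-- The law of the rank and the position of the first visit. -/
def gapMarkLaw (S : Set X) : Measure (ℕ × X) := (iidLaw ν).map (gapMark S)

theorem isProbabilityMeasure_gapMarkLaw {S : Set X} (hS : MeasurableSet S) :
    IsProbabilityMeasure (gapMarkLaw ν S) :=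
  Measure.isProbabilityMeasure_map (measurable_gapMark hS).aemeasurable

/-- Renewal at the first visit: on the event that it occurs at index `i`, the gap and the mark only
depend on the indices up to `i`, and the rest is an independent copy of the sequence. The
contributions are then summed over `i`. -/
theorem map_gapMark_afterFirst {S : Set X} (hS : MeasurableSet S) (hpos : ν S ≠ 0) :
    (iidLaw ν).map (fun z => (gapMark S z, afterFirst S z)) =
      (gapMarkLaw ν S).prod (iidLaw ν) := by
  have hgm := measurable_gapMark hS
  have ham := measurable_afterFirst hS
  have : IsProbabilityMeasure (gapMarkLaw ν S) := isProbabilityMeasure_gapMarkLaw ν hS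
  symm
  refine Measure.prod_eq fun C B hC hB => ?_
  rw [Measure.map_apply (hgm.prodMk ham) (hC.prod hB), gapMarkLaw, Measure.map_apply hgm hC]
  set D : ℕ → Set (ℕ → X) := fun i =>
    {z | z i ∈ S ∧ ∀ j < i, z j ∉ S} ∩ {z | ((i + 1, z i) : ℕ × X) ∈ C} with hD
  have hDm : ∀ i, MeasurableSet (D i) := fun i => (measurableSet_firstAt hS i).inter
    ((measurable_const.prodMk (measurable_pi_apply i)) hC)
  have hDd : Pairwise (Function.onFun Disjoint D) := by
    intro i j hij
    refine Set.disjoint_left.2 fun z h1 h2 => ?_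
    rcases lt_or_gt_of_ne hij with h | h
    · exact h2.1.2 i h h1.1.1
    · exact h1.1.2 j h h2.1.1
  have hsh : ∀ i, MeasurableSet {z : ℕ → X | (fun k => z (i + 1 + k)) ∈ B} := fun i =>
    (measurable_pi_lambda _ fun k => measurable_pi_apply _) hB
  have hprod : ∀ i, iidLaw ν (D i ∩ {z | (fun k => z (i + 1 + k)) ∈ B}) =
      iidLaw ν (D i) * iidLaw ν B := by
    intro i
    have hp := measurePreserving_sumElim ν (ι := ℕ) (κ := ℕ) (κ' := ℕ)
      (fun k => if k < i + 1 then Sum.inl k else Sum.inr (k - (i + 1))) (by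
        intro k l h
        simp only at h
        split_ifs at h with h1 h2 h2
        · exact Sum.inl_injective h
        · have := Sum.inr_injective h
          omega)
    rw [iidLaw, ← hp.measure_preimage ((hDm i).inter (hsh i)).nullMeasurableSet, ← Measure.prod_prod]
    congr 1
    ext q
    have e1 : ∀ k ≤ i, (Sum.elim q.1 q.2 (if k < i + 1 then Sum.inl k else Sum.inr (k - (i + 1)))) =
        q.1 k := fun k hk => by rw [if_pos (by omega)]; rfl
    have e2 : ∀ k, (Sum.elim q.1 q.2 (if i + 1 + k < i + 1 then Sum.inl (i + 1 + k)
        else Sum.inr (i + 1 + k - (i + 1)))) = q.2 k := fun k => by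
      rw [if_neg (by omega)]
      simp
    simp only [Set.mem_preimage, Set.mem_inter_iff, Set.mem_ofPred_eq, hD, Set.mem_prod, e2,
      e1 i le_rfl]
    refine and_congr_left fun _ => and_congr_left fun _ => and_congr_right fun _ => ?_
    exact forall₂_congr fun j hj => by rw [e1 j hj.le]
  have hae := ae_exists_mem ν hS hpos
  have e1 : iidLaw ν (gapMark S ⁻¹' C) = iidLaw ν (⋃ i, D i) := by
    refine measure_congr ?_
    filter_upwards [hae] with z hz
    refine propext (Iff.trans ?_ Set.mem_iUnion.symm)
    constructor
    · intro h
      exact ⟨firstIn S z, (firstIn_eq_iff _).1 ⟨rfl, hz⟩, h⟩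
    · rintro ⟨i, h1, h2⟩
      obtain ⟨rfl, -⟩ := (firstIn_eq_iff i).2 h1
      exact h2
  have e2 : iidLaw ν ((fun z => (gapMark S z, afterFirst S z)) ⁻¹' (C ×ˢ B)) =
      iidLaw ν (⋃ i, D i ∩ {z | (fun k => z (i + 1 + k)) ∈ B}) := by
    refine measure_congr ?_
    filter_upwards [hae] with z hz
    refine propext (Iff.trans ?_ Set.mem_iUnion.symm)
    constructor
    · rintro ⟨h1, h2⟩
      exact ⟨firstIn S z, ⟨(firstIn_eq_iff _).1 ⟨rfl, hz⟩, h1⟩, h2⟩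
    · rintro ⟨i, ⟨h1, h2⟩, h3⟩
      obtain ⟨rfl, -⟩ := (firstIn_eq_iff i).2 h1
      exact ⟨h2, h3⟩
  rw [e1, e2, measure_iUnion hDd hDm, measure_iUnion (fun i j hij => (hDd hij).mono
    Set.inter_subset_left Set.inter_subset_left) fun i => (hDm i).inter (hsh i)]
  simp only [hprod]
  exact ENNReal.tsum_mul_right

/-- Since `f` is independent of `θ` and `θ` preserves the law, the first coordinate splits off and
the argument repeats on the remaining ones. -/
theorem map_iterate_eq_infinitePi {Y Z : Type*} [MeasurableSpace Y] [MeasurableSpace Z]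
    {μ : Measure Z} [IsProbabilityMeasure μ] {κ : Measure Y} [IsProbabilityMeasure κ]
    {f : Z → Y} {θ : Z → Z} (hf : Measurable f) (hθ : Measurable θ)
    (h : μ.map (fun z => (f z, θ z)) = κ.prod μ) :
    μ.map (fun z k => f (θ^[k] z)) = Measure.infinitePi fun _ : ℕ => κ := by
  have hm : Measurable fun (z : Z) (k : ℕ) => f (θ^[k] z) :=
    measurable_pi_lambda _ fun k => hf.comp (hθ.iterate k)
  have hset : ∀ (n : ℕ) (A : ℕ → Set Y), (∀ i, MeasurableSet (A i)) →
      MeasurableSet {z : ℕ → Y | ∀ i < n, z i ∈ A i} := by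
    intro n A hA
    have : {z : ℕ → Y | ∀ i < n, z i ∈ A i} = ⋂ i, ⋂ (_ : i < n), {z | z i ∈ A i} := by ext; simp
    rw [this]
    exact MeasurableSet.iInter fun i => MeasurableSet.iInter fun _ => measurable_pi_apply i (hA i)
  refine eq_infinitePi_nat κ fun n A hA => ?_
  rw [Measure.map_apply hm (hset n A hA)]
  induction n generalizing A with
  | zero => simp
  | succ n ih =>
    have e : (fun (z : Z) (k : ℕ) => f (θ^[k] z)) ⁻¹' {z | ∀ i < n + 1, z i ∈ A i} =
        (fun z => (f z, θ z)) ⁻¹' (A 0 ×ˢ ((fun (z : Z) (k : ℕ) => f (θ^[k] z)) ⁻¹'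
          {z | ∀ i < n, z i ∈ A (i + 1)})) := by
      ext z
      simp only [Set.mem_preimage, Set.mem_ofPred_eq, Set.mem_prod]
      constructor
      · intro h
        refine ⟨h 0 (by omega), fun i hi => ?_⟩
        have := h (i + 1) (by omega)
        rwa [Function.iterate_succ_apply] at this
      · rintro ⟨h1, h2⟩ i hi
        rcases i with _ | i
        · exact h1
        · rw [Function.iterate_succ_apply]
          exact h2 i (by omega)
    rw [e, ← Measure.map_apply (hf.prodMk hθ) ((hA 0).prod (hm (hset n _ fun i => hA (i + 1)))), h,
      Measure.prod_prod, ih _ fun i => hA (i + 1), Finset.prod_range_succ']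
    ring

/-- The successive gaps and positions are i.i.d. -/
theorem map_gapMark_seq {S : Set X} (hS : MeasurableSet S) (hpos : ν S ≠ 0) :
    (iidLaw ν).map (fun z k => gapMark S ((afterFirst S)^[k] z)) =
      Measure.infinitePi fun _ : ℕ => gapMarkLaw ν S := by
  have : IsProbabilityMeasure (gapMarkLaw ν S) := isProbabilityMeasure_gapMarkLaw ν hS
  exact map_iterate_eq_infinitePi (measurable_gapMark hS) (measurable_afterFirst hS)
    (map_gapMark_afterFirst ν hS hpos)

theorem map_afterFirst {S : Set X} (hS : MeasurableSet S) (hpos : ν S ≠ 0) :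
    (iidLaw ν).map (afterFirst S) = iidLaw ν := by
  have : IsProbabilityMeasure (gapMarkLaw ν S) := isProbabilityMeasure_gapMarkLaw ν hS
  have h := congrArg (Measure.map Prod.snd) (map_gapMark_afterFirst ν hS hpos)
  rw [Measure.map_map measurable_snd ((measurable_gapMark hS).prodMk (measurable_afterFirst hS))] at h
  exact h.trans (by simp)

theorem ae_recurrent {S : Set X} (hS : MeasurableSet S) (hpos : ν S ≠ 0) :
    ∀ᵐ z ∂(iidLaw ν), Recurrent S z := by
  have hmp : MeasurePreserving (afterFirst S) (iidLaw ν) (iidLaw ν) :=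
    ⟨measurable_afterFirst hS, map_afterFirst ν hS hpos⟩
  refine ae_all_iff.2 fun k => ?_
  exact (hmp.iterate k).quasiMeasurePreserving.ae (ae_exists_mem ν hS hpos)

theorem gapMarkLaw_singleton_prod {S A : Set X} (hS : MeasurableSet S) (hA : MeasurableSet A)
    (hpos : ν S ≠ 0) (i : ℕ) :
    gapMarkLaw ν S ({i + 1} ×ˢ A) = ν Sᶜ ^ i * ν (S ∩ A) ∧ gapMarkLaw ν S ({0} ×ˢ A) = 0 := by
  have hgm := measurable_gapMark hS
  constructor
  · rw [gapMarkLaw, Measure.map_apply hgm ((measurableSet_singleton _).prod hA),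
      ← iidLaw_firstAt ν hS hA i]
    refine measure_congr ?_
    filter_upwards [ae_exists_mem ν hS hpos] with z hz
    refine propext ?_
    constructor
    · rintro ⟨h1, h2⟩
      have h1 : firstIn S z + 1 = i + 1 := h1
      have h1 : firstIn S z = i := by omega
      subst h1
      obtain ⟨h3, h4⟩ := (firstIn_eq_iff _).1 ⟨rfl, hz⟩
      exact ⟨⟨h3, h2⟩, h4⟩
    · rintro ⟨⟨h1, h2⟩, h3⟩
      obtain ⟨rfl, -⟩ := (firstIn_eq_iff i).2 ⟨h1, h3⟩
      exact ⟨rfl, h2⟩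
  · rw [gapMarkLaw, Measure.map_apply hgm ((measurableSet_singleton _).prod hA)]
    have : gapMark S ⁻¹' ({0} ×ˢ A) = ∅ := by
      ext z
      simp [gapMark]
    rw [this, measure_empty]

/-- The rank of the first visit is a discretized exponential variable, and is independent of the
position of the visit. -/
theorem gapMarkLaw_eq {S : Set X} (hS : MeasurableSet S) (hpos : ν S ≠ 0) {lam : ℝ} (hl : 0 < lam)
    (hlam : ν Sᶜ = ENNReal.ofReal (Real.exp (-lam))) :
    gapMarkLaw ν S = (stdExp.map fun ξ => ⌊ξ / lam⌋₊ + 1).prod (ProbabilityTheory.cond ν S) := by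
  have hfm : Measurable fun ξ : ℝ => ⌊ξ / lam⌋₊ + 1 :=
    (Nat.measurable_floor.comp (measurable_id.div_const lam)).add_const 1
  have := isProbabilityMeasure_gapMarkLaw ν hS
  have : IsProbabilityMeasure (ProbabilityTheory.cond ν S) := cond_isProbabilityMeasure hpos
  have : IsProbabilityMeasure (stdExp.map fun ξ : ℝ => ⌊ξ / lam⌋₊ + 1) :=
    Measure.isProbabilityMeasure_map hfm.aemeasurable
  symm
  -- The failure probability being `exp (-lam)`, slicing an exponential variable into intervals of
  -- length `lam` produces the geometric law. Endpoints are null, which permits replacing half-open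
  -- intervals by differences of open half-lines.
  have hgeo : ∀ i : ℕ, stdExp.map (fun ξ : ℝ => ⌊ξ / lam⌋₊ + 1) {i + 1} = ν Sᶜ ^ i * ν S := by
    intro i
    rw [Measure.map_apply hfm (measurableSet_singleton _)]
    have e1 : (fun ξ : ℝ => ⌊ξ / lam⌋₊ + 1) ⁻¹' {i + 1} =ᵐ[stdExp]
        (Set.Ioi (lam * i) \ Set.Ioi (lam * (i + 1)) : Set ℝ) := by
      have hne : ∀ c : ℝ, 0 ≤ c → ∀ᵐ ξ ∂stdExp, ξ ≠ c := by
        intro c hc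
        have hna : stdExp {c} = 0 := by
          have h1 : stdExp = volume.withDensity (exponentialPDF 1) := rfl
          exact (h1 ▸ withDensity_absolutelyContinuous _ _ : stdExp ≪ volume) (by simp)
        exact measure_eq_zero_iff_ae_notMem.1 hna
      have hpos0 : ∀ᵐ ξ ∂stdExp, 0 < ξ := by
        have h1 := stdExp_Ioi (le_refl (0 : ℝ))
        rw [neg_zero, Real.exp_zero, ENNReal.ofReal_one] at h1
        exact (prob_compl_eq_zero_iff measurableSet_Ioi).2 h1
      filter_upwards [hne (lam * i) (by positivity), hne (lam * (i + 1)) (by positivity), hpos0]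
        with ξ h1 h2 h3
      refine propext ?_
      show ⌊ξ / lam⌋₊ + 1 = i + 1 ↔ lam * i < ξ ∧ ¬ lam * (i + 1) < ξ
      rw [add_left_inj, Nat.floor_eq_iff (by positivity), le_div_iff₀ hl, div_lt_iff₀ hl, not_lt]
      constructor
      · rintro ⟨h4, h5⟩
        exact ⟨lt_of_le_of_ne (by linarith) (Ne.symm h1), by linarith⟩
      · rintro ⟨h4, h5⟩
        exact ⟨by linarith, lt_of_lt_of_le (lt_of_le_of_ne h5 h2) (by linarith)⟩
    rw [measure_congr e1, measure_sdiff (Set.Ioi_subset_Ioi (by nlinarith)) measurableSet_Ioi.nullMeasurableSet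
      (measure_ne_top _ _), stdExp_Ioi (by positivity), stdExp_Ioi (by positivity)]
    have e2 : ν S = 1 - ENNReal.ofReal (Real.exp (-lam)) := by
      rw [← hlam, prob_compl_eq_one_sub hS, ENNReal.sub_sub_cancel (by simp) prob_le_one]
    have e3 : Real.exp (-(lam * i)) = Real.exp (-lam) ^ i := by
      rw [← Real.exp_nat_mul]; congr 1; ring
    have e4 : Real.exp (-(lam * (i + 1))) = Real.exp (-lam) ^ i * Real.exp (-lam) := by
      rw [← e3, ← Real.exp_add]; congr 1; ring
    rw [hlam, e2, e3, e4, ← ENNReal.ofReal_one, ← ENNReal.ofReal_sub _ (Real.exp_pos _).le,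
      ← ENNReal.ofReal_pow (Real.exp_pos _).le, ← ENNReal.ofReal_mul (by positivity),
      ← ENNReal.ofReal_sub _ (by positivity)]
    congr 1
    ring
  refine Measure.prod_eq fun s A hs hA => ?_
  have key : ∀ g, gapMarkLaw ν S ((s ∩ {g}) ×ˢ A) =
      stdExp.map (fun ξ : ℝ => ⌊ξ / lam⌋₊ + 1) (s ∩ {g}) * ProbabilityTheory.cond ν S A := by
    intro g
    by_cases hg : g ∈ s
    · rw [Set.inter_eq_right.2 (Set.singleton_subset_iff.2 hg)]
      rcases g with _ | i
      · rw [(gapMarkLaw_singleton_prod ν hS hA hpos 0).2, Measure.map_apply hfm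
          (measurableSet_singleton _)]
        have : (fun ξ : ℝ => ⌊ξ / lam⌋₊ + 1) ⁻¹' {0} = ∅ := by ext; simp
        rw [this, measure_empty, zero_mul]
      · rw [(gapMarkLaw_singleton_prod ν hS hA hpos i).1, hgeo, cond_apply hS, mul_assoc,
          ← mul_assoc (ν S), ENNReal.mul_inv_cancel hpos (measure_ne_top _ _), one_mul]
    · have : s ∩ {g} = ∅ := by
        ext x
        simp only [Set.mem_inter_iff, Set.mem_singleton_iff, Set.mem_empty_iff_false, iff_false]
        rintro ⟨h1, rfl⟩
        exact hg h1
      simp [this]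
  have hU : s = ⋃ g, s ∩ {g} := by ext; simp
  have hd : Pairwise (Function.onFun Disjoint fun g => s ∩ {g}) := by
    intro g g' hgg
    refine Set.disjoint_left.2 fun x h1 h2 => hgg ?_
    exact (show x = g from h1.2).symm.trans h2.2
  have e1 : s ×ˢ A = ⋃ g, (s ∩ {g}) ×ˢ A := by ext x; simp
  have hd2 : Pairwise (Function.onFun Disjoint fun g => (s ∩ {g}) ×ˢ A) := fun g g' hgg =>
    Set.Disjoint.set_prod_left (hd hgg) _ _
  have e3 : stdExp.map (fun ξ : ℝ => ⌊ξ / lam⌋₊ + 1) s =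
      ∑' g, stdExp.map (fun ξ : ℝ => ⌊ξ / lam⌋₊ + 1) (s ∩ {g}) := by
    conv_lhs => rw [hU]
    exact measure_iUnion hd fun g => hs.inter (measurableSet_singleton g)
  rw [e1, measure_iUnion hd2 fun g => (hs.inter (measurableSet_singleton g)).prod hA, e3,
    ← ENNReal.tsum_mul_right]
  exact tsum_congr key

end Gaps

end

section

/-! ### The depths of the deep traps on the scale `B` -/

section Scales

variable {L σ : ℕ → ℝ} {κ : ℝ}

/-- The level reached by the maximum of `exp L` independent standard Gaussians. -/
def level (L : ℝ) : ℝ :=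
  √(2 * L) - 1 / (2 * √(2 * L)) * (Real.log L + Real.log (4 * Real.pi))

theorem tendsto_log_add_const_div_sqrt (c : ℝ) :
    Tendsto (fun x : ℝ => (Real.log x + c) / √x) atTop (𝓝 0) := by
  have h1 : Tendsto (fun x : ℝ => Real.log x / √x) atTop (𝓝 0) := by
    have := (isLittleO_log_rpow_atTop (r := 1 / 2) (by norm_num)).tendsto_div_nhds_zero
    refine this.congr fun x => ?_
    rw [Real.sqrt_eq_rpow]
  have h2 : Tendsto (fun x : ℝ => c / √x) atTop (𝓝 0) :=
    tendsto_const_nhds.div_atTop Real.tendsto_sqrt_atTop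
  have := h1.add h2
  rw [add_zero] at this
  exact this.congr fun x => (add_div _ _ _).symm

theorem tendsto_level_div (hL : Tendsto L atTop atTop)
    (hv : Tendsto (fun N => √(2 * L N) / σ N) atTop (𝓝 κ)) :
    Tendsto (fun N => level (L N) / σ N) atTop (𝓝 κ) := by
  have h0 : Tendsto (fun N => 1 - (Real.log (L N) + Real.log (4 * Real.pi)) / √(L N) / (4 * √(L N)))
      atTop (𝓝 (1 - 0)) := by
    refine tendsto_const_nhds.sub (Tendsto.div_atTop
      ((tendsto_log_add_const_div_sqrt _).comp hL) ?_)
    exact (Real.tendsto_sqrt_atTop.comp hL).const_mul_atTop (by norm_num)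
  have h1 := hv.mul h0
  rw [sub_zero, mul_one] at h1
  refine h1.congr' ?_
  filter_upwards [hL.eventually_gt_atTop 0] with N hN
  have h2 : √(2 * L N) = √2 * √(L N) := Real.sqrt_mul (by norm_num) _
  have h3 : 0 < √(L N) := Real.sqrt_pos.2 hN
  have h4 : 0 < √(2 : ℝ) := Real.sqrt_pos.2 (by norm_num)
  have h5 : √(2 : ℝ) ^ 2 = 2 := Real.sq_sqrt (by norm_num)
  rw [level, h2]
  by_cases hσ : σ N = 0
  · simp [hσ]
  field_simp
  rw [h5]
  ring

/-- The logarithmic correction in `level` is the one for which, on squaring, the term linear in it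
produces the factor `√(4 π x)`: it cancels the Gaussian normalisation and leaves `√(2 x)`, up to the
square of the correction. -/
theorem exp_mul_gaussian_level {x : ℝ} (hx : 0 < x) :
    Real.exp x * gaussianPDFReal 0 1 (level x) =
      √(2 * x) * Real.exp (-((Real.log x + Real.log (4 * Real.pi)) / √x) ^ 2 / 16) := by
  set c := Real.log x + Real.log (4 * Real.pi) with hc
  have hs : 0 < √(2 * x) := Real.sqrt_pos.2 (by linarith)
  have hs2 : √(2 * x) ^ 2 = 2 * x := Real.sq_sqrt (by linarith)
  have hx2 : √x ^ 2 = x := Real.sq_sqrt hx.le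
  have hlev : level x ^ 2 = 2 * x - c + c ^ 2 / (8 * x) := by
    have e : level x = √(2 * x) - c / (2 * √(2 * x)) := by rw [level, hc]; ring
    have e2 : level x ^ 2 = √(2 * x) ^ 2 - c + c ^ 2 / (4 * √(2 * x) ^ 2) := by
      rw [e]; field_simp; ring
    rw [e2, hs2]; ring
  have hexp : Real.exp (c / 2) = √(2 * Real.pi) * √(2 * x) := by
    have hpi := Real.pi_pos
    rw [← Real.sqrt_mul (by positivity), hc, ← Real.log_mul hx.ne' (by positivity),
      ← Real.log_sqrt (by positivity), Real.exp_log (Real.sqrt_pos.2 (by positivity))]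
    congr 1
    ring
  have hp : √(2 * Real.pi) ≠ 0 := (Real.sqrt_pos.2 (by positivity)).ne'
  rw [gaussianPDFReal]
  simp only [NNReal.coe_one, mul_one, sub_zero]
  have e3 : Real.exp x * Real.exp (-(level x) ^ 2 / 2) =
      Real.exp (c / 2) * Real.exp (-(c / √x) ^ 2 / 16) := by
    rw [← Real.exp_add, ← Real.exp_add, div_pow, hx2, hlev]
    congr 1
    field_simp
    ring
  calc Real.exp x * ((√(2 * Real.pi))⁻¹ * Real.exp (-(level x) ^ 2 / 2))
      = (√(2 * Real.pi))⁻¹ * (Real.exp x * Real.exp (-(level x) ^ 2 / 2)) := by ring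
    _ = _ := by rw [e3, hexp]; field_simp

theorem tendsto_exp_mul_gaussian_level (hL : Tendsto L atTop atTop)
    (hv : Tendsto (fun N => √(2 * L N) / σ N) atTop (𝓝 κ)) :
    Tendsto (fun N => Real.exp (L N) * gaussianPDFReal 0 1 (level (L N)) / σ N) atTop (𝓝 κ) := by
  have h1 : Tendsto (fun N =>
      Real.exp (-((Real.log (L N) + Real.log (4 * Real.pi)) / √(L N)) ^ 2 / 16)) atTop (𝓝 1) := by
    have h2 := ((((tendsto_log_add_const_div_sqrt (Real.log (4 * Real.pi))).comp hL).pow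
      2).neg.div_const 16)
    have h3 := (Real.continuous_exp.tendsto _).comp h2
    simpa [Function.comp_def] using h3
  have h4 := hv.mul h1
  rw [mul_one] at h4
  refine h4.congr' ?_
  filter_upwards [hL.eventually_gt_atTop 0] with N hN
  rw [exp_mul_gaussian_level hN]
  ring

/-- The substitution `z = b + w / s` centres the Gaussian at the level and turns the ratio of
exponentials into `exp w`. The threshold is positive, so the atom at `0` of the positive part does
not contribute. -/
theorem setIntegral_posGaussian {b s δ : ℝ} (hs : 0 < s) (hc : 0 < b + Real.log δ / s) (f : ℝ → ℝ)
    (hf : Measurable f) :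
    ∫ z in Set.Ici (b + Real.log δ / s), f (Real.exp (s * z) / Real.exp (s * b)) ∂posGaussian =
      gaussianPDFReal 0 1 b / s * ∫ w in Set.Ici (Real.log δ),
        f (Real.exp w) * Real.exp (-(b / s * w) - w ^ 2 / (2 * s ^ 2)) := by
  set c := b + Real.log δ / s with hcdef
  set h : ℝ → ℝ := (Set.Ici c).indicator
    (fun z => f (Real.exp (s * z) / Real.exp (s * b))) with hh
  have hhm : Measurable h := Measurable.indicator (by fun_prop) measurableSet_Ici
  have e1 : ∫ z in Set.Ici c, f (Real.exp (s * z) / Real.exp (s * b)) ∂posGaussian =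
      ∫ z, h z ∂(gaussianReal 0 1) := by
    rw [← integral_indicator measurableSet_Ici, posGaussian,
      integral_map (by fun_prop) hhm.aestronglyMeasurable]
    refine integral_congr_ae (ae_of_all _ fun z => ?_)
    show h (max z 0) = h z
    rcases le_total 0 z with hz | hz
    · rw [max_eq_left hz]
    · rw [max_eq_right hz, hh, Set.indicator_of_notMem, Set.indicator_of_notMem]
      · simp only [Set.mem_Ici, not_le]; linarith
      · simpa using hc
  rw [e1, integral_gaussianReal_eq_integral_smul one_ne_zero]
  have e2 := Measure.integral_comp_div (fun z => gaussianPDFReal 0 1 (b + z) • h (b + z)) s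
  have e3 := integral_add_left_eq_self (μ := volume)
    (fun z => gaussianPDFReal 0 1 z • h z) b
  rw [e3, abs_of_pos hs] at e2
  rw [← integral_indicator measurableSet_Ici, ← integral_const_mul]
  have e4 : ∫ x, gaussianPDFReal 0 1 x • h x =
      s⁻¹ * ∫ w, gaussianPDFReal 0 1 (b + w / s) • h (b + w / s) := by
    rw [e2, smul_eq_mul, ← mul_assoc, inv_mul_cancel₀ hs.ne', one_mul]
  rw [e4, ← integral_const_mul]
  refine integral_congr_ae (ae_of_all _ fun w => ?_)
  simp only [hh, Set.indicator, Set.mem_Ici, hcdef, add_le_add_iff_left,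
    div_le_div_iff_of_pos_right hs, smul_eq_mul]
  split_ifs with hw
  · have e5 : Real.exp (s * (b + w / s)) / Real.exp (s * b) = Real.exp w := by
      rw [← Real.exp_sub]
      congr 1
      field_simp
      ring
    have e6 : gaussianPDFReal 0 1 (b + w / s) =
        gaussianPDFReal 0 1 b * Real.exp (-(b / s * w) - w ^ 2 / (2 * s ^ 2)) := by
      simp only [gaussianPDFReal, NNReal.coe_one, mul_one, sub_zero]
      rw [mul_assoc, ← Real.exp_add]
      congr 2
      field_simp
      ring
    rw [e5, e6]
    ring
  · simp

theorem integral_paretoMeasure {δ : ℝ} (hδ : 0 < δ) (hκ : 0 < κ) (f : ℝ → ℝ) :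
    κ * ∫ w in Set.Ici (Real.log δ), f (Real.exp w) * Real.exp (-(κ * w)) =
      δ ^ (-κ) * ∫ x, f x ∂(paretoMeasure δ κ) := by
  have e1 : ∫ x, f x ∂(paretoMeasure δ κ) = ∫ x in Set.Ici δ, κ * δ ^ κ * x ^ (-(κ + 1)) * f x := by
    rw [paretoMeasure]
    have hm : Measurable (paretoPDFReal δ κ) := measurable_paretoPDFReal δ κ
    rw [show paretoPDF δ κ = fun x => ENNReal.ofReal (paretoPDFReal δ κ x) from rfl,
      integral_withDensity_eq_integral_toReal_smul (by fun_prop) (by simp),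
      ← integral_indicator measurableSet_Ici]
    refine integral_congr_ae (ae_of_all _ fun x => ?_)
    simp only [Set.indicator, Set.mem_Ici, paretoPDFReal]
    split_ifs with h
    · have hx : 0 < x := hδ.trans_le h
      rw [ENNReal.toReal_ofReal (by positivity), smul_eq_mul]
    · simp
  have e2 : Real.exp '' Set.Ici (Real.log δ) = Set.Ici δ := by
    ext x
    constructor
    · rintro ⟨w, hw, rfl⟩
      exact (Real.log_le_iff_le_exp hδ).1 hw
    · intro hx
      have hx0 : 0 < x := hδ.trans_le hx
      exact ⟨Real.log x, Real.log_le_log hδ hx, Real.exp_log hx0⟩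
  rw [e1, ← e2, integral_image_eq_integral_abs_deriv_smul measurableSet_Ici
    (fun w _ => (Real.hasDerivAt_exp w).hasDerivWithinAt) Real.exp_injective.injOn,
    ← integral_const_mul, ← integral_const_mul]
  refine integral_congr_ae (ae_of_all _ fun w => ?_)
  have e3 : Real.exp w ^ (-(κ + 1)) = Real.exp (-(κ * w)) * (Real.exp w)⁻¹ := by
    rw [← Real.exp_mul, ← Real.exp_neg, ← Real.exp_add]
    congr 1
    ring
  have e4 : δ ^ (-κ) * δ ^ κ = 1 := by
    rw [← Real.rpow_add hδ]; simp
  simp only [abs_of_pos (Real.exp_pos w), smul_eq_mul, e3]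
  have := (Real.exp_pos w).ne'
  calc κ * (f (Real.exp w) * Real.exp (-(κ * w)))
      = (δ ^ (-κ) * δ ^ κ) * (Real.exp w * (Real.exp w)⁻¹) *
        (κ * (f (Real.exp w) * Real.exp (-(κ * w)))) := by
          rw [e4, mul_inv_cancel₀ this]; ring
    _ = _ := by ring

/-- The linear term of the exponent converges to `-κ w` and the quadratic one vanishes because `σ`
tends to infinity; this is how the Gaussian tail becomes a power law in `exp w`. -/
theorem tendsto_setIntegral_exp {b : ℕ → ℝ} (hκ : 0 < κ) (hσ : Tendsto σ atTop atTop)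
    (hb : Tendsto (fun N => b N / σ N) atTop (𝓝 κ)) (ℓ : ℝ) {f : ℝ → ℝ} (hf : Measurable f) {C : ℝ}
    (hC : ∀ x, |f x| ≤ C) :
    Tendsto (fun N => ∫ w in Set.Ici ℓ,
        f (Real.exp w) * Real.exp (-(b N / σ N * w) - w ^ 2 / (2 * σ N ^ 2))) atTop
      (𝓝 (∫ w in Set.Ici ℓ, f (Real.exp w) * Real.exp (-(κ * w)))) := by
  have hC0 : 0 ≤ C := (abs_nonneg _).trans (hC 0)
  -- Eventually `b / σ` lies between `κ / 2` and `2 κ`: the first exponent dominates for positive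
  -- `w`, the second for negative `w`, which occurs when `δ < 1`.
  refine tendsto_integral_filter_of_dominated_convergence
    (fun w => C * (Real.exp (-(κ / 2) * w) + Real.exp (-(2 * κ) * w))) ?_ ?_ ?_ ?_
  · exact Eventually.of_forall fun N => Measurable.aestronglyMeasurable (by fun_prop)
  · filter_upwards [hb.eventually (lt_mem_nhds (show κ / 2 < κ by linarith)),
      hb.eventually (gt_mem_nhds (show κ < 2 * κ by linarith))] with N h1 h2
    refine ae_of_all _ fun w => ?_
    rw [norm_mul, Real.norm_eq_abs, Real.norm_eq_abs, abs_of_pos (Real.exp_pos _)]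
    refine mul_le_mul (hC _) ?_ (Real.exp_pos _).le hC0
    have h3 : 0 ≤ w ^ 2 / (2 * σ N ^ 2) := by positivity
    rcases le_total 0 w with hw | hw
    · refine le_trans (Real.exp_le_exp.2 ?_) (le_add_of_nonneg_right (Real.exp_pos _).le)
      nlinarith [mul_le_mul_of_nonneg_right h1.le hw]
    · refine le_trans (Real.exp_le_exp.2 ?_) (le_add_of_nonneg_left (Real.exp_pos _).le)
      nlinarith [mul_le_mul_of_nonpos_right h2.le hw]
  · have h1 : ∀ a : ℝ, a < 0 → IntegrableOn (fun w => Real.exp (a * w)) (Set.Ici ℓ) := fun a ha =>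
      (integrableOn_Ici_iff_integrableOn_Ioi).2 (integrableOn_exp_mul_Ioi ha ℓ)
    exact ((h1 _ (by linarith)).add (h1 _ (by linarith))).const_mul C
  · refine ae_of_all _ fun w => ?_
    refine tendsto_const_nhds.mul ((Real.continuous_exp.tendsto _).comp ?_)
    have h1 : Tendsto (fun N => w ^ 2 / (2 * σ N ^ 2)) atTop (𝓝 0) :=
      tendsto_const_nhds.div_atTop (((tendsto_pow_atTop two_ne_zero).comp hσ).const_mul_atTop
        (by norm_num))
    simpa using (hb.mul_const w).neg.sub h1

/-- The set of the energies of the deep traps. -/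
def deepSet (s B δ : ℝ) : Set ℝ := {z | δ * B ≤ Real.exp (s * z)}

theorem measurableSet_deepSet (s B δ : ℝ) : MeasurableSet (deepSet s B δ) :=
  measurableSet_le measurable_const (by fun_prop)

theorem deepSet_eq {s b δ : ℝ} (hs : 0 < s) (hδ : 0 < δ) :
    deepSet s (Real.exp (s * b)) δ = Set.Ici (b + Real.log δ / s) := by
  ext z
  have e : δ * Real.exp (s * b) = Real.exp (s * (b + Real.log δ / s)) := by
    rw [mul_add, mul_div_cancel₀ _ hs.ne', Real.exp_add, Real.exp_log hδ, mul_comm]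
  simp only [deepSet, Set.mem_ofPred_eq, e, Real.exp_le_exp, Set.mem_Ici]
  exact mul_le_mul_iff_right₀ hs

/-- The rescaled depths have a density with respect to the inverse of the number of the sites, which
converges to a power law. -/
theorem tendsto_mul_setIntegral_deepSet (hκ : 0 < κ) {δ : ℝ} (hδ : 0 < δ)
    (hL : Tendsto L atTop atTop) (hσ : Tendsto σ atTop atTop)
    (hv : Tendsto (fun N => √(2 * L N) / σ N) atTop (𝓝 κ)) {f : ℝ → ℝ} (hf : Measurable f) {C : ℝ}
    (hC : ∀ x, |f x| ≤ C) :
    Tendsto (fun N => Real.exp (L N) * ∫ z in deepSet (σ N) (Real.exp (σ N * level (L N))) δ,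
        f (Real.exp (σ N * z) / Real.exp (σ N * level (L N))) ∂posGaussian) atTop
      (𝓝 (δ ^ (-κ) * ∫ x, f x ∂(paretoMeasure δ κ))) := by
  have hb := tendsto_level_div hL hv
  rw [← integral_paretoMeasure hδ hκ]
  refine ((tendsto_exp_mul_gaussian_level hL hv).mul
    (tendsto_setIntegral_exp hκ hσ hb (Real.log δ) hf hC)).congr' ?_
  have hpos : ∀ᶠ N in atTop, 0 < level (L N) / σ N + Real.log δ / σ N / σ N := by
    have h0 : Tendsto (fun N => Real.log δ / σ N / σ N) atTop (𝓝 0) :=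
      (tendsto_const_nhds.div_atTop hσ).div_atTop hσ
    have := hb.add h0
    rw [add_zero] at this
    exact this.eventually (lt_mem_nhds hκ)
  filter_upwards [hpos, hσ.eventually_gt_atTop 0] with N h1 h2
  rw [deepSet_eq h2 hδ, setIntegral_posGaussian h2 _ f hf]
  · ring
  · rw [← add_div] at h1
    exact (div_pos_iff_of_pos_right h2).1 h1

end Scales

end

section

/-! ### The law of the gaps between the deep traps, and of their depths -/

theorem map_div_stdExp {ρ : ℝ} (hρ : 0 < ρ) : stdExp.map (fun ξ => ξ / ρ) = expMeasure ρ := by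
  have h1 : IsProbabilityMeasure (stdExp.map (fun ξ => ξ / ρ)) :=
    Measure.isProbabilityMeasure_map (by fun_prop)
  have h2 := isProbabilityMeasure_expMeasure hρ
  have h3 := isProbabilityMeasure_expMeasure one_pos
  refine Measure.eq_of_cdf _ _ ?_
  ext x
  rw [cdf_expMeasure_eq hρ, cdf_eq_real, map_measureReal_apply (by fun_prop) measurableSet_Iic]
  have e : (fun ξ : ℝ => ξ / ρ) ⁻¹' Set.Iic x = Set.Iic (ρ * x) := by
    ext ξ
    simp only [Set.mem_preimage, Set.mem_Iic, div_le_iff₀ hρ, mul_comm]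
  rw [e, stdExp, ← cdf_eq_real, cdf_expMeasure_eq one_pos]
  simp only [mul_nonneg_iff_of_pos_left hρ, one_mul]

/-- The gap and the depth on their natural scales. -/
def rescaled (d s B : ℝ) (q : ℕ × ℝ) : ℝ × ℝ := ((q.1 : ℝ) / d, Real.exp (s * q.2) / B)

theorem measurable_rescaled (d s B : ℝ) : Measurable (rescaled d s B) := by
  unfold rescaled
  have : Measurable fun q : ℕ × ℝ => (q.1 : ℝ) := measurable_from_top.comp measurable_fst
  fun_prop

section GapLaw

variable {L σ : ℕ → ℝ} {κ : ℝ}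

theorem tendsto_mul_neg_log_one_sub {d p : ℕ → ℝ} {ρ : ℝ} (hd : Tendsto d atTop atTop)
    (h : Tendsto (fun N => d N * p N) atTop (𝓝 ρ)) :
    Tendsto p atTop (𝓝 0) ∧ Tendsto (fun N => d N * -Real.log (1 - p N)) atTop (𝓝 ρ) := by
  have hp : Tendsto p atTop (𝓝 0) := by
    refine (h.div_atTop hd).congr' ?_
    filter_upwards [hd.eventually_gt_atTop 0] with N hN
    field_simp
  refine ⟨hp, ?_⟩
  have h1 : Tendsto (fun N => d N * p N * (1 - p N)⁻¹) atTop (𝓝 ρ) := by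
    have := h.mul ((tendsto_const_nhds (x := (1 : ℝ))).sub hp |>.inv₀ (by norm_num))
    simpa using this
  refine tendsto_of_tendsto_of_tendsto_of_le_of_le' h h1 ?_ ?_
  · filter_upwards [hd.eventually_gt_atTop 0, hp.eventually (gt_mem_nhds one_pos)] with N hN hN1
    refine mul_le_mul_of_nonneg_left ?_ hN.le
    linarith [Real.log_le_sub_one_of_pos (sub_pos.2 hN1)]
  · filter_upwards [hd.eventually_gt_atTop 0, hp.eventually (gt_mem_nhds one_pos)] with N hN hN1
    rw [mul_assoc]
    refine mul_le_mul_of_nonneg_left ?_ hN.le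
    have h2 := Real.one_sub_inv_le_log_of_pos (sub_pos.2 hN1)
    have h3 : p N * (1 - p N)⁻¹ = (1 - p N)⁻¹ - 1 := by
      have := (sub_pos.2 hN1).ne'
      field_simp
      ring
    linarith

theorem tendsto_floor_div {d lam : ℕ → ℝ} {ρ ξ : ℝ} (hρ : 0 < ρ) (hξ : 0 ≤ ξ)
    (hd : Tendsto d atTop atTop) (h : Tendsto (fun N => d N * lam N) atTop (𝓝 ρ)) :
    Tendsto (fun N => ((⌊ξ / lam N⌋₊ + 1 : ℕ) : ℝ) / d N) atTop (𝓝 (ξ / ρ)) := by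
  have h1 : Tendsto (fun N => ξ / (d N * lam N)) atTop (𝓝 (ξ / ρ)) :=
    tendsto_const_nhds.div h hρ.ne'
  have h2 : Tendsto (fun N => ξ / (d N * lam N) + 1 / d N) atTop (𝓝 (ξ / ρ)) := by
    simpa using h1.add ((tendsto_const_nhds (x := (1 : ℝ))).div_atTop hd)
  have hev : ∀ᶠ N in atTop, 0 < d N ∧ 0 < lam N := by
    filter_upwards [hd.eventually_gt_atTop 0, h.eventually (lt_mem_nhds hρ)] with N h3 h4
    exact ⟨h3, pos_of_mul_pos_right h4 h3.le⟩
  refine tendsto_of_tendsto_of_tendsto_of_le_of_le' h1 h2 ?_ ?_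
  · filter_upwards [hev] with N ⟨hN, hl⟩
    rw [mul_comm, ← div_div]
    refine div_le_div_of_nonneg_right ?_ hN.le
    push_cast
    exact (Nat.lt_floor_add_one _).le
  · filter_upwards [hev] with N ⟨hN, hl⟩
    rw [mul_comm, ← div_div, ← add_div]
    refine div_le_div_of_nonneg_right ?_ hN.le
    push_cast
    linarith [Nat.floor_le (show 0 ≤ ξ / lam N by positivity)]

/-- The law of the gap between two successive deep traps and of the depth of a deep trap, on their
natural scales. -/
def rescaledLaw (L s δ : ℝ) : ProbabilityMeasure (ℝ × ℝ) :=
  ⟨(gapMarkLaw posGaussian (deepSet s (Real.exp (s * level L)) δ)).map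
      (rescaled (Real.exp L) s (Real.exp (s * level L))),
    have := isProbabilityMeasure_gapMarkLaw posGaussian
      (measurableSet_deepSet s (Real.exp (s * level L)) δ)
    Measure.isProbabilityMeasure_map (measurable_rescaled _ _ _).aemeasurable⟩

/-- The limit of the law of the gaps and depths. -/
def limitLaw {κ δ : ℝ} (hκ : 0 < κ) (hδ : 0 < δ) : ProbabilityMeasure (ℝ × ℝ) :=
  ProbabilityMeasure.prod
    ⟨expMeasure (δ ^ (-κ)), isProbabilityMeasure_expMeasure (Real.rpow_pos_of_pos hδ _)⟩
    ⟨paretoMeasure δ κ, isProbabilityMeasure_paretoMeasure hδ hκ⟩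

/-- The gaps for all `N` are realised from one exponential variable and then converge almost surely.
Integrals against the conditional law of the depths are quotients of two integrals given by
`tendsto_mul_setIntegral_deepSet`. Gap and depth being independent, product laws converge. -/
theorem tendsto_rescaledLaw (hκ : 0 < κ) {δ : ℝ} (hδ : 0 < δ)
    (hL : Tendsto L atTop atTop) (hσ : Tendsto σ atTop atTop)
    (hv : Tendsto (fun N => √(2 * L N) / σ N) atTop (𝓝 κ)) :
    (∀ᶠ N in atTop, posGaussian (deepSet (σ N) (Real.exp (σ N * level (L N))) δ) ≠ 0) ∧
      Tendsto (fun N => rescaledLaw (L N) (σ N) δ) atTop (𝓝 (limitLaw hκ hδ)) := by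
  have hpar := isProbabilityMeasure_paretoMeasure hδ hκ
  have hρ : 0 < δ ^ (-κ) := Real.rpow_pos_of_pos hδ _
  set ρ := δ ^ (-κ) with hρdef
  set B : ℕ → ℝ := fun N => Real.exp (σ N * level (L N)) with hB
  set S : ℕ → Set ℝ := fun N => deepSet (σ N) (B N) δ with hS
  have hSm : ∀ N, MeasurableSet (S N) := fun N => measurableSet_deepSet _ _ _
  set d : ℕ → ℝ := fun N => Real.exp (L N) with hd
  have hdt : Tendsto d atTop atTop := Real.tendsto_exp_atTop.comp hL
  have hmain : ∀ (f : ℝ → ℝ) (C : ℝ), Measurable f → (∀ x, |f x| ≤ C) →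
      Tendsto (fun N => d N * ∫ z in S N, f (Real.exp (σ N * z) / B N) ∂posGaussian) atTop
        (𝓝 (ρ * ∫ x, f x ∂(paretoMeasure δ κ))) := fun f C hf hC =>
    tendsto_mul_setIntegral_deepSet hκ hδ hL hσ hv hf hC
  set p : ℕ → ℝ := fun N => posGaussian.real (S N) with hp
  have hdp : Tendsto (fun N => d N * p N) atTop (𝓝 ρ) := by
    have := hmain (fun _ => 1) 1 measurable_const (by simp)
    simpa [hp] using this
  obtain ⟨hp0, hlam⟩ := tendsto_mul_neg_log_one_sub hdt hdp
  have hppos : ∀ᶠ N in atTop, 0 < p N := by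
    filter_upwards [hdp.eventually (lt_mem_nhds hρ)] with N hN
    exact pos_of_mul_pos_right hN (Real.exp_pos _).le
  have hp1 : ∀ᶠ N in atTop, p N < 1 := hp0.eventually (gt_mem_nhds one_pos)
  have hne : ∀ᶠ N in atTop, posGaussian (S N) ≠ 0 := by
    filter_upwards [hppos] with N hN h0
    simp [hp, measureReal_def, h0] at hN
  refine ⟨hne, ?_⟩
  set lam : ℕ → ℝ := fun N => -Real.log (1 - p N) with hlamdef
  have hgm : ∀ N, Measurable fun ξ : ℝ => ((⌊ξ / lam N⌋₊ + 1 : ℕ) : ℝ) / d N := fun N =>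
    (measurable_from_top.comp ((Nat.measurable_floor.comp
      (measurable_id.div_const (lam N))).add_const 1)).div_const _
  set A : ℕ → ProbabilityMeasure ℝ := fun N =>
    ⟨stdExp.map fun ξ : ℝ => ((⌊ξ / lam N⌋₊ + 1 : ℕ) : ℝ) / d N,
      Measure.isProbabilityMeasure_map (hgm N).aemeasurable⟩ with hA
  have hAlim : Tendsto A atTop (𝓝 ⟨expMeasure ρ, isProbabilityMeasure_expMeasure hρ⟩) := by
    have h1 : ∀ᵐ ξ ∂stdExp, 0 < ξ := by
      have h2 : stdExp (Set.Ioi 0) = 1 := by simpa using stdExp_Ioi le_rfl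
      exact (prob_compl_eq_zero_iff measurableSet_Ioi).2 h2
    have h3 := (tendstoInDistribution_of_ae_tendsto (μ' := stdExp) (l := atTop)
      (X := fun N (ξ : ℝ) => ((⌊ξ / lam N⌋₊ + 1 : ℕ) : ℝ) / d N) (Z := fun ξ => ξ / ρ)
      (fun N => (hgm N).aemeasurable) (by fun_prop)
      (h1.mono fun ξ hξ => tendsto_floor_div hρ hξ.le hdt hlam)).tendsto
    have e : (⟨expMeasure ρ, isProbabilityMeasure_expMeasure hρ⟩ : ProbabilityMeasure ℝ) =
        ⟨stdExp.map fun ξ => ξ / ρ, Measure.isProbabilityMeasure_map (by fun_prop)⟩ :=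
      Subtype.ext (map_div_stdExp hρ).symm
    rw [e]
    exact h3
  -- An arbitrary law is taken for the finitely many `N` at which the deep set may be null and
  -- conditioning is meaningless.
  obtain ⟨Q, hQ⟩ : ∃ Q : ℕ → ProbabilityMeasure ℝ, ∀ N, posGaussian (S N) ≠ 0 →
      (Q N : Measure ℝ) = (ProbabilityTheory.cond posGaussian (S N)).map
        (fun z => Real.exp (σ N * z) / B N) := by
    suffices h : ∀ N, ∃ R : ProbabilityMeasure ℝ, posGaussian (S N) ≠ 0 →
        (R : Measure ℝ) = (ProbabilityTheory.cond posGaussian (S N)).map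
          (fun z => Real.exp (σ N * z) / B N) from
      ⟨fun N => (h N).choose, fun N => (h N).choose_spec⟩
    intro N
    by_cases h : posGaussian (S N) ≠ 0
    · have := cond_isProbabilityMeasure h
      exact ⟨⟨_, Measure.isProbabilityMeasure_map (by fun_prop)⟩, fun _ => rfl⟩
    · exact ⟨⟨Measure.dirac 0, inferInstance⟩, fun h' => absurd h' h⟩
  have hQlim : Tendsto Q atTop (𝓝 ⟨paretoMeasure δ κ, hpar⟩) := by
    refine ProbabilityMeasure.tendsto_iff_forall_integral_tendsto.2 fun f => ?_
    have h1 := (hmain f ‖f‖ f.continuous.measurable fun x => f.norm_coe_le_norm x).div hdp hρ.ne'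
    rw [mul_div_cancel_left₀ _ hρ.ne'] at h1
    refine h1.congr' ?_
    filter_upwards [hne, hppos] with N hN hpN
    rw [hQ N hN, integral_map (by fun_prop) f.continuous.aestronglyMeasurable,
      ProbabilityTheory.cond, integral_smul_measure, smul_eq_mul, ENNReal.toReal_inv]
    have hdN : d N ≠ 0 := (Real.exp_pos _).ne'
    show (d N * _) / (d N * p N) = (p N)⁻¹ * _
    rw [mul_div_mul_left _ _ hdN, div_eq_inv_mul]
  have hprod := (ProbabilityMeasure.continuous_prod.tendsto
    ((⟨expMeasure ρ, isProbabilityMeasure_expMeasure hρ⟩ : ProbabilityMeasure ℝ),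
      (⟨paretoMeasure δ κ, hpar⟩ : ProbabilityMeasure ℝ))).comp (hAlim.prodMk_nhds hQlim)
  refine hprod.congr' ?_
  filter_upwards [hne, hppos, hp1] with N hN hpN hpN1
  refine Subtype.ext ?_
  have hlamN : 0 < lam N := by
    have := Real.log_neg (sub_pos.2 hpN1) (by linarith)
    simp only [hlamdef]
    linarith
  have hcompl : posGaussian (S N)ᶜ = ENNReal.ofReal (Real.exp (-lam N)) := by
    rw [hlamdef, neg_neg, Real.exp_log (sub_pos.2 hpN1), prob_compl_eq_one_sub (hSm N),
      ENNReal.ofReal_sub _ hpN.le, ENNReal.ofReal_one, hp]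
    simp
  show (A N : Measure ℝ).prod (Q N : Measure ℝ) =
    (gapMarkLaw posGaussian (S N)).map (rescaled (d N) (σ N) (B N))
  have := cond_isProbabilityMeasure hN
  rw [gapMarkLaw_eq posGaussian (hSm N) hN hlamN hcompl, hQ N hN]
  have e : rescaled (d N) (σ N) (B N) =
      Prod.map (fun k : ℕ => (k : ℝ) / d N) (fun z => Real.exp (σ N * z) / B N) := rfl
  have hm1 : Measurable fun k : ℕ => (k : ℝ) / d N := measurable_from_top
  have hfm : Measurable fun ξ : ℝ => ⌊ξ / lam N⌋₊ + 1 :=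
    (Nat.measurable_floor.comp (measurable_id.div_const (lam N))).add_const 1
  have : IsProbabilityMeasure (stdExp.map fun ξ : ℝ => ⌊ξ / lam N⌋₊ + 1) :=
    Measure.isProbabilityMeasure_map hfm.aemeasurable
  rw [e, ← Measure.map_prod_map _ _ hm1 (by fun_prop), Measure.map_map hm1 hfm]
  rfl

end GapLaw

end

/-! ### Convergence in distribution by approximation, and construction of the limit -/

section

/-! ### Approximation in distribution -/

/-- If `Z N` converges in distribution to `ζ`, and if `Y N` is, with high probability, the image by
the continuous map `G` of a point close to `Z N`, then `Y N` converges in distribution to the image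
of `ζ` by `G`. -/
theorem tendsto_map_of_approx {E F : Type*} [PseudoMetricSpace E] [MeasurableSpace E]
    [BorelSpace E] [TopologicalSpace F] [MeasurableSpace F] [BorelSpace F]
    {Θ : ℕ → Type*} [∀ N, MeasurableSpace (Θ N)] {μ : ∀ N, Measure (Θ N)}
    {Z : ∀ N, Θ N → E} (hZ : ∀ N, AEMeasurable (Z N) (μ N))
    {P : ℕ → ProbabilityMeasure E} {ζ : ProbabilityMeasure E} (hPζ : Tendsto P atTop (𝓝 ζ))
    (hP : ∀ᶠ N in atTop, (P N : Measure E) = (μ N).map (Z N))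
    {Y : ∀ N, Θ N → F} (hY : ∀ N, AEMeasurable (Y N) (μ N))
    {R : ℕ → ProbabilityMeasure F} (hR : ∀ N, (R N : Measure F) = (μ N).map (Y N))
    {G : E → F} (hG : Continuous G) (e₀ : E)
    (h : ∀ ε > 0, ∀ C : ℝ, Tendsto (fun N => μ N {q | dist (Z N q) e₀ < C ∧
      ¬ ∃ e, Y N q = G e ∧ dist (Z N q) e ≤ ε}) atTop (𝓝 0)) :
    Tendsto R atTop (𝓝 (ζ.map hG.measurable.aemeasurable)) := by
  refine tendsto_of_forall_isOpen_le_liminf_nat' fun U hU => ?_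
  set A : Set E := G ⁻¹' U with hA
  have hAo : IsOpen A := hU.preimage hG
  -- The open set `A` is exhausted by bounded open sets lying at distance more than `1 / (n + 1)`
  -- from its complement: a point that close to `V n` is still in `A`. Boundedness is imposed
  -- because the approximation is only assumed on balls.
  set V : ℕ → Set E := fun n => (Metric.cthickening (1 / ((n : ℝ) + 1)) Aᶜ)ᶜ ∩ Metric.ball e₀ n with hV
  have hVo : ∀ n, IsOpen (V n) := fun n =>
    Metric.isClosed_cthickening.isOpen_compl.inter Metric.isOpen_ball
  have hVm : Monotone V := fun n n' hn =>
    Set.inter_subset_inter (Set.compl_subset_compl.2 (Metric.cthickening_mono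
      (one_div_le_one_div_of_le (by positivity) (by gcongr)) _))
      (Metric.ball_subset_ball (by exact_mod_cast hn))
  have hVu : ⋃ n, V n = A := by
    ext e
    simp only [Set.mem_iUnion]
    constructor
    · rintro ⟨n, hn, -⟩
      by_contra hne
      exact hn (Metric.self_subset_cthickening _ hne)
    · intro he
      have h1 : e ∉ closure Aᶜ := by
        rw [hAo.isClosed_compl.closure_eq]
        simpa using he
      rw [Metric.closure_eq_iInter_cthickening] at h1
      simp only [Set.mem_iInter, not_forall] at h1
      obtain ⟨ε, hε, h2⟩ := h1
      obtain ⟨n₁, hn₁⟩ := exists_nat_one_div_lt hε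
      obtain ⟨n₂, hn₂⟩ := exists_nat_gt (dist e e₀)
      refine ⟨max n₁ n₂, fun h3 => h2 (Metric.cthickening_mono ?_ _ h3), ?_⟩
      · refine le_trans (one_div_le_one_div_of_le (by positivity) ?_) hn₁.le
        push_cast
        gcongr
        exact le_max_left _ _
      · exact hn₂.trans_le (by exact_mod_cast le_max_right _ _)
  have e1 : ((ζ.map hG.measurable.aemeasurable : ProbabilityMeasure F) : Measure F) U =
      (ζ : Measure E) A := Measure.map_apply hG.measurable hU.measurableSet
  rw [e1, ← hVu, hVm.measure_iUnion]
  refine iSup_le fun n => ?_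
  have hbad := h (1 / ((n : ℝ) + 1)) (by positivity) n
  refine (ProbabilityMeasure.le_liminf_measure_open_of_tendsto hPζ (hVo n)).trans ?_
  refine le_trans ?_ (ENNReal.liminf_add_of_right_tendsto_zero hbad _).le
  refine liminf_le_liminf ?_
  filter_upwards [hP] with N hN
  rw [Pi.add_apply]
  rw [hN, hR N, Measure.map_apply_of_aemeasurable (hZ N) (hVo n).measurableSet,
    Measure.map_apply_of_aemeasurable (hY N) hU.measurableSet]
  refine (measure_mono fun q hq => ?_).trans (measure_union_le _ _)
  by_cases hq' : ∃ e, Y N q = G e ∧ dist (Z N q) e ≤ 1 / ((n : ℝ) + 1)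
  · obtain ⟨e, he1, he2⟩ := hq'
    left
    show Y N q ∈ U
    rw [he1]
    by_contra hne
    exact hq.1 (Metric.mem_cthickening_of_dist_le _ e _ _ hne he2)
  · exact Or.inr ⟨hq.2, hq'⟩

/-! ### The limit process -/

theorem infinitePi_map_fin {X : Type*} [MeasurableSpace X] (ν : Measure X) [IsProbabilityMeasure ν]
    (m : ℕ) :
    (Measure.infinitePi fun _ : ℕ => ν).map (fun z (k : Fin m) => z k) =
      Measure.pi fun _ : Fin m => ν := by
  symm
  refine Measure.pi_eq fun s hs => ?_
  rw [Measure.map_apply (by fun_prop) (MeasurableSet.univ_pi hs)]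
  have e : (fun (z : ℕ → X) (k : Fin m) => z k) ⁻¹' Set.univ.pi s =
      Set.pi (Finset.range m) (fun i => if h : i < m then s ⟨i, h⟩ else Set.univ) := by
    ext z
    simp only [Set.mem_preimage, Set.mem_pi, Set.mem_univ, true_imp_iff, Finset.coe_range,
      Set.mem_Iio]
    constructor
    · intro h i hi
      rw [dif_pos hi]
      exact h ⟨i, hi⟩
    · intro h k
      have := h k k.2
      rwa [dif_pos k.2] at this
  rw [e, Measure.infinitePi_pi _ fun i _ => ?_, Finset.prod_range]
  · exact Finset.prod_congr rfl fun k _ => by rw [dif_pos k.2]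
  · split_ifs
    exacts [hs _, MeasurableSet.univ]

/-- The partial sums of the gaps, together with the marks. -/
def sumMap (m : ℕ) (x : Fin m → ℝ × ℝ) (k : Fin m) : ℝ × ℝ :=
  (∑ i ∈ Finset.range (k + 1), if h : i < m then (x ⟨i, h⟩).1 else 0, (x k).2)

theorem continuous_sumMap (m : ℕ) : Continuous (sumMap m) := by
  refine continuous_pi fun k => Continuous.prodMk (continuous_finsetSum _ fun i _ => ?_) (by fun_prop)
  split_ifs
  · fun_prop
  · fun_prop

theorem sumMap_apply {m : ℕ} (z : ℕ → ℝ × ℝ) (k : Fin m) :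
    sumMap m (fun j => z j) k = (∑ i ∈ Finset.range (k + 1), (z i).1, (z k).2) := by
  have e : (∑ i ∈ Finset.range (k + 1), if h : i < m then (z i).1 else 0) =
      ∑ i ∈ Finset.range (k + 1), (z i).1 := Finset.sum_congr rfl fun i hi => by
    rw [dif_pos (by have := Finset.mem_range.1 hi; omega)]
  exact Prod.ext e rfl

/-- The nonnegative parts, in the extended half-line. -/
def toExtended (m : ℕ) (e : Fin m → ℝ × ℝ) (k : Fin m) : ℝ≥0∞ × ℝ≥0∞ :=
  (ENNReal.ofReal (e k).1, ENNReal.ofReal (e k).2)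

theorem continuous_toExtended (m : ℕ) : Continuous (toExtended m) := by
  unfold toExtended
  have := ENNReal.continuous_ofReal
  fun_prop

/-- The number of the points of the process with gaps `ω.1` in the interval `[0, u]`. -/
def gapCount (u : ℝ≥0) (ω : (ℕ → ℝ) × (ℕ → ℝ)) : ℕ :=
  {n : ℕ | 1 ≤ n ∧ ∑ i ∈ Finset.range n, ω.1 i ≤ (u : ℝ)}.ncard

/-- Gaps exceeding every integer force the partial sums to infinity. This is needed because `ncard`
of an infinite set is `0`, which would make the count meaningless. -/
theorem jumpInstant_gapCount {ω : (ℕ → ℝ) × (ℕ → ℝ)} (h0 : ∀ i, 0 ≤ ω.1 i)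
    (h1 : ∀ K : ℕ, ∃ i, (K : ℝ) < ω.1 i) (n : ℕ) :
    jumpInstant gapCount (n + 1) ω = ENNReal.ofReal (∑ i ∈ Finset.range (n + 1), ω.1 i) := by
  set s : ℕ → ℝ := fun n => ∑ i ∈ Finset.range n, ω.1 i with hs
  have hsm : Monotone s := monotone_nat_of_le_succ fun n => by
    simp only [hs, Finset.sum_range_succ]
    linarith [h0 n]
  have hs0 : ∀ n, 0 ≤ s n := fun n => Finset.sum_nonneg fun i _ => h0 i
  have hfin : ∀ u : ℝ≥0, {n : ℕ | 1 ≤ n ∧ s n ≤ (u : ℝ)}.Finite := by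
    intro u
    obtain ⟨K, hK⟩ := exists_nat_gt (u : ℝ)
    obtain ⟨i, hi⟩ := h1 K
    refine (Set.finite_Iic i).subset fun k hk => ?_
    by_contra hlt
    have h2 : s (i + 1) ≤ s k := hsm (by simpa using hlt)
    have h3 : ω.1 i ≤ s (i + 1) := by
      simp only [hs, Finset.sum_range_succ]
      linarith [hs0 i]
    linarith [hk.2]
  have hiff : ∀ u : ℝ≥0, n + 1 ≤ gapCount u ω ↔ s (n + 1) ≤ u := by
    intro u
    constructor
    · intro hle
      by_contra hlt
      have hsub : {n : ℕ | 1 ≤ n ∧ s n ≤ (u : ℝ)} ⊆ Set.Icc 1 n := by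
        rintro k ⟨hk1, hk2⟩
        refine ⟨hk1, ?_⟩
        by_contra hk
        exact hlt ((hsm (by omega)).trans hk2)
      have := Set.ncard_le_ncard hsub (Set.finite_Icc 1 n)
      rw [Set.ncard_eq_toFinset_card' (Set.Icc 1 n), Set.toFinset_Icc, Nat.card_Icc] at this
      have h2 : n + 1 ≤ _ := hle.trans this
      omega
    · intro hle
      have hsub : Set.Icc 1 (n + 1) ⊆ {n : ℕ | 1 ≤ n ∧ s n ≤ (u : ℝ)} :=
        fun k hk => ⟨hk.1, (hsm hk.2).trans hle⟩
      have := Set.ncard_le_ncard hsub (hfin u)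
      rwa [Set.ncard_eq_toFinset_card' (Set.Icc 1 (n + 1)), Set.toFinset_Icc, Nat.card_Icc,
        Nat.add_sub_cancel] at this
  simp only [jumpInstant, hiff]
  refine le_antisymm ?_ (le_iInf₂ fun u hu => ENNReal.ofReal_le_of_le_toReal hu)
  refine iInf₂_le_of_le (s (n + 1)).toNNReal ?_ le_rfl
  rw [Real.coe_toNNReal _ (hs0 _)]

section LimitSpace

/-- The law of the independent sequences of gaps and marks of the limit process. -/
def limitMeasure (ρ : ℝ) (π : Measure ℝ) : Measure ((ℕ → ℝ) × (ℕ → ℝ)) :=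
  (Measure.infinitePi fun _ => expMeasure ρ).prod (Measure.infinitePi fun _ => π)

variable {ρ : ℝ}

theorem isProbabilityMeasure_limitMeasure (hρ : 0 < ρ) (π : Measure ℝ) [IsProbabilityMeasure π]
    : IsProbabilityMeasure (limitMeasure ρ π) := by
  have := isProbabilityMeasure_expMeasure hρ
  unfold limitMeasure
  infer_instance

theorem measurePreserving_fst_limitMeasure (hρ : 0 < ρ) (π : Measure ℝ) [IsProbabilityMeasure π] :
    MeasurePreserving Prod.fst (limitMeasure ρ π) (Measure.infinitePi fun _ => expMeasure ρ) := by
  have := isProbabilityMeasure_expMeasure hρ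
  exact measurePreserving_fst

theorem measurePreserving_snd_limitMeasure (hρ : 0 < ρ) (π : Measure ℝ) [IsProbabilityMeasure π] :
    MeasurePreserving Prod.snd (limitMeasure ρ π) (Measure.infinitePi fun _ => π) := by
  have := isProbabilityMeasure_expMeasure hρ
  exact measurePreserving_snd

theorem hasLaw_gap (hρ : 0 < ρ) (π : Measure ℝ) [IsProbabilityMeasure π]
    (i : ℕ) : HasLaw (fun ω => ω.1 i) (expMeasure ρ) (limitMeasure ρ π) := by
  have := isProbabilityMeasure_expMeasure hρ
  exact ((measurePreserving_eval_infinitePi (fun _ : ℕ => expMeasure ρ) i).comp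
    (measurePreserving_fst_limitMeasure hρ π)).hasLaw

theorem hasLaw_mark (hρ : 0 < ρ) (π : Measure ℝ) [IsProbabilityMeasure π]
    (i : ℕ) : HasLaw (fun ω => ω.2 i) π (limitMeasure ρ π) :=
  ((measurePreserving_eval_infinitePi (fun _ : ℕ => π) i).comp
    (measurePreserving_snd_limitMeasure hρ π)).hasLaw

theorem iIndepFun_gap (hρ : 0 < ρ) (π : Measure ℝ) [IsProbabilityMeasure π]
    : iIndepFun (fun (i : ℕ) ω => ω.1 i) (limitMeasure ρ π) := by
  have := isProbabilityMeasure_expMeasure hρ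
  have := isProbabilityMeasure_limitMeasure hρ π
  rw [iIndepFun_iff_map_fun_eq_infinitePi_map (by fun_prop)]
  simp only [(hasLaw_gap hρ π _).map_eq]
  exact (measurePreserving_fst_limitMeasure hρ π).map_eq

theorem iIndepFun_mark (hρ : 0 < ρ) (π : Measure ℝ) [IsProbabilityMeasure π]
    : iIndepFun (fun (i : ℕ) ω => ω.2 i) (limitMeasure ρ π) := by
  have := isProbabilityMeasure_limitMeasure hρ π
  rw [iIndepFun_iff_map_fun_eq_infinitePi_map (by fun_prop)]
  simp only [(hasLaw_mark hρ π _).map_eq]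
  exact (measurePreserving_snd_limitMeasure hρ π).map_eq

theorem expMeasure_Ioi_ne_zero (hρ : 0 < ρ) (K : ℝ) : expMeasure ρ (Set.Ioi K) ≠ 0 := by
  have h2 := isProbabilityMeasure_expMeasure hρ
  rw [← Set.compl_Iic, Ne, prob_compl_eq_zero_iff measurableSet_Iic]
  intro h
  have h3 := cdf_expMeasure_eq hρ K
  rw [cdf_eq_real, measureReal_def, h, ENNReal.toReal_one] at h3
  split_ifs at h3
  · linarith [Real.exp_pos (-(ρ * K))]
  · exact one_ne_zero h3

theorem ae_jumpInstant (hρ : 0 < ρ) (π : Measure ℝ) [IsProbabilityMeasure π]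
    : ∀ᵐ ω ∂(limitMeasure ρ π), ∀ n,
    jumpInstant gapCount (n + 1) ω = ENNReal.ofReal (∑ i ∈ Finset.range (n + 1), ω.1 i) := by
  have h2 := isProbabilityMeasure_expMeasure hρ
  have hnn : ∀ᵐ x ∂(expMeasure ρ), 0 ≤ x := by
    rw [← map_div_stdExp hρ]
    refine (ae_map_iff (by fun_prop) measurableSet_Ici).2 ?_
    have h1 : ∀ᵐ ξ ∂stdExp, 0 < ξ := by
      have h2 : stdExp (Set.Ioi 0) = 1 := by simpa using stdExp_Ioi le_rfl
      exact (prob_compl_eq_zero_iff measurableSet_Ioi).2 h2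
    filter_upwards [h1] with ξ hξ
    positivity
  have h3 : ∀ᵐ z ∂(Measure.infinitePi fun _ : ℕ => expMeasure ρ), ∀ i, 0 ≤ z i :=
    ae_all_iff.2 fun i => (measurePreserving_eval_infinitePi
      (fun _ : ℕ => expMeasure ρ) i).quasiMeasurePreserving.ae hnn
  have h4 : ∀ᵐ z ∂(Measure.infinitePi fun _ : ℕ => expMeasure ρ), ∀ K : ℕ, ∃ i, (K : ℝ) < z i :=
    ae_all_iff.2 fun K => ae_exists_mem (expMeasure ρ) measurableSet_Ioi
      (expMeasure_Ioi_ne_zero hρ K)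
  filter_upwards [(measurePreserving_fst_limitMeasure hρ π).quasiMeasurePreserving.ae h3,
    (measurePreserving_fst_limitMeasure hρ π).quasiMeasurePreserving.ae h4] with ω h5 h6
  exact jumpInstant_gapCount h5 h6

theorem indepFun_jumpInstant_mark (hρ : 0 < ρ) (π : Measure ℝ) [IsProbabilityMeasure π] :
    IndepFun (fun ω (n : ℕ) => jumpInstant gapCount (n + 1) ω) (fun ω (n : ℕ) => ω.2 n)
      (limitMeasure ρ π) := by
  have := isProbabilityMeasure_expMeasure hρ
  have hm : Measurable fun (z : ℕ → ℝ) (n : ℕ) =>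
      ENNReal.ofReal (∑ i ∈ Finset.range (n + 1), z i) := by fun_prop
  have h := indepFun_prod (μ := Measure.infinitePi fun _ : ℕ => expMeasure ρ)
    (ν := Measure.infinitePi fun _ : ℕ => π) hm measurable_id
  refine IndepFun.congr h ?_ EventuallyEq.rfl
  filter_upwards [ae_jumpInstant hρ π] with ω hω
  exact funext fun n => (hω n).symm

theorem map_gap_mark (hρ : 0 < ρ) (π : Measure ℝ) [IsProbabilityMeasure π] (m : ℕ) :
    (limitMeasure ρ π).map (fun ω (k : Fin m) => (ω.1 k, ω.2 k)) =
      Measure.pi fun _ : Fin m => (expMeasure ρ).prod π := by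
  have := isProbabilityMeasure_expMeasure hρ
  have h1 := (measurePreserving_arrowProdEquivProdArrow ℝ ℝ (Fin m) (fun _ => expMeasure ρ)
    (fun _ => π)).symm.map_eq
  rw [← h1, ← infinitePi_map_fin, ← infinitePi_map_fin,
    Measure.map_prod_map _ _ (by fun_prop) (by fun_prop), Measure.map_map (by fun_prop) (by fun_prop)]
  rfl

theorem map_jumpInstant_mark (hρ : 0 < ρ) (π : Measure ℝ) [IsProbabilityMeasure π] (m : ℕ) :
    (limitMeasure ρ π).map (fun ω (k : Fin m) =>
        (jumpInstant gapCount (k + 1) ω, ENNReal.ofReal (ω.2 k))) =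
      (Measure.pi fun _ : Fin m => (expMeasure ρ).prod π).map (toExtended m ∘ sumMap m) := by
  rw [← map_gap_mark hρ π m, Measure.map_map ((continuous_toExtended m).comp
    (continuous_sumMap m)).measurable (by fun_prop)]
  refine Measure.map_congr ?_
  filter_upwards [ae_jumpInstant hρ π] with ω hω
  funext k
  rw [hω]
  show _ = toExtended m (sumMap m fun k => (fun i => (ω.1 i, ω.2 i)) k) k
  simp only [toExtended, sumMap_apply (fun i => (ω.1 i, ω.2 i))]

theorem aemeasurable_jumpInstant_mark (hρ : 0 < ρ) (π : Measure ℝ) [IsProbabilityMeasure π]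
    (m : ℕ) :
    AEMeasurable (fun (ω : (ℕ → ℝ) × (ℕ → ℝ)) (k : Fin m) =>
      (jumpInstant gapCount (k + 1) ω, ENNReal.ofReal (ω.2 k))) (limitMeasure ρ π) := by
  refine ⟨fun ω k => (ENNReal.ofReal (∑ i ∈ Finset.range (k + 1), ω.1 i), ENNReal.ofReal (ω.2 k)),
    by fun_prop, ?_⟩
  filter_upwards [ae_jumpInstant hρ π] with ω hω
  funext k
  rw [hω]

end LimitSpace

/-- Convergence in distribution of the discovery times and depths of the first deep traps, from
their approximation by the visits of an i.i.d. sequence. -/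
theorem tendsto_map_traps {L σ : ℕ → ℝ} {κ : ℝ} (hκ : 0 < κ) {δ : ℝ} (hδ : 0 < δ)
    (hL : Tendsto L atTop atTop) (hσ : Tendsto σ atTop atTop)
    (hv : Tendsto (fun N => √(2 * L N) / σ N) atTop (𝓝 κ)) (m : ℕ)
    {Θ : ℕ → Type*} [∀ N, MeasurableSpace (Θ N)] {μ : ∀ N, Measure (Θ N)}
    [∀ N, IsProbabilityMeasure (μ N)]
    {W : ∀ N, Θ N → ℕ → ℕ × ℝ} (hWm : ∀ N, Measurable (W N))
    (hW : ∀ N, posGaussian (deepSet (σ N) (Real.exp (σ N * level (L N))) δ) ≠ 0 →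
      (μ N).map (W N) = Measure.infinitePi fun _ =>
        gapMarkLaw posGaussian (deepSet (σ N) (Real.exp (σ N * level (L N))) δ))
    {Y : ∀ N, Θ N → Fin m → ℝ≥0∞ × ℝ≥0∞} (hY : ∀ N, AEMeasurable (Y N) (μ N))
    {R : ℕ → ProbabilityMeasure (Fin m → ℝ≥0∞ × ℝ≥0∞)}
    (hR : ∀ N, (R N : Measure (Fin m → ℝ≥0∞ × ℝ≥0∞)) = (μ N).map (Y N))
    {Λ : ProbabilityMeasure (Fin m → ℝ≥0∞ × ℝ≥0∞)}
    (hΛ : (Λ : Measure (Fin m → ℝ≥0∞ × ℝ≥0∞)) =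
      (Measure.pi fun _ : Fin m => (expMeasure (δ ^ (-κ))).prod (paretoMeasure δ κ)).map
        (toExtended m ∘ sumMap m))
    (h : ∀ ε > 0, ∀ C : ℝ, Tendsto (fun N => μ N {q |
      dist (sumMap m fun k => rescaled (Real.exp (L N)) (σ N) (Real.exp (σ N * level (L N)))
        (W N q k)) 0 < C ∧
      ¬ ∃ e, Y N q = toExtended m e ∧
        dist (sumMap m fun k => rescaled (Real.exp (L N)) (σ N) (Real.exp (σ N * level (L N)))
          (W N q k)) e ≤ ε}) atTop (𝓝 0)) :
    Tendsto R atTop (𝓝 Λ) := by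
  obtain ⟨hne, hlim⟩ := tendsto_rescaledLaw hκ hδ hL hσ hv
  have hsm := (continuous_sumMap m).measurable
  have h1 := ((ProbabilityMeasure.continuous_pi (ι := Fin m)).tendsto
    (fun _ => limitLaw hκ hδ)).comp (tendsto_pi_nhds.2 fun _ => hlim)
  have h2 := ProbabilityMeasure.tendsto_map_of_tendsto_of_continuous _ _ h1 (continuous_sumMap m)
  have hZm : ∀ N, Measurable fun q => sumMap m fun k =>
      rescaled (Real.exp (L N)) (σ N) (Real.exp (σ N * level (L N))) (W N q k) := fun N =>
    hsm.comp (measurable_pi_lambda _ fun k => (measurable_rescaled _ _ _).comp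
      ((measurable_pi_apply _).comp (hWm N)))
  have h3 := tendsto_map_of_approx (fun N => (hZm N).aemeasurable) h2 ?_ hY hR
    (continuous_toExtended m) 0 h
  · convert h3 using 2
    refine Subtype.ext ?_
    refine hΛ.trans ?_
    rw [← Measure.map_map (continuous_toExtended m).measurable hsm]
    rfl
  · filter_upwards [hne] with N hN
    have hgp := isProbabilityMeasure_gapMarkLaw posGaussian
      (measurableSet_deepSet (σ N) (Real.exp (σ N * level (L N))) δ)
    have hrm := measurable_rescaled (Real.exp (L N)) (σ N) (Real.exp (σ N * level (L N)))
    have e1 : (μ N).map (fun q (k : Fin m) =>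
        rescaled (Real.exp (L N)) (σ N) (Real.exp (σ N * level (L N))) (W N q k)) =
        Measure.pi fun _ : Fin m => (rescaledLaw (L N) (σ N) δ : Measure (ℝ × ℝ)) := by
      have e2 : (fun q (k : Fin m) =>
          rescaled (Real.exp (L N)) (σ N) (Real.exp (σ N * level (L N))) (W N q k)) =
          (fun (x : Fin m → ℕ × ℝ) k =>
            rescaled (Real.exp (L N)) (σ N) (Real.exp (σ N * level (L N))) (x k)) ∘
          (fun (z : ℕ → ℕ × ℝ) (k : Fin m) => z k) ∘ W N := rfl
      rw [e2, ← Measure.map_map (by fun_prop) (by fun_prop), ← Measure.map_map (by fun_prop) (hWm N),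
        hW N hN, infinitePi_map_fin, Measure.pi_map_pi fun _ => hrm.aemeasurable]
      rfl
    show (Measure.pi fun _ : Fin m => (rescaledLaw (L N) (σ N) δ : Measure (ℝ × ℝ))).map (sumMap m) = _
    have hm : Measurable fun q (k : Fin m) =>
        rescaled (Real.exp (L N)) (σ N) (Real.exp (σ N * level (L N))) (W N q k) :=
      measurable_pi_lambda _ fun k => hrm.comp ((measurable_pi_apply (k : ℕ)).comp (hWm N))
    rw [← e1, Measure.map_map hsm hm]
    rfl

end

/-! ### From the trap indices and times to the visits of an i.i.d. sequence -/

section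

variable {N : ℕ}

/-! ### Measurability of the deep traps -/

theorem measurableSet_mem_deepIndices (β a δ B : ℝ) (o : BallOrder N) (i : ℕ) :
    MeasurableSet {ω : Sample N | i ∈ deepIndices β a δ B o ω} := by
  have h : Measurable fun ω : Sample N => depth β ω (explored a o ω i) := by
    refine measurable_comp_countable (F := fun (x : Cube N) (ω : Sample N) => depth β ω x)
      (fun x => ?_) (measurable_sites a o (i - 1))
    unfold depth energy
    fun_prop
  exact (MeasurableSet.const _).inter ((MeasurableSet.const _).inter
    (measurableSet_le measurable_const h))

/-- The index is a function of finitely many measurable conditions, one for each rank up to `2 ^ N`;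
measurability of the depth and of the time follows by conditioning on their values. -/
theorem exists_measurable_trapIndex (β a δ B : ℝ) (o : BallOrder N) (n : ℕ) :
    ∃ (f : Sample N → Fin (2 ^ N + 1) → Prop) (g : (Fin (2 ^ N + 1) → Prop) → ℕ∞),
      Measurable f ∧ ∀ ω, trapIndex β a δ B o ω n = g (f ω) := by
  refine ⟨fun ω j => (j : ℕ) ∈ deepIndices β a δ B o ω, fun c =>
    if n ≤ {i : ℕ | ∃ h : i < 2 ^ N + 1, c ⟨i, h⟩}.ncard
    then ((Nat.nth (fun i => i ∈ {i : ℕ | ∃ h : i < 2 ^ N + 1, c ⟨i, h⟩}) (n - 1) : ℕ) : ℕ∞)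
    else ⊤, measurable_pi_lambda _ fun j => measurableSet_setOfPred.1
      (measurableSet_mem_deepIndices β a δ B o j), fun ω => ?_⟩
  have e : deepIndices β a δ B o ω =
      {i : ℕ | ∃ h : i < 2 ^ N + 1, i ∈ deepIndices β a δ B o ω} := by
    ext i
    constructor
    · intro h
      exact ⟨Nat.lt_succ_of_le h.2.1, h⟩
    · rintro ⟨-, h⟩
      exact h
  show trapIndex β a δ B o ω n =
    if n ≤ {i : ℕ | ∃ h : i < 2 ^ N + 1, i ∈ deepIndices β a δ B o ω}.ncard
    then ((Nat.nth (fun i => i ∈ {i : ℕ | ∃ h : i < 2 ^ N + 1, i ∈ deepIndices β a δ B o ω})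
      (n - 1) : ℕ) : ℕ∞)
    else ⊤
  rw [← e]
  rfl

theorem measurable_trapDepth (β a δ B : ℝ) (o : BallOrder N) (n : ℕ) :
    Measurable fun ω : Sample N => trapDepth β a δ B o ω n := by
  obtain ⟨f, g, hf, hg⟩ := exists_measurable_trapIndex β a δ B o n
  unfold trapDepth
  simp only [hg]
  refine measurable_comp_countable (F := fun (c : Fin (2 ^ N + 1) → Prop) (ω : Sample N) =>
    if g c = ⊤ then (⊤ : ℝ≥0∞)
    else ENNReal.ofReal (depth β ω (explored a o ω (g c).toNat))) (fun c => ?_) hf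
  split_ifs
  · exact measurable_const
  · refine ENNReal.measurable_ofReal.comp ?_
    refine measurable_comp_countable (F := fun (x : Cube N) (ω : Sample N) => depth β ω x)
      (fun x => ?_) (measurable_sites a o ((g c).toNat - 1))
    unfold depth energy
    fun_prop

/-- The number of discovered sites is nondecreasing in time, so rational times give the same
infimum, which is then measurable. -/
theorem iInf_card_disc_eq (a : ℝ) (c : ℕ∞) (ω : Sample N) :
    (⨅ (t : ℝ≥0) (_ : c ≤ ((disc a t ω).card : ℕ∞)), (t : ℝ≥0∞)) =
      ⨅ q : ℚ, if c ≤ ((disc a (Real.toNNReal q) ω).card : ℕ∞) then (Real.toNNReal q : ℝ≥0∞)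
        else ⊤ := by
  refine le_antisymm (le_iInf fun q => ?_) (le_iInf₂ fun t ht => ?_)
  · split_ifs with h
    · exact iInf₂_le (f := fun (t : ℝ≥0) (_ : c ≤ ((disc a t ω).card : ℕ∞)) => (t : ℝ≥0∞)) _ h
    · exact le_top
  · refine le_of_forall_gt fun x hx => ?_
    obtain ⟨q, -, hq1, hq2⟩ := ENNReal.lt_iff_exists_rat_btwn.1 hx
    refine lt_of_le_of_lt (iInf_le _ q) ?_
    rw [if_pos]
    · exact hq2
    · refine ht.trans ?_
      exact_mod_cast Finset.card_le_card (disc_mono a ω (by exact_mod_cast hq1.le))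

theorem aemeasurable_trapTime (β a δ B : ℝ) (o : BallOrder N) (n : ℕ) :
    AEMeasurable (fun ω : Sample N => trapTime β a δ B o ω n) (annealed N) := by
  obtain ⟨f, g, hf, hg⟩ := exists_measurable_trapIndex β a δ B o n
  refine ⟨fun ω => ⨅ q : ℚ, if g (f ω) ≤ ((disc a (Real.toNNReal q) ω).card : ℕ∞)
    then (Real.toNNReal q : ℝ≥0∞) else ⊤, ?_, ?_⟩
  · refine Measurable.iInf fun q => ?_
    refine measurable_comp_countable (F := fun (c : Fin (2 ^ N + 1) → Prop) (ω : Sample N) =>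
      if g c ≤ ((disc a (Real.toNNReal q) ω).card : ℕ∞) then (Real.toNNReal q : ℝ≥0∞)
        else ⊤) (fun c => ?_) hf
    exact (measurable_from_top (f := fun S : Finset (Cube N) =>
      if g c ≤ (S.card : ℕ∞) then (Real.toNNReal q : ℝ≥0∞) else ⊤)).comp (measurable_disc a _)
  · filter_upwards [ae_good_annealed a] with ω hω
    rw [← iInf_card_disc_eq, trapTime]
    simp only [hω.numDiscovered_eq, hg]

/-! ### The deep traps as visits of the deep set -/

theorem exists_ballSequence_eq {a : ℝ} {o : BallOrder N} {ω : Sample N} {u : ℝ≥0} {x : Cube N}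
    (hx : x ∈ disc a u ω) : ∃ n, ballSequence a o ω n = x := by
  obtain ⟨n, -, h⟩ := mem_disc.1 hx
  obtain ⟨i, -, hi⟩ := exists_distinct_eq (s := jumpChain a ω) (Nat.lt_succ_self n)
  have h' : hammingDist x (visited a ω i) ≤ 1 := by
    rw [visited, hi]
    exact h
  obtain ⟨r, -, hr⟩ := ballSequence_mem a o ω i h'
  exact ⟨_, hr⟩

/-- Before as many sites as have been discovered, the exploration has not been exhausted and its
`k`-th value is new, so the auxiliary sequence is not used. The shift by one comes from `explored`,
which counts from `1`. -/
theorem fieldSeq_eq_energy {a : ℝ} {o : BallOrder N} {ω : Sample N} {u : ℝ≥0} {k : ℕ}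
    (hk : k < (disc a u ω).card) (ζ : ℕ → ℝ) :
    fieldSeq a o ω ζ k = energy ω (explored a o ω (k + 1)) := by
  obtain ⟨n, hn, hj⟩ := exists_isNew_of_card (s := ballSequence a o ω)
    (fun x hx => exists_ballSequence_eq hx) hk
  rw [fieldSeq, if_neg]
  · rfl
  · rintro ⟨i, hi, h⟩
    exact distinct_ne hn hj hi h

theorem card_disc_le_two_pow (a : ℝ) (u : ℝ≥0) (ω : Sample N) : (disc a u ω).card ≤ 2 ^ N := by
  refine (Finset.card_le_univ _).trans ?_
  simp [ZMod.card]

/-- As long as the rank does not exceed the number of sites discovered at time `u`, the exploration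
reads genuine energies, and a deep trap is exactly a visit of the deep set by `fieldSeq`. -/
theorem trapIndex_eq_visitRank {β a δ B : ℝ} {o : BallOrder N} {ω : Sample N} {u : ℝ≥0}
    {ζ : ℕ → ℝ} (hrec : Recurrent (deepSet (β * √(N : ℝ)) B δ) (fieldSeq a o ω ζ)) {k : ℕ}
    (hk : visitRank (deepSet (β * √(N : ℝ)) B δ) (fieldSeq a o ω ζ) (k + 1) ≤ (disc a u ω).card) :
    trapIndex β a δ B o ω (k + 1) =
        (visitRank (deepSet (β * √(N : ℝ)) B δ) (fieldSeq a o ω ζ) (k + 1) : ℕ) ∧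
      trapDepth β a δ B o ω (k + 1) = ENNReal.ofReal (Real.exp (β * √(N : ℝ) *
        (gapMark (deepSet (β * √(N : ℝ)) B δ)
          ((afterFirst (deepSet (β * √(N : ℝ)) B δ))^[k] (fieldSeq a o ω ζ))).2)) := by
  classical
  set S := deepSet (β * √(N : ℝ)) B δ with hS
  set z := fieldSeq a o ω ζ with hz
  set D := deepIndices β a δ B o ω with hD
  set M := (disc a u ω).card with hM
  have hM2 : M ≤ 2 ^ N := card_disc_le_two_pow a u ω
  obtain ⟨r, hr⟩ : ∃ r, visitRank S z (k + 1) = r + 1 := ⟨_, visitRank_succ S z k⟩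
  have hmem := hrec.mem k
  have hcount := hrec.count_pred_eq k
  rw [hr] at hk hmem hcount ⊢
  rw [Nat.add_sub_cancel] at hmem hcount
  have hiff : ∀ i < M, i + 1 ∈ D ↔ z i ∈ S := by
    intro i hi
    rw [hz, fieldSeq_eq_energy hi ζ]
    constructor
    · intro h
      exact h.2.2
    · intro h
      exact ⟨Nat.succ_pos _, by omega, h⟩
  have hrD : r + 1 ∈ D := (hiff r (by omega)).2 hmem.1
  have h0 : (0 : ℕ) ∉ D := fun h => absurd h.1 (by norm_num)
  have hcD : Nat.count (fun i => i ∈ D) (r + 1) = k := by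
    -- Indices of traps start at `1` and those of visits at `0`: `0` is never a trap index, so the
    -- traps before `r + 1` are the visits before `r`.
    rw [Nat.count_succ', if_neg h0, add_zero, ← hcount, Nat.count_eq_card_filter_range,
      Nat.count_eq_card_filter_range]
    congr 1
    refine Finset.filter_congr fun i hi => hiff i ?_
    have := Finset.mem_range.1 hi
    omega
  have hfin : D.Finite := (Set.finite_Iic (2 ^ N)).subset fun i hi => hi.2.1
  have hnc : k + 1 ≤ D.ncard := by
    have h1 : Nat.count (fun i => i ∈ D) (r + 2) = k + 1 := by
      rw [Nat.count_succ, hcD, if_pos hrD]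
    rw [← h1, Nat.count_eq_card_filter_range, ← Set.ncard_coe_finset]
    exact Set.ncard_le_ncard (fun i hi => (Finset.mem_filter.1 (Finset.mem_coe.1 hi)).2) hfin
  have hidx : trapIndex β a δ B o ω (k + 1) = ((r + 1 : ℕ) : ℕ∞) := by
    rw [trapIndex, if_pos hnc, Nat.add_sub_cancel]
    congr 1
    have := Nat.nth_count (p := fun i => i ∈ D) hrD
    rwa [hcD] at this
  refine ⟨hidx, ?_⟩
  rw [trapDepth, hidx, if_neg (ENat.natCast_ne_top _), ENat.toNat_natCast, depth,
    ← fieldSeq_eq_energy (u := u) (by omega) ζ, ← hmem.2]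

/-- The first time when a nondecreasing function exceeds a level, when the function is close to a
linear one on a grid. -/
theorem abs_firstTime_sub_le {f : ℝ≥0 → ℕ} {t η : ℝ≥0} {d C : ℝ} (ht : 0 < t)
    (hη : 0 < η) (hd : 0 < d) {J : ℕ} (hJ : C / η + 3 ≤ J)
    (hgrid : ∀ j ≤ J, |(f (j * η * t) : ℝ) / d - j * η| ≤ η) {r : ℕ} (hr : (r : ℝ) / d < C)
    (hf : Monotone f) :
    (⨅ (u : ℝ≥0) (_ : (r : ℕ∞) ≤ (f u : ℕ∞)), (u : ℝ≥0∞)) / t ≠ ⊤ ∧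
      |((⨅ (u : ℝ≥0) (_ : (r : ℕ∞) ≤ (f u : ℕ∞)), (u : ℝ≥0∞)) / t).toReal - r / d| ≤ 2 * η := by
  set T : ℝ≥0∞ := ⨅ (u : ℝ≥0) (_ : (r : ℕ∞) ≤ (f u : ℕ∞)), (u : ℝ≥0∞) with hT
  have hη' : (0 : ℝ) < η := hη
  set x : ℝ := r / d with hx
  have hx0 : 0 ≤ x := by positivity
  have hrx : (r : ℝ) = x * d := by rw [hx]; field_simp
  -- At grid point `c + 1` the function has passed `x` in spite of the error `η`; at grid point `c -
  -- 2` it has not reached it yet. These two points give the error `2 η`, and `c + 1 ≤ J` uses the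
  -- margin in `hJ`.
  set c : ℕ := ⌈x / η⌉₊ with hc
  have hc1 : x ≤ c * η := by
    rw [← div_le_iff₀ hη']
    exact Nat.le_ceil _
  have hc2 : (c : ℝ) * η < x + η := by
    have h1 := Nat.ceil_lt_add_one (show 0 ≤ x / η by positivity)
    have h2 := mul_lt_mul_of_pos_right h1 hη'
    have h3 : (x / η + 1) * η = x + η := by field_simp
    rw [h3] at h2
    exact h2
  have hcJ : c + 1 ≤ J := by
    have h1 := Nat.ceil_lt_add_one (show 0 ≤ x / η by positivity)
    have h2 : x / η < C / η := div_lt_div_of_pos_right hr hη'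
    have h3 : ((c + 1 : ℕ) : ℝ) ≤ J := by
      push_cast
      linarith
    exact_mod_cast h3
  have hup : T ≤ (((c + 1 : ℕ) * η * t : ℝ≥0) : ℝ≥0∞) := by
    refine iInf₂_le _ ?_
    have h1 := (abs_le.1 (hgrid (c + 1) hcJ)).1
    have h2 : x ≤ (f ((c + 1 : ℕ) * η * t) : ℝ) / d := by
      push_cast at h1 ⊢
      linarith
    rw [le_div_iff₀ hd, ← hrx] at h2
    exact_mod_cast h2
  have hTt : T / t ≤ (((c + 1 : ℕ) * η : ℝ≥0) : ℝ≥0∞) := by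
    refine ENNReal.div_le_of_le_mul ?_
    exact_mod_cast hup
  have hne : T / t ≠ ⊤ := ne_top_of_le_ne_top ENNReal.coe_ne_top hTt
  refine ⟨hne, abs_le.2 ⟨?_, ?_⟩⟩
  -- For `c < 2` one has `x ≤ η` and the lower bound holds because times are nonnegative.
  · rcases Nat.lt_or_ge c 2 with hlt | hge
    · have h1 : (c : ℝ) ≤ 1 := by exact_mod_cast Nat.lt_succ_iff.1 hlt
      have h2 : (0 : ℝ) ≤ (T / t).toReal := ENNReal.toReal_nonneg
      nlinarith
    · obtain ⟨e, he⟩ := Nat.exists_eq_add_of_le' hge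
      have hlow : ((e * η * t : ℝ≥0) : ℝ≥0∞) ≤ T := by
        refine le_iInf₂ fun u hu => ?_
        by_contra hlt
        have h1 : f u ≤ f (e * η * t) := hf (by exact_mod_cast (not_le.1 hlt).le)
        have h2 := (abs_le.1 (hgrid e (by omega))).2
        have h3 : r ≤ f (e * η * t) := le_trans (by exact_mod_cast hu) h1
        have h4 : x ≤ (f (e * η * t) : ℝ) / d := by
          rw [le_div_iff₀ hd, ← hrx]
          exact_mod_cast h3
        rw [he] at hc2
        push_cast at hc2
        linarith
      have h5 : ((e * η : ℝ≥0) : ℝ≥0∞) ≤ T / t := by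
        rw [ENNReal.le_div_iff_mul_le (Or.inl (by exact_mod_cast ht.ne')) (Or.inl ENNReal.coe_ne_top)]
        exact_mod_cast hlow
      have h6 := ENNReal.toReal_mono hne h5
      rw [ENNReal.coe_toReal] at h6
      rw [he] at hc1
      push_cast at h6 hc1
      linarith
  · have h6 := ENNReal.toReal_mono ENNReal.coe_ne_top hTt
    rw [ENNReal.coe_toReal] at h6
    push_cast at h6
    linarith

end

section

variable {N : ℕ}

/-! ### Convergence -/

theorem aemeasurable_rescaledTraps (β a δ B : ℝ) (t : ℝ≥0) (o : BallOrder N) (m : ℕ) :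
    AEMeasurable (fun (ω : Sample N) (k : Fin m) =>
      (trapTime β a δ B o ω (k + 1) / (t : ℝ≥0∞), trapDepth β a δ B o ω (k + 1) / ENNReal.ofReal B))
      (annealed N) :=
  aemeasurable_pi_lambda _ fun _ =>
    ((aemeasurable_trapTime β a δ B o _).div_const _).prodMk
      ((measurable_trapDepth β a δ B o _).aemeasurable.div_const _)

/-- The partial sums of the rescaled gaps are the ranks divided by `d`, and the marks are the exact
depths; the only error comes from replacing a rank divided by `d` by a time divided by `t`, which
the grid estimate controls. -/
theorem exists_toExtended_eq {β a δ B d C : ℝ} {o : BallOrder N} {ω : Sample N} {ζ : ℕ → ℝ}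
    {t η : ℝ≥0} {J m : ℕ} (hω : Good a ω)
    (hrec : Recurrent (deepSet (β * √(N : ℝ)) B δ) (fieldSeq a o ω ζ))
    (ht : 0 < t) (hη : 0 < η) (hd : 0 < d) (hB : 0 < B) (hJ : C / η + 3 ≤ J)
    (hgrid : ∀ j ≤ J, |(numDiscovered a ω (j * η * t) : ℝ) / d - j * η| ≤ η)
    (hC : dist (sumMap m fun k => rescaled d (β * √(N : ℝ)) B (gapMark (deepSet (β * √(N : ℝ)) B δ)
      ((afterFirst (deepSet (β * √(N : ℝ)) B δ))^[k] (fieldSeq a o ω ζ)))) 0 < C) :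
    ∃ e, (fun k : Fin m => (trapTime β a δ B o ω (k + 1) / (t : ℝ≥0∞),
        trapDepth β a δ B o ω (k + 1) / ENNReal.ofReal B)) = toExtended m e ∧
      dist (sumMap m fun k => rescaled d (β * √(N : ℝ)) B (gapMark (deepSet (β * √(N : ℝ)) B δ)
        ((afterFirst (deepSet (β * √(N : ℝ)) B δ))^[k] (fieldSeq a o ω ζ)))) e ≤ 2 * η := by
  set S := deepSet (β * √(N : ℝ)) B δ with hS
  set z := fieldSeq a o ω ζ with hz
  set Z := sumMap m fun k => rescaled d (β * √(N : ℝ)) B (gapMark S ((afterFirst S)^[k] z)) with hZ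
  have hZk : ∀ k : Fin m, Z k = ((visitRank S z (k + 1) : ℝ) / d,
      Real.exp (β * √(N : ℝ) * (gapMark S ((afterFirst S)^[k] z)).2) / B) := by
    intro k
    rw [hZ, sumMap_apply fun i => rescaled d (β * √(N : ℝ)) B (gapMark S ((afterFirst S)^[i] z))]
    simp only [rescaled, ← Finset.sum_div, visitRank]
    push_cast
    rfl
  have hCk : ∀ k : Fin m, (visitRank S z (k + 1) : ℝ) / d < C := by
    intro k
    refine lt_of_le_of_lt ?_ hC
    refine le_trans ?_ (dist_le_pi_dist Z 0 k)
    rw [hZk, Pi.zero_apply, Prod.dist_eq]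
    refine le_max_of_le_left ?_
    rw [Prod.fst_zero, Real.dist_eq, sub_zero]
    exact le_abs_self _
  have hη' : (0 : ℝ) < η := hη
  -- At the last grid point more than `C d` sites are discovered, so the first `m` traps are already
  -- among them and no infinite value occurs.
  have hcard : ∀ k : Fin m, visitRank S z (k + 1) ≤ (disc a (J * η * t) ω).card := by
    intro k
    have h1 := (abs_le.1 (hgrid J le_rfl)).1
    rw [hω.numDiscovered_eq] at h1
    have h2 : C + 3 * η ≤ J * η := by
      have h3 := mul_le_mul_of_nonneg_right hJ hη'.le
      have h4 : (C / η + 3) * η = C + 3 * η := by field_simp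
      linarith
    have h3 := (hCk k).le.trans (show C ≤ ((disc a (J * η * t) ω).card : ℝ) / d by linarith)
    rw [div_le_div_iff_of_pos_right hd] at h3
    exact_mod_cast h3
  have hmono : Monotone fun u => numDiscovered a ω u := fun u v huv => by
    simp only [hω.numDiscovered_eq]
    exact Finset.card_le_card (disc_mono a ω huv)
  have key := fun k : Fin m => abs_firstTime_sub_le ht hη hd hJ hgrid (hCk k) hmono
  have htime : ∀ k : Fin m, trapTime β a δ B o ω (k + 1) =
      ⨅ (u : ℝ≥0) (_ : (visitRank S z (k + 1) : ℕ∞) ≤ (numDiscovered a ω u : ℕ∞)), (u : ℝ≥0∞) :=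
    fun k => by rw [trapTime, (trapIndex_eq_visitRank hrec (hcard k)).1]
  refine ⟨fun k => ((trapTime β a δ B o ω (k + 1) / (t : ℝ≥0∞)).toReal, (Z k).2), ?_, ?_⟩
  · funext k
    refine Prod.ext ?_ ?_
    · show _ = ENNReal.ofReal _
      rw [ENNReal.ofReal_toReal]
      rw [htime k]
      exact (key k).1
    · show _ = ENNReal.ofReal (Z k).2
      rw [hZk, ENNReal.ofReal_div_of_pos hB, (trapIndex_eq_visitRank hrec (hcard k)).2]
  · refine (dist_pi_le_iff (by positivity)).2 fun k => ?_
    rw [Prod.dist_eq, dist_self, max_le_iff]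
    refine ⟨?_, by positivity⟩
    rw [hZk, htime k, dist_comm, Real.dist_eq]
    exact (key k).2

theorem tendsto_measure_grid {cbar abar : ℝ} {a : ℕ → ℝ} {t : ℕ → ℝ≥0}
    (hc0 : 0 < cbar) (hc1 : cbar < Real.log 2)
    (ha : ∀ᶠ N : ℕ in atTop, 1 ≤ a N ∧ a N ≤ abar * √(2 * Real.log (N : ℝ)))
    (ht : (fun N : ℕ => Real.log (t N : ℝ)) ~[atTop] (fun N : ℕ => cbar * (N : ℝ)))
    {η : ℝ≥0} (hη : 0 < η) (J : ℕ) :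
    Tendsto (fun N => annealed N {ω | ¬ ∀ j ≤ J, |(numDiscovered (a N) ω (j * η * t N) : ℝ) /
      dScale N (a N) (t N) - j * η| ≤ η}) atTop (𝓝 0) := by
  obtain ⟨-, -, hconv⟩ := tendsto_integral_abs_numDiscovered hc0 hc1 ha ht
  have hη' : (0 : ℝ) < η := hη
  have hint : ∀ N (u : ℝ≥0) (s : ℝ), Integrable (fun ω : Sample N =>
      |(numDiscovered (a N) ω u : ℝ) / dScale N (a N) (t N) - s|) (annealed N) := fun N u s => by
    have h : Integrable (fun ω : Sample N => (numDiscovered (a N) ω u : ℝ)) (annealed N) := by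
      refine (integrable_comp_finset (μ := annealed N) (measurable_disc (a N) u)
        (fun S => (S.card : ℝ))).congr ?_
      filter_upwards [ae_good_annealed (a N)] with ω hω
      rw [hω.numDiscovered_eq]
    exact ((h.div_const _).sub (integrable_const _)).abs
  have hlim : Tendsto (fun N => ∑ j ∈ Finset.range (J + 1), ENNReal.ofReal
      ((∫ ω, |(numDiscovered (a N) ω (j * η * t N) : ℝ) / dScale N (a N) (t N) - (j * η : ℝ≥0)|
        ∂annealed N) / η)) atTop (𝓝 0) := by
    have h0 : (0 : ℝ≥0∞) = ∑ j ∈ Finset.range (J + 1), ENNReal.ofReal (0 / η) := by simp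
    rw [h0]
    refine tendsto_finsetSum _ fun j _ => ?_
    exact (ENNReal.continuous_ofReal.tendsto _).comp ((hconv (j * η)).div_const _)
  refine tendsto_of_tendsto_of_tendsto_of_le_of_le tendsto_const_nhds hlim (fun _ => zero_le) fun N => ?_
  have hsub : {ω : Sample N | ¬ ∀ j ≤ J, |(numDiscovered (a N) ω (j * η * t N) : ℝ) /
      dScale N (a N) (t N) - j * η| ≤ η} ⊆ ⋃ j ∈ Finset.range (J + 1),
      {ω | (η : ℝ) ≤ |(numDiscovered (a N) ω (j * η * t N) : ℝ) / dScale N (a N) (t N) -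
        (j * η : ℝ≥0)|} := by
    intro ω hω
    simp only [Set.mem_ofPred_eq, not_forall] at hω
    obtain ⟨j, hj, hlt⟩ := hω
    refine Set.mem_biUnion (Finset.mem_coe.2 (Finset.mem_range.2 (Nat.lt_succ_of_le hj))) ?_
    simp only [Set.mem_ofPred_eq]
    push_cast
    exact (not_le.1 hlt).le
  refine (measure_mono hsub).trans ((measure_biUnion_finset_le _ _).trans
    (Finset.sum_le_sum fun j _ => ?_))
  rw [← ofReal_measureReal]
  refine ENNReal.ofReal_le_ofReal ?_
  rw [le_div_iff₀ hη', mul_comm]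
  exact mul_meas_ge_le_integral_of_nonneg (ae_of_all _ fun _ => abs_nonneg _) (hint N _ _) _

theorem tendsto_sqrt_log_div {β cbar : ℝ} {L : ℕ → ℝ}
    (hL : Tendsto (fun N : ℕ => L N / N) atTop (𝓝 cbar)) :
    Tendsto (fun N : ℕ => √(2 * L N) / (β * √(N : ℝ))) atTop (𝓝 (√(2 * cbar) / β)) := by
  have h := ((Real.continuous_sqrt.tendsto _).comp (hL.const_mul 2)).div_const β
  refine h.congr' ?_
  filter_upwards [eventually_gt_atTop 0] with N hN
  have hN' : (0 : ℝ) < N := by exact_mod_cast hN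
  show √(2 * (L N / N)) / β = _
  rw [← mul_div_assoc, Real.sqrt_div' _ hN'.le, div_div, mul_comm β]

end

end RandomTraps

end

/-! ### Assembly of the limit theorem -/

theorem propositionp
    (β cbar abar δ : ℝ) (hβ : 0 < β)
    (hc0 : 0 < cbar) (hc1 : cbar < Real.log 2)
    (habar : abar < 1 / 20) (hδ : 0 < δ)
    (a : ℕ → ℝ)
    (ha : ∀ᶠ N : ℕ in atTop, 1 ≤ a N ∧ a N ≤ abar * √(2 * Real.log (N : ℝ)))
    (t : ℕ → ℝ≥0)
    (ht : (fun N : ℕ => Real.log (t N : ℝ)) ~[atTop] (fun N : ℕ => cbar * (N : ℝ)))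
    (o : ∀ N : ℕ, BallOrder N) :
    ∃ (Ω : Type) (_ : MeasurableSpace Ω) (P : Measure Ω) (_ : IsProbabilityMeasure P)
      (M : ℝ≥0 → Ω → ℕ) (τ : ℕ → Ω → ℝ),
      IsPoissonProcess P (δ ^ (-(√(2 * cbar) / β))) M ∧
      (∀ n, HasLaw (τ n) (paretoMeasure δ (√(2 * cbar) / β)) P) ∧
      iIndepFun τ P ∧
      IndepFun (fun ω (n : ℕ) => jumpInstant M (n + 1) ω) (fun ω (n : ℕ) => τ n ω) P ∧
      ∀ m : ℕ,
        TendstoInDistribution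
          (fun (N : ℕ) (ω : Sample N) (k : Fin m) =>
            (trapTime β (a N) δ (BScale N β (a N) (t N)) (o N) ω (k + 1) / (t N : ℝ≥0∞),
              trapDepth β (a N) δ (BScale N β (a N) (t N)) (o N) ω (k + 1) /
                ENNReal.ofReal (BScale N β (a N) (t N))))
          atTop
          (fun (ω : Ω) (k : Fin m) =>
            (jumpInstant M (k + 1) ω, ENNReal.ofReal (τ k ω)))
          annealed P := by
  have hκ : 0 < √(2 * cbar) / β := div_pos (Real.sqrt_pos.2 (by linarith)) hβ
  set κ := √(2 * cbar) / β with hκdef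
  have hρ : 0 < δ ^ (-κ) := Real.rpow_pos_of_pos hδ _
  have hpar := isProbabilityMeasure_paretoMeasure hδ hκ
  have hprob := isProbabilityMeasure_limitMeasure hρ (paretoMeasure δ κ)
  refine ⟨(ℕ → ℝ) × (ℕ → ℝ), inferInstance, limitMeasure (δ ^ (-κ)) (paretoMeasure δ κ), hprob,
    gapCount, fun n ω => ω.2 n,
    ⟨fun i ω => ω.1 i, hasLaw_gap hρ _, iIndepFun_gap hρ _, ae_of_all _ fun ω u => rfl⟩,
    hasLaw_mark hρ _, iIndepFun_mark hρ _, indepFun_jumpInstant_mark hρ _, fun m => ?_⟩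
  obtain ⟨hdpos, hdlog, -⟩ := tendsto_integral_abs_numDiscovered hc0 hc1 ha ht
  obtain ⟨htpos, -⟩ := eventually_time_pos hc0 ht
  set d : ℕ → ℝ := fun N => dScale N (a N) (t N) with hd
  set L : ℕ → ℝ := fun N => Real.log (d N) with hL
  set σ : ℕ → ℝ := fun N => β * √(N : ℝ) with hσ
  set B : ℕ → ℝ := fun N => BScale N β (a N) (t N) with hB
  have hBpos : ∀ N, 0 < B N := fun N => Real.exp_pos _
  have hLt : Tendsto L atTop atTop := by
    refine (hdlog.pos_mul_atTop hc0 tendsto_natCast_atTop_atTop).congr' ?_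
    filter_upwards [eventually_gt_atTop 0] with N hN
    exact div_mul_cancel₀ _ (by exact_mod_cast hN.ne')
  have hσt : Tendsto σ atTop atTop :=
    (Real.tendsto_sqrt_atTop.comp tendsto_natCast_atTop_atTop).const_mul_atTop hβ
  set S : ℕ → Set ℝ := fun N => deepSet (σ N) (B N) δ with hS
  have hSm : ∀ N, MeasurableSet (S N) := fun N => measurableSet_deepSet _ _ _
  have hY := fun N => aemeasurable_rescaledTraps β (a N) δ (B N) (t N) (o N) m
  -- The annealed law is enlarged by the auxiliary sequence that completes `fieldSeq`; the traps do
  -- not depend on it, so projecting recovers their law.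
  set μ : ∀ N, Measure (Sample N × (ℕ → ℝ)) := fun N =>
    (annealed N).prod (iidLaw posGaussian) with hμ
  have hfst : ∀ N, MeasurePreserving Prod.fst (μ N) (annealed N) := fun N => measurePreserving_fst
  have hfield : ∀ N, MeasurePreserving (fun q : Sample N × (ℕ → ℝ) => fieldSeq (a N) (o N) q.1 q.2)
      (μ N) (iidLaw posGaussian) := fun N => measurePreserving_fieldSeq (a N) (o N)
  have hseq : ∀ N, Measurable fun (z : ℕ → ℝ) (k : ℕ) => gapMark (S N) ((afterFirst (S N))^[k] z) :=
    fun N => measurable_pi_lambda _ fun k => (measurable_gapMark (hSm N)).comp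
      ((measurable_afterFirst (hSm N)).iterate k)
  obtain ⟨hne, -⟩ := tendsto_rescaledLaw hκ hδ hLt hσt (tendsto_sqrt_log_div hdlog)
  refine ⟨hY, aemeasurable_jumpInstant_mark hρ _ m, ?_⟩
  refine tendsto_map_traps hκ hδ hLt hσt (tendsto_sqrt_log_div hdlog) m (μ := μ)
    (W := fun N q k => gapMark (S N) ((afterFirst (S N))^[k] (fieldSeq (a N) (o N) q.1 q.2)))
    (fun N => (hseq N).comp (hfield N).measurable) (fun N hN => ?_)
    (Y := fun N q k => (trapTime β (a N) δ (B N) (o N) q.1 (k + 1) / (t N : ℝ≥0∞),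
      trapDepth β (a N) δ (B N) (o N) q.1 (k + 1) / ENNReal.ofReal (B N)))
    (fun N => (hY N).comp_quasiMeasurePreserving (hfst N).quasiMeasurePreserving) (fun N => ?_)
    (map_jumpInstant_mark hρ _ m) fun ε hε C => ?_
  · have h := map_gapMark_seq posGaussian (hSm N) hN
    rw [← (hfield N).map_eq, Measure.map_map (hseq N) (hfield N).measurable] at h
    exact h
  · have h := hY N
    rw [← (hfst N).map_eq] at h
    have h2 := h.map_map_of_aemeasurable (hfst N).aemeasurable
    rw [(hfst N).map_eq] at h2
    exact h2
  -- The mesh is half of `ε` because the first-time estimate costs `2 η`. Up to null sets the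
  -- approximation can only fail when the count of discovered sites deviates at some grid point,
  -- which has vanishing probability.
  · obtain ⟨η, hη, hηε⟩ : ∃ η : ℝ≥0, 0 < η ∧ 2 * (η : ℝ) ≤ ε :=
      ⟨⟨ε / 2, by positivity⟩, by exact_mod_cast half_pos hε, by
        show 2 * (ε / 2) ≤ ε
        linarith⟩
    obtain ⟨J, hJ⟩ := exists_nat_ge (C / η + 3)
    have hgrid := tendsto_measure_grid hc0 hc1 ha ht hη J
    refine tendsto_of_tendsto_of_tendsto_of_le_of_le' tendsto_const_nhds hgrid
      (Eventually.of_forall fun _ => zero_le) ?_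
    filter_upwards [hdpos, htpos, hne] with N hdN htN hneN
    have hrec : ∀ᵐ q ∂(μ N), Recurrent (S N) (fieldSeq (a N) (o N) q.1 q.2) :=
      (hfield N).quasiMeasurePreserving.ae (ae_recurrent posGaussian (hSm N) hneN)
    have hgood : ∀ᵐ q ∂(μ N), Good (a N) q.1 :=
      (hfst N).quasiMeasurePreserving.ae (ae_good_annealed (a N))
    have hdL : dScale N (a N) (t N) = Real.exp (L N) := (Real.exp_log hdN).symm
    set G : Set (Sample N) := {ω | ¬ ∀ j ≤ J, |(numDiscovered (a N) ω (j * η * t N) : ℝ) /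
      dScale N (a N) (t N) - j * η| ≤ η} with hG
    have hprod : μ N (Prod.fst ⁻¹' G) = annealed N G := by
      rw [← Set.prod_univ, hμ, Measure.prod_prod, measure_univ, mul_one]
    rw [← hprod]
    refine measure_mono_ae ?_
    filter_upwards [hrec, hgood] with q hq1 hq2 hbad
    by_contra hgr
    have hgr' : ∀ j ≤ J, |(numDiscovered (a N) q.1 (j * η * t N) : ℝ) / Real.exp (L N) - j * η| ≤ η := by
      rw [← hdL]
      exact not_not.1 hgr
    obtain ⟨e, he1, he2⟩ := exists_toExtended_eq hq2 hq1 (by exact_mod_cast htN) hη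
      (Real.exp_pos (L N)) (hBpos N) hJ hgr' hbad.1
    exact hbad.2 ⟨e, he1, he2.trans hηε⟩
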